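/- Let $0<q<1$ and $[x]:=(q^x-q^{-x})/(q-q^{-1})$. **Algebras.** $\mathcal A(S^4_q)$ is the unital complex $*$-algebra generated by $x_0=x_0^*$, $x_1$, $x_2$ with relations $x_ix_j=q^2x_jx_i$ ($0\le i<j\le 2$), $x_i^*x_j=q^2x_jx_i^*$ ($i\ne j$), $[x_1^*,x_1]=(1-q^4)x_0^2$, $[x_2^*,x_2]=x_1^*x_1-q^4x_1x_1^*$, $x_0^2+x_1x_1^*+x_2x_2^*=1$. $U_q(so(5))$ is the $*$-algebra generated by $K_i=K_i^*$, $K_i^{-1}$, $E_i$ and $F_i:=E_i^*$ ($i=1,2$), with relations $[K_1,K_2]=0$, $[E_i,F_j]=\delta_{ij}(K_j^2-K_j^{-2})/(q^j-q^{-j})$, $K_iE_iK_i^{-1}=q^iE_i$, $K_iE_jK_i^{-1}=q^{-1}E_j$ ($i\ne j$), $E_1E_2^2-(q^2+q^{-2})E_2E_1E_2+E_2^2E_1=0$, $E_1^3E_2-(q^2+1+q^{-2})(E_1^2E_2E_1-E_1E_2E_1^2)-E_2E_1^3=0$ and their adjoints; its coproduct is $\Delta K_i=K_i\otimes K_i$,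 $\Delta E_i=E_i\otimes K_i+K_i^{-1}\otimes E_i$, $\Delta F_i=F_i\otimes K_i+K_i^{-1}\otimes F_i$. It acts on $\mathcal A(S^4_q)$ by $K_1\triangleright x_1=qx_1$, $K_2\triangleright x_1=q^{-1}x_1$, $K_2\triangleright x_2=qx_2$, $E_1\triangleright x_0=q^{-1/2}x_1$, $E_2\triangleright x_1=x_2$, $F_1\triangleright x_1=q^{1/2}[2]x_0$, $F_1\triangleright x_0=-q^{-3/2}x_1^*$, $F_2\triangleright x_2=x_1$, trivially on the other pairs of generators ($K_i\triangleright x_j=x_j$, $E_i\triangleright x_j=F_i\triangleright x_j=0$), and compatibly with the involution. The crossed product $\mathcal A(S^4_q)\rtimes U_q(so(5))$ is the $*$-algebra generated by both algebras with the relations $hx=(h_{(1)}\triangleright x)h_{(2)}$. **Hilbert space and representation.** $\mathcal H=\mathcal H_+\oplus\mathcal H_-$, where $\mathcal H_\pm$ has orthonormal basis $|l,m_1,m_2;j\rangle_\pm$ with $l\in\mathbb N+\frac12$, $j=\frac12,\frac32,\dots,l$, $j-|m_1|\in\mathbb N$, $l+\frac12-j-|m_2|\in\mathbb N$; vectors with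 inadmissible labels are $0$. Let $\gamma=\pm1$ on $\mathcal H_\pm$, let $F|l,m_1,m_2;j\rangle_\pm=|l,m_1,m_2;j\rangle_\mp$, and let $D=(l+\frac32)F$ with its maximal domain, so that $|D|$ is multiplication by $l+\frac32$. For a label let $\epsilon=\pm\frac12$ be such that $l+\epsilon-j-m_2$ is even (in each coefficient below, $\epsilon$ is computed from the indices $(l,j,m_2)$ of that coefficient). Put $$A^+_{j,m_1}=q^{m_1-1}\tfrac{\sqrt{[j+m_1+1][j-m_1+1]}}{[2j+2]},\quad A^0_{j,m_1}=q^{-2}\tfrac{q^{j+m_1+1}[2][j-m_1]-[2j]}{[2j][2j+2]},$$ $$B^+_{j,m_1}=q^{-j+m_1-1/2}\tfrac{\sqrt{[j+m_1+1][j+m_1+2]}}{[2j+2]},\quad B^0_{j,m_1}=(1+q^2)q^{m_1-1/2}\tfrac{\sqrt{[j-m_1][j+m_1+1]}}{[2j][2j+2]},\quad B^-_{j,m_1}=-q^{j+m_1+1/2}\tfrac{\sqrt{[j-m_1][j-m_1-1]}}{[2j]},$$ $$C^+_{l,j,m_2}=-q^{m_2-1-\epsilon}\tfrac{\sqrt{[l+j+m_2+3+\epsilon][l+j-m_2+3-\epsilon]}}{[2l+4]},\quad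 C^-_{l,j,m_2}=-q^{m_2-1+\epsilon}\tfrac{\sqrt{[l-j+m_2-\epsilon][l-j-m_2+\epsilon]}}{[2l+2]},$$ $$C^0_{l,j,m_2}=[4\epsilon]q^{2\epsilon l+m_2-1+3\epsilon}\tfrac{\sqrt{[l+\frac12+j-2\epsilon m_2+2][l+\frac12-j-2\epsilon m_2]}}{[2l+2][2l+4]},$$ $$H^+_{l,j,m_2}=q^{m_2-1+\epsilon(2j+1)}\tfrac{\sqrt{[l+2\epsilon j-m_2+2+\epsilon][l-2\epsilon j+m_2+2-\epsilon]}}{[2l+4]},$$ $$H^0_{l,j,m_2}=\tfrac{[l-\epsilon(2j+1)-m_2+1][l-\epsilon(2j+1)+m_2+2]-q^{-2}[l+\epsilon(2j+1)-m_2+2][l+\epsilon(2j+1)+m_2+1]}{[2l+2][2l+4]},$$ $$D^+_{l,j,m_2}=q^{-l+m_2-3/2}\tfrac{\sqrt{[l+j+m_2+3+\epsilon][l-j+m_2+2-\epsilon]}}{[2l+4]},\quad D^-_{l,j,m_2}=-q^{l+m_2+3/2}\tfrac{\sqrt{[l-j-m_2+\epsilon][l+j-m_2+1-\epsilon]}}{[2l+2]},$$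 $$D^0_{l,j,m_2}=[2]q^{m_2+1/2}\tfrac{\sqrt{[l-2\epsilon j-m_2+1-\epsilon][l-2\epsilon j+m_2+2-\epsilon]}}{[2l+2][2l+4]}.$$ **Terminology.** An even spectral triple $(\mathcal A,\mathcal H,D,\gamma)$: a $*$-representation $\pi$ of $\mathcal A$ by bounded operators, $D$ self-adjoint with $D+i$ having a compact inverse, $[D,\pi(a)]$ bounded for all $a$, and a self-adjoint $\gamma$ with $\gamma^2=1$ that commutes with $\pi(\mathcal A)$ and anticommutes with $D$. It is $U_q(so(5))$-equivariant if a dense subspace $M\subset\mathrm{dom}\,D$ carries a $*$-representation of $\mathcal A\rtimes U_q(so(5))$ extending $\pi$, commuting with $\gamma$, and with $[D,h]=0$ on $M$ for $h\in U_q(so(5))$. Let $\delta=[|D|,\cdot\,]$. The triple is regular if $\pi(\mathcal A)\cup[D,\pi(\mathcal A)]\subset\bigcap_k\mathrm{dom}\,\delta^k$; then $\Psi^0$ is the algebra generated by all $\delta^k(T)$, $T\in\pi(\mathcal A)\cup[D,\pi(\mathcal A)]$, $k\in\mathbb N$. It has metric dimension $n$ if the singular values of $|D|^{-n}$ are $O(1/k)$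 and its Dixmier trace is positive. For $T\in\Psi^0$ let $\zeta_T(s)=\mathrm{Tr}(T|D|^{-s})$. The dimension spectrum in $\mathrm{Re}\,s>2$ is the set of all poles there of meromorphic extensions of the functions $\zeta_T$, $T\in\Psi^0$. **Statement.** There is a $*$-representation $\pi$ of $\mathcal A(S^4_q)$ by bounded operators on $\mathcal H$ with $$\begin{aligned}x_0|l,m_1,m_2;j\rangle_\pm={}&A^+_{j,m_1}\big(C^+_{l,j,m_2}|l{+}1,m_1,m_2;j{+}1\rangle_\pm\mp C^0_{l,j,m_2}|l,m_1,m_2;j{+}1\rangle_\pm+C^-_{l,j,m_2}|l{-}1,m_1,m_2;j{+}1\rangle_\pm\big)\\&+A^0_{j,m_1}\big(H^+_{l,j,m_2}|l{+}1,m_1,m_2;j\rangle_\pm\pm H^0_{l,j,m_2}|l,m_1,m_2;j\rangle_\pm+H^+_{l-1,j,m_2}|l{-}1,m_1,m_2;j\rangle_\pm\big)\\&+A^+_{j-1,m_1}\big(C^-_{l+1,j-1,m_2}|l{+}1,m_1,m_2;j{-}1\rangle_\pm\mp C^0_{l,j-1,m_2}|l,m_1,m_2;j{-}1\rangle_\pm+C^+_{l-1,j-1,m_2}|l{-}1,m_1,m_2;j{-}1\rangle_\pm\big),\end{aligned}$$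 $x_1$ given by the same formula with $m_1$ replaced by $m_1+1$ in the vectors on the right and $A^+_{j,m_1},A^0_{j,m_1},A^+_{j-1,m_1}$ replaced by $B^+_{j,m_1},B^0_{j,m_1},B^-_{j,m_1}$, and $$x_2|l,m_1,m_2;j\rangle_\pm=D^+_{l,j,m_2}|l{+}1,m_1,m_2{+}1;j\rangle_\pm\pm D^0_{l,j,m_2}|l,m_1,m_2{+}1;j\rangle_\pm+D^-_{l,j,m_2}|l{-}1,m_1,m_2{+}1;j\rangle_\pm .$$ With it $(\mathcal A(S^4_q),\mathcal H,D,\gamma)$ is a $U_q(so(5))$-equivariant regular even spectral triple of metric dimension $4$. For every $T\in\Psi^0$, $T|D|^{-s}$ is of trace class for $\mathrm{Re}\,s>4$, $\zeta_T$ is holomorphic there, and $\zeta_T$ extends to a meromorphic function on $\mathrm{Re}\,s>2$ all of whose poles are simple. The dimension spectrum in $\mathrm{Re}\,s>2$ is exactly $\{3,4\}$. For every $a\in\mathcal A(S^4_q)$, $$\int\mkern-19mu-\;a|D|^{-4}:=\mathrm{Res}_{s=4}\,\zeta_{\pi(a)}(s)=\frac{2}{3\pi}\int_0^{2\pi}\sigma(a)(\theta)\,d\theta,$$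 where $\sigma$ is the unital $*$-morphism from $\mathcal A(S^4_q)$ to functions on the circle with $\sigma(x_0)=\sigma(x_1)=0$ and $\sigma(x_2)(\theta)=e^{i\theta}$. -/

import Mathlib

open scoped ENNReal InnerProductSpace Topology BoundedContinuousFunction
open MulOpposite

noncomputable section

namespace QuantumSphere

/-! ### `*`-algebras presented by generators and relations -/

/-- The free unital complex algebra on symbols `x` (coded `(x, false)`) and `x^*` (coded
`(x, true)`), for `x` in `X`; with the involution below it is the free `*`-algebra on `X`. -/
def FreeStarAlg (X : Type) : Type := FreeAlgebra ℂ (X × Bool)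

instance (X : Type) : Ring (FreeStarAlg X) := inferInstanceAs (Ring (FreeAlgebra ℂ (X × Bool)))

instance (X : Type) : Algebra ℂ (FreeStarAlg X) :=
  inferInstanceAs (Algebra ℂ (FreeAlgebra ℂ (X × Bool)))

/-- The opposite algebra of a complex algebra, with complex conjugate scalar multiplication. -/
def ConjOpp (B : Type) : Type := Bᵐᵒᵖ

instance (B : Type) [Ring B] : Ring (ConjOpp B) := inferInstanceAs (Ring Bᵐᵒᵖ)

instance (B : Type) [Ring B] [Algebra ℂ B] : Algebra ℂ (ConjOpp B) :=
  RingHom.toAlgebra' ((algebraMap ℂ Bᵐᵒᵖ).comp (starRingEnd ℂ))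
    (fun c x => Algebra.commutes (A := Bᵐᵒᵖ) (starRingEnd ℂ c) x)

namespace FreeStarAlg

variable {X : Type}

/-- The symbols `x` and `x^*` as elements. -/
def symb (p : X × Bool) : FreeStarAlg X := FreeAlgebra.ι ℂ p

/-- The generator `x`. -/
def gen (x : X) : FreeStarAlg X := symb (x, false)

/-- The involution, as an algebra morphism to the conjugate opposite algebra. -/
def starAux (X : Type) : FreeStarAlg X →ₐ[ℂ] ConjOpp (FreeStarAlg X) :=
  FreeAlgebra.lift ℂ (fun p : X × Bool => op (symb (p.1, !p.2)))

theorem starAux_algebraMap (c : ℂ) :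
    starAux X (algebraMap ℂ _ c) = op (algebraMap ℂ (FreeStarAlg X) (starRingEnd ℂ c)) :=
  (starAux X).commutes c

theorem starAux_symb (p : X × Bool) :
    starAux X (symb p) = op (symb (p.1, !p.2)) :=
  FreeAlgebra.lift_ι_apply _ _

/-- The conjugate linear antimultiplicative involution exchanging `x` and `x^*`. -/
instance : StarRing (FreeStarAlg X) where
  star a := unop (starAux X a : (FreeStarAlg X)ᵐᵒᵖ)
  star_involutive a := by
    refine FreeAlgebra.induction (R := ℂ) (X := X × Bool)
      (motive := fun a => unop (starAux X (unop (starAux X a : (FreeStarAlg X)ᵐᵒᵖ)) :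
        (FreeStarAlg X)ᵐᵒᵖ) = a) ?_ ?_ ?_ ?_ a
    · intro c
      have := starAux_algebraMap (X := X) c
      have h2 := starAux_algebraMap (X := X) (starRingEnd ℂ c)
      rw [Complex.conj_conj] at h2
      exact (congrArg (fun z : ConjOpp (FreeStarAlg X) =>
        (unop (starAux X (unop (z : (FreeStarAlg X)ᵐᵒᵖ)) : (FreeStarAlg X)ᵐᵒᵖ))) this).trans
        (congrArg unop h2)
    · intro p
      have h1 := starAux_symb p
      have h2 := starAux_symb ((p.1, !p.2) : X × Bool)
      simp only [Bool.not_not] at h2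
      exact (congrArg (fun z : ConjOpp (FreeStarAlg X) =>
        (unop (starAux X (unop (z : (FreeStarAlg X)ᵐᵒᵖ)) : (FreeStarAlg X)ᵐᵒᵖ))) h1).trans
        (congrArg unop h2)
    · intro a b ha hb
      have h1 : starAux X (a * b) = starAux X a * starAux X b := map_mul _ _ _
      have h2 : unop (starAux X (a * b) : (FreeStarAlg X)ᵐᵒᵖ)
        = unop (starAux X b : (FreeStarAlg X)ᵐᵒᵖ) * unop (starAux X a : (FreeStarAlg X)ᵐᵒᵖ) :=
        congrArg unop h1
      have h3 := map_mul (starAux X) (unop (starAux X b : (FreeStarAlg X)ᵐᵒᵖ))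
        (unop (starAux X a : (FreeStarAlg X)ᵐᵒᵖ))
      have h4 := congrArg (fun z : FreeStarAlg X => unop (starAux X z : (FreeStarAlg X)ᵐᵒᵖ)) h2
      refine h4.trans ((congrArg (unop (α := FreeStarAlg X)) h3).trans ?_)
      exact congrArg₂ (fun x y : FreeStarAlg X => x * y) ha hb
    · intro a b ha hb
      have h1 : starAux X (a + b) = starAux X a + starAux X b := map_add _ _ _
      have h2 : unop (starAux X (a + b) : (FreeStarAlg X)ᵐᵒᵖ)
        = unop (starAux X a : (FreeStarAlg X)ᵐᵒᵖ) + unop (starAux X b : (FreeStarAlg X)ᵐᵒᵖ) :=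
        congrArg unop h1
      have h3 := map_add (starAux X) (unop (starAux X a : (FreeStarAlg X)ᵐᵒᵖ))
        (unop (starAux X b : (FreeStarAlg X)ᵐᵒᵖ))
      have h4 := congrArg (fun z : FreeStarAlg X => unop (starAux X z : (FreeStarAlg X)ᵐᵒᵖ)) h2
      refine h4.trans ((congrArg (unop (α := FreeStarAlg X)) h3).trans ?_)
      exact congrArg₂ (fun x y : FreeStarAlg X => x + y) ha hb
  star_mul a b := congrArg (unop (α := FreeStarAlg X)) (map_mul (starAux X) a b)
  star_add a b := congrArg (unop (α := FreeStarAlg X)) (map_add (starAux X) a b)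

theorem star_algebraMap (c : ℂ) :
    star (algebraMap ℂ (FreeStarAlg X) c) = algebraMap ℂ (FreeStarAlg X) (starRingEnd ℂ c) :=
  congrArg (unop (α := FreeStarAlg X)) (starAux_algebraMap c)

theorem star_symb (p : X × Bool) :
    star (symb p) = symb (p.1, !p.2) :=
  congrArg (unop (α := FreeStarAlg X)) (starAux_symb p)

instance : StarModule ℂ (FreeStarAlg X) where
  star_smul c a := by
    rw [Algebra.smul_def, Algebra.smul_def, star_mul, star_algebraMap]
    exact (Algebra.commutes _ _).symm

variable {B : Type} [Ring B] [StarRing B] [Algebra ℂ B] [StarModule ℂ B]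

/-- The `*`-algebra morphism from the free `*`-algebra that extends a map on generators. -/
def lift (f : X → B) : FreeStarAlg X →⋆ₐ[ℂ] B where
  toAlgHom := FreeAlgebra.lift ℂ (fun p : X × Bool => bif p.2 then star (f p.1) else f p.1)
  map_star' a := by
    set φ : FreeStarAlg X →ₐ[ℂ] B :=
      FreeAlgebra.lift ℂ (fun p : X × Bool => bif p.2 then star (f p.1) else f p.1) with hφ
    change φ (star a) = star (φ a)
    refine FreeAlgebra.induction (R := ℂ) (X := X × Bool)
      (motive := fun a : FreeStarAlg X => φ (star a) = star (φ a)) ?_ ?_ ?_ ?_ a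
    · intro c
      have h1 := star_algebraMap (X := X) c
      have h2 := φ.commutes c
      have h3 := φ.commutes (starRingEnd ℂ c)
      refine (congrArg φ h1).trans (h3.trans ?_)
      refine Eq.trans ?_ (congrArg star h2).symm
      exact (algebraMap_star_comm c)
    · rintro ⟨x, b⟩
      have h1 := star_symb (X := X) (x, b)
      refine (congrArg φ h1).trans ?_
      have h2 : ∀ p : X × Bool, φ (symb p)
        = bif p.2 then star (f p.1) else f p.1 := fun p => FreeAlgebra.lift_ι_apply _ _
      refine (h2 _).trans (Eq.trans ?_ (congrArg star (h2 _)).symm)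
      cases b <;> simp
    · intro a b ha hb
      have h1 := star_mul (R := FreeStarAlg X) a b
      refine (congrArg φ h1).trans ((map_mul φ _ _).trans ?_)
      refine (congrArg₂ (· * ·) hb ha).trans ?_
      exact (star_mul (φ a) (φ b)).symm.trans (congrArg star (map_mul φ a b)).symm
    · intro a b ha hb
      have h1 := star_add (R := FreeStarAlg X) a b
      refine (congrArg φ h1).trans ((map_add φ _ _).trans ?_)
      refine (congrArg₂ (· + ·) ha hb).trans ?_
      exact (star_add (φ a) (φ b)).symm.trans (congrArg star (map_add φ a b)).symm

theorem lift_gen (f : X → B) (x : X) : lift f (gen x) = f x :=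
  FreeAlgebra.lift_ι_apply (R := ℂ)
    (fun p : X × Bool => bif p.2 then star (f p.1) else f p.1) (x, false)

end FreeStarAlg

section Presented

variable {X : Type} (r : FreeStarAlg X → FreeStarAlg X → Prop)

/-- A set of relations together with the adjoint relations. -/
def StarRel (a b : FreeStarAlg X) : Prop := r a b ∨ r (star a) (star b)

theorem StarRel.star (a b : FreeStarAlg X) (h : StarRel r a b) :
    StarRel r (star a) (star b) := by
  rcases h with h | h
  · exact Or.inr (by simpa using h)
  · exact Or.inl h

/-- The universal unital `*`-algebra on generators `X` satisfying the relations `r` (and hence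
their adjoints). -/
def PresentedStarAlg : Type := RingQuot (StarRel r)

instance : Ring (PresentedStarAlg r) := inferInstanceAs (Ring (RingQuot (StarRel r)))

instance : Algebra ℂ (PresentedStarAlg r) := inferInstanceAs (Algebra ℂ (RingQuot (StarRel r)))

instance : StarRing (PresentedStarAlg r) := RingQuot.starRing (StarRel r) (StarRel.star r)

namespace PresentedStarAlg

/-- The quotient map, as an algebra morphism. -/
def mkAlg : FreeStarAlg X →ₐ[ℂ] PresentedStarAlg r := RingQuot.mkAlgHom ℂ (StarRel r)

theorem mkAlg_star (a : FreeStarAlg X) : mkAlg r (star a) = star (mkAlg r a) := by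
  simp only [mkAlg, RingQuot.mkAlgHom, RingQuot.mkRingHom]
  rfl

theorem mkAlg_surjective : Function.Surjective (mkAlg r) := RingQuot.mkAlgHom_surjective ℂ _

instance : StarModule ℂ (PresentedStarAlg r) where
  star_smul c a := by
    obtain ⟨a, rfl⟩ := mkAlg_surjective r a
    rw [← map_smul, ← mkAlg_star, star_smul, map_smul, mkAlg_star]

/-- The quotient map. -/
def mk : FreeStarAlg X →⋆ₐ[ℂ] PresentedStarAlg r :=
  { mkAlg r with map_star' := mkAlg_star r }

theorem mk_rel {a b : FreeStarAlg X} (h : r a b) : mk r a = mk r b :=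
  RingQuot.mkAlgHom_rel ℂ (Or.inl h : StarRel r a b)

/-- The image of a generator. -/
def gen (x : X) : PresentedStarAlg r := mk r (FreeStarAlg.gen x)

variable {B : Type} [Ring B] [StarRing B] [Algebra ℂ B]

theorem lift_rel (φ : FreeStarAlg X →⋆ₐ[ℂ] B) (h : ∀ a b, r a b → φ a = φ b)
    {a b : FreeStarAlg X} (hab : StarRel r a b) : (φ : FreeStarAlg X →ₐ[ℂ] B) a = φ b := by
  rcases hab with hab | hab
  · exact h a b hab
  · have := h _ _ hab
    rw [map_star, map_star] at this
    exact star_injective this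

/-- The universal property: a `*`-morphism from the free `*`-algebra that respects the relations
descends to the quotient. -/
def lift (φ : FreeStarAlg X →⋆ₐ[ℂ] B) (h : ∀ a b, r a b → φ a = φ b) :
    PresentedStarAlg r →⋆ₐ[ℂ] B where
  toAlgHom := RingQuot.liftAlgHom ℂ ⟨(φ : FreeStarAlg X →ₐ[ℂ] B), fun _ _ => lift_rel r φ h⟩
  map_star' a := by
    obtain ⟨a, rfl⟩ := mkAlg_surjective r a
    have key : ∀ c : FreeStarAlg X, RingQuot.liftAlgHom ℂ
        ⟨(φ : FreeStarAlg X →ₐ[ℂ] B), fun _ _ => lift_rel r φ h⟩ (mkAlg r c) = φ c :=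
      fun c => RingQuot.liftAlgHom_mkAlgHom_apply ℂ _ _ c
    rw [← mkAlg_star]
    exact (key _).trans ((map_star φ a).trans (congrArg star (key a)).symm)

theorem lift_mk (φ : FreeStarAlg X →⋆ₐ[ℂ] B) (h : ∀ a b, r a b → φ a = φ b)
    (a : FreeStarAlg X) : lift r φ h (mk r a) = φ a :=
  RingQuot.liftAlgHom_mkAlgHom_apply ℂ _ _ a

end PresentedStarAlg

end Presented

/-! ### The algebras -/

section Algebras

variable (q : ℝ)

/-- Generators `x_0, x_1, x_2` of the free `*`-algebra. -/
abbrev xgen (i : Fin 3) : FreeStarAlg (Fin 3) := FreeStarAlg.gen i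

/-- The defining relations of the coordinate algebra of the quantum orthogonal 4-sphere. -/
inductive SphereRel : FreeStarAlg (Fin 3) → FreeStarAlg (Fin 3) → Prop
  | self_adj : SphereRel (star (xgen 0)) (xgen 0)
  | comm (i j : Fin 3) (h : i < j) :
      SphereRel (xgen i * xgen j) (((q ^ 2 : ℝ) : ℂ) • (xgen j * xgen i))
  | star_comm (i j : Fin 3) (h : i ≠ j) :
      SphereRel (star (xgen i) * xgen j) (((q ^ 2 : ℝ) : ℂ) • (xgen j * star (xgen i)))
  | comm_one : SphereRel (star (xgen 1) * xgen 1 - xgen 1 * star (xgen 1))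
      (((1 - q ^ 4 : ℝ) : ℂ) • xgen 0 ^ 2)
  | comm_two : SphereRel (star (xgen 2) * xgen 2 - xgen 2 * star (xgen 2))
      (star (xgen 1) * xgen 1 - ((q ^ 4 : ℝ) : ℂ) • (xgen 1 * star (xgen 1)))
  | radius : SphereRel (xgen 0 ^ 2 + xgen 1 * star (xgen 1) + xgen 2 * star (xgen 2)) 1

/-- The coordinate `*`-algebra `𝒜(S⁴_q)`. -/
abbrev SphereAlg : Type := PresentedStarAlg (SphereRel q)

/-- The generator `x_i` of `𝒜(S⁴_q)`. -/
def sphereX (i : Fin 3) : SphereAlg q := PresentedStarAlg.gen (SphereRel q) i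

/-- Generators `K_1, K_2` (indexed by `0, 1`), their inverses, and `E_1, E_2`. -/
inductive UqGen : Type
  | K (i : Fin 2)
  | Kinv (i : Fin 2)
  | E (i : Fin 2)

/-- `K_{i+1}`, `K_{i+1}⁻¹`, `E_{i+1}` and `F_{i+1} = E_{i+1}^*` in the free `*`-algebra. -/
abbrev Kgen (i : Fin 2) : FreeStarAlg UqGen := FreeStarAlg.gen (UqGen.K i)

/-- `K_{i+1}⁻¹`. -/
abbrev Kinvgen (i : Fin 2) : FreeStarAlg UqGen := FreeStarAlg.gen (UqGen.Kinv i)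

/-- `E_{i+1}`. -/
abbrev Egen (i : Fin 2) : FreeStarAlg UqGen := FreeStarAlg.gen (UqGen.E i)

/-- `F_{i+1} = E_{i+1}^*`. -/
abbrev Fgen (i : Fin 2) : FreeStarAlg UqGen := star (Egen i)

/-- The defining relations of the `*`-algebra `U_q(so(5))`; with index `i : Fin 2` standing for
`i + 1 ∈ {1, 2}`, so that `q^{i+1}` is the parameter of the `i`-th simple root. -/
inductive UqRel : FreeStarAlg UqGen → FreeStarAlg UqGen → Prop
  | K_self_adj (i : Fin 2) : UqRel (star (Kgen i)) (Kgen i)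
  | K_comm : UqRel (Kgen 0 * Kgen 1) (Kgen 1 * Kgen 0)
  | K_inv (i : Fin 2) : UqRel (Kgen i * Kinvgen i) 1
  | inv_K (i : Fin 2) : UqRel (Kinvgen i * Kgen i) 1
  | EF (i : Fin 2) : UqRel (Egen i * Fgen i - Fgen i * Egen i)
      ((((q ^ (i.val + 1) - (q ^ (i.val + 1))⁻¹)⁻¹ : ℝ) : ℂ) • (Kgen i ^ 2 - Kinvgen i ^ 2))
  | EF_comm (i j : Fin 2) (h : i ≠ j) : UqRel (Egen i * Fgen j) (Fgen j * Egen i)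
  | KE (i : Fin 2) :
      UqRel (Kgen i * Egen i * Kinvgen i) (((q ^ (i.val + 1) : ℝ) : ℂ) • Egen i)
  | KE_ne (i j : Fin 2) (h : i ≠ j) :
      UqRel (Kgen i * Egen j * Kinvgen i) (((q⁻¹ : ℝ) : ℂ) • Egen j)
  | serre_one : UqRel
      (Egen 0 * Egen 1 ^ 2 - ((q ^ 2 + (q ^ 2)⁻¹ : ℝ) : ℂ) • (Egen 1 * Egen 0 * Egen 1)
        + Egen 1 ^ 2 * Egen 0) 0
  | serre_two : UqRel
      (Egen 0 ^ 3 * Egen 1 - ((q ^ 2 + 1 + (q ^ 2)⁻¹ : ℝ) : ℂ) •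
        (Egen 0 ^ 2 * Egen 1 * Egen 0 - Egen 0 * Egen 1 * Egen 0 ^ 2)
        - Egen 1 * Egen 0 ^ 3) 0

/-- The `*`-algebra `U_q(so(5))`. Its coproduct is the `*`-morphism with
`Δ K_i = K_i ⊗ K_i` and `Δ E_i = E_i ⊗ K_i + K_i⁻¹ ⊗ E_i`. -/
abbrev UqSO5 : Type := PresentedStarAlg (UqRel q)

/-- `[x] = (q^x - q^{-x}) / (q - q⁻¹)`. -/
def qnum (x : ℝ) : ℝ := (q ^ x - q ^ (-x)) / (q - q⁻¹)

/-- The action of `K_1` and `K_2` on generators: `K_{i+1} ▷ x_j = actK i j • x_j`. -/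
def actK : Fin 2 → Fin 3 → ℝ := ![![1, q, 1], ![1, q⁻¹, q]]

/-- The action of `E_1` and `E_2` on generators: `actE i j = E_{i+1} ▷ x_j`. -/
def actE : Fin 2 → Fin 3 → FreeStarAlg (Fin 3) :=
  ![![((q ^ (-(1 / 2 : ℝ)) : ℝ) : ℂ) • xgen 1, 0, 0], ![0, xgen 2, 0]]

/-- The action of `F_1` and `F_2` on generators: `actF i j = F_{i+1} ▷ x_j`. -/
def actF : Fin 2 → Fin 3 → FreeStarAlg (Fin 3) :=
  ![![((-q ^ (-(3 / 2 : ℝ)) : ℝ) : ℂ) • star (xgen 1),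
      ((q ^ (1 / 2 : ℝ) * qnum q 2 : ℝ) : ℂ) • xgen 0, 0],
    ![0, 0, xgen 1]]

/-- The inclusion of the free `*`-algebra on the `x_i` in the one on all generators. -/
def inX : FreeStarAlg (Fin 3) →⋆ₐ[ℂ] FreeStarAlg (Fin 3 ⊕ UqGen) :=
  FreeStarAlg.lift (fun i => FreeStarAlg.gen (Sum.inl i))

/-- The inclusion of the free `*`-algebra on the `K_i, K_i⁻¹, E_i` in the one on all generators. -/
def inU : FreeStarAlg UqGen →⋆ₐ[ℂ] FreeStarAlg (Fin 3 ⊕ UqGen) :=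
  FreeStarAlg.lift (fun g => FreeStarAlg.gen (Sum.inr g))

/-- The relations of the crossed product: those of the two factors and, for `h` among the
`K_i, E_i, F_i` and `x` among the `x_j`, the relation `h x = (h₍₁₎ ▷ x) h₍₂₎`. -/
inductive CrossedRel : FreeStarAlg (Fin 3 ⊕ UqGen) → FreeStarAlg (Fin 3 ⊕ UqGen) → Prop
  | sphere (a b : FreeStarAlg (Fin 3)) (h : SphereRel q a b) : CrossedRel (inX a) (inX b)
  | uq (a b : FreeStarAlg UqGen) (h : UqRel q a b) : CrossedRel (inU a) (inU b)
  | K (i : Fin 2) (j : Fin 3) :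
      CrossedRel (inU (Kgen i) * inX (xgen j)) (inX ((actK q i j : ℂ) • xgen j) * inU (Kgen i))
  | E (i : Fin 2) (j : Fin 3) :
      CrossedRel (inU (Egen i) * inX (xgen j))
        (inX (actE q i j) * inU (Kgen i)
          + inX (((actK q i j)⁻¹ : ℂ) • xgen j) * inU (Egen i))
  | F (i : Fin 2) (j : Fin 3) :
      CrossedRel (inU (Fgen i) * inX (xgen j))
        (inX (actF q i j) * inU (Kgen i)
          + inX (((actK q i j)⁻¹ : ℂ) • xgen j) * inU (Fgen i))

/-- The crossed product `*`-algebra `𝒜(S⁴_q) ⋊ U_q(so(5))`. -/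
abbrev CrossedAlg : Type := PresentedStarAlg (CrossedRel q)

/-- The canonical morphism `𝒜(S⁴_q) → 𝒜(S⁴_q) ⋊ U_q(so(5))`. -/
def sphereToCrossed : SphereAlg q →⋆ₐ[ℂ] CrossedAlg q :=
  PresentedStarAlg.lift (SphereRel q) ((PresentedStarAlg.mk (CrossedRel q)).comp inX)
    (fun a b h => PresentedStarAlg.mk_rel (CrossedRel q) (CrossedRel.sphere a b h))

/-- The canonical morphism `U_q(so(5)) → 𝒜(S⁴_q) ⋊ U_q(so(5))`. -/
def uqToCrossed : UqSO5 q →⋆ₐ[ℂ] CrossedAlg q :=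
  PresentedStarAlg.lift (UqRel q) ((PresentedStarAlg.mk (CrossedRel q)).comp inU)
    (fun a b h => PresentedStarAlg.mk_rel (CrossedRel q) (CrossedRel.uq a b h))

/-- The unitary generator `u(θ) = e^{iθ}` of the functions on the circle. -/
def circleU : C(Circle, ℂ) := ⟨fun z => (z : ℂ), continuous_subtype_val⟩

/-- The values `0, 0, u` of the character map on `x_0, x_1, x_2`. -/
def symbolGen : Fin 3 → C(Circle, ℂ) := ![0, 0, circleU]

theorem symbol_rel (a b : FreeStarAlg (Fin 3)) (h : SphereRel q a b) :
    FreeStarAlg.lift symbolGen a = FreeStarAlg.lift symbolGen b := by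
  have hu : circleU * star circleU = 1 := by
    ext z
    change (z : ℂ) * (starRingEnd ℂ) (z : ℂ) = 1
    rw [Complex.mul_conj, Complex.normSq_eq_norm_sq, Circle.norm_coe]
    simp
  cases h with
  | self_adj => simp [map_star, FreeStarAlg.lift_gen, symbolGen]
  | comm i j h =>
    fin_cases i <;> fin_cases j <;> simp [FreeStarAlg.lift_gen, symbolGen] at h ⊢
  | star_comm i j h =>
    fin_cases i <;> fin_cases j <;> simp [map_star, FreeStarAlg.lift_gen, symbolGen] at h ⊢
  | comm_one => simp [map_star, FreeStarAlg.lift_gen, symbolGen]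
  | comm_two => simp [map_star, FreeStarAlg.lift_gen, symbolGen, mul_comm]
  | radius => simpa [map_star, FreeStarAlg.lift_gen, symbolGen] using hu

/-- The `*`-algebra morphism `σ` from `𝒜(S⁴_q)` to functions on the circle with
`σ(x_0) = σ(x_1) = 0` and `σ(x_2) = u`. -/
def sphereSymbol : SphereAlg q →⋆ₐ[ℂ] C(Circle, ℂ) :=
  PresentedStarAlg.lift (SphereRel q) (FreeStarAlg.lift symbolGen) (symbol_rel q)

end Algebras

/-! ### Operators on a Hilbert space and spectral triples -/

section General

variable {H : Type} [NormedAddCommGroup H] [InnerProductSpace ℂ H] [CompleteSpace H]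

/-- `S` is the commutator `[D, T]` of a bounded operator `T` with an unbounded operator `D`: `T`
preserves the domain of `D`, and `D T - T D = S` on this domain. -/
def IsCommutator (D : H →ₗ.[ℂ] H) (T S : H →L[ℂ] H) : Prop :=
  ∀ v : D.domain, ∃ h : T v ∈ D.domain, D ⟨T v, h⟩ - T (D v) = S v

/-- `D + i` has a compact (two-sided) inverse. -/
def HasCompactResolvent (D : H →ₗ.[ℂ] H) : Prop :=
  ∃ R : H →L[ℂ] H, IsCompactOperator R ∧
    (∀ v : H, ∃ h : R v ∈ D.domain, D ⟨R v, h⟩ + Complex.I • R v = v) ∧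
    ∀ v : D.domain, R (D v + Complex.I • (v : H)) = v

/-- `(𝒜, H, D)` is an even spectral triple with grading `γ`. -/
structure IsEvenSpectralTriple {A : Type} [Ring A] [StarRing A] [Algebra ℂ A]
    (π : A →⋆ₐ[ℂ] (H →L[ℂ] H)) (D : H →ₗ.[ℂ] H) (γ : H →L[ℂ] H) : Prop where
  dense_domain : Dense (D.domain : Set H)
  selfAdjoint : IsSelfAdjoint D
  compact_resolvent : HasCompactResolvent D
  bounded_commutator : ∀ a, ∃ S : H →L[ℂ] H, IsCommutator D (π a) S
  grading_selfAdjoint : IsSelfAdjoint γ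
  grading_sq : γ * γ = 1
  grading_comm : ∀ a, γ * π a = π a * γ
  grading_anticomm : ∀ v : D.domain, ∃ h : γ v ∈ D.domain, D ⟨γ v, h⟩ = -γ (D v)

/-- The linear operator `T` of `H` restricts to the operator `T'` of the subspace `M`. -/
def RestrictsTo {M : Submodule ℂ H} (T : H → H) (T' : Module.End ℂ M) : Prop :=
  ∀ v : M, (T' v : H) = T v

/-- Equivariance of an even spectral triple over `𝒜` with respect to `𝒰`, where `C` is the crossed
product `𝒜 ⋊ 𝒰`, with the canonical morphisms `ιA : 𝒜 → C` and `ιU : 𝒰 → C`: a dense subspace `M` of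
the domain of `D` carries a `*`-representation `ρ` of `C` that is given on `𝒜` by `π`; the grading
commutes with `ρ` and `D` commutes with the image of `𝒰`, on `M`. -/
def IsEquivariant {A U C : Type} [Ring A] [StarRing A] [Algebra ℂ A]
    [Ring U] [StarRing U] [Algebra ℂ U] [Ring C] [StarRing C] [Algebra ℂ C]
    (ιA : A →⋆ₐ[ℂ] C) (ιU : U →⋆ₐ[ℂ] C)
    (π : A →⋆ₐ[ℂ] (H →L[ℂ] H)) (D : H →ₗ.[ℂ] H) (γ : H →L[ℂ] H) : Prop :=
  ∃ (M : Submodule ℂ H) (ρ : C →ₐ[ℂ] Module.End ℂ M) (D' γ' : Module.End ℂ M),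
    Dense (M : Set H) ∧
    (∀ (c : C) (v w : M), inner ℂ (ρ c v : H) (w : H) = inner ℂ (v : H) (ρ (star c) w : H)) ∧
    (∀ a, RestrictsTo (π a) (ρ (ιA a))) ∧
    (∀ v : M, ∃ h : (v : H) ∈ D.domain, (D' v : H) = D ⟨v, h⟩) ∧
    RestrictsTo γ γ' ∧
    (∀ u, D' * ρ (ιU u) = ρ (ιU u) * D') ∧
    ∀ c, γ' * ρ c = ρ c * γ'

/-- `A` is the absolute value of the self-adjoint operator `D`: the positive self-adjoint operator
with the same domain such that `‖A v‖ = ‖D v‖` there (equivalently, with `A² = D²`). -/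
structure IsOperatorAbs (D A : H →ₗ.[ℂ] H) : Prop where
  selfAdjoint : IsSelfAdjoint A
  nonneg : ∀ v : A.domain, 0 ≤ RCLike.re (inner ℂ (A v) (v : H))
  domain_eq : A.domain = D.domain
  norm_eq : ∀ (v : H) (hA : v ∈ A.domain) (hD : v ∈ D.domain), ‖A ⟨v, hA⟩‖ = ‖D ⟨v, hD⟩‖

/-- The class `OP⁰`, the common domain of all powers of the derivation `δ = [|D|, ·]`. -/
def OPZero (absD : H →ₗ.[ℂ] H) (T : H →L[ℂ] H) : Prop :=
  ∃ S : ℕ → H →L[ℂ] H, S 0 = T ∧ ∀ k, IsCommutator absD (S k) (S (k + 1))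

variable {A : Type} [Ring A] [StarRing A] [Algebra ℂ A]

/-- Regularity: `𝒜` and `[D, 𝒜]` are contained in `OP⁰`. -/
def IsRegularTriple (π : A →⋆ₐ[ℂ] (H →L[ℂ] H)) (D absD : H →ₗ.[ℂ] H) : Prop :=
  ∀ a, OPZero absD (π a) ∧ ∃ S, IsCommutator D (π a) S ∧ OPZero absD S

/-- The operators `δ^k(T)` with `T` in `𝒜 ∪ [D, 𝒜]` and `k` in `ℕ`. -/
inductive PsiGen (π : A →⋆ₐ[ℂ] (H →L[ℂ] H)) (D absD : H →ₗ.[ℂ] H) : (H →L[ℂ] H) → Prop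
  | rep (a : A) : PsiGen π D absD (π a)
  | comm (a : A) (S : H →L[ℂ] H) (h : IsCommutator D (π a) S) : PsiGen π D absD S
  | delta (T S : H →L[ℂ] H) (hT : PsiGen π D absD T) (h : IsCommutator absD T S) :
      PsiGen π D absD S

/-- The algebra `Ψ⁰` of pseudo-differential operators of order at most zero. -/
def PsiZero (π : A →⋆ₐ[ℂ] (H →L[ℂ] H)) (D absD : H →ₗ.[ℂ] H) : Subalgebra ℂ (H →L[ℂ] H) :=
  Algebra.adjoin ℂ {T | PsiGen π D absD T}

/-- The singular value `μ_{k+1}(T)`, the infimum over the `k`-dimensional subspaces `V` of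
`sup {‖T v‖ : v ⟂ V, ‖v‖ = 1}`. -/
def singularVal (T : H →L[ℂ] H) (k : ℕ) : ℝ :=
  ⨅ V : {V : Submodule ℂ H // FiniteDimensional ℂ V ∧ Module.finrank ℂ V = k},
    sSup {r : ℝ | ∃ v ∈ (V : Submodule ℂ H)ᗮ, ‖v‖ = 1 ∧ r = ‖T v‖}

/-- Trace class operators. -/
def IsTraceClass (T : H →L[ℂ] H) : Prop := Summable (singularVal T)

/-- The Dixmier ideal `ℒ^{(1,∞)}`, in the sense that `μ_n(T) = O(1/n)`. -/
def InDixmierIdeal (T : H →L[ℂ] H) : Prop :=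
  ∃ C : ℝ, ∀ k : ℕ, singularVal T k ≤ C / (k + 1)

/-- A generalized limit: a positive linear functional on the bounded real sequences that agrees
with the limit on convergent sequences. -/
structure GeneralizedLimit where
  toFun : (ℕ →ᵇ ℝ) →ₗ[ℝ] ℝ
  nonneg : ∀ u : ℕ →ᵇ ℝ, (∀ n, 0 ≤ u n) → 0 ≤ toFun u
  eq_lim : ∀ (u : ℕ →ᵇ ℝ) (L : ℝ), Filter.Tendsto u Filter.atTop (𝓝 L) → toFun u = L

/-- The sequence `(1 / log N) ∑_{n=1}^N μ_n(T)`. -/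
def dixmierSeq (T : H →L[ℂ] H) (N : ℕ) : ℝ :=
  (∑ k ∈ Finset.range N, singularVal T k) / Real.log N

/-- The triple has metric dimension `n`, where `absPow s` is `|D|^{-s}`: the positive operator
`P = |D|^{-n}` is in the Dixmier ideal and has positive Dixmier trace `Tr_ω(P) = ω(dixmierSeq P)`.
Positivity is asked for all generalized limits `ω`, in particular for the scale invariant ones. -/
def HasMetricDimension (absPow : ℂ → H →L[ℂ] H) (n : ℝ) : Prop :=
  InDixmierIdeal (absPow n) ∧
    ∃ u : ℕ →ᵇ ℝ, (∀ N, u N = dixmierSeq (absPow n) N) ∧ ∀ ω : GeneralizedLimit, 0 < ω.toFun u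

/-- `Z` is a meromorphic extension to the half-plane `Re s > r` of a function `f` defined on the
half-plane `Re s > n`. -/
def IsMeromorphicExtension (f : ℂ → ℂ) (n r : ℝ) (Z : ℂ → ℂ) : Prop :=
  MeromorphicOn Z {s : ℂ | r < s.re} ∧ ∀ s : ℂ, n < s.re → Z s = f s

end General

/-! ### Operators on `ℓ²` -/

section EllTwo

variable {ι : Type}

/-- The Hilbert space `ℓ²(ι)`. -/
abbrev EllTwo (ι : Type) : Type := lp (fun _ : ι => ℂ) 2

open Classical in
/-- The standard orthonormal basis of `ℓ²(ι)`. -/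
def basisVec (i : ι) : EllTwo ι := lp.single 2 i (1 : ℂ)

/-- The operator `(v_i)_i ↦ (d_i v_{e(i)})_i` with its maximal domain. -/
def weightedPerm (e : ι → ι) (d : ι → ℂ) : EllTwo ι →ₗ.[ℂ] EllTwo ι where
  domain :=
    { carrier := {v | Memℓp (fun i => d i * v (e i)) 2}
      zero_mem' := by
        have : (fun i => d i * (0 : EllTwo ι) (e i)) = (0 : ι → ℂ) := by ext i; simp
        simpa only [Set.mem_ofPred_eq, this] using (zero_memℓp : Memℓp (0 : ι → ℂ) 2)
      add_mem' := by
        intro v w hv hw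
        have : (fun i => d i * (v + w) (e i))
            = (fun i => d i * v (e i)) + (fun i => d i * w (e i)) := by
          ext i; simp [mul_add]
        simpa only [Set.mem_ofPred_eq, this] using hv.add hw
      smul_mem' := by
        intro c v hv
        have : (fun i => d i * (c • v) (e i)) = c • (fun i => d i * v (e i)) := by
          ext i; simp [mul_left_comm]
        simpa only [Set.mem_ofPred_eq, this] using hv.const_smul c }
  toFun :=
    { toFun := fun v => ⟨fun i => d i * (v : EllTwo ι) (e i), v.2⟩
      map_add' := fun v w => Subtype.ext (funext fun i =>
        mul_add (d i) ((v : EllTwo ι) (e i)) ((w : EllTwo ι) (e i)))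
      map_smul' := fun c v => Subtype.ext (funext fun i =>
        mul_left_comm (d i) c ((v : EllTwo ι) (e i))) }

theorem memℓp_mul {d : ι → ℂ} {C : ℝ} (hC : ∀ i, ‖d i‖ ≤ C) (v : EllTwo ι) :
    Memℓp (fun i => d i * v i) 2 := by
  refine Memℓp.mono' ((lp.memℓp v).const_smul (C : ℂ)) fun i => ?_
  rw [Pi.smul_apply, norm_smul, Complex.norm_real]
  calc ‖d i * v i‖ = ‖d i‖ * ‖v i‖ := norm_mul _ _
    _ ≤ ‖C‖ * ‖v i‖ :=
      mul_le_mul_of_nonneg_right ((hC i).trans (Real.le_norm_self C)) (norm_nonneg _)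

theorem norm_mul_le {d : ι → ℂ} {C : ℝ} (hC : ∀ i, ‖d i‖ ≤ C) (v : EllTwo ι) :
    ‖(⟨fun i => d i * v i, memℓp_mul hC v⟩ : EllTwo ι)‖ ≤ C * ‖v‖ := by
  rcases isEmpty_or_nonempty ι with hι | hι
  · have h1 : (⟨fun i => d i * v i, memℓp_mul hC v⟩ : EllTwo ι) = 0 :=
      Subtype.ext (funext fun i => isEmptyElim i)
    have h2 : v = 0 := Subtype.ext (funext fun i => isEmptyElim i)
    rw [h1, h2]
    simp
  · have hC0 : 0 ≤ C := (norm_nonneg _).trans (hC (Classical.arbitrary ι))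
    have h1 : ‖(C : ℂ) • v‖ = C * ‖v‖ := by
      rw [norm_smul, Complex.norm_real, Real.norm_of_nonneg hC0]
    rw [← h1]
    refine lp.norm_mono (by norm_num) fun i => ?_
    change ‖d i * v i‖ ≤ ‖(C : ℂ) * v i‖
    rw [norm_mul, norm_mul, Complex.norm_real, Real.norm_of_nonneg hC0]
    exact mul_le_mul_of_nonneg_right (hC i) (norm_nonneg _)

open Classical in
/-- The bounded diagonal operator with diagonal entries `d`; the value is `0` if `d` is not
bounded. -/
def diagOp (d : ι → ℂ) : EllTwo ι →L[ℂ] EllTwo ι :=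
  if h : ∃ C : ℝ, ∀ i, ‖d i‖ ≤ C then
    LinearMap.mkContinuous
      { toFun := fun v => ⟨fun i => d i * v i, memℓp_mul h.choose_spec v⟩
        map_add' := fun v w => Subtype.ext (funext fun i => mul_add (d i) (v i) (w i))
        map_smul' := fun c v => Subtype.ext (funext fun i => mul_left_comm (d i) c (v i)) }
      h.choose (norm_mul_le h.choose_spec)
  else 0

theorem diagOp_apply {d : ι → ℂ} {C : ℝ} (hC : ∀ i, ‖d i‖ ≤ C) (v : EllTwo ι) (i : ι) :
    diagOp d v i = d i * v i := by
  have h : ∃ C : ℝ, ∀ i, ‖d i‖ ≤ C := ⟨C, hC⟩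
  simp only [diagOp, dif_pos h]
  rfl

/-- The trace of a trace class operator on `ℓ²(ι)`, computed in the standard basis. -/
def trace (T : EllTwo ι →L[ℂ] EllTwo ι) : ℂ := ∑' i, inner ℂ (basisVec i) (T (basisVec i))

/-- The zeta function `ζ_T(s) = Tr(T |D|^{-s})`, where `absPow s` is `|D|^{-s}`. -/
def zetaFun (absPow : ℂ → EllTwo ι →L[ℂ] EllTwo ι) (T : EllTwo ι →L[ℂ] EllTwo ι) (s : ℂ) : ℂ :=
  trace (T * absPow s)

/-- The part in `Re s > r` of the dimension spectrum of a triple of metric dimension `n`: the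
poles there of meromorphic extensions of the functions `ζ_T`, for `T` in `Ψ`. -/
def dimensionSpectrum (absPow : ℂ → EllTwo ι →L[ℂ] EllTwo ι)
    (Ψ : Set (EllTwo ι →L[ℂ] EllTwo ι)) (n r : ℝ) : Set ℂ :=
  {s | r < s.re ∧ ∃ T ∈ Ψ, ∃ Z, IsMeromorphicExtension (zetaFun absPow T) n r Z ∧
    meromorphicOrderAt Z s < 0}

end EllTwo

/-! ### The spinor representations and the Dirac operator -/

section Spinors

/-- The half-integers `l, m_1, m_2, j` are coded by the integers `n, a, b, k` with `l = n + 1/2`,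
`m_1 = a + 1/2`, `m_2 = b + 1/2`, `j = k + 1/2`. The admissible labels are those with
`1/2 ≤ j ≤ l`, `|m_1| ≤ j` and `|m_2| ≤ l + 1/2 - j`. -/
def IsLabel (n a b k : ℤ) : Prop :=
  0 ≤ k ∧ k ≤ n ∧ -k - 1 ≤ a ∧ a ≤ k ∧ k - n - 1 ≤ b ∧ b ≤ n - k

/-- The admissible labels `(n, a, b, k)`. -/
def Label : Type := {p : ℤ × ℤ × ℤ × ℤ // IsLabel p.1 p.2.1 p.2.2.1 p.2.2.2}

/-- The Hilbert space `ℋ = ℋ₊ ⊕ ℋ₋`; the sign is `true` for `+` and `false` for `-`. -/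
abbrev SpinorSpace : Type := EllTwo (Bool × Label)

open Classical in
/-- The basis vector `|l, m_1, m_2; j⟩_±`, which is `0` if the label is not admissible. -/
def ket (s : Bool) (n a b k : ℤ) : SpinorSpace :=
  if h : IsLabel n a b k then basisVec (s, (⟨(n, a, b, k), h⟩ : Label)) else 0

/-- The half-integer coded by `n`. -/
def half (n : ℤ) : ℝ := n + 1 / 2

/-- `ε = ± 1/2` with `l + ε - j - m_2` even. -/
def eps (n k b : ℤ) : ℝ := if Even (n - k - b) then 1 / 2 else -(1 / 2)

/-- The sign `± 1`. -/
def sgn (s : Bool) : ℝ := if s then 1 else -1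

variable (q : ℝ)

/-- `A⁺_{j, m_1}`. -/
def coefAp (k a : ℤ) : ℝ :=
  let j := half k; let m := half a
  q ^ (m - 1) * √(qnum q (j + m + 1) * qnum q (j - m + 1)) / qnum q (2 * j + 2)

/-- `A⁰_{j, m_1}`. -/
def coefA0 (k a : ℤ) : ℝ :=
  let j := half k; let m := half a
  q ^ (-2 : ℝ) * (q ^ (j + m + 1) * qnum q 2 * qnum q (j - m) - qnum q (2 * j))
    / (qnum q (2 * j) * qnum q (2 * j + 2))

/-- `B⁺_{j, m_1}`. -/
def coefBp (k a : ℤ) : ℝ :=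
  let j := half k; let m := half a
  q ^ (-j + m - 1 / 2) * √(qnum q (j + m + 1) * qnum q (j + m + 2)) / qnum q (2 * j + 2)

/-- `B⁰_{j, m_1}`. -/
def coefB0 (k a : ℤ) : ℝ :=
  let j := half k; let m := half a
  (1 + q ^ 2) * q ^ (m - 1 / 2) * √(qnum q (j - m) * qnum q (j + m + 1))
    / (qnum q (2 * j) * qnum q (2 * j + 2))

/-- `B⁻_{j, m_1}`. -/
def coefBm (k a : ℤ) : ℝ :=
  let j := half k; let m := half a
  q ^ (j + m + 1 / 2) * (-√(qnum q (j - m) * qnum q (j - m - 1))) / qnum q (2 * j)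

/-- `C⁺_{l, j, m_2}`. -/
def coefCp (n k b : ℤ) : ℝ :=
  let l := half n; let j := half k; let m := half b; let e := eps n k b
  q ^ (m - 1 - e) * (-√(qnum q (l + j + m + 3 + e) * qnum q (l + j - m + 3 - e)))
    / qnum q (2 * l + 4)

/-- `C⁰_{l, j, m_2}`. -/
def coefC0 (n k b : ℤ) : ℝ :=
  let l := half n; let j := half k; let m := half b; let e := eps n k b
  qnum q (4 * e) * q ^ (2 * e * l + m - 1 + 3 * e)
    * √(qnum q (l + 1 / 2 + j - 2 * e * m + 2) * qnum q (l + 1 / 2 - j - 2 * e * m))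
    / (qnum q (2 * l + 2) * qnum q (2 * l + 4))

/-- `C⁻_{l, j, m_2}`. -/
def coefCm (n k b : ℤ) : ℝ :=
  let l := half n; let j := half k; let m := half b; let e := eps n k b
  q ^ (m - 1 + e) * (-√(qnum q (l - j + m - e) * qnum q (l - j - m + e))) / qnum q (2 * l + 2)

/-- `H⁺_{l, j, m_2}`. -/
def coefHp (n k b : ℤ) : ℝ :=
  let l := half n; let j := half k; let m := half b; let e := eps n k b
  q ^ (m - 1 + e * (2 * j + 1))
    * √(qnum q (l + 2 * e * j - m + 2 + e) * qnum q (l - 2 * e * j + m + 2 - e))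
    / qnum q (2 * l + 4)

/-- `H⁰_{l, j, m_2}`. -/
def coefH0 (n k b : ℤ) : ℝ :=
  let l := half n; let j := half k; let m := half b; let e := eps n k b
  (qnum q (l - e * (2 * j + 1) - m + 1) * qnum q (l - e * (2 * j + 1) + m + 2)
    - q ^ (-2 : ℝ) * qnum q (l + e * (2 * j + 1) - m + 2) * qnum q (l + e * (2 * j + 1) + m + 1))
    / (qnum q (2 * l + 2) * qnum q (2 * l + 4))

/-- `D⁺_{l, j, m_2}`. -/
def coefDp (n k b : ℤ) : ℝ :=
  let l := half n; let j := half k; let m := half b; let e := eps n k b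
  q ^ (-l + m - 3 / 2) * √(qnum q (l + j + m + 3 + e) * qnum q (l - j + m + 2 - e))
    / qnum q (2 * l + 4)

/-- `D⁰_{l, j, m_2}`. -/
def coefD0 (n k b : ℤ) : ℝ :=
  let l := half n; let j := half k; let m := half b; let e := eps n k b
  qnum q 2 * q ^ (m + 1 / 2)
    * √(qnum q (l - 2 * e * j - m + 1 - e) * qnum q (l - 2 * e * j + m + 2 - e))
    / (qnum q (2 * l + 2) * qnum q (2 * l + 4))

/-- `D⁻_{l, j, m_2}`. -/
def coefDm (n k b : ℤ) : ℝ :=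
  let l := half n; let j := half k; let m := half b; let e := eps n k b
  q ^ (l + m + 3 / 2) * (-√(qnum q (l - j - m + e) * qnum q (l + j - m + 1 - e)))
    / qnum q (2 * l + 2)

/-- `π` is the direct sum of the two chiral spinor representations of `𝒜(S⁴_q)`. -/
structure IsSpinorRep (π : SphereAlg q →⋆ₐ[ℂ] (SpinorSpace →L[ℂ] SpinorSpace)) : Prop where
  x_zero : ∀ (s : Bool) (n a b k : ℤ), IsLabel n a b k →
    π (sphereX q 0) (ket s n a b k) =
        ((coefAp q k a * coefCp q n k b : ℝ) : ℂ) • ket s (n + 1) a b (k + 1)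
      - ((sgn s * (coefAp q k a * coefC0 q n k b) : ℝ) : ℂ) • ket s n a b (k + 1)
      + ((coefAp q k a * coefCm q n k b : ℝ) : ℂ) • ket s (n - 1) a b (k + 1)
      + ((coefA0 q k a * coefHp q n k b : ℝ) : ℂ) • ket s (n + 1) a b k
      + ((sgn s * (coefA0 q k a * coefH0 q n k b) : ℝ) : ℂ) • ket s n a b k
      + ((coefA0 q k a * coefHp q (n - 1) k b : ℝ) : ℂ) • ket s (n - 1) a b k
      + ((coefAp q (k - 1) a * coefCm q (n + 1) (k - 1) b : ℝ) : ℂ) • ket s (n + 1) a b (k - 1)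
      - ((sgn s * (coefAp q (k - 1) a * coefC0 q n (k - 1) b) : ℝ) : ℂ) • ket s n a b (k - 1)
      + ((coefAp q (k - 1) a * coefCp q (n - 1) (k - 1) b : ℝ) : ℂ) • ket s (n - 1) a b (k - 1)
  x_one : ∀ (s : Bool) (n a b k : ℤ), IsLabel n a b k →
    π (sphereX q 1) (ket s n a b k) =
        ((coefBp q k a * coefCp q n k b : ℝ) : ℂ) • ket s (n + 1) (a + 1) b (k + 1)
      - ((sgn s * (coefBp q k a * coefC0 q n k b) : ℝ) : ℂ) • ket s n (a + 1) b (k + 1)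
      + ((coefBp q k a * coefCm q n k b : ℝ) : ℂ) • ket s (n - 1) (a + 1) b (k + 1)
      + ((coefB0 q k a * coefHp q n k b : ℝ) : ℂ) • ket s (n + 1) (a + 1) b k
      + ((sgn s * (coefB0 q k a * coefH0 q n k b) : ℝ) : ℂ) • ket s n (a + 1) b k
      + ((coefB0 q k a * coefHp q (n - 1) k b : ℝ) : ℂ) • ket s (n - 1) (a + 1) b k
      + ((coefBm q k a * coefCm q (n + 1) (k - 1) b : ℝ) : ℂ) • ket s (n + 1) (a + 1) b (k - 1)
      - ((sgn s * (coefBm q k a * coefC0 q n (k - 1) b) : ℝ) : ℂ) • ket s n (a + 1) b (k - 1)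
      + ((coefBm q k a * coefCp q (n - 1) (k - 1) b : ℝ) : ℂ) • ket s (n - 1) (a + 1) b (k - 1)
  x_two : ∀ (s : Bool) (n a b k : ℤ), IsLabel n a b k →
    π (sphereX q 2) (ket s n a b k) =
        ((coefDp q n k b : ℝ) : ℂ) • ket s (n + 1) a (b + 1) k
      + ((sgn s * coefD0 q n k b : ℝ) : ℂ) • ket s n a (b + 1) k
      + ((coefDm q n k b : ℝ) : ℂ) • ket s (n - 1) a (b + 1) k

/-- The eigenvalue `l + 3/2 = n + 2` of `|D|`. -/
def eigval (i : Bool × Label) : ℂ := (i.2.val.1 : ℂ) + 2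

/-- The Dirac operator `D |l, m_1, m_2; j⟩_± = (l + 3/2) |l, m_1, m_2; j⟩_∓`. -/
def dirac : SpinorSpace →ₗ.[ℂ] SpinorSpace := weightedPerm (fun i => (!i.1, i.2)) eigval

/-- The operator `|D|`, with `|D| |l, m_1, m_2; j⟩_± = (l + 3/2) |l, m_1, m_2; j⟩_±`. -/
def absDirac : SpinorSpace →ₗ.[ℂ] SpinorSpace := weightedPerm id eigval

/-- The operator `|D|^{-s}`, bounded for `Re s ≥ 0`. -/
def absDiracPow (s : ℂ) : SpinorSpace →L[ℂ] SpinorSpace := diagOp (fun i => eigval i ^ (-s))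

/-- The grading `γ`, equal to `± 1` on `ℋ_±`. -/
def grading : SpinorSpace →L[ℂ] SpinorSpace := diagOp (fun i => (sgn i.1 : ℂ))

end Spinors

end QuantumSphere

end

open QuantumSphere

noncomputable section

set_option linter.unusedSimpArgs false
set_option linter.unusedVariables false
set_option linter.unusedSectionVars false
set_option linter.unnecessarySeqFocus false

namespace QuantumSphere

/-! ### Structure constants as complex functions of integer labels -/

section Coefficients

variable (x : ℂ)

/-- The `q`-number `[i]` for `q = x ^ 2`. -/
def zq (i : ℤ) : ℂ := (x ^ (2 * i) - x ^ (-2 * i)) / (x ^ (2 : ℤ) - x ^ (-2 : ℤ))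

/-- A complex square root of the `q`-number `[i]`. -/
def rq (i : ℤ) : ℂ := zq x i ^ ((2 : ℕ) : ℂ)⁻¹

theorem rq_sq (i : ℤ) : rq x i ^ 2 = zq x i := Complex.cpow_nat_inv_pow _ two_ne_zero

theorem rq_pow_four (i : ℤ) : rq x i ^ 4 = zq x i ^ 2 := by
  rw [← rq_sq, ← pow_mul]

theorem zq_zero : zq x 0 = 0 := by simp [zq]

theorem rq_zero : rq x 0 = 0 := by simp [rq, zq_zero]

/-- The displacement of the label attached to an index. -/
def dd : Fin 3 → ℤ := ![1, 0, -1]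

/-- The dependence of `E_2` on the first pair of labels. -/
def es (i : Fin 3) (k a : ℤ) : ℂ :=
  ![rq x (k - a + 1) * rq x (k - a + 2), rq x (k + a + 1) * rq x (k - a + 1),
    rq x (k + a + 1) * rq x (k + a)] i

/-- The dependence of `E_2` on the second pair of labels. -/
def ee (i : Fin 3) (n k b : ℤ) : ℂ :=
  if Even (n - k - b) then
    ![rq x (n - k - b) * rq x (n + k + b + 5) / (zq x 2 * zq x (2 * k + 3)),
      rq x (n - k - b) * rq x (n - k + b + 2) / (zq x (2 * k + 1) * zq x (2 * k + 3)),
      -(rq x (n + k - b + 1) * rq x (n - k + b + 2)) / (zq x 2 * zq x (2 * k + 1))] i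
  else
    ![rq x (n - k - b - 1) * rq x (n + k + b + 4) / (zq x 2 * zq x (2 * k + 3)),
      rq x (n + k - b + 2) * rq x (n + k + b + 4) / (zq x (2 * k + 1) * zq x (2 * k + 3)),
      -(rq x (n + k - b + 2) * rq x (n - k + b + 3)) / (zq x 2 * zq x (2 * k + 1))] i

/-- The dependence of `F_2` on the second pair of labels. -/
def ef (i : Fin 3) (n k b : ℤ) : ℂ := ee x i.rev n (k + dd i) (b - 1)

/-- The dependence of `F_2` on the first pair of labels. -/
def fs (i : Fin 3) (k a : ℤ) : ℂ := es x i.rev (k + dd i) (a + 1)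

/-- The coefficients of `x_2`, where `σ` is the sign of the representation. -/
def dc (σ : ℂ) (j : Fin 3) (n k b : ℤ) : ℂ :=
  if Even (n - k - b) then
    ![x ^ (2 * b - 2 * n - 3) * (rq x (n + k + b + 5) * rq x (n - k + b + 2)) / zq x (2 * n + 5),
      σ * zq x 2 * x ^ (2 * b + 2) * (rq x (n - k - b) * rq x (n - k + b + 2))
        / (zq x (2 * n + 3) * zq x (2 * n + 5)),
      -x ^ (2 * n + 2 * b + 5) * (rq x (n - k - b) * rq x (n + k - b + 1)) / zq x (2 * n + 3)] j
  else
    ![x ^ (2 * b - 2 * n - 3) * (rq x (n + k + b + 4) * rq x (n - k + b + 3)) / zq x (2 * n + 5),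
      σ * zq x 2 * x ^ (2 * b + 2) * (rq x (n + k - b + 2) * rq x (n + k + b + 4))
        / (zq x (2 * n + 3) * zq x (2 * n + 5)),
      -x ^ (2 * n + 2 * b + 5) * (rq x (n - k - b - 1) * rq x (n + k - b + 2))
        / zq x (2 * n + 3)] j

/-- `C⁺`. -/
def cp (n k b : ℤ) : ℂ :=
  if Even (n - k - b) then
    -x ^ (2 * b - 2) * (rq x (n + k + b + 5) * rq x (n + k - b + 3)) / zq x (2 * n + 5)
  else -x ^ (2 * b) * (rq x (n + k + b + 4) * rq x (n + k - b + 4)) / zq x (2 * n + 5)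

/-- `C⁻`. -/
def cm (n k b : ℤ) : ℂ :=
  if Even (n - k - b) then
    -x ^ (2 * b) * (rq x (n - k + b) * rq x (n - k - b)) / zq x (2 * n + 3)
  else -x ^ (2 * b - 2) * (rq x (n - k + b + 1) * rq x (n - k - b - 1)) / zq x (2 * n + 3)

/-- `C⁰`. -/
def cz (n k b : ℤ) : ℂ :=
  if Even (n - k - b) then
    zq x 2 * x ^ (2 * n + 2 * b + 3) * (rq x (n + k - b + 3) * rq x (n - k - b))
      / (zq x (2 * n + 3) * zq x (2 * n + 5))
  else
    -(zq x 2 * x ^ (2 * b - 2 * n - 5)) * (rq x (n + k + b + 4) * rq x (n - k + b + 1))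
      / (zq x (2 * n + 3) * zq x (2 * n + 5))

/-- `H⁺`. -/
def hp (n k b : ℤ) : ℂ :=
  if Even (n - k - b) then
    x ^ (2 * b + 2 * k + 1) * (rq x (n + k - b + 3) * rq x (n - k + b + 2)) / zq x (2 * n + 5)
  else x ^ (2 * b - 2 * k - 3) * (rq x (n - k - b + 1) * rq x (n + k + b + 4)) / zq x (2 * n + 5)

/-- `H⁰`. -/
def hz (n k b : ℤ) : ℂ :=
  if Even (n - k - b) then
    (zq x (n - k - b) * zq x (n - k + b + 2)
      - x ^ (-4 : ℤ) * (zq x (n + k - b + 3) * zq x (n + k + b + 3)))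
      / (zq x (2 * n + 3) * zq x (2 * n + 5))
  else
    (zq x (n + k - b + 2) * zq x (n + k + b + 4)
      - x ^ (-4 : ℤ) * (zq x (n - k - b + 1) * zq x (n - k + b + 1)))
      / (zq x (2 * n + 3) * zq x (2 * n + 5))

/-- The common dependence of `x_0` and `x_1` on the second pair of labels. -/
def yc (σ : ℂ) (i j : Fin 3) (n k b : ℤ) : ℂ :=
  ![![cp x n k b, -(σ * cz x n k b), cm x n k b],
    ![hp x n k b, σ * hz x n k b, hp x (n - 1) k b],
    ![cm x (n + 1) (k - 1) b, -(σ * cz x n (k - 1) b), cp x (n - 1) (k - 1) b]] i j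

/-- The factor of `x_1` that depends on `k` only. -/
def gB (i : Fin 3) (k : ℤ) : ℂ :=
  ![x ^ (-2 * k - 1) / zq x (2 * k + 3), (1 + x ^ (4 : ℤ)) / (zq x (2 * k + 1) * zq x (2 * k + 3)),
    -x ^ (2 * k + 3) / zq x (2 * k + 1)] i

/-- The coefficients `B⁺, B⁰, B⁻`. -/
def bc (i : Fin 3) (k a : ℤ) : ℂ := x ^ (2 * a) * gB x i k * fs x i k a

/-- The coefficients `A⁺_j, A⁰_j, A⁺_{j-1}`. -/
def ac (i : Fin 3) (k a : ℤ) : ℂ :=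
  ![x ^ (2 * a - 1) * (rq x (k + a + 2) * rq x (k - a + 1)) / zq x (2 * k + 3),
    x ^ (-4 : ℤ) * (x ^ (2 * k + 2 * a + 4) * zq x 2 * zq x (k - a) - zq x (2 * k + 1))
      / (zq x (2 * k + 1) * zq x (2 * k + 3)),
    x ^ (2 * a - 1) * (rq x (k + a + 1) * rq x (k - a)) / zq x (2 * k + 1)] i

end Coefficients

section Identities

variable {x : ℂ} (hx : x ≠ 0) (hq : ∀ i : ℤ, i ≠ 0 → zq x i ≠ 0) 
theorem rev0 : (0 : Fin 3).rev = 2 := rfl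
theorem rev1 : (1 : Fin 3).rev = 1 := rfl
theorem rev2 : (2 : Fin 3).rev = 0 := rfl
include hq in
theorem pow_four_sub_one_ne_zero : x ^ 4 - 1 ≠ 0 := by
  intro h
  have h1 : x ^ 4 = 1 := by linear_combination h
  apply hq 1 one_ne_zero
  have h2 : x ^ (2 : ℤ) = x ^ (-2 : ℤ) := by
    rw [zpow_neg]
    exact eq_inv_of_mul_eq_one_left (by rw [← h1, ← zpow_add' (by simp)]; norm_cast)
  rw [zq, h2, sub_self, div_zero]

include hx hq
theorem pow_eight_sub_one_ne_zero : x ^ 8 - 1 ≠ 0 := by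
  intro h
  have h1 : x ^ 8 = 1 := by linear_combination h
  apply hq 2 two_ne_zero
  have h2 : x ^ (2 * 2 : ℤ) = x ^ (-2 * 2 : ℤ) := by
    rw [neg_mul, zpow_neg]
    exact eq_inv_of_mul_eq_one_left (by rw [← h1, ← zpow_add' (by simp)]; norm_cast)
  rw [zq, h2, sub_self, zero_div]

/-- The coefficients of `E_1`. -/
def e1 (x : ℂ) (k a : ℤ) : ℂ := rq x (k - a) * rq x (k + a + 2)

omit hx hq in
theorem e1_fs (i : Fin 3) (k a : ℤ) : fs x i k a * e1 x (k + dd i) (a + 1) = e1 x k a * fs x i k (a + 1) := by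
  fin_cases i <;> simp only [e1, fs, es, dd, Fin.zero_eta, Fin.mk_one, Fin.reduceFinMk, rev0, rev1, rev2, Matrix.cons_val] <;> ring_nf

theorem e1_e1 (k a : ℤ) : e1 x k (a - 1) ^ 2 - e1 x k a ^ 2 = (x ^ (4 * a + 2) - x ^ (-4 * a - 2)) / (x ^ (2 : ℤ) - x ^ (-2 : ℤ)) := by
  have h4 := pow_four_sub_one_ne_zero hq
  have hk := zpow_ne_zero k hx
  have ha := zpow_ne_zero a hx
  simp only [e1, mul_pow, rq_sq]
  ring_nf
  simp only [zq, zpow_add₀ hx, zpow_sub₀ hx, zpow_mul, zpow_neg, zpow_ofNat, neg_mul, mul_comm (2:ℤ), mul_comm (4:ℤ)]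
  generalize x ^ k = K at *
  generalize x ^ a = A at *
  field_simp
  ring

set_option maxHeartbeats 1000000 in
theorem bc_e1 (i : Fin 3) (k a : ℤ) : bc x i k a * e1 x (k + dd i) a = x ^ (2 * a + 2) * zq x 2 * ac x i k a + x ^ (-2 : ℤ) * (e1 x k (a - 1) * bc x i k (a - 1)) := by
  have h0 : zq x (1 + k * 2) ≠ 0 := hq _ (by omega)
  have h1 : zq x (3 + k * 2) ≠ 0 := hq _ (by omega)
  have h4 := pow_four_sub_one_ne_zero hq
  have hk := zpow_ne_zero k hx
  have ha := zpow_ne_zero a hx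
  fin_cases i <;>
  simp only [e1, bc, ac, gB, fs, es, dd, Fin.zero_eta, Fin.mk_one, Fin.reduceFinMk, rev0, rev1, rev2, Matrix.cons_val] <;>
  · ring_nf
    try simp only [rq_sq]
    field_simp
    simp only [zq, zpow_add₀ hx, zpow_sub₀ hx, zpow_mul, zpow_neg, zpow_ofNat, neg_mul, mul_comm (2:ℤ), mul_comm (4:ℤ)]
    generalize x ^ k = K at *
    generalize x ^ a = A at *
    field_simp
    ring

set_option maxHeartbeats 4000000 in
theorem low_0_p2 {σ : ℂ} (hs : σ ^ 2 = 1) (n : ℤ) : (dc x σ 0 n 0 (-n - 1) * yc x σ 0 0 (n + dd 0) 0 (-n) - x ^ (4 : ℤ) * (yc x σ 0 0 n 0 (-n - 1) * dc x σ 0 (n + dd 0) (dd 0) (-n - 1))) = 0 := by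
  have h0 : zq x 1 ≠ 0 := hq _ (by omega)
  have h1 : zq x 3 ≠ 0 := hq _ (by omega)
  have h01 : zq x 5 ≠ 0 := hq _ (by omega)
  have h2 : zq x (5 + n * 2) ≠ 0 := hq _ (by omega)
  have h20 : zq x (3 + n * 2) ≠ 0 := hq _ (by omega)
  have h21 : zq x (1 + n * 2) ≠ 0 := hq _ (by omega)
  have h22 : zq x (7 + n * 2) ≠ 0 := hq _ (by omega)
  have h23 : zq x (-1 + n * 2) ≠ 0 := hq _ (by omega)
  have h3 := hq 2 (by omega)
  have h4 := pow_four_sub_one_ne_zero hq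
  have h5 := pow_eight_sub_one_ne_zero hx hq
  have hn := zpow_ne_zero n hx
  simp only [yc, dc, cp, cm, cz, hp, hz, ac, bc, fs, es, gB, dd, rev0, rev1, rev2, Matrix.cons_val, Int.even_iff]
  repeat' first | rw [if_pos (by omega)] | rw [if_neg (by omega)]
  ring_nf
  try simp only [rq_sq, rq_pow_four, rq_zero, hs]
  try field_simp
  try simp only [zq, zpow_add₀ hx, zpow_sub₀ hx, zpow_mul, zpow_neg, zpow_ofNat, neg_mul, mul_comm (2:ℤ), mul_comm (4:ℤ)]
  generalize x ^ n = N at *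
  try field_simp
  try ring

set_option maxHeartbeats 4000000 in
theorem low_0_p1 {σ : ℂ} (hs : σ ^ 2 = 1) (n : ℤ) : (dc x σ 0 n 0 (-n - 1) * yc x σ 0 1 (n + dd 0) 0 (-n) - x ^ (4 : ℤ) * (yc x σ 0 1 n 0 (-n - 1) * dc x σ 0 (n + dd 1) (dd 0) (-n - 1))) + (dc x σ 1 n 0 (-n - 1) * yc x σ 0 0 (n + dd 1) 0 (-n) - x ^ (4 : ℤ) * (yc x σ 0 0 n 0 (-n - 1) * dc x σ 1 (n + dd 0) (dd 0) (-n - 1))) = 0 := by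
  have h0 : zq x 1 ≠ 0 := hq _ (by omega)
  have h1 : zq x 3 ≠ 0 := hq _ (by omega)
  have h01 : zq x 5 ≠ 0 := hq _ (by omega)
  have h2 : zq x (5 + n * 2) ≠ 0 := hq _ (by omega)
  have h20 : zq x (3 + n * 2) ≠ 0 := hq _ (by omega)
  have h21 : zq x (1 + n * 2) ≠ 0 := hq _ (by omega)
  have h22 : zq x (7 + n * 2) ≠ 0 := hq _ (by omega)
  have h23 : zq x (-1 + n * 2) ≠ 0 := hq _ (by omega)
  have h3 := hq 2 (by omega)
  have h4 := pow_four_sub_one_ne_zero hq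
  have h5 := pow_eight_sub_one_ne_zero hx hq
  have hn := zpow_ne_zero n hx
  simp only [yc, dc, cp, cm, cz, hp, hz, ac, bc, fs, es, gB, dd, rev0, rev1, rev2, Matrix.cons_val, Int.even_iff]
  repeat' first | rw [if_pos (by omega)] | rw [if_neg (by omega)]
  ring_nf
  try simp only [rq_sq, rq_pow_four, rq_zero, hs]
  try field_simp
  try simp only [zq, zpow_add₀ hx, zpow_sub₀ hx, zpow_mul, zpow_neg, zpow_ofNat, neg_mul, mul_comm (2:ℤ), mul_comm (4:ℤ)]
  generalize x ^ n = N at *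
  try field_simp
  try ring

set_option maxHeartbeats 4000000 in
theorem low_0_0 {σ : ℂ} (hs : σ ^ 2 = 1) (n : ℤ) : (dc x σ 0 n 0 (-n - 1) * yc x σ 0 2 (n + dd 0) 0 (-n) - x ^ (4 : ℤ) * (yc x σ 0 2 n 0 (-n - 1) * dc x σ 0 (n + dd 2) (dd 0) (-n - 1))) + (dc x σ 1 n 0 (-n - 1) * yc x σ 0 1 (n + dd 1) 0 (-n) - x ^ (4 : ℤ) * (yc x σ 0 1 n 0 (-n - 1) * dc x σ 1 (n + dd 1) (dd 0) (-n - 1))) + (dc x σ 2 n 0 (-n - 1) * yc x σ 0 0 (n + dd 2) 0 (-n) - x ^ (4 : ℤ) * (yc x σ 0 0 n 0 (-n - 1) * dc x σ 2 (n + dd 0) (dd 0) (-n - 1))) = 0 := by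
  have h0 : zq x 1 ≠ 0 := hq _ (by omega)
  have h1 : zq x 3 ≠ 0 := hq _ (by omega)
  have h01 : zq x 5 ≠ 0 := hq _ (by omega)
  have h2 : zq x (5 + n * 2) ≠ 0 := hq _ (by omega)
  have h20 : zq x (3 + n * 2) ≠ 0 := hq _ (by omega)
  have h21 : zq x (1 + n * 2) ≠ 0 := hq _ (by omega)
  have h22 : zq x (7 + n * 2) ≠ 0 := hq _ (by omega)
  have h23 : zq x (-1 + n * 2) ≠ 0 := hq _ (by omega)
  have h3 := hq 2 (by omega)
  have h4 := pow_four_sub_one_ne_zero hq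
  have h5 := pow_eight_sub_one_ne_zero hx hq
  have hn := zpow_ne_zero n hx
  simp only [yc, dc, cp, cm, cz, hp, hz, ac, bc, fs, es, gB, dd, rev0, rev1, rev2, Matrix.cons_val, Int.even_iff]
  repeat' first | rw [if_pos (by omega)] | rw [if_neg (by omega)]
  ring_nf
  try simp only [rq_sq, rq_pow_four, rq_zero, hs]
  try field_simp
  try simp only [zq, zpow_add₀ hx, zpow_sub₀ hx, zpow_mul, zpow_neg, zpow_ofNat, neg_mul, mul_comm (2:ℤ), mul_comm (4:ℤ)]
  generalize x ^ n = N at *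
  try field_simp
  try ring

set_option maxHeartbeats 4000000 in
theorem low_0_m1 {σ : ℂ} (hs : σ ^ 2 = 1) (n : ℤ) : (dc x σ 1 n 0 (-n - 1) * yc x σ 0 2 (n + dd 1) 0 (-n) - x ^ (4 : ℤ) * (yc x σ 0 2 n 0 (-n - 1) * dc x σ 1 (n + dd 2) (dd 0) (-n - 1))) + (dc x σ 2 n 0 (-n - 1) * yc x σ 0 1 (n + dd 2) 0 (-n) - x ^ (4 : ℤ) * (yc x σ 0 1 n 0 (-n - 1) * dc x σ 2 (n + dd 1) (dd 0) (-n - 1))) = 0 := by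
  have h0 : zq x 1 ≠ 0 := hq _ (by omega)
  have h1 : zq x 3 ≠ 0 := hq _ (by omega)
  have h01 : zq x 5 ≠ 0 := hq _ (by omega)
  have h2 : zq x (5 + n * 2) ≠ 0 := hq _ (by omega)
  have h20 : zq x (3 + n * 2) ≠ 0 := hq _ (by omega)
  have h21 : zq x (1 + n * 2) ≠ 0 := hq _ (by omega)
  have h22 : zq x (7 + n * 2) ≠ 0 := hq _ (by omega)
  have h23 : zq x (-1 + n * 2) ≠ 0 := hq _ (by omega)
  have h3 := hq 2 (by omega)
  have h4 := pow_four_sub_one_ne_zero hq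
  have h5 := pow_eight_sub_one_ne_zero hx hq
  have hn := zpow_ne_zero n hx
  simp only [yc, dc, cp, cm, cz, hp, hz, ac, bc, fs, es, gB, dd, rev0, rev1, rev2, Matrix.cons_val, Int.even_iff]
  repeat' first | rw [if_pos (by omega)] | rw [if_neg (by omega)]
  ring_nf
  try simp only [rq_sq, rq_pow_four, rq_zero, hs]
  try field_simp
  try simp only [zq, zpow_add₀ hx, zpow_sub₀ hx, zpow_mul, zpow_neg, zpow_ofNat, neg_mul, mul_comm (2:ℤ), mul_comm (4:ℤ)]
  generalize x ^ n = N at *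
  try field_simp
  try ring

set_option maxHeartbeats 4000000 in
theorem low_0_m2 {σ : ℂ} (hs : σ ^ 2 = 1) (n : ℤ) : (dc x σ 2 n 0 (-n - 1) * yc x σ 0 2 (n + dd 2) 0 (-n) - x ^ (4 : ℤ) * (yc x σ 0 2 n 0 (-n - 1) * dc x σ 2 (n + dd 2) (dd 0) (-n - 1))) = 0 := by
  have h0 : zq x 1 ≠ 0 := hq _ (by omega)
  have h1 : zq x 3 ≠ 0 := hq _ (by omega)
  have h01 : zq x 5 ≠ 0 := hq _ (by omega)
  have h2 : zq x (5 + n * 2) ≠ 0 := hq _ (by omega)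
  have h20 : zq x (3 + n * 2) ≠ 0 := hq _ (by omega)
  have h21 : zq x (1 + n * 2) ≠ 0 := hq _ (by omega)
  have h22 : zq x (7 + n * 2) ≠ 0 := hq _ (by omega)
  have h23 : zq x (-1 + n * 2) ≠ 0 := hq _ (by omega)
  have h3 := hq 2 (by omega)
  have h4 := pow_four_sub_one_ne_zero hq
  have h5 := pow_eight_sub_one_ne_zero hx hq
  have hn := zpow_ne_zero n hx
  simp only [yc, dc, cp, cm, cz, hp, hz, ac, bc, fs, es, gB, dd, rev0, rev1, rev2, Matrix.cons_val, Int.even_iff]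
  repeat' first | rw [if_pos (by omega)] | rw [if_neg (by omega)]
  ring_nf
  try simp only [rq_sq, rq_pow_four, rq_zero, hs]
  try field_simp
  try simp only [zq, zpow_add₀ hx, zpow_sub₀ hx, zpow_mul, zpow_neg, zpow_ofNat, neg_mul, mul_comm (2:ℤ), mul_comm (4:ℤ)]
  generalize x ^ n = N at *
  try field_simp
  try ring

set_option maxHeartbeats 4000000 in
theorem low_1_p2 {σ : ℂ} (hs : σ ^ 2 = 1) (n : ℤ) : (dc x σ 0 n 0 (-n - 1) * yc x σ 1 0 (n + dd 0) 0 (-n) - x ^ (4 : ℤ) * (yc x σ 1 0 n 0 (-n - 1) * dc x σ 0 (n + dd 0) (dd 1) (-n - 1))) = 0 := by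
  have h0 : zq x 1 ≠ 0 := hq _ (by omega)
  have h1 : zq x 3 ≠ 0 := hq _ (by omega)
  have h01 : zq x 5 ≠ 0 := hq _ (by omega)
  have h2 : zq x (5 + n * 2) ≠ 0 := hq _ (by omega)
  have h20 : zq x (3 + n * 2) ≠ 0 := hq _ (by omega)
  have h21 : zq x (1 + n * 2) ≠ 0 := hq _ (by omega)
  have h22 : zq x (7 + n * 2) ≠ 0 := hq _ (by omega)
  have h23 : zq x (-1 + n * 2) ≠ 0 := hq _ (by omega)
  have h3 := hq 2 (by omega)
  have h4 := pow_four_sub_one_ne_zero hq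
  have h5 := pow_eight_sub_one_ne_zero hx hq
  have hn := zpow_ne_zero n hx
  simp only [yc, dc, cp, cm, cz, hp, hz, ac, bc, fs, es, gB, dd, rev0, rev1, rev2, Matrix.cons_val, Int.even_iff]
  repeat' first | rw [if_pos (by omega)] | rw [if_neg (by omega)]
  ring_nf
  try simp only [rq_sq, rq_pow_four, rq_zero, hs]
  try field_simp
  try simp only [zq, zpow_add₀ hx, zpow_sub₀ hx, zpow_mul, zpow_neg, zpow_ofNat, neg_mul, mul_comm (2:ℤ), mul_comm (4:ℤ)]
  generalize x ^ n = N at *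
  try field_simp
  try ring

set_option maxHeartbeats 4000000 in
theorem low_1_p1 {σ : ℂ} (hs : σ ^ 2 = 1) (n : ℤ) : (dc x σ 0 n 0 (-n - 1) * yc x σ 1 1 (n + dd 0) 0 (-n) - x ^ (4 : ℤ) * (yc x σ 1 1 n 0 (-n - 1) * dc x σ 0 (n + dd 1) (dd 1) (-n - 1))) + (dc x σ 1 n 0 (-n - 1) * yc x σ 1 0 (n + dd 1) 0 (-n) - x ^ (4 : ℤ) * (yc x σ 1 0 n 0 (-n - 1) * dc x σ 1 (n + dd 0) (dd 1) (-n - 1))) = 0 := by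
  have h0 : zq x 1 ≠ 0 := hq _ (by omega)
  have h1 : zq x 3 ≠ 0 := hq _ (by omega)
  have h01 : zq x 5 ≠ 0 := hq _ (by omega)
  have h2 : zq x (5 + n * 2) ≠ 0 := hq _ (by omega)
  have h20 : zq x (3 + n * 2) ≠ 0 := hq _ (by omega)
  have h21 : zq x (1 + n * 2) ≠ 0 := hq _ (by omega)
  have h22 : zq x (7 + n * 2) ≠ 0 := hq _ (by omega)
  have h23 : zq x (-1 + n * 2) ≠ 0 := hq _ (by omega)
  have h3 := hq 2 (by omega)
  have h4 := pow_four_sub_one_ne_zero hq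
  have h5 := pow_eight_sub_one_ne_zero hx hq
  have hn := zpow_ne_zero n hx
  simp only [yc, dc, cp, cm, cz, hp, hz, ac, bc, fs, es, gB, dd, rev0, rev1, rev2, Matrix.cons_val, Int.even_iff]
  repeat' first | rw [if_pos (by omega)] | rw [if_neg (by omega)]
  ring_nf
  try simp only [rq_sq, rq_pow_four, rq_zero, hs]
  try field_simp
  try simp only [zq, zpow_add₀ hx, zpow_sub₀ hx, zpow_mul, zpow_neg, zpow_ofNat, neg_mul, mul_comm (2:ℤ), mul_comm (4:ℤ)]
  generalize x ^ n = N at *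
  try field_simp
  try ring

set_option maxHeartbeats 4000000 in
theorem low_1_0 {σ : ℂ} (hs : σ ^ 2 = 1) (n : ℤ) : (dc x σ 0 n 0 (-n - 1) * yc x σ 1 2 (n + dd 0) 0 (-n) - x ^ (4 : ℤ) * (yc x σ 1 2 n 0 (-n - 1) * dc x σ 0 (n + dd 2) (dd 1) (-n - 1))) + (dc x σ 1 n 0 (-n - 1) * yc x σ 1 1 (n + dd 1) 0 (-n) - x ^ (4 : ℤ) * (yc x σ 1 1 n 0 (-n - 1) * dc x σ 1 (n + dd 1) (dd 1) (-n - 1))) + (dc x σ 2 n 0 (-n - 1) * yc x σ 1 0 (n + dd 2) 0 (-n) - x ^ (4 : ℤ) * (yc x σ 1 0 n 0 (-n - 1) * dc x σ 2 (n + dd 0) (dd 1) (-n - 1))) = 0 := by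
  have h0 : zq x 1 ≠ 0 := hq _ (by omega)
  have h1 : zq x 3 ≠ 0 := hq _ (by omega)
  have h01 : zq x 5 ≠ 0 := hq _ (by omega)
  have h2 : zq x (5 + n * 2) ≠ 0 := hq _ (by omega)
  have h20 : zq x (3 + n * 2) ≠ 0 := hq _ (by omega)
  have h21 : zq x (1 + n * 2) ≠ 0 := hq _ (by omega)
  have h22 : zq x (7 + n * 2) ≠ 0 := hq _ (by omega)
  have h23 : zq x (-1 + n * 2) ≠ 0 := hq _ (by omega)
  have h3 := hq 2 (by omega)
  have h4 := pow_four_sub_one_ne_zero hq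
  have h5 := pow_eight_sub_one_ne_zero hx hq
  have hn := zpow_ne_zero n hx
  simp only [yc, dc, cp, cm, cz, hp, hz, ac, bc, fs, es, gB, dd, rev0, rev1, rev2, Matrix.cons_val, Int.even_iff]
  repeat' first | rw [if_pos (by omega)] | rw [if_neg (by omega)]
  ring_nf
  try simp only [rq_sq, rq_pow_four, rq_zero, hs]
  try field_simp
  try simp only [zq, zpow_add₀ hx, zpow_sub₀ hx, zpow_mul, zpow_neg, zpow_ofNat, neg_mul, mul_comm (2:ℤ), mul_comm (4:ℤ)]
  generalize x ^ n = N at *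
  try field_simp
  try ring

set_option maxHeartbeats 4000000 in
theorem low_1_m1 {σ : ℂ} (hs : σ ^ 2 = 1) (n : ℤ) : (dc x σ 1 n 0 (-n - 1) * yc x σ 1 2 (n + dd 1) 0 (-n) - x ^ (4 : ℤ) * (yc x σ 1 2 n 0 (-n - 1) * dc x σ 1 (n + dd 2) (dd 1) (-n - 1))) + (dc x σ 2 n 0 (-n - 1) * yc x σ 1 1 (n + dd 2) 0 (-n) - x ^ (4 : ℤ) * (yc x σ 1 1 n 0 (-n - 1) * dc x σ 2 (n + dd 1) (dd 1) (-n - 1))) = 0 := by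
  have h0 : zq x 1 ≠ 0 := hq _ (by omega)
  have h1 : zq x 3 ≠ 0 := hq _ (by omega)
  have h01 : zq x 5 ≠ 0 := hq _ (by omega)
  have h2 : zq x (5 + n * 2) ≠ 0 := hq _ (by omega)
  have h20 : zq x (3 + n * 2) ≠ 0 := hq _ (by omega)
  have h21 : zq x (1 + n * 2) ≠ 0 := hq _ (by omega)
  have h22 : zq x (7 + n * 2) ≠ 0 := hq _ (by omega)
  have h23 : zq x (-1 + n * 2) ≠ 0 := hq _ (by omega)
  have h3 := hq 2 (by omega)
  have h4 := pow_four_sub_one_ne_zero hq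
  have h5 := pow_eight_sub_one_ne_zero hx hq
  have hn := zpow_ne_zero n hx
  simp only [yc, dc, cp, cm, cz, hp, hz, ac, bc, fs, es, gB, dd, rev0, rev1, rev2, Matrix.cons_val, Int.even_iff]
  repeat' first | rw [if_pos (by omega)] | rw [if_neg (by omega)]
  ring_nf
  try simp only [rq_sq, rq_pow_four, rq_zero, hs]
  try field_simp
  try simp only [zq, zpow_add₀ hx, zpow_sub₀ hx, zpow_mul, zpow_neg, zpow_ofNat, neg_mul, mul_comm (2:ℤ), mul_comm (4:ℤ)]
  generalize x ^ n = N at *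
  try field_simp
  try ring

set_option maxHeartbeats 4000000 in
theorem low_1_m2 {σ : ℂ} (hs : σ ^ 2 = 1) (n : ℤ) : (dc x σ 2 n 0 (-n - 1) * yc x σ 1 2 (n + dd 2) 0 (-n) - x ^ (4 : ℤ) * (yc x σ 1 2 n 0 (-n - 1) * dc x σ 2 (n + dd 2) (dd 1) (-n - 1))) = 0 := by
  have h0 : zq x 1 ≠ 0 := hq _ (by omega)
  have h1 : zq x 3 ≠ 0 := hq _ (by omega)
  have h01 : zq x 5 ≠ 0 := hq _ (by omega)
  have h2 : zq x (5 + n * 2) ≠ 0 := hq _ (by omega)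
  have h20 : zq x (3 + n * 2) ≠ 0 := hq _ (by omega)
  have h21 : zq x (1 + n * 2) ≠ 0 := hq _ (by omega)
  have h22 : zq x (7 + n * 2) ≠ 0 := hq _ (by omega)
  have h23 : zq x (-1 + n * 2) ≠ 0 := hq _ (by omega)
  have h3 := hq 2 (by omega)
  have h4 := pow_four_sub_one_ne_zero hq
  have h5 := pow_eight_sub_one_ne_zero hx hq
  have hn := zpow_ne_zero n hx
  simp only [yc, dc, cp, cm, cz, hp, hz, ac, bc, fs, es, gB, dd, rev0, rev1, rev2, Matrix.cons_val, Int.even_iff]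
  repeat' first | rw [if_pos (by omega)] | rw [if_neg (by omega)]
  ring_nf
  try simp only [rq_sq, rq_pow_four, rq_zero, hs]
  try field_simp
  try simp only [zq, zpow_add₀ hx, zpow_sub₀ hx, zpow_mul, zpow_neg, zpow_ofNat, neg_mul, mul_comm (2:ℤ), mul_comm (4:ℤ)]
  generalize x ^ n = N at *
  try field_simp
  try ring

set_option maxHeartbeats 4000000 in
theorem low_norm {σ : ℂ} (hs : σ ^ 2 = 1) (n : ℤ) : (ac x 0 0 (-1) * yc x σ 0 0 n 0 (-n-1)) ^ 2 + (ac x 1 0 (-1) * yc x σ 1 0 n 0 (-n-1)) ^ 2 + (ac x 1 0 (-1) * yc x σ 1 1 n 0 (-n-1)) ^ 2 + (bc x 2 1 (-2) * yc x σ 2 2 (n+1) 1 (-n-1)) ^ 2 + (dc x σ 2 (n + 1) 0 (-n-2)) ^ 2 = 1 := by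
  have h0 : zq x 1 ≠ 0 := hq _ (by omega)
  have h1 : zq x 3 ≠ 0 := hq _ (by omega)
  have h01 : zq x 5 ≠ 0 := hq _ (by omega)
  have h2 : zq x (5 + n * 2) ≠ 0 := hq _ (by omega)
  have h20 : zq x (3 + n * 2) ≠ 0 := hq _ (by omega)
  have h21 : zq x (1 + n * 2) ≠ 0 := hq _ (by omega)
  have h22 : zq x (7 + n * 2) ≠ 0 := hq _ (by omega)
  have h23 : zq x (-1 + n * 2) ≠ 0 := hq _ (by omega)
  have h3 := hq 2 (by omega)
  have h4 := pow_four_sub_one_ne_zero hq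
  have h5 := pow_eight_sub_one_ne_zero hx hq
  have hn := zpow_ne_zero n hx
  simp only [yc, dc, cp, cm, cz, hp, hz, ac, bc, fs, es, gB, dd, rev0, rev1, rev2, Matrix.cons_val, Int.even_iff]
  repeat' first | rw [if_pos (by omega)] | rw [if_neg (by omega)]
  ring_nf
  try simp only [rq_sq, rq_pow_four, rq_zero, hs]
  try field_simp
  try simp only [zq, zpow_add₀ hx, zpow_sub₀ hx, zpow_mul, zpow_neg, zpow_ofNat, neg_mul, mul_comm (2:ℤ), mul_comm (4:ℤ)]
  generalize x ^ n = N at *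
  try field_simp
  try ring

set_option maxHeartbeats 4000000 in
theorem bc_yc (σ : ℂ) (i j : Fin 3) (n k b : ℤ) : x ^ (2 * b) * gB x i k * yc x σ i j n k b
    = dc x σ j n k b * ef x i (n + dd j) k (b+1) - x ^ (-2 : ℤ) * (ef x i n k b * dc x σ j n (k+dd i) (b-1)) := by
  have h0 : zq x (1 + k * 2) ≠ 0 := hq _ (by omega)
  have h1 : zq x (3 + k * 2) ≠ 0 := hq _ (by omega)
  have h2 : zq x (5 + n * 2) ≠ 0 := hq _ (by omega)
  have h20 : zq x (3 + n * 2) ≠ 0 := hq _ (by omega)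
  have h21 : zq x (1 + n * 2) ≠ 0 := hq _ (by omega)
  have h3 := hq 2 (by omega)
  have h4 := pow_four_sub_one_ne_zero hq
  have hn := zpow_ne_zero n hx
  have hk := zpow_ne_zero k hx
  have hb := zpow_ne_zero b hx
  fin_cases i <;> fin_cases j <;>
  simp only [yc, gB, dc, ef, cp, cm, cz, hp, hz, ee, dd, Fin.zero_eta, Fin.mk_one, Fin.reduceFinMk, rev0, rev1, rev2, Matrix.cons_val, Int.even_iff] <;>
  split_ifs <;> (try (exfalso; omega)) <;>
  · ring_nf
    simp only [rq_sq]
    field_simp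
    simp only [zq, zpow_add₀ hx, zpow_sub₀ hx, zpow_mul, zpow_neg, zpow_ofNat, neg_mul, mul_comm (2:ℤ)]
    generalize x ^ n = N at *
    generalize x ^ k = K at *
    generalize x ^ b = B at *
    field_simp
    ring

set_option maxHeartbeats 4000000 in
theorem dc_ee (σ : ℂ) (i j : Fin 3) (n k b : ℤ) : dc x σ j n k b * ee x i (n + dd j) k (b + 1) = x ^ (-2 : ℤ) * (ee x i n k b * dc x σ j n (k + dd i) (b + 1)) := by
  have h0 : zq x (1 + k * 2) ≠ 0 := hq _ (by omega)
  have h1 : zq x (3 + k * 2) ≠ 0 := hq _ (by omega)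
  have h01 : zq x (5 + k * 2) ≠ 0 := hq _ (by omega)
  have h02 : zq x (-1 + k * 2) ≠ 0 := hq _ (by omega)
  have h2 : zq x (5 + n * 2) ≠ 0 := hq _ (by omega)
  have h20 : zq x (3 + n * 2) ≠ 0 := hq _ (by omega)
  have h21 : zq x (1 + n * 2) ≠ 0 := hq _ (by omega)
  have h22 : zq x (7 + n * 2) ≠ 0 := hq _ (by omega)
  have h3 := hq 2 (by omega)
  have h4 := pow_four_sub_one_ne_zero hq
  have h5 := pow_eight_sub_one_ne_zero hx hq
  have hn := zpow_ne_zero n hx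
  have hk := zpow_ne_zero k hx
  have hb := zpow_ne_zero b hx
  fin_cases i <;> fin_cases j <;>
  simp only [yc, gB, dc, es, fs, ef, cp, cm, cz, hp, hz, ee, dd, Fin.zero_eta, Fin.mk_one, Fin.reduceFinMk, rev0, rev1, rev2, Matrix.cons_val, Int.even_iff] <;>
  split_ifs <;> (try (exfalso; omega)) <;>
  · ring_nf
    try simp only [rq_sq]
    try field_simp
    try simp only [zq, zpow_add₀ hx, zpow_sub₀ hx, zpow_mul, zpow_neg, zpow_ofNat, neg_mul, mul_comm (2:ℤ), mul_comm (4:ℤ)]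
    generalize x ^ n = N at *
    generalize x ^ k = K at *
    generalize x ^ b = B at *
    try field_simp
    try ring
set_option maxHeartbeats 4000000 in
theorem ef00 (n a b k : ℤ) : (fs x 0 k a * ef x 0 n k b * (es x 0 (k + dd 0) (a + 1) * ee x 0 n (k + dd 0) (b - 1)) - es x 0 k a * ee x 0 n k b * (fs x 0 (k + dd 0) (a - 1) * ef x 0 n (k + dd 0) (b + 1))) = 0 := by
  have h0 : zq x (1 + k * 2) ≠ 0 := hq _ (by omega)
  have h1 : zq x (3 + k * 2) ≠ 0 := hq _ (by omega)
  have h01 : zq x (5 + k * 2) ≠ 0 := hq _ (by omega)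
  have h02 : zq x (-1 + k * 2) ≠ 0 := hq _ (by omega)
  have h2 : zq x (5 + n * 2) ≠ 0 := hq _ (by omega)
  have h20 : zq x (3 + n * 2) ≠ 0 := hq _ (by omega)
  have h21 : zq x (1 + n * 2) ≠ 0 := hq _ (by omega)
  have h22 : zq x (7 + n * 2) ≠ 0 := hq _ (by omega)
  have h3 := hq 2 (by omega)
  have h4 := pow_four_sub_one_ne_zero hq
  have h5 := pow_eight_sub_one_ne_zero hx hq
  have hn := zpow_ne_zero n hx
  have hk := zpow_ne_zero k hx
  have hb := zpow_ne_zero b hx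
  have ha := zpow_ne_zero a hx
  simp only [yc, gB, dc, es, fs, ef, cp, cm, cz, hp, hz, ee, dd, Fin.zero_eta, Fin.mk_one, Fin.reduceFinMk, rev0, rev1, rev2, Matrix.cons_val, Int.even_iff] <;>
  split_ifs <;> (try (exfalso; omega)) <;>
  ring_nf

set_option maxHeartbeats 4000000 in
theorem ef22 (n a b k : ℤ) : (fs x 2 k a * ef x 2 n k b * (es x 2 (k + dd 2) (a + 1) * ee x 2 n (k + dd 2) (b - 1)) - es x 2 k a * ee x 2 n k b * (fs x 2 (k + dd 2) (a - 1) * ef x 2 n (k + dd 2) (b + 1))) = 0 := by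
  have h0 : zq x (1 + k * 2) ≠ 0 := hq _ (by omega)
  have h1 : zq x (3 + k * 2) ≠ 0 := hq _ (by omega)
  have h01 : zq x (5 + k * 2) ≠ 0 := hq _ (by omega)
  have h02 : zq x (-1 + k * 2) ≠ 0 := hq _ (by omega)
  have h2 : zq x (5 + n * 2) ≠ 0 := hq _ (by omega)
  have h20 : zq x (3 + n * 2) ≠ 0 := hq _ (by omega)
  have h21 : zq x (1 + n * 2) ≠ 0 := hq _ (by omega)
  have h22 : zq x (7 + n * 2) ≠ 0 := hq _ (by omega)
  have h3 := hq 2 (by omega)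
  have h4 := pow_four_sub_one_ne_zero hq
  have h5 := pow_eight_sub_one_ne_zero hx hq
  have hn := zpow_ne_zero n hx
  have hk := zpow_ne_zero k hx
  have hb := zpow_ne_zero b hx
  have ha := zpow_ne_zero a hx
  simp only [yc, gB, dc, es, fs, ef, cp, cm, cz, hp, hz, ee, dd, Fin.zero_eta, Fin.mk_one, Fin.reduceFinMk, rev0, rev1, rev2, Matrix.cons_val, Int.even_iff] <;>
  split_ifs <;> (try (exfalso; omega)) <;>
  ring_nf

set_option maxHeartbeats 4000000 in
theorem ef01 (n a b k : ℤ) : (fs x 0 k a * ef x 0 n k b * (es x 1 (k + dd 0) (a + 1) * ee x 1 n (k + dd 0) (b - 1)) - es x 1 k a * ee x 1 n k b * (fs x 0 (k + dd 1) (a - 1) * ef x 0 n (k + dd 1) (b + 1))) + (fs x 1 k a * ef x 1 n k b * (es x 0 (k + dd 1) (a + 1) * ee x 0 n (k + dd 1) (b - 1)) - es x 0 k a * ee x 0 n k b * (fs x 1 (k + dd 0) (a - 1) * ef x 1 n (k + dd 0) (b + 1))) = 0 := by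
  have h0 : zq x (1 + k * 2) ≠ 0 := hq _ (by omega)
  have h1 : zq x (3 + k * 2) ≠ 0 := hq _ (by omega)
  have h01 : zq x (5 + k * 2) ≠ 0 := hq _ (by omega)
  have h02 : zq x (-1 + k * 2) ≠ 0 := hq _ (by omega)
  have h2 : zq x (5 + n * 2) ≠ 0 := hq _ (by omega)
  have h20 : zq x (3 + n * 2) ≠ 0 := hq _ (by omega)
  have h21 : zq x (1 + n * 2) ≠ 0 := hq _ (by omega)
  have h22 : zq x (7 + n * 2) ≠ 0 := hq _ (by omega)
  have h3 := hq 2 (by omega)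
  have h4 := pow_four_sub_one_ne_zero hq
  have h5 := pow_eight_sub_one_ne_zero hx hq
  have hn := zpow_ne_zero n hx
  have hk := zpow_ne_zero k hx
  have hb := zpow_ne_zero b hx
  have ha := zpow_ne_zero a hx
  simp only [yc, gB, dc, es, fs, ef, cp, cm, cz, hp, hz, ee, dd, Fin.zero_eta, Fin.mk_one, Fin.reduceFinMk, rev0, rev1, rev2, Matrix.cons_val, Int.even_iff] <;>
  split_ifs <;> (try (exfalso; omega)) <;>
  · ring_nf
    try simp only [rq_sq]
    try field_simp
    try simp only [zq, zpow_add₀ hx, zpow_sub₀ hx, zpow_mul, zpow_neg, zpow_ofNat, neg_mul, mul_comm (2:ℤ), mul_comm (4:ℤ)]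
    generalize x ^ n = N at *
    generalize x ^ k = K at *
    generalize x ^ b = B at *
    generalize x ^ a = A at *
    try field_simp
    try ring
set_option maxHeartbeats 4000000 in
theorem ef12 (n a b k : ℤ) : (fs x 1 k a * ef x 1 n k b * (es x 2 (k + dd 1) (a + 1) * ee x 2 n (k + dd 1) (b - 1)) - es x 2 k a * ee x 2 n k b * (fs x 1 (k + dd 2) (a - 1) * ef x 1 n (k + dd 2) (b + 1))) + (fs x 2 k a * ef x 2 n k b * (es x 1 (k + dd 2) (a + 1) * ee x 1 n (k + dd 2) (b - 1)) - es x 1 k a * ee x 1 n k b * (fs x 2 (k + dd 1) (a - 1) * ef x 2 n (k + dd 1) (b + 1))) = 0 := by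
  have h0 : zq x (1 + k * 2) ≠ 0 := hq _ (by omega)
  have h1 : zq x (3 + k * 2) ≠ 0 := hq _ (by omega)
  have h01 : zq x (5 + k * 2) ≠ 0 := hq _ (by omega)
  have h02 : zq x (-1 + k * 2) ≠ 0 := hq _ (by omega)
  have h2 : zq x (5 + n * 2) ≠ 0 := hq _ (by omega)
  have h20 : zq x (3 + n * 2) ≠ 0 := hq _ (by omega)
  have h21 : zq x (1 + n * 2) ≠ 0 := hq _ (by omega)
  have h22 : zq x (7 + n * 2) ≠ 0 := hq _ (by omega)
  have h3 := hq 2 (by omega)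
  have h4 := pow_four_sub_one_ne_zero hq
  have h5 := pow_eight_sub_one_ne_zero hx hq
  have hn := zpow_ne_zero n hx
  have hk := zpow_ne_zero k hx
  have hb := zpow_ne_zero b hx
  have ha := zpow_ne_zero a hx
  simp only [yc, gB, dc, es, fs, ef, cp, cm, cz, hp, hz, ee, dd, Fin.zero_eta, Fin.mk_one, Fin.reduceFinMk, rev0, rev1, rev2, Matrix.cons_val, Int.even_iff] <;>
  split_ifs <;> (try (exfalso; omega)) <;>
  · ring_nf
    try simp only [rq_sq]
    try field_simp
    try simp only [zq, zpow_add₀ hx, zpow_sub₀ hx, zpow_mul, zpow_neg, zpow_ofNat, neg_mul, mul_comm (2:ℤ), mul_comm (4:ℤ)]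
    generalize x ^ n = N at *
    generalize x ^ k = K at *
    generalize x ^ b = B at *
    generalize x ^ a = A at *
    try field_simp
    try ring
set_option maxHeartbeats 4000000 in
theorem ef0 (n a b k : ℤ) : (fs x 0 k a * ef x 0 n k b * (es x 2 (k + dd 0) (a + 1) * ee x 2 n (k + dd 0) (b - 1)) - es x 2 k a * ee x 2 n k b * (fs x 0 (k + dd 2) (a - 1) * ef x 0 n (k + dd 2) (b + 1))) + (fs x 1 k a * ef x 1 n k b * (es x 1 (k + dd 1) (a + 1) * ee x 1 n (k + dd 1) (b - 1)) - es x 1 k a * ee x 1 n k b * (fs x 1 (k + dd 1) (a - 1) * ef x 1 n (k + dd 1) (b + 1))) + (fs x 2 k a * ef x 2 n k b * (es x 0 (k + dd 2) (a + 1) * ee x 0 n (k + dd 2) (b - 1)) - es x 0 k a * ee x 0 n k b * (fs x 2 (k + dd 0) (a - 1) * ef x 2 n (k + dd 0) (b + 1))) = (x ^ (4 * (b - a)) - x ^ (-4 * (b - a))) / (x ^ (4 : ℤ) - x ^ (-4 : ℤ)) := by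
  have h0 : zq x (1 + k * 2) ≠ 0 := hq _ (by omega)
  have h1 : zq x (3 + k * 2) ≠ 0 := hq _ (by omega)
  have h01 : zq x (5 + k * 2) ≠ 0 := hq _ (by omega)
  have h02 : zq x (-1 + k * 2) ≠ 0 := hq _ (by omega)
  have h2 : zq x (5 + n * 2) ≠ 0 := hq _ (by omega)
  have h20 : zq x (3 + n * 2) ≠ 0 := hq _ (by omega)
  have h21 : zq x (1 + n * 2) ≠ 0 := hq _ (by omega)
  have h22 : zq x (7 + n * 2) ≠ 0 := hq _ (by omega)
  have h3 := hq 2 (by omega)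
  have h4 := pow_four_sub_one_ne_zero hq
  have h5 := pow_eight_sub_one_ne_zero hx hq
  have hn := zpow_ne_zero n hx
  have hk := zpow_ne_zero k hx
  have hb := zpow_ne_zero b hx
  have ha := zpow_ne_zero a hx
  simp only [yc, gB, dc, es, fs, ef, cp, cm, cz, hp, hz, ee, dd, Fin.zero_eta, Fin.mk_one, Fin.reduceFinMk, rev0, rev1, rev2, Matrix.cons_val, Int.even_iff] <;>
  split_ifs <;> (try (exfalso; omega)) <;>
  · ring_nf
    try simp only [rq_sq]
    try field_simp
    try simp only [zq, zpow_add₀ hx, zpow_sub₀ hx, zpow_mul, zpow_neg, zpow_ofNat, neg_mul, mul_comm (2:ℤ), mul_comm (4:ℤ)]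
    generalize x ^ n = N at *
    generalize x ^ k = K at *
    generalize x ^ b = B at *
    generalize x ^ a = A at *
    try field_simp
    try ring

end Identities

/-! ### Weighted shifts on functions of integer labels -/

/-- The group of label displacements `(n, a, b, k)`. -/
abbrev Lat : Type := ℤ × ℤ × ℤ × ℤ

/-- Functions of a sign and an integer label. -/
abbrev LatFun : Type := Bool → Lat → ℂ

/-- The weighted shift by `d` with weight `c`. -/
def sh (d : Lat) (c : LatFun) : Module.End ℂ LatFun where
  toFun f := fun s p => c s (p - d) * f s (p - d)
  map_add' f g := by ext s p; simp [mul_add]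
  map_smul' t f := by ext s p; simp [mul_left_comm]

theorem sh_apply (d : Lat) (c f : LatFun) (s : Bool) (p : Lat) :
    sh d c f s p = c s (p - d) * f s (p - d) := rfl

theorem sh_mul (d d' : Lat) (c c' : LatFun) :
    sh d' c' * sh d c = sh (d' + d) (fun s p => c' s (p + d) * c s p) := by
  refine LinearMap.ext fun f => funext fun s => funext fun p => ?_
  simp only [Module.End.mul_apply, sh_apply]
  rw [show p - (d' + d) + d = p - d' by abel, show p - (d' + d) = p - d' - d by abel, mul_assoc]

theorem sh_add (d : Lat) (c c' : LatFun) : sh d c + sh d c' = sh d (c + c') := by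
  refine LinearMap.ext fun f => funext fun s => funext fun p => ?_
  simp [sh_apply, add_mul]

theorem sh_sub (d : Lat) (c c' : LatFun) : sh d c - sh d c' = sh d (c - c') := by
  refine LinearMap.ext fun f => funext fun s => funext fun p => ?_
  simp [sh_apply, sub_mul]

theorem smul_sh (t : ℂ) (d : Lat) (c : LatFun) : t • sh d c = sh d (t • c) := by
  refine LinearMap.ext fun f => funext fun s => funext fun p => ?_
  simp [sh_apply, mul_assoc]

theorem sh_zero (d : Lat) : sh d 0 = 0 := by
  refine LinearMap.ext fun f => funext fun s => funext fun p => ?_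
  simp [sh_apply]

theorem sh_one : sh 0 (fun _ _ => 1) = 1 := by
  refine LinearMap.ext fun f => funext fun s => funext fun p => ?_
  simp [sh_apply]

theorem sh_congr {d d' : Lat} {c c' : LatFun} (hd : d = d') (h : ∀ s p, c s p = c' s p) :
    sh d c = sh d' c' := by
  rw [hd, show c = c' from funext fun s => funext fun p => h s p]

/-- The sign of a component as a complex number. -/
def csgn (s : Bool) : ℂ := if s then 1 else -1

theorem csgn_sq (s : Bool) : csgn s ^ 2 = 1 := by cases s <;> simp [csgn]

section Operators

variable (x : ℂ)

/-- `K_1` and its powers. -/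
def wK1 (e : ℤ) : Module.End ℂ LatFun := sh 0 fun _ p => x ^ (e * (2 * p.2.1 + 1))

/-- `K_2` and its powers. -/
def wK2 (e : ℤ) : Module.End ℂ LatFun := sh 0 fun _ p => x ^ (e * (2 * (p.2.2.1 - p.2.1)))

/-- `E_1`. -/
def wE1 : Module.End ℂ LatFun := sh (0, 1, 0, 0) fun _ p => e1 x p.2.2.2 p.2.1

/-- `F_1`. -/
def wF1 : Module.End ℂ LatFun := sh (0, -1, 0, 0) fun _ p => e1 x p.2.2.2 (p.2.1 - 1)

/-- `E_2`. -/
def wE2 : Module.End ℂ LatFun :=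
  ∑ i, sh (0, -1, 1, dd i) fun _ p => es x i p.2.2.2 p.2.1 * ee x i p.1 p.2.2.2 p.2.2.1

/-- `F_2`. -/
def wF2 : Module.End ℂ LatFun :=
  ∑ i, sh (0, 1, -1, dd i) fun _ p => fs x i p.2.2.2 p.2.1 * ef x i p.1 p.2.2.2 p.2.2.1

/-- `x_0`. -/
def wX0 : Module.End ℂ LatFun := ∑ i, ∑ j, sh (dd j, 0, 0, dd i) fun s p =>
  ac x i p.2.2.2 p.2.1 * yc x (csgn s) i j p.1 p.2.2.2 p.2.2.1

/-- `x_1`. -/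
def wX1 : Module.End ℂ LatFun := ∑ i, ∑ j, sh (dd j, 1, 0, dd i) fun s p =>
  bc x i p.2.2.2 p.2.1 * yc x (csgn s) i j p.1 p.2.2.2 p.2.2.1

/-- `x_2`. -/
def wX2 : Module.End ℂ LatFun :=
  ∑ j, sh (dd j, 0, 1, 0) fun s p => dc x (csgn s) j p.1 p.2.2.2 p.2.2.1

variable {x} (hx : x ≠ 0) (hq : ∀ i : ℤ, i ≠ 0 → zq x i ≠ 0)

include hx

theorem wK1_mul (e f : ℤ) : wK1 x e * wK1 x f = wK1 x (e + f) := by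
  rw [wK1, wK1, sh_mul]
  refine sh_congr (by simp) fun s p => ?_
  simp only [add_zero, ← zpow_add₀ hx]
  congr 1; ring

theorem wK2_mul (e f : ℤ) : wK2 x e * wK2 x f = wK2 x (e + f) := by
  rw [wK2, wK2, sh_mul]
  refine sh_congr (by simp) fun s p => ?_
  simp only [add_zero, ← zpow_add₀ hx]
  congr 1; ring

omit hx in
theorem wK1_zero : wK1 x 0 = 1 := by
  rw [← sh_one, wK1]; exact sh_congr rfl fun s p => by simp

omit hx in
theorem wK2_zero : wK2 x 0 = 1 := by
  rw [← sh_one, wK2]; exact sh_congr rfl fun s p => by simp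

omit hx in
theorem wK_comm (e f : ℤ) : wK1 x e * wK2 x f = wK2 x f * wK1 x e := by
  rw [wK1, wK2, sh_mul, sh_mul]
  exact sh_congr rfl fun s p => by simp [mul_comm]

theorem wK1_sh (e : ℤ) (d : Lat) (c : LatFun) :
    wK1 x e * sh d c = x ^ (2 * e * d.2.1) • (sh d c * wK1 x e) := by
  rw [wK1, sh_mul, sh_mul, smul_sh]
  refine sh_congr (by simp) fun s p => ?_
  simp only [Pi.smul_apply, smul_eq_mul, add_zero, Prod.fst_add, Prod.snd_add]
  rw [mul_left_comm, ← zpow_add₀ hx, mul_comm]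
  ring_nf

theorem wK2_sh (e : ℤ) (d : Lat) (c : LatFun) :
    wK2 x e * sh d c = x ^ (2 * e * (d.2.2.1 - d.2.1)) • (sh d c * wK2 x e) := by
  rw [wK2, sh_mul, sh_mul, smul_sh]
  refine sh_congr (by simp) fun s p => ?_
  have h : x ^ (e * (2 * (p.2.2.1 + d.2.2.1 - (p.2.1 + d.2.1))))
      = x ^ (2 * e * (d.2.2.1 - d.2.1)) * x ^ (e * (2 * (p.2.2.1 - p.2.1))) := by
    rw [← zpow_add₀ hx]; ring_nf
  simp only [Pi.smul_apply, smul_eq_mul, add_zero, Prod.fst_add, Prod.snd_add]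
  linear_combination c s p * h

theorem wK1_E1 (e : ℤ) : wK1 x e * wE1 x = x ^ (2 * e) • (wE1 x * wK1 x e) := by
  rw [wE1, wK1_sh hx]; simp

theorem wK2_E1 (e : ℤ) : wK2 x e * wE1 x = x ^ (-2 * e) • (wE1 x * wK2 x e) := by
  rw [wE1, wK2_sh hx]; simp

theorem wK1_E2 (e : ℤ) : wK1 x e * wE2 x = x ^ (-2 * e) • (wE2 x * wK1 x e) := by
  simp only [wE2, Finset.mul_sum, Finset.sum_mul, Finset.smul_sum, wK1_sh hx]; simp

theorem wK2_E2 (e : ℤ) : wK2 x e * wE2 x = x ^ (4 * e) • (wE2 x * wK2 x e) := by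
  simp only [wE2, Finset.mul_sum, Finset.sum_mul, Finset.smul_sum, wK2_sh hx]
  simp [show 2 * e * 2 = 4 * e by ring]

theorem wK1_X0 (e : ℤ) : wK1 x e * wX0 x = wX0 x * wK1 x e := by
  simp only [wX0, Finset.mul_sum, Finset.sum_mul, wK1_sh hx]; simp

theorem wK2_X0 (e : ℤ) : wK2 x e * wX0 x = wX0 x * wK2 x e := by
  simp only [wX0, Finset.mul_sum, Finset.sum_mul, wK2_sh hx]; simp

theorem wK1_X1 (e : ℤ) : wK1 x e * wX1 x = x ^ (2 * e) • (wX1 x * wK1 x e) := by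
  simp only [wX1, Finset.mul_sum, Finset.sum_mul, Finset.smul_sum, wK1_sh hx]; simp

theorem wK2_X1 (e : ℤ) : wK2 x e * wX1 x = x ^ (-2 * e) • (wX1 x * wK2 x e) := by
  simp only [wX1, Finset.mul_sum, Finset.sum_mul, Finset.smul_sum, wK2_sh hx]; simp

theorem wK1_X2 (e : ℤ) : wK1 x e * wX2 x = wX2 x * wK1 x e := by
  simp only [wX2, Finset.mul_sum, Finset.sum_mul, wK1_sh hx]; simp

theorem wK2_X2 (e : ℤ) : wK2 x e * wX2 x = x ^ (2 * e) • (wX2 x * wK2 x e) := by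
  simp only [wX2, Finset.mul_sum, Finset.sum_mul, Finset.smul_sum, wK2_sh hx]; simp

omit hx in
theorem wE1_X2 : wE1 x * wX2 x = wX2 x * wE1 x := by
  simp only [wX2, wE1, Finset.mul_sum, Finset.sum_mul, sh_mul]
  refine Finset.sum_congr rfl fun j _ => sh_congr (by simp) fun s p => ?_
  simp [mul_comm]

omit hx in
theorem wF1_X2 : wF1 x * wX2 x = wX2 x * wF1 x := by
  simp only [wX2, wF1, Finset.mul_sum, Finset.sum_mul, sh_mul]
  refine Finset.sum_congr rfl fun j _ => sh_congr (by simp) fun s p => ?_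
  simp [mul_comm]

omit hx in
theorem wE1_F2 : wE1 x * wF2 x = wF2 x * wE1 x := by
  simp only [wF2, wE1, Finset.mul_sum, Finset.sum_mul, sh_mul]
  refine Finset.sum_congr rfl fun i _ => sh_congr (by simp) fun s p => ?_
  simp only [Prod.fst_add, Prod.snd_add, add_zero]
  linear_combination ef x i p.1 p.2.2.2 p.2.2.1 * e1_fs (x := x) i p.2.2.2 p.2.1

include hq

theorem wE1_F1 : wE1 x * wF1 x - wF1 x * wE1 x
    = (x ^ (2 : ℤ) - x ^ (-2 : ℤ))⁻¹ • (wK1 x 2 - wK1 x (-2)) := by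
  have h1 : wE1 x * wF1 x = sh 0 fun _ p => e1 x p.2.2.2 (p.2.1 - 1) ^ 2 := by
    rw [wE1, wF1, sh_mul]
    refine sh_congr (by simp) fun s p => ?_
    simp [← sub_eq_add_neg, sq]
  have h2 : wF1 x * wE1 x = sh 0 fun _ p => e1 x p.2.2.2 p.2.1 ^ 2 := by
    rw [wE1, wF1, sh_mul]
    refine sh_congr (by simp) fun s p => ?_
    simp [sq]
  rw [h1, h2, wK1, wK1, sh_sub, sh_sub, smul_sh]
  refine sh_congr rfl fun s p => ?_
  simp only [Pi.sub_apply, Pi.smul_apply, smul_eq_mul, e1_e1 hx hq]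
  ring_nf

theorem wE2_X2 : wE2 x * wX2 x = x ^ (-2 : ℤ) • (wX2 x * wE2 x) := by
  simp only [wX2, wE2, Finset.mul_sum, Finset.sum_mul, sh_mul, Finset.smul_sum, smul_sh]
  rw [Finset.sum_comm]
  refine Finset.sum_congr rfl fun i _ => Finset.sum_congr rfl fun j _ =>
    sh_congr (by simp) fun s p => ?_
  simp only [Prod.fst_add, Prod.snd_add, add_zero, Pi.smul_apply, smul_eq_mul]
  linear_combination es x i p.2.2.2 p.2.1 * dc_ee hx hq (csgn s) i j p.1 p.2.2.2 p.2.2.1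

theorem wF2_X2 : wF2 x * wX2 x = wX1 x * wK2 x 1 + x ^ (-2 : ℤ) • (wX2 x * wF2 x) := by
  have h : ∑ j, ∑ i, sh (dd j, 1, 0, dd i) (fun s p => x ^ (-2 : ℤ) *
      (dc x (csgn s) j p.1 (p.2.2.2 + dd i) (p.2.2.1 - 1)
        * (fs x i p.2.2.2 p.2.1 * ef x i p.1 p.2.2.2 p.2.2.1)))
      = x ^ (-2 : ℤ) • (wX2 x * wF2 x) := by
    simp only [wX2, wF2, Finset.mul_sum, Finset.sum_mul, sh_mul, Finset.smul_sum, smul_sh]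
    rw [Finset.sum_comm]
    refine Finset.sum_congr rfl fun i _ => Finset.sum_congr rfl fun j _ =>
      sh_congr (by simp) fun s p => ?_
    simp [sub_eq_add_neg]
  rw [← h, Finset.sum_comm]
  simp only [wX2, wX1, wF2, wK2, Finset.mul_sum, Finset.sum_mul, sh_mul]
  rw [Finset.sum_comm, ← Finset.sum_add_distrib]
  refine Finset.sum_congr rfl fun i _ => ?_
  rw [← Finset.sum_add_distrib]
  refine Finset.sum_congr rfl fun j _ => ?_
  rw [add_zero, sh_add]
  refine sh_congr (by simp) fun s p => ?_
  have h1 : x ^ (1 * (2 * (p.2.2.1 - p.2.1))) * x ^ (2 * p.2.1) = x ^ (2 * p.2.2.1) := by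
    rw [← zpow_add₀ hx]; ring_nf
  have h2 := bc_yc hx hq (csgn s) i j p.1 p.2.2.2 p.2.2.1
  simp only [Pi.add_apply, Prod.fst_add, Prod.snd_add, add_zero, bc]
  linear_combination (-fs x i p.2.2.2 p.2.1) * h2
    - gB x i p.2.2.2 * fs x i p.2.2.2 p.2.1 * yc x (csgn s) i j p.1 p.2.2.2 p.2.2.1 * h1

theorem wF1_X1 : wF1 x * wX1 x
    = (x * zq x 2) • (wX0 x * wK1 x 1) + x ^ (-2 : ℤ) • (wX1 x * wF1 x) := by
  simp only [wX0, wX1, wF1, wK1, Finset.mul_sum, Finset.sum_mul, sh_mul, Finset.smul_sum, smul_sh,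
    ← Finset.sum_add_distrib]
  refine Finset.sum_congr rfl fun i _ => Finset.sum_congr rfl fun j _ => ?_
  rw [add_zero, sh_congr (d := (dd j, 1, 0, dd i) + (0, -1, 0, 0)) (d' := (dd j, 0, 0, dd i))
    (by simp) fun _ _ => rfl, sh_add]
  refine sh_congr (by simp) fun s p => ?_
  have h1 : x * x ^ (1 * (2 * p.2.1 + 1)) = x ^ (2 * p.2.1 + 2) := by
    rw [← zpow_one_add₀ hx]; ring_nf
  simp only [Pi.add_apply, Pi.smul_apply, smul_eq_mul, Prod.fst_add, Prod.snd_add, add_zero,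
    add_sub_cancel_right, ← sub_eq_add_neg]
  linear_combination yc x (csgn s) i j p.1 p.2.2.2 p.2.2.1 * bc_e1 hx hq i p.2.2.2 p.2.1
    - zq x 2 * ac x i p.2.2.2 p.2.1 * yc x (csgn s) i j p.1 p.2.2.2 p.2.2.1 * h1

theorem wE2_F2 : wE2 x * wF2 x - wF2 x * wE2 x
    = (x ^ (4 : ℤ) - x ^ (-4 : ℤ))⁻¹ • (wK2 x 2 - wK2 x (-2)) := by
  set P : Fin 3 → Fin 3 → LatFun := fun i j _ p =>
    fs x i p.2.2.2 p.2.1 * ef x i p.1 p.2.2.2 p.2.2.1 * (es x j (p.2.2.2 + dd i) (p.2.1 + 1)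
      * ee x j p.1 (p.2.2.2 + dd i) (p.2.2.1 - 1)) with hP
  set Q : Fin 3 → Fin 3 → LatFun := fun i j _ p =>
    es x j p.2.2.2 p.2.1 * ee x j p.1 p.2.2.2 p.2.2.1 * (fs x i (p.2.2.2 + dd j) (p.2.1 - 1)
      * ef x i p.1 (p.2.2.2 + dd j) (p.2.2.1 + 1)) with hQ
  have h1 : wE2 x * wF2 x = ∑ i, ∑ j, sh (0, 0, 0, dd i + dd j) (P i j) := by
    simp only [wE2, wF2, Finset.mul_sum, Finset.sum_mul, sh_mul]
    refine Finset.sum_congr rfl fun i _ => Finset.sum_congr rfl fun j _ =>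
      sh_congr (by simp [add_comm]) fun s p => ?_
    simp only [hP, Prod.fst_add, Prod.snd_add, add_zero, ← sub_eq_add_neg]
    ring
  have h2 : wF2 x * wE2 x = ∑ i, ∑ j, sh (0, 0, 0, dd i + dd j) (Q i j) := by
    simp only [wE2, wF2, Finset.mul_sum, Finset.sum_mul, sh_mul]
    rw [Finset.sum_comm]
    refine Finset.sum_congr rfl fun i _ => Finset.sum_congr rfl fun j _ =>
      sh_congr (by simp) fun s p => ?_
    simp only [hQ, Prod.fst_add, Prod.snd_add, add_zero, ← sub_eq_add_neg]
    ring
  have h3 : ∀ i j, sh (0, 0, 0, dd i + dd j) (P i j) - sh (0, 0, 0, dd i + dd j) (Q i j)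
      = sh (0, 0, 0, dd i + dd j) (P i j - Q i j) := fun i j => sh_sub _ _ _
  rw [h1, h2, ← Finset.sum_sub_distrib]
  simp only [← Finset.sum_sub_distrib, h3]
  have e1 : sh (0, 0, 0, dd 0 + dd 0) (P 0 0 - Q 0 0) = 0 := by
    rw [← sh_zero]; exact sh_congr rfl fun s p => ef00 hx hq _ _ _ _
  have e2 : sh (0, 0, 0, dd 2 + dd 2) (P 2 2 - Q 2 2) = 0 := by
    rw [← sh_zero]; exact sh_congr rfl fun s p => ef22 hx hq _ _ _ _
  have e3 : sh (0, 0, 0, dd 0 + dd 1) (P 0 1 - Q 0 1)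
      + sh (0, 0, 0, dd 1 + dd 0) (P 1 0 - Q 1 0) = 0 := by
    rw [← sh_zero (0, 0, 0, dd 0 + dd 1), add_comm (dd 1), sh_add]
    exact sh_congr rfl fun s p => ef01 hx hq _ _ _ _
  have e4 : sh (0, 0, 0, dd 1 + dd 2) (P 1 2 - Q 1 2)
      + sh (0, 0, 0, dd 2 + dd 1) (P 2 1 - Q 2 1) = 0 := by
    rw [← sh_zero (0, 0, 0, dd 1 + dd 2), add_comm (dd 2), sh_add]
    exact sh_congr rfl fun s p => ef12 hx hq _ _ _ _
  have e5 : sh (0, 0, 0, dd 0 + dd 2) (P 0 2 - Q 0 2) + sh (0, 0, 0, dd 1 + dd 1) (P 1 1 - Q 1 1)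
      + sh (0, 0, 0, dd 2 + dd 0) (P 2 0 - Q 2 0)
      = (x ^ (4 : ℤ) - x ^ (-4 : ℤ))⁻¹ • (wK2 x 2 - wK2 x (-2)) := by
    rw [wK2, wK2, sh_sub, smul_sh]
    simp only [dd, Matrix.cons_val, add_zero, Int.add_right_neg, Int.reduceAdd, Int.reduceNeg,
      sh_add]
    refine sh_congr rfl fun s p => (ef0 hx hq p.1 p.2.1 p.2.2.1 p.2.2.2).trans ?_
    simp only [Pi.sub_apply, Pi.smul_apply, smul_eq_mul]
    ring_nf
  simp only [Fin.sum_univ_three]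
  rw [← e5]
  have key : ∀ a b c d e f g h i : Module.End ℂ LatFun, a = 0 → i = 0 → b + d = 0 → f + h = 0 →
      a + b + c + (d + e + f) + (g + h + i) = c + e + g := by
    intro a b c d e f g h i ha hi hbd hfh
    calc a + b + c + (d + e + f) + (g + h + i) = a + i + (b + d) + (f + h) + (c + e + g) := by abel
      _ = c + e + g := by rw [ha, hi, hbd, hfh]; simp
  exact key _ _ _ _ _ _ _ _ _ e1 e2 e3 e4

end Operators

/-! ### Comparison with the real structure constants -/

section RealCoefficients

variable {q : ℝ} (hq0 : 0 < q) (hq1 : q < 1)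

/-- The square root of `q` as a complex number. -/
def sx (q : ℝ) : ℂ := ((√q : ℝ) : ℂ)

include hq0 in
theorem sx_ne_zero : sx q ≠ 0 := by
  simpa [sx] using (Real.sqrt_pos.2 hq0).ne'

include hq0 in
theorem rpow_half_int (m : ℤ) : q ^ ((m : ℝ) / 2) = √q ^ m := by
  rw [Real.sqrt_eq_rpow, ← Real.rpow_intCast, ← Real.rpow_mul hq0.le]
  congr 1; ring

include hq0 in
theorem cast_rpow {h : ℝ} (m : ℤ) (hm : h = m / 2) : ((q ^ h : ℝ) : ℂ) = sx q ^ m := by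
  rw [hm, rpow_half_int hq0, sx, Complex.ofReal_zpow]

include hq0 in
theorem cast_qnum {h : ℝ} (i : ℤ) (hi : h = i) : ((qnum q h : ℝ) : ℂ) = zq (sx q) i := by
  have h1 : q = √q ^ (2 : ℤ) := by
    rw [← rpow_half_int hq0]; norm_num
  have h2 : q⁻¹ = √q ^ (-2 : ℤ) := by rw [zpow_neg, ← h1]
  rw [qnum, zq, Complex.ofReal_div, Complex.ofReal_sub, Complex.ofReal_sub,
    cast_rpow hq0 (2 * i) (by rw [hi]; push_cast; ring),
    cast_rpow hq0 (-2 * i) (by rw [hi]; push_cast; ring), h2, Complex.ofReal_zpow,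
    show ((q : ℝ) : ℂ) = sx q ^ (2 : ℤ) by rw [sx, ← Complex.ofReal_zpow, ← h1]]
  rfl

include hq0 in
theorem cast_qnum_neg_two : ((qnum q (4 * -(1 / 2)) : ℝ) : ℂ) = -zq (sx q) 2 := by
  rw [← cast_qnum hq0 2 (h := 2) (by norm_num), ← Complex.ofReal_neg, qnum, qnum,
    show (4 * -(1 / 2) : ℝ) = -2 by norm_num, neg_neg]
  congr 1; ring

include hq0 hq1

theorem qnum_den_neg : q - q⁻¹ < 0 := by
  have := (one_lt_inv₀ hq0).2 hq1
  linarith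

theorem qnum_pos {h : ℝ} (hh : 0 < h) : 0 < qnum q h := by
  refine div_pos_of_neg_of_neg ?_ (qnum_den_neg hq0 hq1)
  rw [sub_neg]
  exact Real.rpow_lt_rpow_of_exponent_gt hq0 hq1 (by linarith)

theorem qnum_nonneg {h : ℝ} (hh : 0 ≤ h) : 0 ≤ qnum q h := by
  rcases hh.eq_or_lt with rfl | hh
  · simp [qnum]
  · exact (qnum_pos hq0 hq1 hh).le

theorem zq_sx_ne_zero (i : ℤ) (hi : i ≠ 0) : zq (sx q) i ≠ 0 := by
  have key : ∀ j : ℤ, 0 < j → zq (sx q) j ≠ 0 := fun j hj => by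
    rw [← cast_qnum hq0 j rfl]
    exact_mod_cast (qnum_pos hq0 hq1 (by exact_mod_cast hj)).ne'
  rcases lt_or_gt_of_ne hi with h | h
  · have h1 := key (-i) (by omega)
    intro h2
    apply h1
    rw [zq, show 2 * -i = -2 * i by ring, show -2 * -i = 2 * i by ring, ← neg_sub, neg_div]
    exact neg_eq_zero.2 h2
  · exact key i h

theorem rq_sx {h : ℝ} (i : ℤ) (hi : h = i) (h0 : 0 ≤ i) :
    rq (sx q) i = ((√(qnum q h) : ℝ) : ℂ) := by
  have h1 : (0 : ℝ) ≤ qnum q h := qnum_nonneg hq0 hq1 (by rw [hi]; exact_mod_cast h0)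
  rw [rq, ← cast_qnum hq0 i hi, Real.sqrt_eq_rpow, Complex.ofReal_cpow h1]
  norm_num

theorem cast_sqrt {h h' : ℝ} (i i' : ℤ) (hi : h = i) (hi' : h' = i') (h0 : 0 ≤ i) (h0' : 0 ≤ i') :
    ((√(qnum q h * qnum q h') : ℝ) : ℂ) = rq (sx q) i * rq (sx q) i' := by
  rw [rq_sx hq0 hq1 i hi h0, rq_sx hq0 hq1 i' hi' h0', ← Complex.ofReal_mul, Real.sqrt_mul]
  exact qnum_nonneg hq0 hq1 (by rw [hi]; exact_mod_cast h0)

omit hq0 hq1 in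
theorem eps_of_even {n k b : ℤ} (h : Even (n - k - b)) : eps n k b = 1 / 2 := if_pos h

omit hq0 hq1 in
theorem eps_of_not_even {n k b : ℤ} (h : ¬Even (n - k - b)) : eps n k b = -(1 / 2) := if_neg h

/-- The range of the labels `a`, `k`. -/
def LabA (k a : ℤ) : Prop := -k - 1 ≤ a ∧ a ≤ k

/-- The range of the labels `n`, `k`, `b`. -/
def LabB (n k b : ℤ) : Prop := k - n - 1 ≤ b ∧ b ≤ n - k

omit hq0 hq1 in
theorem isLabel_iff {n a b k : ℤ} : IsLabel n a b k ↔ LabA k a ∧ LabB n k b := by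
  simp only [IsLabel, LabA, LabB]; omega

theorem cast_Ap {k a : ℤ} (h : LabA k a) : ((coefAp q k a : ℝ) : ℂ) = ac (sx q) 0 k a := by
  obtain ⟨h1, h2⟩ := h
  simp only [coefAp, half, ac, Matrix.cons_val]
  push_cast
  rw [cast_rpow hq0 (2 * a - 1) (by push_cast; ring),
    cast_sqrt hq0 hq1 (k + a + 2) (k - a + 1) (by push_cast; ring) (by push_cast; ring)
      (by omega) (by omega), cast_qnum hq0 (2 * k + 3) (by push_cast; ring)]

theorem cast_A0 {k a : ℤ} (h : LabA k a) : ((coefA0 q k a : ℝ) : ℂ) = ac (sx q) 1 k a := by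
  obtain ⟨h1, h2⟩ := h
  simp only [coefA0, half, ac, Matrix.cons_val]
  push_cast
  rw [cast_rpow hq0 (-4) (by norm_num),
    cast_rpow hq0 (2 * k + 2 * a + 4) (by push_cast; ring),
    cast_qnum hq0 2 (by norm_num),
    cast_qnum hq0 (k - a) (by push_cast; ring),
    cast_qnum hq0 (2 * k + 1) (by push_cast; ring),
    cast_qnum hq0 (2 * k + 3) (by push_cast; ring)]

theorem cast_Bp {k a : ℤ} (h : LabA k a) : ((coefBp q k a : ℝ) : ℂ) = bc (sx q) 0 k a := by
  obtain ⟨h1, h2⟩ := h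
  simp only [coefBp, half, bc, gB, fs, es, rev0, dd, Matrix.cons_val]
  push_cast
  rw [cast_rpow hq0 (2 * a - 2 * k - 1) (by push_cast; ring),
    cast_sqrt hq0 hq1 (k + a + 2) (k + a + 3) (by push_cast; ring) (by push_cast; ring) (by omega) (by omega),
    cast_qnum hq0 (2 * k + 3) (by push_cast; ring)]
  have hx := sx_ne_zero hq0
  rw [show 2 * a - 2 * k - 1 = 2 * a + (-2 * k - 1) by ring, zpow_add₀ hx]
  ring_nf

theorem cast_B0 {k a : ℤ} (h : LabA k a) : ((coefB0 q k a : ℝ) : ℂ) = bc (sx q) 1 k a := by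
  obtain ⟨h1, h2⟩ := h
  simp only [coefB0, half, bc, gB, fs, es, rev1, dd, Matrix.cons_val]
  push_cast
  rw [cast_rpow hq0 (2 * a) (by push_cast; ring),
    cast_sqrt hq0 hq1 (k - a) (k + a + 2) (by push_cast; ring) (by push_cast; ring) (by omega) (by omega),
    cast_qnum hq0 (2 * k + 1) (by push_cast; ring),
    cast_qnum hq0 (2 * k + 3) (by push_cast; ring),
    show ((q : ℝ) : ℂ) = sx q ^ (2 : ℤ) by rw [← cast_rpow hq0 2 (h := 1) (by norm_num)]; simp]
  rw [← zpow_natCast, ← zpow_mul]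
  ring_nf

theorem cast_Bm {k a : ℤ} (h : -k - 1 ≤ a ∧ a + 1 ≤ k) : ((coefBm q k a : ℝ) : ℂ) = bc (sx q) 2 k a := by
  obtain ⟨h1, h2⟩ := h
  simp only [coefBm, half, bc, gB, fs, es, rev2, dd, Matrix.cons_val]
  push_cast
  rw [cast_rpow hq0 (2 * k + 2 * a + 3) (by push_cast; ring),
    cast_sqrt hq0 hq1 (k - a) (k - a - 1) (by push_cast; ring) (by push_cast; ring) (by omega) (by omega),
    cast_qnum hq0 (2 * k + 1) (by push_cast; ring)]
  have hx := sx_ne_zero hq0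
  rw [show 2 * k + 2 * a + 3 = 2 * a + (2 * k + 3) by ring, zpow_add₀ hx]
  ring_nf

theorem cast_Cp {n k b : ℤ} (h : LabB n k b) (hk : 0 ≤ k) : ((coefCp q n k b : ℝ) : ℂ) = cp (sx q) n k b := by
  obtain ⟨h1, h2⟩ := h
  by_cases he : Even (n - k - b)
  · simp only [coefCp, half, cp, Matrix.cons_val, eps_of_even he, if_pos he]
    rw [Int.even_iff] at he
    push_cast
    rw [cast_rpow hq0 (2 * b - 2) (by push_cast; ring),
      cast_sqrt hq0 hq1 (n + k + b + 5) (n + k - b + 3) (by push_cast; ring) (by push_cast; ring) (by omega) (by omega),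
      cast_qnum hq0 (2 * n + 5) (by push_cast; ring)]
    try ring_nf
  · simp only [coefCp, half, cp, Matrix.cons_val, eps_of_not_even he, if_neg he]
    rw [Int.even_iff] at he
    push_cast
    rw [cast_rpow hq0 (2 * b) (by push_cast; ring),
      cast_sqrt hq0 hq1 (n + k + b + 4) (n + k - b + 4) (by push_cast; ring) (by push_cast; ring) (by omega) (by omega),
      cast_qnum hq0 (2 * n + 5) (by push_cast; ring)]
    try ring_nf

theorem cast_Cm {n k b : ℤ} (h : LabB n k b) (hk : 0 ≤ k) : ((coefCm q n k b : ℝ) : ℂ) = cm (sx q) n k b := by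
  obtain ⟨h1, h2⟩ := h
  by_cases he : Even (n - k - b)
  · simp only [coefCm, half, cm, Matrix.cons_val, eps_of_even he, if_pos he]
    rw [Int.even_iff] at he
    push_cast
    rw [cast_rpow hq0 (2 * b) (by push_cast; ring),
      cast_sqrt hq0 hq1 (n - k + b) (n - k - b) (by push_cast; ring) (by push_cast; ring) (by omega) (by omega),
      cast_qnum hq0 (2 * n + 3) (by push_cast; ring)]
    try ring_nf
  · simp only [coefCm, half, cm, Matrix.cons_val, eps_of_not_even he, if_neg he]
    rw [Int.even_iff] at he
    push_cast
    rw [cast_rpow hq0 (2 * b - 2) (by push_cast; ring),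
      cast_sqrt hq0 hq1 (n - k + b + 1) (n - k - b - 1) (by push_cast; ring) (by push_cast; ring) (by omega) (by omega),
      cast_qnum hq0 (2 * n + 3) (by push_cast; ring)]
    try ring_nf

theorem cast_C0 {n k b : ℤ} (h : LabB n k b) (hk : 0 ≤ k) : ((coefC0 q n k b : ℝ) : ℂ) = cz (sx q) n k b := by
  obtain ⟨h1, h2⟩ := h
  by_cases he : Even (n - k - b)
  · simp only [coefC0, half, cz, Matrix.cons_val, eps_of_even he, if_pos he]
    rw [Int.even_iff] at he
    push_cast
    rw [cast_qnum hq0 2 (by norm_num),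
      cast_rpow hq0 (2 * n + 2 * b + 3) (by push_cast; ring),
      cast_sqrt hq0 hq1 (n + k - b + 3) (n - k - b) (by push_cast; ring) (by push_cast; ring) (by omega) (by omega),
      cast_qnum hq0 (2 * n + 3) (by push_cast; ring),
      cast_qnum hq0 (2 * n + 5) (by push_cast; ring)]
    try ring_nf
  · simp only [coefC0, half, cz, Matrix.cons_val, eps_of_not_even he, if_neg he]
    rw [Int.even_iff] at he
    push_cast
    rw [cast_qnum_neg_two hq0,
      cast_rpow hq0 (2 * b - 2 * n - 5) (by push_cast; ring),
      cast_sqrt hq0 hq1 (n + k + b + 4) (n - k + b + 1) (by push_cast; ring) (by push_cast; ring) (by omega) (by omega),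
      cast_qnum hq0 (2 * n + 3) (by push_cast; ring),
      cast_qnum hq0 (2 * n + 5) (by push_cast; ring)]
    try ring_nf

theorem cast_Hp {n k b : ℤ} (h : LabB n k b) (hk : 0 ≤ k) : ((coefHp q n k b : ℝ) : ℂ) = hp (sx q) n k b := by
  obtain ⟨h1, h2⟩ := h
  by_cases he : Even (n - k - b)
  · simp only [coefHp, half, hp, Matrix.cons_val, eps_of_even he, if_pos he]
    rw [Int.even_iff] at he
    push_cast
    rw [cast_rpow hq0 (2 * b + 2 * k + 1) (by push_cast; ring),
      cast_sqrt hq0 hq1 (n + k - b + 3) (n - k + b + 2) (by push_cast; ring) (by push_cast; ring) (by omega) (by omega),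
      cast_qnum hq0 (2 * n + 5) (by push_cast; ring)]
    try ring_nf
  · simp only [coefHp, half, hp, Matrix.cons_val, eps_of_not_even he, if_neg he]
    rw [Int.even_iff] at he
    push_cast
    rw [cast_rpow hq0 (2 * b - 2 * k - 3) (by push_cast; ring),
      cast_sqrt hq0 hq1 (n - k - b + 1) (n + k + b + 4) (by push_cast; ring) (by push_cast; ring) (by omega) (by omega),
      cast_qnum hq0 (2 * n + 5) (by push_cast; ring)]
    try ring_nf

theorem cast_H0 {n k b : ℤ} (h : LabB n k b) (hk : 0 ≤ k) : ((coefH0 q n k b : ℝ) : ℂ) = hz (sx q) n k b := by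
  obtain ⟨h1, h2⟩ := h
  by_cases he : Even (n - k - b)
  · simp only [coefH0, half, hz, Matrix.cons_val, eps_of_even he, if_pos he]
    rw [Int.even_iff] at he
    push_cast
    rw [cast_qnum hq0 (n - k - b) (by push_cast; ring),
      cast_qnum hq0 (n - k + b + 2) (by push_cast; ring),
      cast_rpow hq0 (-4) (by norm_num),
      cast_qnum hq0 (n + k - b + 3) (by push_cast; ring),
      cast_qnum hq0 (n + k + b + 3) (by push_cast; ring),
      cast_qnum hq0 (2 * n + 3) (by push_cast; ring),
      cast_qnum hq0 (2 * n + 5) (by push_cast; ring)]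
    try ring_nf
  · simp only [coefH0, half, hz, Matrix.cons_val, eps_of_not_even he, if_neg he]
    rw [Int.even_iff] at he
    push_cast
    rw [cast_qnum hq0 (n + k - b + 2) (by push_cast; ring),
      cast_qnum hq0 (n + k + b + 4) (by push_cast; ring),
      cast_rpow hq0 (-4) (by norm_num),
      cast_qnum hq0 (n - k - b + 1) (by push_cast; ring),
      cast_qnum hq0 (n - k + b + 1) (by push_cast; ring),
      cast_qnum hq0 (2 * n + 3) (by push_cast; ring),
      cast_qnum hq0 (2 * n + 5) (by push_cast; ring)]
    try ring_nf

theorem cast_Dp (σ : ℂ) {n k b : ℤ} (h : LabB n k b) (hk : 0 ≤ k) : ((coefDp q n k b : ℝ) : ℂ) = dc (sx q) σ 0 n k b := by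
  obtain ⟨h1, h2⟩ := h
  by_cases he : Even (n - k - b)
  · simp only [coefDp, half, dc, Matrix.cons_val, eps_of_even he, if_pos he]
    rw [Int.even_iff] at he
    push_cast
    rw [cast_rpow hq0 (2 * b - 2 * n - 3) (by push_cast; ring),
      cast_sqrt hq0 hq1 (n + k + b + 5) (n - k + b + 2) (by push_cast; ring) (by push_cast; ring) (by omega) (by omega),
      cast_qnum hq0 (2 * n + 5) (by push_cast; ring)]
    try ring_nf
  · simp only [coefDp, half, dc, Matrix.cons_val, eps_of_not_even he, if_neg he]
    rw [Int.even_iff] at he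
    push_cast
    rw [cast_rpow hq0 (2 * b - 2 * n - 3) (by push_cast; ring),
      cast_sqrt hq0 hq1 (n + k + b + 4) (n - k + b + 3) (by push_cast; ring) (by push_cast; ring) (by omega) (by omega),
      cast_qnum hq0 (2 * n + 5) (by push_cast; ring)]
    try ring_nf

theorem cast_D0 {n k b : ℤ} (h : LabB n k b) (hk : 0 ≤ k) : ((coefD0 q n k b : ℝ) : ℂ) = dc (sx q) 1 1 n k b := by
  obtain ⟨h1, h2⟩ := h
  by_cases he : Even (n - k - b)
  · simp only [coefD0, half, dc, Matrix.cons_val, eps_of_even he, if_pos he]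
    rw [Int.even_iff] at he
    push_cast
    rw [cast_qnum hq0 2 (by norm_num),
      cast_rpow hq0 (2 * b + 2) (by push_cast; ring),
      cast_sqrt hq0 hq1 (n - k - b) (n - k + b + 2) (by push_cast; ring) (by push_cast; ring) (by omega) (by omega),
      cast_qnum hq0 (2 * n + 3) (by push_cast; ring),
      cast_qnum hq0 (2 * n + 5) (by push_cast; ring)]
    try ring_nf
  · simp only [coefD0, half, dc, Matrix.cons_val, eps_of_not_even he, if_neg he]
    rw [Int.even_iff] at he
    push_cast
    rw [cast_qnum hq0 2 (by norm_num),
      cast_rpow hq0 (2 * b + 2) (by push_cast; ring),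
      cast_sqrt hq0 hq1 (n + k - b + 2) (n + k + b + 4) (by push_cast; ring) (by push_cast; ring) (by omega) (by omega),
      cast_qnum hq0 (2 * n + 3) (by push_cast; ring),
      cast_qnum hq0 (2 * n + 5) (by push_cast; ring)]
    try ring_nf

theorem cast_Dm (σ : ℂ) {n k b : ℤ} (h : LabB n k b) (hk : 0 ≤ k) : ((coefDm q n k b : ℝ) : ℂ) = dc (sx q) σ 2 n k b := by
  obtain ⟨h1, h2⟩ := h
  by_cases he : Even (n - k - b)
  · simp only [coefDm, half, dc, Matrix.cons_val, eps_of_even he, if_pos he]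
    rw [Int.even_iff] at he
    push_cast
    rw [cast_rpow hq0 (2 * n + 2 * b + 5) (by push_cast; ring),
      cast_sqrt hq0 hq1 (n - k - b) (n + k - b + 1) (by push_cast; ring) (by push_cast; ring) (by omega) (by omega),
      cast_qnum hq0 (2 * n + 3) (by push_cast; ring)]
    try ring_nf
  · simp only [coefDm, half, dc, Matrix.cons_val, eps_of_not_even he, if_neg he]
    rw [Int.even_iff] at he
    push_cast
    rw [cast_rpow hq0 (2 * n + 2 * b + 5) (by push_cast; ring),
      cast_sqrt hq0 hq1 (n - k - b - 1) (n + k - b + 2) (by push_cast; ring) (by push_cast; ring) (by omega) (by omega),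
      cast_qnum hq0 (2 * n + 3) (by push_cast; ring)]
    try ring_nf

theorem conj_rq {i : ℤ} (hi : 0 ≤ i) : starRingEnd ℂ (rq (sx q) i) = rq (sx q) i := by
  rw [rq_sx hq0 hq1 i rfl hi, Complex.conj_ofReal]

omit hq1 in
theorem conj_zq (i : ℤ) : starRingEnd ℂ (zq (sx q) i) = zq (sx q) i := by
  rw [← cast_qnum hq0 i rfl, Complex.conj_ofReal]

theorem conj_es (i : Fin 3) {k a : ℤ} (h : LabA k a) :
    starRingEnd ℂ (es (sx q) i k a) = es (sx q) i k a := by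
  obtain ⟨h1, h2⟩ := h
  fin_cases i <;> simp only [es, Fin.zero_eta, Fin.mk_one, Fin.reduceFinMk, Matrix.cons_val, map_mul]
  · rw [conj_rq hq0 hq1 (by omega), conj_rq hq0 hq1 (by omega)]
  · rw [conj_rq hq0 hq1 (by omega), conj_rq hq0 hq1 (by omega)]
  · rcases h1.eq_or_lt with h | h
    · rw [show k + a + 1 = 0 by omega, rq_zero]; simp
    · rw [conj_rq hq0 hq1 (by omega), conj_rq hq0 hq1 (by omega)]

theorem conj_ee (i : Fin 3) {n k b : ℤ} (h : LabB n k b) (hk : 0 ≤ k) :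
    starRingEnd ℂ (ee (sx q) i n k b) = ee (sx q) i n k b := by
  obtain ⟨h1, h2⟩ := h
  simp only [ee, Int.even_iff]
  split_ifs <;> fin_cases i <;>
  · simp only [Fin.zero_eta, Fin.mk_one, Fin.reduceFinMk, Matrix.cons_val, map_mul, map_div₀,
      conj_zq hq0, map_neg]
    rw [conj_rq hq0 hq1 (by omega), conj_rq hq0 hq1 (by omega)]

theorem conj_e1 {k a : ℤ} (h : LabA k a) : starRingEnd ℂ (e1 (sx q) k a) = e1 (sx q) k a := by
  obtain ⟨h1, h2⟩ := h
  rw [e1, map_mul, conj_rq hq0 hq1 (by omega), conj_rq hq0 hq1 (by omega)]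

end RealCoefficients

section Exits

variable (x : ℂ)

theorem rq_of_eq_zero {i : ℤ} (h : i = 0) : rq x i = 0 := by rw [h, rq_zero]

theorem e1_exit {k a : ℤ} (h : LabA k a) (h' : ¬LabA k (a + 1)) : e1 x k a = 0 := by
  simp only [LabA] at h h'
  rw [e1, rq_of_eq_zero x (by omega), zero_mul]

theorem e1_exit' {k a : ℤ} (h : LabA k a) (h' : ¬LabA k (a - 1)) : e1 x k (a - 1) = 0 := by
  simp only [LabA] at h h'
  rw [e1, rq_of_eq_zero x (i := k + (a - 1) + 2) (by omega), mul_zero]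

theorem es_exit (i : Fin 3) {k a : ℤ} (h : LabA k a) (h' : ¬LabA (k + dd i) (a - 1)) :
    es x i k a = 0 := by
  simp only [LabA] at h h'
  fin_cases i <;>
    simp only [es, dd, Fin.zero_eta, Fin.mk_one, Fin.reduceFinMk, Matrix.cons_val] at h' ⊢
  · omega
  · rw [rq_of_eq_zero x (i := k + a + 1) (by omega), zero_mul]
  · have : k + a + 1 = 0 ∨ k + a = 0 := by omega
    rcases this with h | h <;> simp [h, rq_zero]

theorem fs_exit (i : Fin 3) {k a : ℤ} (h : LabA k a) (h' : ¬LabA (k + dd i) (a + 1)) :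
    fs x i k a = 0 := by
  simp only [LabA] at h h'
  fin_cases i <;>
    simp only [fs, es, dd, Fin.zero_eta, Fin.mk_one, Fin.reduceFinMk, Matrix.cons_val, rev0, rev1,
      rev2] at h' ⊢
  · omega
  · rw [rq_of_eq_zero x (i := k + 0 - (a + 1) + 1) (by omega), mul_zero]
  · have : k + -1 - (a + 1) + 1 = 0 ∨ k + -1 - (a + 1) + 2 = 0 := by omega
    rcases this with h | h <;> simp only [h, rq_zero, zero_mul, mul_zero]

theorem ac_exit (i : Fin 3) {k a : ℤ} (h : LabA k a) (h' : ¬LabA (k + dd i) a) :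
    ac x i k a = 0 := by
  simp only [LabA] at h h'
  fin_cases i <;>
    simp only [ac, dd, Fin.zero_eta, Fin.mk_one, Fin.reduceFinMk, Matrix.cons_val] at h' ⊢
  · omega
  · omega
  · have : k + a + 1 = 0 ∨ k - a = 0 := by omega
    rcases this with h | h <;> simp [h, rq_zero]

theorem bc_exit (i : Fin 3) {k a : ℤ} (h : LabA k a) (h' : ¬LabA (k + dd i) (a + 1)) :
    bc x i k a = 0 := by
  rw [bc, fs_exit x i h h', mul_zero]

theorem ee_exit (i : Fin 3) {n k b : ℤ} (h : LabB n k b) (h' : ¬LabB n (k + dd i) (b + 1)) :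
    ee x i n k b = 0 := by
  simp only [LabB] at h h'
  simp only [ee, Int.even_iff]
  split_ifs <;> fin_cases i <;>
    simp only [dd, Fin.zero_eta, Fin.mk_one, Fin.reduceFinMk, Matrix.cons_val] at h' ⊢ <;>
    first
    | omega
    | (simp (discharger := omega) only [rq_of_eq_zero, zero_mul, mul_zero, neg_zero, zero_div])

theorem ef_exit (i : Fin 3) {n k b : ℤ} (h : LabB n k b) (h' : ¬LabB n (k + dd i) (b - 1)) :
    ef x i n k b = 0 := by
  simp only [LabB] at h h'
  simp only [ef, ee, Int.even_iff]
  split_ifs <;> fin_cases i <;>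
    simp only [dd, Fin.zero_eta, Fin.mk_one, Fin.reduceFinMk, Matrix.cons_val, rev0, rev1,
      rev2] at * <;>
    first
    | omega
    | (simp (discharger := omega) only [rq_of_eq_zero, zero_mul, mul_zero, neg_zero, zero_div])

theorem dc_exit (σ : ℂ) (j : Fin 3) {n k b : ℤ} (h : LabB n k b)
    (h' : ¬LabB (n + dd j) k (b + 1)) : dc x σ j n k b = 0 := by
  simp only [LabB] at h h'
  simp only [dc, Int.even_iff]
  split_ifs <;> fin_cases j <;>
    simp only [dd, Fin.zero_eta, Fin.mk_one, Fin.reduceFinMk, Matrix.cons_val] at h' ⊢ <;>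
    first
    | omega
    | (simp (discharger := omega) only [rq_of_eq_zero, zero_mul, mul_zero, neg_zero, zero_div])

theorem yc_exit (σ : ℂ) (i j : Fin 3) {n k b : ℤ} (h : LabB n k b)
    (h' : ¬LabB (n + dd j) (k + dd i) b) : yc x σ i j n k b = 0 := by
  simp only [LabB] at h h'
  fin_cases i <;> fin_cases j <;>
    simp only [yc, cz, cm, hp, Int.even_iff, dd, Fin.zero_eta, Fin.mk_one, Fin.reduceFinMk,
      Matrix.cons_val] at h' ⊢ <;>
    first
    | omega
    | (split_ifs <;>
       simp (discharger := omega) only [rq_of_eq_zero, zero_mul, mul_zero, neg_zero, zero_div]; done)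
    | (split_ifs
       · have : n - k + b = 0 ∨ n - k - b = 0 := by omega
         rcases this with h | h <;> simp only [h, rq_zero, zero_mul, mul_zero, zero_div]
       · have : n - k + b + 1 = 0 ∨ n - k - b - 1 = 0 := by omega
         rcases this with h | h <;> simp only [h, rq_zero, zero_mul, mul_zero, zero_div])

end Exits

/-! ### The `*`-algebra of adjointable operators of a pre-Hilbert space -/

section Adjointable

variable (E : Type) [NormedAddCommGroup E] [InnerProductSpace ℂ E]

/-- The algebra of the operators that have a formal adjoint. -/
def AdjAlg : Subalgebra ℂ (Module.End ℂ E) where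
  carrier := {T | ∃ S : Module.End ℂ E, ∀ v w, inner ℂ (T v) w = inner ℂ v (S w)}
  mul_mem' := by
    rintro T T' ⟨S, hS⟩ ⟨S', hS'⟩
    exact ⟨S' * S, fun v w => by simp [hS, hS']⟩
  add_mem' := by
    rintro T T' ⟨S, hS⟩ ⟨S', hS'⟩
    exact ⟨S + S', fun v w => by simp [hS, hS', inner_add_left, inner_add_right]⟩
  algebraMap_mem' c := ⟨starRingEnd ℂ c • 1, fun v w => by
    simp [Algebra.algebraMap_eq_smul_one, inner_smul_left, inner_smul_right, mul_comm]⟩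

variable {E}

namespace AdjAlg

theorem adj_unique {S S' : Module.End ℂ E} (h : ∀ v w, inner ℂ v (S w) = inner ℂ v (S' w)) :
    S = S' :=
  LinearMap.ext fun w => ext_inner_left ℂ fun v => h v w

instance : StarRing (AdjAlg E) where
  star T := ⟨T.2.choose, (T : Module.End ℂ E), fun v w => by
    rw [← inner_conj_symm, ← T.2.choose_spec, inner_conj_symm]⟩
  star_involutive T := by
    refine Subtype.ext (adj_unique fun v w => ?_)
    have h := (⟨T.2.choose, (T : Module.End ℂ E), fun v w => by
      rw [← inner_conj_symm, ← T.2.choose_spec, inner_conj_symm]⟩ : AdjAlg E).2.choose_spec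
    refine (h v w).symm.trans ?_
    change inner ℂ (T.2.choose v) w = _
    rw [← inner_conj_symm, ← T.2.choose_spec, inner_conj_symm]
  star_mul T T' := by
    refine Subtype.ext (adj_unique fun v w => ?_)
    rw [← (T * T').2.choose_spec]
    change inner ℂ ((T : Module.End ℂ E) ((T' : Module.End ℂ E) v)) w
      = inner ℂ v (T'.2.choose (T.2.choose w))
    rw [T.2.choose_spec, T'.2.choose_spec]
  star_add T T' := by
    refine Subtype.ext (adj_unique fun v w => ?_)
    rw [← (T + T').2.choose_spec]
    change inner ℂ ((T : Module.End ℂ E) v + (T' : Module.End ℂ E) v) w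
      = inner ℂ v (T.2.choose w + T'.2.choose w)
    rw [inner_add_left, inner_add_right, T.2.choose_spec, T'.2.choose_spec]

theorem inner_star (T : AdjAlg E) (v w : E) :
    inner ℂ ((T : Module.End ℂ E) v) w = inner ℂ v (((star T : AdjAlg E) : Module.End ℂ E) w) :=
  T.2.choose_spec v w

theorem star_eq {T S : AdjAlg E}
    (h : ∀ v w, inner ℂ ((T : Module.End ℂ E) v) w = inner ℂ v ((S : Module.End ℂ E) w)) :
    star T = S :=
  Subtype.ext (adj_unique fun v w => by rw [← h, inner_star])

instance : StarModule ℂ (AdjAlg E) where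
  star_smul c T := by
    refine star_eq fun v w => ?_
    change inner ℂ (c • (T : Module.End ℂ E) v) w
      = inner ℂ v (starRingEnd ℂ c • ((star T : AdjAlg E) : Module.End ℂ E) w)
    rw [inner_smul_left, inner_smul_right, inner_star]

end AdjAlg

end Adjointable

/-! ### The embedding of the Hilbert space in the functions of integer labels -/

section Embedding

/-- The standard Hilbert basis of `ℓ²(ι)`. -/
def ellBasis (ι : Type) : HilbertBasis ι ℂ (EllTwo ι) := ⟨LinearIsometryEquiv.refl ℂ _⟩

theorem ellBasis_apply {ι : Type} (i : ι) : ellBasis ι i = basisVec i := by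
  classical
  rw [← HilbertBasis.repr_symm_single, basisVec]
  simp only [ellBasis]
  convert! rfl

theorem inner_basisVec {ι : Type} (i : ι) (v : EllTwo ι) : inner ℂ (basisVec i) v = v i := by
  rw [← ellBasis_apply, ← HilbertBasis.repr_apply_apply]
  rfl

open Classical in
theorem basisVec_apply {ι : Type} (i j : ι) : (basisVec i : EllTwo ι) j = if j = i then 1 else 0 := by
  rw [basisVec, lp.single_apply]
  by_cases h : j = i
  · subst h; simp
  · simp [h]

/-- Admissibility of a label. -/
def Lab (p : Lat) : Prop := IsLabel p.1 p.2.1 p.2.2.1 p.2.2.2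

/-- An admissible label. -/
def lb (p : Lat) (h : Lab p) : Label := ⟨p, h⟩

theorem lab_iff {p : Lat} : Lab p ↔ LabA p.2.2.2 p.2.1 ∧ LabB p.1 p.2.2.2 p.2.2.1 := isLabel_iff

open Classical in
/-- The extension by zero of a square summable family. -/
def toFn : SpinorSpace →ₗ[ℂ] LatFun where
  toFun v s p := if h : Lab p then v (s, lb p h) else 0
  map_add' v w := by
    funext s p
    by_cases h : Lab p <;> simp [h]
  map_smul' c v := by
    funext s p
    by_cases h : Lab p <;> simp [h]

theorem toFn_of_lab (v : SpinorSpace) (s : Bool) {p : Lat} (h : Lab p) :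
    toFn v s p = v (s, lb p h) := dif_pos h

theorem toFn_of_not_lab (v : SpinorSpace) (s : Bool) {p : Lat} (h : ¬Lab p) : toFn v s p = 0 :=
  dif_neg h

theorem toFn_injective : Function.Injective toFn := by
  intro v w h
  refine lp.ext (funext fun i => ?_)
  obtain ⟨s, p, hp⟩ := i
  have := congrFun (congrFun h s) p
  rwa [toFn_of_lab v s hp, toFn_of_lab w s hp] at this

/-- The basis vector of a label, `0` if the label is not admissible. -/
def kv (s : Bool) (p : Lat) : SpinorSpace := ket s p.1 p.2.1 p.2.2.1 p.2.2.2

theorem kv_of_lab (s : Bool) {p : Lat} (h : Lab p) : kv s p = basisVec (s, lb p h) :=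
  dif_pos h

theorem kv_of_not_lab (s : Bool) {p : Lat} (h : ¬Lab p) : kv s p = 0 := dif_neg h

theorem inner_kv (s : Bool) (p : Lat) (v : SpinorSpace) : inner ℂ (kv s p) v = toFn v s p := by
  by_cases h : Lab p
  · rw [kv_of_lab s h, inner_basisVec, toFn_of_lab v s h]
  · rw [kv_of_not_lab s h, inner_zero_left, toFn_of_not_lab v s h]

open Classical in
/-- The indicator function of a label. -/
def dl (s : Bool) (p : Lat) : LatFun := fun t r => if t = s ∧ r = p then 1 else 0

theorem toFn_kv (s : Bool) {p : Lat} (h : Lab p) : toFn (kv s p) = dl s p := by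
  funext t r
  by_cases hr : Lab r
  · rw [toFn_of_lab _ _ hr, kv_of_lab s h, basisVec_apply, dl]
    congr 1
    simp only [Prod.mk.injEq, eq_iff_iff]
    exact and_congr_right fun _ => Subtype.ext_iff
  · rw [toFn_of_not_lab _ _ hr, dl, if_neg]
    rintro ⟨_, rfl⟩
    exact hr h

theorem toFn_kv_of_not_lab (s : Bool) {p : Lat} (h : ¬Lab p) : toFn (kv s p) = 0 := by
  rw [kv_of_not_lab s h, map_zero]

theorem sh_dl (d : Lat) (c : LatFun) (s : Bool) (p : Lat) :
    sh d c (dl s p) = c s p • dl s (p + d) := by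
  funext t r
  simp only [sh_apply, dl, Pi.smul_apply, smul_eq_mul]
  by_cases h : t = s ∧ r = p + d
  · obtain ⟨rfl, rfl⟩ := h; simp
  · rw [if_neg h, if_neg, mul_zero, mul_zero]
    rintro ⟨rfl, h2⟩
    exact h ⟨rfl, by rw [← h2]; abel⟩

/-- The finitely supported vectors. -/
def finM : Submodule ℂ SpinorSpace := Submodule.span ℂ (Set.range basisVec)

theorem kv_mem (s : Bool) (p : Lat) : kv s p ∈ finM := by
  by_cases h : Lab p
  · rw [kv_of_lab s h]; exact Submodule.subset_span ⟨_, rfl⟩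
  · rw [kv_of_not_lab s h]; exact zero_mem _

/-- The basis vectors as elements of the space of finitely supported vectors. -/
def km (s : Bool) (p : Lat) : finM := ⟨kv s p, kv_mem s p⟩

theorem km_of_not_lab (s : Bool) {p : Lat} (h : ¬Lab p) : km s p = 0 :=
  Subtype.ext (kv_of_not_lab s h)

theorem finM_induction {N : Submodule ℂ finM} (h : ∀ s p, Lab p → km s p ∈ N) : N = ⊤ := by
  rw [eq_top_iff]
  rintro ⟨v, hv⟩ -
  induction hv using Submodule.span_induction with
  | mem v hv =>
    obtain ⟨⟨s, p, hp⟩, rfl⟩ := hv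
    convert h s p hp using 1
    exact Subtype.ext (kv_of_lab s hp).symm
  | zero => exact zero_mem N
  | add v w hv hw h1 h2 => exact add_mem h1 h2
  | smul c v hv h1 => exact N.smul_mem c h1

theorem finM_dense : Dense (finM : Set SpinorSpace) := by
  have h := (ellBasis (Bool × Label)).dense_span
  rw [show (Set.range (ellBasis (Bool × Label))) = Set.range basisVec by
    rw [show ⇑(ellBasis (Bool × Label)) = basisVec from funext ellBasis_apply]] at h
  exact Submodule.dense_iff_topologicalClosure_eq_top.2 h

/-- `b` is the restriction of `T` to the finitely supported functions of labels. -/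
def Rp (b : Module.End ℂ finM) (T : Module.End ℂ LatFun) : Prop :=
  ∀ v : finM, toFn (b v : SpinorSpace) = T (toFn v)

theorem Rp.mul {b b' : Module.End ℂ finM} {T T' : Module.End ℂ LatFun} (h : Rp b T)
    (h' : Rp b' T') : Rp (b * b') (T * T') := fun v => by
  rw [Module.End.mul_apply, Module.End.mul_apply, h, h']

theorem Rp.add {b b' : Module.End ℂ finM} {T T' : Module.End ℂ LatFun} (h : Rp b T)
    (h' : Rp b' T') : Rp (b + b') (T + T') := fun v => by
  rw [LinearMap.add_apply, LinearMap.add_apply, Submodule.coe_add, map_add, h, h']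

theorem Rp.sub {b b' : Module.End ℂ finM} {T T' : Module.End ℂ LatFun} (h : Rp b T)
    (h' : Rp b' T') : Rp (b - b') (T - T') := fun v => by
  rw [LinearMap.sub_apply, LinearMap.sub_apply, Submodule.coe_sub, map_sub, h, h']

theorem Rp.smul {b : Module.End ℂ finM} {T : Module.End ℂ LatFun} (h : Rp b T) (c : ℂ) :
    Rp (c • b) (c • T) := fun v => by
  rw [LinearMap.smul_apply, LinearMap.smul_apply, Submodule.coe_smul, map_smul, h]

theorem Rp.one : Rp 1 1 := fun _ => rfl

theorem Rp.unique {b b' : Module.End ℂ finM} {T : Module.End ℂ LatFun} (h : Rp b T)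
    (h' : Rp b' T) : b = b' :=
  LinearMap.ext fun v => Subtype.ext (toFn_injective ((h v).trans (h' v).symm))

/-- The weight vanishes where the shift leaves the set of labels. -/
def Good (d : Lat) (c : LatFun) : Prop := ∀ s p, Lab p → ¬Lab (p + d) → c s p = 0

/-- The operator restricts to the finitely supported functions of labels. -/
def Pres (T : Module.End ℂ LatFun) : Prop :=
  ∀ s p, Lab p → ∃ u : finM, toFn u = T (toFn (kv s p))

theorem Good.sh_kv {d : Lat} {c : LatFun} (h : Good d c) (s : Bool) {p : Lat} (hp : Lab p) :
    sh d c (toFn (kv s p)) = c s p • toFn (kv s (p + d)) := by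
  rw [toFn_kv s hp, sh_dl]
  by_cases h' : Lab (p + d)
  · rw [toFn_kv s h']
  · rw [h s p hp h', zero_smul, zero_smul]

theorem Good.pres {d : Lat} {c : LatFun} (h : Good d c) : Pres (sh d c) := fun s p hp =>
  ⟨c s p • km s (p + d), by rw [h.sh_kv s hp, Submodule.coe_smul, map_smul]; rfl⟩

theorem Pres.sum {ι : Type} {S : Finset ι} {T : ι → Module.End ℂ LatFun}
    (h : ∀ i, Pres (T i)) : Pres (∑ i ∈ S, T i) := fun s p hp => by
  choose u hu using fun i => h i s p hp
  refine ⟨∑ i ∈ S, u i, ?_⟩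
  rw [Submodule.coe_sum, map_sum, LinearMap.sum_apply]
  exact Finset.sum_congr rfl fun i _ => hu i

theorem Pres.exists {T : Module.End ℂ LatFun} (h : Pres T) :
    ∃ b : Module.End ℂ finM, Rp b T := by
  have key : ∀ v : finM, ∃ u : finM, toFn u = T (toFn v) := by
    let N : Submodule ℂ finM :=
      { carrier := {v | ∃ u : finM, toFn u = T (toFn v)}
        zero_mem' := ⟨0, by simp⟩
        add_mem' := by
          rintro v w ⟨u, hu⟩ ⟨u', hu'⟩
          exact ⟨u + u', by simp [hu, hu']⟩
        smul_mem' := by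
          rintro c v ⟨u, hu⟩
          exact ⟨c • u, by simp [hu]⟩ }
    have hN : N = ⊤ := finM_induction fun s p hp => h s p hp
    intro v
    have : v ∈ N := hN ▸ Submodule.mem_top
    exact this
  choose f hf using key
  refine ⟨{ toFun := f, map_add' := fun v w => ?_, map_smul' := fun c v => ?_ }, hf⟩
  · exact Subtype.ext (toFn_injective (by simp [hf]))
  · exact Subtype.ext (toFn_injective (by simp [hf]))

/-- The restriction to the finitely supported functions of labels. -/
def onM (T : Module.End ℂ LatFun) (h : Pres T) : Module.End ℂ finM := h.exists.choose

theorem onM_rp (T : Module.End ℂ LatFun) (h : Pres T) : Rp (onM T h) T := h.exists.choose_spec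

/-- Adjointness is checked on matrix coefficients. -/
theorem adj_of_coeff {b b' : Module.End ℂ finM} {T T' : Module.End ℂ LatFun} (h : Rp b T)
    (h' : Rp b' T') (hT : ∀ s p t r, Lab p → Lab r →
      starRingEnd ℂ (T (dl s p) t r) = T' (dl t r) s p) (v w : finM) :
    inner ℂ (b v) w = inner ℂ v (b' w) := by
  have key : ∀ t r, Lab r → ∀ v : finM, inner ℂ (b v) (km t r) = inner ℂ v (b' (km t r)) := by
    intro t r hr v
    let N : Submodule ℂ finM :=
      { carrier := {v | inner ℂ (b v) (km t r) = inner ℂ v (b' (km t r))}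
        zero_mem' := by simp
        add_mem' := by
          intro v w hv hw
          simp only [Set.mem_ofPred_eq] at *
          rw [map_add, inner_add_left, inner_add_left, hv, hw]
        smul_mem' := by
          intro c v hv
          simp only [Set.mem_ofPred_eq] at *
          rw [map_smul]
          refine (inner_smul_left (𝕜 := ℂ) (b v) (km t r) c).trans ?_
          rw [hv]
          exact (inner_smul_left (𝕜 := ℂ) v (b' (km t r)) c).symm }
    have hN : N = ⊤ := finM_induction fun s p hp => by
      change inner ℂ ((b (km s p) : finM) : SpinorSpace) (kv t r)
        = inner ℂ (kv s p) ((b' (km t r) : finM) : SpinorSpace)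
      rw [← inner_conj_symm, inner_kv, inner_kv, h, h']
      change starRingEnd ℂ (T (toFn (kv s p)) t r) = T' (toFn (kv t r)) s p
      rw [toFn_kv s hp, toFn_kv t hr, hT s p t r hp hr]
    have : v ∈ N := hN ▸ Submodule.mem_top
    exact this
  let N : Submodule ℂ finM :=
    { carrier := {w | inner ℂ (b v) w = inner ℂ v (b' w)}
      zero_mem' := by simp
      add_mem' := by
        intro v w hv hw
        simp only [Set.mem_ofPred_eq] at *
        rw [map_add, inner_add_right, inner_add_right, hv, hw]
      smul_mem' := by
        intro c v hv
        simp only [Set.mem_ofPred_eq] at *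
        rw [map_smul]
        refine (inner_smul_right (𝕜 := ℂ) (b _) v c).trans ?_
        rw [hv]
        exact (inner_smul_right (𝕜 := ℂ) _ (b' v) c).symm }
  have hN : N = ⊤ := finM_induction fun t r hr => key t r hr v
  have : w ∈ N := hN ▸ Submodule.mem_top
  exact this

theorem sh_adj {d : Lat} {c c' : LatFun}
    (h : ∀ s p, Lab p → Lab (p + d) → c' s (p + d) = starRingEnd ℂ (c s p)) (s : Bool) (p : Lat)
    (t : Bool) (r : Lat) (hp : Lab p) (hr : Lab r) :
    starRingEnd ℂ (sh d c (dl s p) t r) = sh (-d) c' (dl t r) s p := by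
  rw [sh_dl, sh_dl]
  simp only [Pi.smul_apply, smul_eq_mul, dl]
  by_cases h1 : t = s ∧ r = p + d
  · obtain ⟨rfl, rfl⟩ := h1
    rw [if_pos ⟨rfl, rfl⟩, if_pos ⟨rfl, by abel⟩, h t p hp hr]
    simp
  · rw [if_neg h1, if_neg]
    · simp
    · rintro ⟨rfl, rfl⟩
      exact h1 ⟨rfl, by abel⟩

end Embedding

/-! ### Consequences of the commutation relations of highest weight type -/

/-- Elements of a `*`-algebra that satisfy the relations of `U_q(so(5))` other than the Serre
relations and those relations of the crossed product with `𝒜(S⁴_q)` that express `x_2` as a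
highest weight vector and `x_1, x_0` through it; here `t = q^{1/2}`. -/
structure WeightData (t : ℂ) (B : Type) [Ring B] [StarRing B] [Algebra ℂ B] where
  (k1 l1 k2 l2 e1 e2 f1 f2 x0 x1 x2 : B)
  star_t : starRingEnd ℂ t = t
  t_ne : t ≠ 0
  den1 : t ^ 4 - 1 ≠ 0
  den2 : t ^ 8 - 1 ≠ 0
  star_k1 : star k1 = k1
  star_l1 : star l1 = l1
  star_k2 : star k2 = k2
  star_l2 : star l2 = l2
  star_e1 : star e1 = f1
  star_e2 : star e2 = f2
  star_x0 : star x0 = x0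
  k1l1 : k1 * l1 = 1
  l1k1 : l1 * k1 = 1
  k2l2 : k2 * l2 = 1
  l2k2 : l2 * k2 = 1
  k_comm : k1 * k2 = k2 * k1
  k1e1 : k1 * e1 = t ^ 2 • (e1 * k1)
  k1e2 : k1 * e2 = (t ^ 2)⁻¹ • (e2 * k1)
  k2e1 : k2 * e1 = (t ^ 2)⁻¹ • (e1 * k2)
  k2e2 : k2 * e2 = t ^ 4 • (e2 * k2)
  k1x0 : k1 * x0 = x0 * k1
  k2x0 : k2 * x0 = x0 * k2
  k1x1 : k1 * x1 = t ^ 2 • (x1 * k1)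
  k2x1 : k2 * x1 = (t ^ 2)⁻¹ • (x1 * k2)
  k1x2 : k1 * x2 = x2 * k1
  k2x2 : k2 * x2 = t ^ 2 • (x2 * k2)
  ef1 : e1 * f1 = f1 * e1 + (t ^ 2 - (t ^ 2)⁻¹)⁻¹ • (k1 ^ 2 - l1 ^ 2)
  ef2 : e2 * f2 = f2 * e2 + (t ^ 4 - (t ^ 4)⁻¹)⁻¹ • (k2 ^ 2 - l2 ^ 2)
  e1f2 : e1 * f2 = f2 * e1
  e1x2 : e1 * x2 = x2 * e1
  f1x2 : f1 * x2 = x2 * f1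
  e2x2 : e2 * x2 = (t ^ 2)⁻¹ • (x2 * e2)
  f2x2 : f2 * x2 = x1 * k2 + (t ^ 2)⁻¹ • (x2 * f2)
  f1x1 : f1 * x1 = (t * (t ^ 2 + (t ^ 2)⁻¹)) • (x0 * k1) + (t ^ 2)⁻¹ • (x1 * f1)

namespace WeightData

variable {t : ℂ} {B : Type} [Ring B] [StarRing B] [Algebra ℂ B] [StarModule ℂ B]
  (S : WeightData t B)

include S

theorem cancel_k1 {a b : B} (h : a * S.k1 = b * S.k1) : a = b := by
  have := congrArg (· * S.l1) h
  simpa [mul_assoc, S.k1l1] using this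

theorem cancel_k2 {a b : B} (h : a * S.k2 = b * S.k2) : a = b := by
  have := congrArg (· * S.l2) h
  simpa [mul_assoc, S.k2l2] using this

/-- A relation passes to the inverse of an invertible element. -/
theorem inv_rel {k l a : B} {c : ℂ} (hc : c ≠ 0) (hkl : k * l = 1) (hlk : l * k = 1)
    (h : k * a = c • (a * k)) : l * a = c⁻¹ • (a * l) := by
  have h1 : l * (k * a) * l = c • (l * a * (k * l)) := by
    rw [h]; simp [mul_assoc]
  rw [← mul_assoc, hlk, one_mul, hkl, mul_one] at h1
  rw [h1, smul_smul, inv_mul_cancel₀ hc, one_smul]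

/-- A relation passes to the adjoint. -/
theorem star_rel {k a : B} {c : ℂ} (hc : c ≠ 0) (hc' : starRingEnd ℂ c = c) (hk : star k = k)
    (h : k * a = c • (a * k)) : k * star a = c⁻¹ • (star a * k) := by
  have h1 := congrArg star h
  rw [star_smul, star_mul, star_mul, hk, RCLike.star_def, hc'] at h1
  rw [h1, smul_smul, inv_mul_cancel₀ hc, one_smul]

theorem t2_ne : t ^ 2 ≠ 0 := pow_ne_zero 2 S.t_ne
theorem t4_ne : t ^ 4 ≠ 0 := pow_ne_zero 4 S.t_ne

theorem star_pow (n : ℕ) : starRingEnd ℂ (t ^ n) = t ^ n := by rw [map_pow, S.star_t]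

theorem star_inv_pow (n : ℕ) : starRingEnd ℂ (t ^ n)⁻¹ = (t ^ n)⁻¹ := by
  rw [map_inv₀, S.star_pow]

theorem star_f1 : star S.f1 = S.e1 := by rw [← S.star_e1, star_star]
theorem star_f2 : star S.f2 = S.e2 := by rw [← S.star_e2, star_star]

theorem k1f1 : S.k1 * S.f1 = (t ^ 2)⁻¹ • (S.f1 * S.k1) := by
  rw [← S.star_e1]; exact S.star_rel S.t2_ne (S.star_pow 2) S.star_k1 S.k1e1

theorem k1f2 : S.k1 * S.f2 = t ^ 2 • (S.f2 * S.k1) := by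
  rw [← S.star_e2]
  simpa using S.star_rel (inv_ne_zero S.t2_ne) (S.star_inv_pow 2) S.star_k1 S.k1e2

theorem k2f1 : S.k2 * S.f1 = t ^ 2 • (S.f1 * S.k2) := by
  rw [← S.star_e1]
  simpa using S.star_rel (inv_ne_zero S.t2_ne) (S.star_inv_pow 2) S.star_k2 S.k2e1

theorem k2f2 : S.k2 * S.f2 = (t ^ 4)⁻¹ • (S.f2 * S.k2) := by
  rw [← S.star_e2]; exact S.star_rel S.t4_ne (S.star_pow 4) S.star_k2 S.k2e2

theorem k1y1 : S.k1 * star S.x1 = (t ^ 2)⁻¹ • (star S.x1 * S.k1) :=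
  S.star_rel S.t2_ne (S.star_pow 2) S.star_k1 S.k1x1

theorem k2y1 : S.k2 * star S.x1 = t ^ 2 • (star S.x1 * S.k2) := by
  simpa using S.star_rel (inv_ne_zero S.t2_ne) (S.star_inv_pow 2) S.star_k2 S.k2x1

theorem k2y2 : S.k2 * star S.x2 = (t ^ 2)⁻¹ • (star S.x2 * S.k2) :=
  S.star_rel S.t2_ne (S.star_pow 2) S.star_k2 S.k2x2

theorem l1f1 : S.l1 * S.f1 = t ^ 2 • (S.f1 * S.l1) := by
  simpa using S.inv_rel (inv_ne_zero S.t2_ne) S.k1l1 S.l1k1 S.k1f1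

theorem l1f2 : S.l1 * S.f2 = (t ^ 2)⁻¹ • (S.f2 * S.l1) :=
  S.inv_rel S.t2_ne S.k1l1 S.l1k1 S.k1f2

theorem l2f1 : S.l2 * S.f1 = (t ^ 2)⁻¹ • (S.f1 * S.l2) :=
  S.inv_rel S.t2_ne S.k2l2 S.l2k2 S.k2f1

theorem l2f2 : S.l2 * S.f2 = t ^ 4 • (S.f2 * S.l2) := by
  simpa using S.inv_rel (inv_ne_zero S.t4_ne) S.k2l2 S.l2k2 S.k2f2

theorem l1x1 : S.l1 * S.x1 = (t ^ 2)⁻¹ • (S.x1 * S.l1) :=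
  S.inv_rel S.t2_ne S.k1l1 S.l1k1 S.k1x1

theorem l2x2 : S.l2 * S.x2 = (t ^ 2)⁻¹ • (S.x2 * S.l2) :=
  S.inv_rel S.t2_ne S.k2l2 S.l2k2 S.k2x2

theorem e2f1 : S.e2 * S.f1 = S.f1 * S.e2 := by
  have := congrArg star S.e1f2
  simpa [S.star_e1, S.star_f2] using this

omit S in
/-- Reassociation of a product relation. -/
theorem assoc_rel {a b c : B} (h : a * b = c) (d : B) : a * (b * d) = c * d := by
  rw [← mul_assoc, h]

theorem e1x1 : S.e1 * S.x1 = (t ^ 2)⁻¹ • (S.x1 * S.e1) := by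
  have h1 : S.x1 * S.k2 = S.f2 * S.x2 - (t ^ 2)⁻¹ • (S.x2 * S.f2) := by rw [S.f2x2]; abel
  have h2 : S.e1 * (S.x1 * S.k2) = S.x1 * S.k2 * S.e1 := by
    rw [h1]
    simp only [mul_sub, sub_mul, mul_smul_comm, smul_mul_assoc, mul_assoc, S.e1x2,
      assoc_rel S.e1f2, S.e1f2, assoc_rel S.e1x2]
  apply S.cancel_k2
  rw [mul_assoc, h2, mul_assoc, S.k2e1]
  simp [mul_assoc]

theorem e2x1 : S.e2 * S.x1 = S.x2 * S.k2 + t ^ 2 • (S.x1 * S.e2) := by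
  have h0 := S.t_ne
  have hd := S.den2
  have h1 : S.x1 * S.k2 = S.f2 * S.x2 - (t ^ 2)⁻¹ • (S.x2 * S.f2) := by rw [S.f2x2]; abel
  apply S.cancel_k2
  rw [mul_assoc, h1]
  simp only [mul_sub, sub_mul, mul_add, add_mul, mul_smul_comm, smul_mul_assoc, mul_assoc, sq,
    assoc_rel S.ef2, S.ef2, S.e2x2, assoc_rel S.e2x2, assoc_rel S.f2x2, S.k2x2, S.l2x2, S.k2e2,
    assoc_rel S.k2x2, assoc_rel S.l2x2, smul_add, smul_sub, smul_smul]
  match_scalars <;> field_simp <;> ring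

theorem c_ne : t * (t ^ 2 + (t ^ 2)⁻¹) ≠ 0 := by
  have h0 := S.t_ne
  have hd := S.den2
  intro h
  apply hd
  have h1 : t * (t ^ 2 + (t ^ 2)⁻¹) * (t * (t ^ 4 - 1)) = t ^ 8 - 1 := by field_simp; ring
  rw [← h1, h, zero_mul]

omit S [StarRing B] [StarModule ℂ B] in
theorem smul_cancel {c : ℂ} (hc : c ≠ 0) {a b : B} (h : c • a = c • b) : a = b :=
  smul_right_injective B hc h

theorem x0k1 : (t * (t ^ 2 + (t ^ 2)⁻¹)) • (S.x0 * S.k1)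
    = S.f1 * S.x1 - (t ^ 2)⁻¹ • (S.x1 * S.f1) := by rw [S.f1x1]; abel

theorem e2x0 : S.e2 * S.x0 = S.x0 * S.e2 := by
  have h0 := S.t_ne
  refine S.cancel_k1 (smul_cancel S.c_ne ?_)
  rw [mul_assoc, ← mul_smul_comm, S.x0k1]
  have hk : S.e2 * S.k1 = t ^ 2 • (S.k1 * S.e2) := by
    rw [S.k1e2, smul_smul, mul_inv_cancel₀ S.t2_ne, one_smul]
  simp only [mul_sub, sub_mul, mul_add, add_mul, mul_smul_comm, smul_mul_assoc, mul_assoc,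
    assoc_rel S.e2f1, S.e2f1, S.e2x1, assoc_rel S.e2x1, assoc_rel S.f1x2, assoc_rel S.f1x1,
    S.k2f1, smul_add, smul_sub, smul_smul, hk]
  match_scalars <;> field_simp <;> ring

theorem e1x0 : S.e1 * S.x0 = S.x0 * S.e1 + t⁻¹ • (S.x1 * S.k1) := by
  have h0 := S.t_ne
  have hd := S.den1
  refine S.cancel_k1 (smul_cancel S.c_ne ?_)
  rw [mul_assoc, ← mul_smul_comm, S.x0k1]
  simp only [mul_sub, sub_mul, mul_add, add_mul, mul_smul_comm, smul_mul_assoc, mul_assoc, sq,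
    assoc_rel S.ef1, S.ef1, S.e1x1, assoc_rel S.e1x1, assoc_rel S.f1x1, S.k1x1, assoc_rel S.k1x1,
    S.l1x1, assoc_rel S.l1x1, S.k1e1, smul_add, smul_sub, smul_smul]
  match_scalars <;> field_simp <;> ring

theorem f1x0 : S.f1 * S.x0 = S.x0 * S.f1 - (t ^ 3)⁻¹ • (star S.x1 * S.k1) := by
  have h0 := S.t_ne
  have h := congrArg star S.e1x0
  simp only [star_mul, star_add, star_smul, S.star_e1, S.star_x0, S.star_k1, RCLike.star_def,
    map_inv₀, S.star_t, S.k1y1, smul_smul] at h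
  rw [h, ← mul_inv, ← pow_succ']
  abel

theorem f2x0 : S.f2 * S.x0 = S.x0 * S.f2 := by
  have h := congrArg star S.e2x0
  simpa only [star_mul, S.star_e2, S.star_x0] using h.symm

theorem e2y1 : S.e2 * star S.x1 = (t ^ 2)⁻¹ • (star S.x1 * S.e2) := by
  have h0 := S.t_ne
  refine S.cancel_k1 (smul_cancel (inv_ne_zero (pow_ne_zero 3 h0)) ?_)
  have h1 : (t ^ 3)⁻¹ • (star S.x1 * S.k1) = S.x0 * S.f1 - S.f1 * S.x0 := by rw [S.f1x0]; abel
  have h2 : S.e2 * (S.x0 * S.f1 - S.f1 * S.x0) = (S.x0 * S.f1 - S.f1 * S.x0) * S.e2 := by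
    simp only [mul_sub, sub_mul, mul_assoc, S.e2x0, assoc_rel S.e2x0, S.e2f1, assoc_rel S.e2f1]
  rw [mul_assoc, ← mul_smul_comm, h1, h2, ← h1]
  simp only [smul_mul_assoc, mul_assoc, S.k1e2, mul_smul_comm]

theorem f2x1 : S.f2 * S.x1 = t ^ 2 • (S.x1 * S.f2) := by
  have h := congrArg star S.e2y1
  simp only [star_mul, star_smul, S.star_e2, star_star, RCLike.star_def, S.star_inv_pow] at h
  rw [h, smul_smul, mul_inv_cancel₀ S.t2_ne, one_smul]

theorem e2y2 : S.e2 * star S.x2 = t ^ 2 • (star S.x2 * S.e2) - t ^ 4 • (star S.x1 * S.k2) := by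
  have h0 := S.t_ne
  have h := congrArg star S.f2x2
  simp only [star_mul, star_add, star_smul, S.star_f2, S.star_k2, RCLike.star_def,
    S.star_inv_pow, S.k2y1] at h
  rw [h]
  match_scalars <;> field_simp <;> ring

theorem f2y1 : S.f2 * star S.x1
    = (t ^ 2)⁻¹ • (star S.x1 * S.f2) - (t ^ 4)⁻¹ • (star S.x2 * S.k2) := by
  have h0 := S.t_ne
  have h := congrArg star S.e2x1
  simp only [star_mul, star_add, star_smul, S.star_e2, S.star_k2, RCLike.star_def,
    S.star_pow, S.k2y2] at h
  rw [h]
  match_scalars <;> field_simp <;> ring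

theorem e1y1 : S.e1 * star S.x1
    = t ^ 2 • (star S.x1 * S.e1) - (t ^ 3 * (t ^ 2 + (t ^ 2)⁻¹)) • (S.x0 * S.k1) := by
  have h0 := S.t_ne
  have h := congrArg star S.f1x1
  simp only [star_mul, star_add, star_smul, S.star_f1, S.star_k1, RCLike.star_def,
    S.star_inv_pow, S.star_pow, S.star_t, S.k1x0, S.star_x0] at h
  rw [h]
  match_scalars <;> field_simp <;> ring

theorem e1y2 : S.e1 * star S.x2 = star S.x2 * S.e1 := by
  have h := congrArg star S.f1x2
  simpa only [star_mul, S.star_f1] using h.symm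

/-- The element whose vanishing is the relation between `x_1` and `x_2`. -/
def zz : B := S.x1 * S.x2 - t ^ 4 • (S.x2 * S.x1)

theorem e1_zz : S.e1 * S.zz = (t ^ 2)⁻¹ • (S.zz * S.e1) := by
  simp only [zz, mul_sub, sub_mul, mul_smul_comm, smul_mul_assoc, mul_assoc, S.e1x1,
    assoc_rel S.e1x1, S.e1x2, assoc_rel S.e1x2, smul_sub, smul_smul]
  match_scalars <;> ring

theorem e2_zz : S.e2 * S.zz = S.zz * S.e2 := by
  have h0 := S.t_ne
  simp only [zz, mul_sub, sub_mul, mul_add, add_mul, mul_smul_comm, smul_mul_assoc, mul_assoc,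
    S.e2x1, assoc_rel S.e2x1, S.e2x2, assoc_rel S.e2x2, S.k2x2, smul_sub, smul_add, smul_smul]
  match_scalars <;> field_simp <;> ring

section Relations

variable (hz : S.x1 * S.x2 = t ^ 4 • (S.x2 * S.x1))

include hz

theorem x0x2 : S.x0 * S.x2 = t ^ 4 • (S.x2 * S.x0) := by
  have h0 := S.t_ne
  refine S.cancel_k1 (smul_cancel S.c_ne (sub_eq_zero.1 ?_))
  have h : (t * (t ^ 2 + (t ^ 2)⁻¹)) • (S.x0 * S.x2 * S.k1)
      - (t * (t ^ 2 + (t ^ 2)⁻¹)) • ((t ^ 4 • (S.x2 * S.x0)) * S.k1)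
      = S.f1 * S.zz - (t ^ 2)⁻¹ • (S.zz * S.f1) := by
    simp only [zz, mul_sub, sub_mul, mul_add, add_mul, mul_smul_comm, smul_mul_assoc, mul_assoc,
      S.f1x1, assoc_rel S.f1x1, S.f1x2, assoc_rel S.f1x2, S.k1x2, smul_sub, smul_add, smul_smul]
    match_scalars <;> field_simp <;> ring
  rw [h, zz, hz]; simp

theorem y1x2 : star S.x1 * S.x2 = t ^ 4 • (S.x2 * star S.x1) := by
  have h0 := S.t_ne
  refine S.cancel_k1 (smul_cancel (inv_ne_zero (pow_ne_zero 3 h0)) (sub_eq_zero.1 ?_))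
  have h : (t ^ 3)⁻¹ • (star S.x1 * S.x2 * S.k1)
      - (t ^ 3)⁻¹ • ((t ^ 4 • (S.x2 * star S.x1)) * S.k1)
      = (S.x0 * S.x2 - t ^ 4 • (S.x2 * S.x0)) * S.f1
        - S.f1 * (S.x0 * S.x2 - t ^ 4 • (S.x2 * S.x0)) := by
    simp only [mul_sub, sub_mul, mul_add, add_mul, mul_smul_comm, smul_mul_assoc, mul_assoc,
      S.f1x0, assoc_rel S.f1x0, S.f1x2, assoc_rel S.f1x2, S.k1x2, smul_sub, smul_add, smul_smul]
    match_scalars <;> field_simp <;> ring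
  rw [h, S.x0x2 hz]; simp

theorem x0x1 : S.x0 * S.x1 = t ^ 4 • (S.x1 * S.x0) := by
  have h0 := S.t_ne
  refine S.cancel_k2 (sub_eq_zero.1 ?_)
  have h : S.x0 * S.x1 * S.k2 - (t ^ 4 • (S.x1 * S.x0)) * S.k2
      = S.f2 * (S.x0 * S.x2 - t ^ 4 • (S.x2 * S.x0))
        - (t ^ 2)⁻¹ • ((S.x0 * S.x2 - t ^ 4 • (S.x2 * S.x0)) * S.f2) := by
    simp only [mul_sub, sub_mul, mul_add, add_mul, mul_smul_comm, smul_mul_assoc, mul_assoc,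
      S.f2x0, assoc_rel S.f2x0, S.f2x2, assoc_rel S.f2x2, S.k2x0, smul_sub, smul_add, smul_smul]
    match_scalars <;> field_simp <;> ring
  rw [h, S.x0x2 hz]; simp

theorem y1x1 : star S.x1 * S.x1 - S.x1 * star S.x1 = (1 - t ^ 8) • S.x0 ^ 2 := by
  have h0 := S.t_ne
  refine S.cancel_k1 (smul_cancel (c := -t⁻¹) (by simp [h0]) (sub_eq_zero.1 ?_))
  have h : -t⁻¹ • ((star S.x1 * S.x1 - S.x1 * star S.x1) * S.k1)
      - -t⁻¹ • ((1 - t ^ 8) • S.x0 ^ 2 * S.k1)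
      = S.f1 * (S.x0 * S.x1 - t ^ 4 • (S.x1 * S.x0))
        - (t ^ 2)⁻¹ • ((S.x0 * S.x1 - t ^ 4 • (S.x1 * S.x0)) * S.f1) := by
    simp only [mul_sub, sub_mul, mul_add, add_mul, mul_smul_comm, smul_mul_assoc, mul_assoc, sq,
      S.f1x0, assoc_rel S.f1x0, S.f1x1, assoc_rel S.f1x1, S.k1x0, S.k1x1, S.k1y1,
      smul_sub, smul_add, smul_smul]
    match_scalars <;> field_simp <;> ring
  rw [h, S.x0x1 hz]; simp

theorem y2x2 : star S.x2 * S.x2 - S.x2 * star S.x2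
    = star S.x1 * S.x1 - t ^ 8 • (S.x1 * star S.x1) := by
  have h0 := S.t_ne
  refine S.cancel_k2 (smul_cancel (c := -(t ^ 2)⁻¹) (by simp [h0]) (sub_eq_zero.1 ?_))
  have h : -(t ^ 2)⁻¹ • ((star S.x2 * S.x2 - S.x2 * star S.x2) * S.k2)
      - -(t ^ 2)⁻¹ • ((star S.x1 * S.x1 - t ^ 8 • (S.x1 * star S.x1)) * S.k2)
      = S.f2 * (star S.x1 * S.x2 - t ^ 4 • (S.x2 * star S.x1))
        - (t ^ 4)⁻¹ • ((star S.x1 * S.x2 - t ^ 4 • (S.x2 * star S.x1)) * S.f2) := by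
    simp only [mul_sub, sub_mul, mul_add, add_mul, mul_smul_comm, smul_mul_assoc, mul_assoc, sq,
      S.f2x2, assoc_rel S.f2x2, S.f2y1, assoc_rel S.f2y1, S.k2x2, S.k2y1,
      smul_sub, smul_add, smul_smul]
    match_scalars <;> field_simp <;> ring
  rw [h, S.y1x2 hz]; simp

end Relations

/-- The squared radius. -/
def rr : B := S.x0 ^ 2 + S.x1 * star S.x1 + S.x2 * star S.x2

theorem e1_rr (hz : S.x1 * S.x2 = t ^ 4 • (S.x2 * S.x1)) : S.e1 * S.rr = S.rr * S.e1 := by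
  have h0 := S.t_ne
  simp only [rr, mul_sub, sub_mul, mul_add, add_mul, mul_smul_comm, smul_mul_assoc, mul_assoc, sq,
    S.e1x0, assoc_rel S.e1x0, S.e1x1, assoc_rel S.e1x1, S.e1y1, S.e1x2, assoc_rel S.e1x2, S.e1y2,
    S.k1x0, assoc_rel (S.x0x1 hz), smul_sub, smul_add, smul_smul]
  match_scalars <;> field_simp <;> ring

theorem e2_rr : S.e2 * S.rr = S.rr * S.e2 := by
  have h0 := S.t_ne
  simp only [rr, mul_sub, sub_mul, mul_add, add_mul, mul_smul_comm, smul_mul_assoc, mul_assoc, sq,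
    S.e2x0, assoc_rel S.e2x0, S.e2x1, assoc_rel S.e2x1, S.e2y1, S.e2x2, assoc_rel S.e2x2, S.e2y2,
    S.k2y1, smul_sub, smul_add, smul_smul]
  match_scalars <;> field_simp <;> ring

omit [StarModule ℂ B] in
theorem commute_rr {g : B} (h0 : g * S.x0 = S.x0 * g) (h1 : g * S.x1 = S.x1 * g)
    (h1' : g * star S.x1 = star S.x1 * g) (h2 : g * S.x2 = S.x2 * g)
    (h2' : g * star S.x2 = star S.x2 * g) : g * S.rr = S.rr * g := by
  have a0 : Commute g S.x0 := h0
  have a1 : Commute g S.x1 := h1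
  have a1' : Commute g (star S.x1) := h1'
  have a2 : Commute g S.x2 := h2
  have a2' : Commute g (star S.x2) := h2'
  exact ((a0.pow_right 2).add_right (a1.mul_right a1')).add_right (a2.mul_right a2')

theorem star_rr : star S.rr = S.rr := by simp [rr, sq, S.star_x0]

theorem f1_rr (hz : S.x1 * S.x2 = t ^ 4 • (S.x2 * S.x1)) : S.f1 * S.rr = S.rr * S.f1 := by
  simpa only [star_mul, S.star_e1, S.star_rr] using (congrArg star (S.e1_rr hz)).symm

theorem f2_rr : S.f2 * S.rr = S.rr * S.f2 := by
  simpa only [star_mul, S.star_e2, S.star_rr] using (congrArg star S.e2_rr).symm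

theorem k2_rr : S.k2 * S.rr = S.rr * S.k2 := by
  have h0 := S.t_ne
  simp only [rr, mul_add, add_mul, mul_smul_comm, mul_assoc, sq, S.k2x0, assoc_rel S.k2x0, S.k2y1,
    assoc_rel S.k2x1, S.k2y2, assoc_rel S.k2x2, smul_mul_assoc, smul_smul]
  match_scalars <;> field_simp <;> ring

/-- The adjoint of the first Serre element. -/
def serre1 : B := S.f2 ^ 2 * S.f1 - (t ^ 4 + (t ^ 4)⁻¹) • (S.f2 * S.f1 * S.f2) + S.f1 * S.f2 ^ 2

/-- The adjoint of the second Serre element. -/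
def serre2 : B := S.f2 * S.f1 ^ 3 - (t ^ 4 + 1 + (t ^ 4)⁻¹) • (S.f1 * S.f2 * S.f1 ^ 2
  - S.f1 ^ 2 * S.f2 * S.f1) - S.f1 ^ 3 * S.f2

theorem e1_serre1 : S.e1 * S.serre1 = S.serre1 * S.e1 := by
  have h0 := S.t_ne
  have hd := S.den1
  simp only [serre1, mul_sub, sub_mul, mul_add, add_mul, mul_smul_comm, smul_mul_assoc, mul_assoc,
    sq, S.e1f2, assoc_rel S.e1f2, S.ef1, assoc_rel S.ef1, S.k1f2, assoc_rel S.k1f2, S.l1f2,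
    assoc_rel S.l1f2, smul_sub, smul_add, smul_smul]
  match_scalars <;> field_simp <;> ring

theorem e2_serre1 : S.e2 * S.serre1 = S.serre1 * S.e2 := by
  have h0 := S.t_ne
  have hd := S.den2
  simp only [serre1, mul_sub, sub_mul, mul_add, add_mul, mul_smul_comm, smul_mul_assoc, mul_assoc,
    sq, S.e2f1, assoc_rel S.e2f1, S.ef2, assoc_rel S.ef2, S.k2f2, assoc_rel S.k2f2, S.l2f2,
    assoc_rel S.l2f2, S.k2f1, assoc_rel S.k2f1, S.l2f1, assoc_rel S.l2f1,
    smul_sub, smul_add, smul_smul]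
  match_scalars <;> field_simp <;> ring

theorem e2_serre2 : S.e2 * S.serre2 = S.serre2 * S.e2 := by
  have h0 := S.t_ne
  have hd := S.den2
  simp only [serre2, mul_sub, sub_mul, mul_add, add_mul, mul_smul_comm, smul_mul_assoc, mul_assoc,
    pow_succ, pow_zero, one_mul, S.e2f1, assoc_rel S.e2f1, S.ef2, assoc_rel S.ef2, S.k2f1,
    assoc_rel S.k2f1, S.l2f1, assoc_rel S.l2f1, smul_sub, smul_add, smul_smul]
  match_scalars <;> field_simp <;> ring

theorem e1_serre2 : S.e1 * S.serre2 = S.serre2 * S.e1 := by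
  have h0 := S.t_ne
  have hd := S.den1
  simp only [serre2, mul_sub, sub_mul, mul_add, add_mul, mul_smul_comm, smul_mul_assoc, mul_assoc,
    pow_succ, pow_zero, one_mul, S.e1f2, assoc_rel S.e1f2, S.ef1, assoc_rel S.ef1, S.k1f1,
    assoc_rel S.k1f1, S.l1f1, assoc_rel S.l1f1, S.k1f2, assoc_rel S.k1f2, S.l1f2,
    assoc_rel S.l1f2, smul_sub, smul_add, smul_smul]
  match_scalars <;> field_simp <;> ring

end WeightData

/-! ### Adjoint pairs of operators on functions of labels -/

section AdjointPairs

/-- Two operators on functions of labels that restrict to mutually adjoint operators of the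
finitely supported vectors. -/
structure IsAdj (T T' : Module.End ℂ LatFun) : Prop where
  pres : Pres T
  pres' : Pres T'
  coeff : ∀ s p t r, Lab p → Lab r → starRingEnd ℂ (T (dl s p) t r) = T' (dl t r) s p

theorem IsAdj.symm {T T' : Module.End ℂ LatFun} (h : IsAdj T T') : IsAdj T' T :=
  ⟨h.pres', h.pres, fun s p t r hp hr => by rw [← h.coeff t r s p hr hp, Complex.conj_conj]⟩

theorem IsAdj.sum {ι : Type} {S : Finset ι} {T T' : ι → Module.End ℂ LatFun}
    (h : ∀ i, IsAdj (T i) (T' i)) : IsAdj (∑ i ∈ S, T i) (∑ i ∈ S, T' i) :=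
  ⟨Pres.sum fun i => (h i).pres, Pres.sum fun i => (h i).pres', fun s p t r hp hr => by
    simp only [LinearMap.sum_apply, Finset.sum_apply, map_sum]
    exact Finset.sum_congr rfl fun i _ => (h i).coeff s p t r hp hr⟩

theorem IsAdj.shift {d d' : Lat} {c c' : LatFun} (hd : d' = -d) (hc : Good d c) (hc' : Good d' c')
    (h : ∀ s p, Lab p → Lab (p + d) → c' s (p + d) = starRingEnd ℂ (c s p)) :
    IsAdj (sh d c) (sh d' c') := by
  subst hd
  exact ⟨hc.pres, hc'.pres, fun s p t r hp hr => sh_adj h s p t r hp hr⟩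

open Classical in
/-- The weight of the adjoint of a weighted shift. -/
def adjW (d : Lat) (c : LatFun) : LatFun := fun s p =>
  if Lab (p - d) then starRingEnd ℂ (c s (p - d)) else 0

theorem good_adjW (d : Lat) (c : LatFun) : Good (-d) (adjW d c) := fun s p _ hd => by
  rw [adjW, if_neg]; rwa [sub_eq_add_neg]

theorem IsAdj.shift_adjW {d : Lat} {c : LatFun} (hc : Good d c) :
    IsAdj (sh d c) (sh (-d) (adjW d c)) :=
  IsAdj.shift rfl hc (good_adjW d c) fun s p hp _ => by
    rw [adjW, add_sub_cancel_right, if_pos hp]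

/-- The element of the algebra of adjointable operators given by an adjoint pair. -/
def elt {T T' : Module.End ℂ LatFun} (h : IsAdj T T') : AdjAlg finM :=
  ⟨onM T h.pres, onM T' h.pres', adj_of_coeff (onM_rp T h.pres) (onM_rp T' h.pres') h.coeff⟩

theorem elt_rp {T T' : Module.End ℂ LatFun} (h : IsAdj T T') :
    Rp (elt h : Module.End ℂ finM) T := onM_rp T h.pres

theorem star_elt {T T' : Module.End ℂ LatFun} (h : IsAdj T T') : star (elt h) = elt h.symm :=
  AdjAlg.star_eq (adj_of_coeff (elt_rp h) (elt_rp h.symm) h.coeff)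

theorem elt_eq {a b : AdjAlg finM} {T T' : Module.End ℂ LatFun}
    (ha : Rp (a : Module.End ℂ finM) T) (hb : Rp (b : Module.End ℂ finM) T') (h : T = T') :
    a = b := by
  subst h
  exact Subtype.ext (ha.unique hb)

theorem rp_km {b : Module.End ℂ finM} {ι : Type} {S : Finset ι} {d : ι → Lat} {c : ι → LatFun}
    (hb : Rp b (∑ i ∈ S, sh (d i) (c i))) (hc : ∀ i, Good (d i) (c i)) (s : Bool) {p : Lat}
    (hp : Lab p) : b (km s p) = ∑ i ∈ S, c i s p • km s (p + d i) := by
  refine Subtype.ext (toFn_injective ?_)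
  rw [hb, LinearMap.sum_apply, Submodule.coe_sum, map_sum]
  refine Finset.sum_congr rfl fun i _ => ?_
  rw [Submodule.coe_smul, map_smul]
  exact (hc i).sh_kv s hp

theorem rp_km_one {b : Module.End ℂ finM} {d : Lat} {c : LatFun}
    (hb : Rp b (sh d c)) (hc : Good d c) (s : Bool) {p : Lat}
    (hp : Lab p) : b (km s p) = c s p • km s (p + d) := by
  refine Subtype.ext (toFn_injective ?_)
  rw [hb, Submodule.coe_smul, map_smul]
  exact hc.sh_kv s hp

end AdjointPairs

/-! ### The generators -/

section Generators

theorem good_zero (c : LatFun) : Good 0 c := fun s p hp h => absurd (by simpa using hp) h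

theorem labA_of {p : Lat} (h : Lab p) : LabA p.2.2.2 p.2.1 := (lab_iff.1 h).1
theorem labB_of {p : Lat} (h : Lab p) : LabB p.1 p.2.2.2 p.2.2.1 := (lab_iff.1 h).2
theorem nonneg_of {p : Lat} (h : Lab p) : 0 ≤ p.2.2.2 := h.1

/-- The product of two weights vanishes where one of the label conditions fails. -/
theorem good_mul {d : Lat} {f g : LatFun}
    (hf : ∀ s p, Lab p → ¬LabA (p.2.2.2 + d.2.2.2) (p.2.1 + d.2.1) → f s p = 0)
    (hg : ∀ s p, Lab p → ¬LabB (p.1 + d.1) (p.2.2.2 + d.2.2.2) (p.2.2.1 + d.2.2.1) → g s p = 0) :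
    Good d (fun s p => f s p * g s p) := fun s p hp h => by
  rw [lab_iff] at h
  by_cases h1 : LabA (p.2.2.2 + d.2.2.2) (p.2.1 + d.2.1)
  · exact mul_eq_zero_of_right _ (hg s p hp fun h2 => h ⟨h1, h2⟩)
  · exact mul_eq_zero_of_left (hf s p hp h1) _

variable (x : ℂ)

theorem good_E1 : Good (0, 1, 0, 0) (fun _ p => e1 x p.2.2.2 p.2.1) := fun s p hp h => by
  refine e1_exit x (labA_of hp) fun h' => h (lab_iff.2 ⟨?_, ?_⟩)
  · simpa using h'
  · simpa using labB_of hp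

theorem good_F1 : Good (0, -1, 0, 0) (fun _ p => e1 x p.2.2.2 (p.2.1 - 1)) := fun s p hp h => by
  refine e1_exit' x (labA_of hp) fun h' => h (lab_iff.2 ⟨?_, ?_⟩)
  · simpa [← sub_eq_add_neg] using h'
  · simpa using labB_of hp

theorem good_E2 (i : Fin 3) : Good (0, -1, 1, dd i)
    (fun _ p => es x i p.2.2.2 p.2.1 * ee x i p.1 p.2.2.2 p.2.2.1) :=
  good_mul (fun s p hp h => es_exit x i (labA_of hp) h)
    (fun s p hp h => ee_exit x i (labB_of hp) (by simpa using h))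

theorem good_F2 (i : Fin 3) : Good (0, 1, -1, dd i)
    (fun _ p => fs x i p.2.2.2 p.2.1 * ef x i p.1 p.2.2.2 p.2.2.1) :=
  good_mul (fun s p hp h => fs_exit x i (labA_of hp) h)
    (fun s p hp h => ef_exit x i (labB_of hp) (by simpa [← sub_eq_add_neg] using h))

theorem good_X0 (i j : Fin 3) : Good (dd j, 0, 0, dd i)
    (fun s p => ac x i p.2.2.2 p.2.1 * yc x (csgn s) i j p.1 p.2.2.2 p.2.2.1) :=
  good_mul (fun s p hp h => ac_exit x i (labA_of hp) (by simpa using h))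
    (fun s p hp h => yc_exit x _ i j (labB_of hp) (by simpa using h))

theorem good_X1 (i j : Fin 3) : Good (dd j, 1, 0, dd i)
    (fun s p => bc x i p.2.2.2 p.2.1 * yc x (csgn s) i j p.1 p.2.2.2 p.2.2.1) :=
  good_mul (fun s p hp h => bc_exit x i (labA_of hp) h)
    (fun s p hp h => yc_exit x _ i j (labB_of hp) (by simpa using h))

theorem good_X2 (j : Fin 3) : Good (dd j, 0, 1, 0)
    (fun s p => dc x (csgn s) j p.1 p.2.2.2 p.2.2.1) := fun s p hp h => by
  refine dc_exit x _ j (labB_of hp) fun h' => h (lab_iff.2 ⟨?_, ?_⟩)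
  · simpa using labA_of hp
  · simpa using h'

theorem ac_rev (i : Fin 3) (k a : ℤ) : ac x i.rev (k + dd i) a = ac x i k a := by
  fin_cases i <;> simp only [ac, dd, Fin.zero_eta, Fin.mk_one, Fin.reduceFinMk, rev0, rev1, rev2,
    Matrix.cons_val] <;> ring_nf

theorem yc_rev (σ : ℂ) (i j : Fin 3) (n k b : ℤ) :
    yc x σ i.rev j.rev (n + dd j) (k + dd i) b = yc x σ i j n k b := by
  fin_cases i <;> fin_cases j <;> simp only [yc, dd, Fin.zero_eta, Fin.mk_one, Fin.reduceFinMk,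
    rev0, rev1, rev2, Matrix.cons_val, add_zero, Int.reduceNeg, add_sub_cancel_right,
    neg_add_cancel_right, ← sub_eq_add_neg, sub_add_cancel]

theorem dd_rev (i : Fin 3) : dd i.rev = -dd i := by
  fin_cases i <;> simp [dd, rev0, rev1, rev2]

variable {q : ℝ} (hq0 : 0 < q) (hq1 : q < 1)

theorem conj_csgn (s : Bool) : starRingEnd ℂ (csgn s) = csgn s := by cases s <;> simp [csgn]

include hq0

theorem conj_sx : starRingEnd ℂ (sx q) = sx q := Complex.conj_ofReal _

theorem isAdj_K1 (e : ℤ) : IsAdj (wK1 (sx q) e) (wK1 (sx q) e) :=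
  IsAdj.shift (by simp) (good_zero _) (good_zero _) fun s p _ _ => by
    simp [map_zpow₀, conj_sx hq0]

theorem isAdj_K2 (e : ℤ) : IsAdj (wK2 (sx q) e) (wK2 (sx q) e) :=
  IsAdj.shift (by simp) (good_zero _) (good_zero _) fun s p _ _ => by
    simp [map_zpow₀, conj_sx hq0]

include hq1

theorem isAdj_E1 : IsAdj (wE1 (sx q)) (wF1 (sx q)) :=
  IsAdj.shift (by simp) (good_E1 _) (good_F1 _) fun s p hp _ => by
    simp [conj_e1 hq0 hq1 (labA_of hp)]

theorem isAdj_E2 : IsAdj (wE2 (sx q)) (wF2 (sx q)) := by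
  have h : wF2 (sx q) = ∑ i : Fin 3, sh (0, 1, -1, dd i.rev) fun _ p =>
      fs (sx q) i.rev p.2.2.2 p.2.1 * ef (sx q) i.rev p.1 p.2.2.2 p.2.2.1 := by
    rw [wF2, ← Equiv.sum_comp Fin.revPerm]; rfl
  rw [h]
  refine IsAdj.sum fun i => IsAdj.shift (by simp [dd_rev]) (good_E2 _ i) (good_F2 _ i.rev)
    fun s p hp _ => ?_
  simp only [Prod.fst_add, Prod.snd_add, fs, ef, Fin.rev_rev, dd_rev, map_mul,
    conj_es hq0 hq1 i (labA_of hp), conj_ee hq0 hq1 i (labB_of hp) (nonneg_of hp)]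
  simp

theorem conj_ac (i : Fin 3) {k a : ℤ} (h : LabA k a) (h' : LabA (k + dd i) a) :
    starRingEnd ℂ (ac (sx q) i k a) = ac (sx q) i k a := by
  have h0 : ∀ {k a}, LabA k a → starRingEnd ℂ (ac (sx q) 0 k a) = ac (sx q) 0 k a :=
    fun h => by rw [← cast_Ap hq0 hq1 h, Complex.conj_ofReal]
  fin_cases i
  · exact h0 h
  · change starRingEnd ℂ (ac (sx q) 1 k a) = ac (sx q) 1 k a
    rw [← cast_A0 hq0 hq1 h, Complex.conj_ofReal]
  · change starRingEnd ℂ (ac (sx q) 2 k a) = ac (sx q) 2 k a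
    rw [← ac_rev (sx q) 2 k a]
    exact h0 h'

theorem conj_yc (s : Bool) (i j : Fin 3) {n k b : ℤ} (h : LabB n k b) (hk : 0 ≤ k)
    (h' : LabB (n + dd j) (k + dd i) b) (hk' : 0 ≤ k + dd i) :
    starRingEnd ℂ (yc (sx q) (csgn s) i j n k b) = yc (sx q) (csgn s) i j n k b := by
  have hcp : ∀ {n k b}, LabB n k b → 0 ≤ k → starRingEnd ℂ (cp (sx q) n k b) = cp (sx q) n k b :=
    fun h hk => by rw [← cast_Cp hq0 hq1 h hk, Complex.conj_ofReal]
  have hcm : ∀ {n k b}, LabB n k b → 0 ≤ k → starRingEnd ℂ (cm (sx q) n k b) = cm (sx q) n k b :=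
    fun h hk => by rw [← cast_Cm hq0 hq1 h hk, Complex.conj_ofReal]
  have hcz : ∀ {n k b}, LabB n k b → 0 ≤ k → starRingEnd ℂ (cz (sx q) n k b) = cz (sx q) n k b :=
    fun h hk => by rw [← cast_C0 hq0 hq1 h hk, Complex.conj_ofReal]
  have hhp : ∀ {n k b}, LabB n k b → 0 ≤ k → starRingEnd ℂ (hp (sx q) n k b) = hp (sx q) n k b :=
    fun h hk => by rw [← cast_Hp hq0 hq1 h hk, Complex.conj_ofReal]
  have hhz : ∀ {n k b}, LabB n k b → 0 ≤ k → starRingEnd ℂ (hz (sx q) n k b) = hz (sx q) n k b :=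
    fun h hk => by rw [← cast_H0 hq0 hq1 h hk, Complex.conj_ofReal]
  fin_cases i <;> fin_cases j <;>
    simp only [yc, dd, Fin.zero_eta, Fin.mk_one, Fin.reduceFinMk, Matrix.cons_val, map_neg,
      map_mul, conj_csgn, Int.reduceNeg, add_zero, ← sub_eq_add_neg] at h' hk' ⊢
  · exact hcp h hk
  · rw [hcz h hk]
  · exact hcm h hk
  · exact hhp h hk
  · rw [hhz h hk]
  · exact hhp h' hk
  · exact hcm h' hk'
  · rw [hcz h' hk']
  · exact hcp h' hk'

theorem isAdj_X0 : IsAdj (wX0 (sx q)) (wX0 (sx q)) := by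
  have h : wX0 (sx q) = ∑ i : Fin 3, ∑ j : Fin 3, sh (dd j.rev, 0, 0, dd i.rev) fun s p =>
      ac (sx q) i.rev p.2.2.2 p.2.1 * yc (sx q) (csgn s) i.rev j.rev p.1 p.2.2.2 p.2.2.1 := by
    rw [wX0, ← Equiv.sum_comp Fin.revPerm]
    refine Finset.sum_congr rfl fun i _ => ?_
    rw [← Equiv.sum_comp Fin.revPerm]; rfl
  conv => arg 2; rw [h]
  refine IsAdj.sum fun i => IsAdj.sum fun j =>
    IsAdj.shift (by simp [dd_rev]) (good_X0 _ i j) (good_X0 _ i.rev j.rev) fun s p hp hd => ?_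
  have h1 := labA_of hd
  have h2 := labB_of hd
  have h3 := nonneg_of hd
  simp only [Prod.fst_add, Prod.snd_add, add_zero] at h1 h2 h3
  simp only [Prod.fst_add, Prod.snd_add, add_zero, ac_rev, yc_rev, map_mul,
    conj_ac hq0 hq1 i (labA_of hp) h1,
    conj_yc hq0 hq1 s i j (labB_of hp) (nonneg_of hp) h2 h3]

omit hq0 hq1

/-- The formal adjoint of `x_1` on functions of labels. -/
def wY1 : Module.End ℂ LatFun := ∑ i : Fin 3, ∑ j : Fin 3, sh (-(dd j, 1, 0, dd i))
  (adjW (dd j, 1, 0, dd i) fun s p =>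
    bc x i p.2.2.2 p.2.1 * yc x (csgn s) i j p.1 p.2.2.2 p.2.2.1)

/-- The formal adjoint of `x_2` on functions of labels. -/
def wY2 : Module.End ℂ LatFun := ∑ j : Fin 3, sh (-(dd j, 0, 1, 0))
  (adjW (dd j, 0, 1, 0) fun s p => dc x (csgn s) j p.1 p.2.2.2 p.2.2.1)

theorem isAdj_X1 : IsAdj (wX1 x) (wY1 x) :=
  IsAdj.sum fun i => IsAdj.sum fun j => IsAdj.shift_adjW (good_X1 x i j)

theorem isAdj_X2 : IsAdj (wX2 x) (wY2 x) :=
  IsAdj.sum fun j => IsAdj.shift_adjW (good_X2 x j)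

/-- The operators on the finitely supported vectors satisfy the relations of highest weight
type. -/
def opData : WeightData (sx q) (AdjAlg finM) :=
  have hx := sx_ne_zero hq0
  have hq := zq_sx_ne_zero hq0 hq1
  have cK1 (e) := elt_rp (isAdj_K1 hq0 e)
  have cK2 (e) := elt_rp (isAdj_K2 hq0 e)
  have cE1 := elt_rp (isAdj_E1 hq0 hq1)
  have cE2 := elt_rp (isAdj_E2 hq0 hq1)
  have cF1 := elt_rp (isAdj_E1 hq0 hq1).symm
  have cF2 := elt_rp (isAdj_E2 hq0 hq1).symm
  have cX0 := elt_rp (isAdj_X0 hq0 hq1)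
  have cX1 := elt_rp (isAdj_X1 (sx q))
  have cX2 := elt_rp (isAdj_X2 (sx q))
  { k1 := elt (isAdj_K1 hq0 1)
    l1 := elt (isAdj_K1 hq0 (-1))
    k2 := elt (isAdj_K2 hq0 1)
    l2 := elt (isAdj_K2 hq0 (-1))
    e1 := elt (isAdj_E1 hq0 hq1)
    e2 := elt (isAdj_E2 hq0 hq1)
    f1 := elt (isAdj_E1 hq0 hq1).symm
    f2 := elt (isAdj_E2 hq0 hq1).symm
    x0 := elt (isAdj_X0 hq0 hq1)
    x1 := elt (isAdj_X1 (sx q))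
    x2 := elt (isAdj_X2 (sx q))
    star_t := conj_sx hq0
    t_ne := hx
    den1 := pow_four_sub_one_ne_zero hq
    den2 := pow_eight_sub_one_ne_zero hx hq
    star_k1 := star_elt _
    star_l1 := star_elt _
    star_k2 := star_elt _
    star_l2 := star_elt _
    star_e1 := star_elt _
    star_e2 := star_elt _
    star_x0 := star_elt _
    k1l1 := elt_eq ((cK1 1).mul (cK1 (-1))) Rp.one (by rw [wK1_mul hx]; exact wK1_zero)
    l1k1 := elt_eq ((cK1 (-1)).mul (cK1 1)) Rp.one (by rw [wK1_mul hx]; exact wK1_zero)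
    k2l2 := elt_eq ((cK2 1).mul (cK2 (-1))) Rp.one (by rw [wK2_mul hx]; exact wK2_zero)
    l2k2 := elt_eq ((cK2 (-1)).mul (cK2 1)) Rp.one (by rw [wK2_mul hx]; exact wK2_zero)
    k_comm := elt_eq ((cK1 1).mul (cK2 1)) ((cK2 1).mul (cK1 1)) (wK_comm _ _)
    k1e1 := elt_eq ((cK1 1).mul cE1) ((cE1.mul (cK1 1)).smul (sx q ^ 2)) (by
      rw [wK1_E1 hx]; norm_num [zpow_ofNat])
    k1e2 := elt_eq ((cK1 1).mul cE2) ((cE2.mul (cK1 1)).smul (sx q ^ 2)⁻¹) (by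
      rw [wK1_E2 hx]; norm_num [zpow_neg, zpow_ofNat])
    k2e1 := elt_eq ((cK2 1).mul cE1) ((cE1.mul (cK2 1)).smul (sx q ^ 2)⁻¹) (by
      rw [wK2_E1 hx]; norm_num [zpow_neg, zpow_ofNat])
    k2e2 := elt_eq ((cK2 1).mul cE2) ((cE2.mul (cK2 1)).smul (sx q ^ 4)) (by
      rw [wK2_E2 hx]; norm_num [zpow_ofNat])
    k1x0 := elt_eq ((cK1 1).mul cX0) (cX0.mul (cK1 1)) (wK1_X0 hx _)
    k2x0 := elt_eq ((cK2 1).mul cX0) (cX0.mul (cK2 1)) (wK2_X0 hx _)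
    k1x1 := elt_eq ((cK1 1).mul cX1) ((cX1.mul (cK1 1)).smul (sx q ^ 2)) (by
      rw [wK1_X1 hx]; norm_num [zpow_ofNat])
    k2x1 := elt_eq ((cK2 1).mul cX1) ((cX1.mul (cK2 1)).smul (sx q ^ 2)⁻¹) (by
      rw [wK2_X1 hx]; norm_num [zpow_neg, zpow_ofNat])
    k1x2 := elt_eq ((cK1 1).mul cX2) (cX2.mul (cK1 1)) (wK1_X2 hx _)
    k2x2 := elt_eq ((cK2 1).mul cX2) ((cX2.mul (cK2 1)).smul (sx q ^ 2)) (by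
      rw [wK2_X2 hx]; norm_num [zpow_ofNat])
    ef1 := by
      rw [sq (elt (isAdj_K1 hq0 1)), sq (elt (isAdj_K1 hq0 (-1)))]
      exact elt_eq (cE1.mul cF1) ((cF1.mul cE1).add
        ((((cK1 1).mul (cK1 1)).sub ((cK1 (-1)).mul (cK1 (-1)))).smul
          (sx q ^ 2 - (sx q ^ 2)⁻¹)⁻¹)) (by
        rw [wK1_mul hx, wK1_mul hx, ← sub_eq_iff_eq_add', wE1_F1 hx hq]
        norm_num [zpow_neg, zpow_ofNat])
    ef2 := by
      rw [sq (elt (isAdj_K2 hq0 1)), sq (elt (isAdj_K2 hq0 (-1)))]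
      exact elt_eq (cE2.mul cF2) ((cF2.mul cE2).add
        ((((cK2 1).mul (cK2 1)).sub ((cK2 (-1)).mul (cK2 (-1)))).smul
          (sx q ^ 4 - (sx q ^ 4)⁻¹)⁻¹)) (by
        rw [wK2_mul hx, wK2_mul hx, ← sub_eq_iff_eq_add', wE2_F2 hx hq]
        norm_num [zpow_neg, zpow_ofNat])
    e1f2 := elt_eq (cE1.mul cF2) (cF2.mul cE1) wE1_F2
    e1x2 := elt_eq (cE1.mul cX2) (cX2.mul cE1) wE1_X2
    f1x2 := elt_eq (cF1.mul cX2) (cX2.mul cF1) wF1_X2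
    e2x2 := elt_eq (cE2.mul cX2) ((cX2.mul cE2).smul (sx q ^ 2)⁻¹) (by
      rw [wE2_X2 hx hq]; norm_num [zpow_neg, zpow_ofNat])
    f2x2 := elt_eq (cF2.mul cX2) ((cX1.mul (cK2 1)).add ((cX2.mul cF2).smul (sx q ^ 2)⁻¹)) (by
      rw [wF2_X2 hx hq]; norm_num [zpow_neg, zpow_ofNat])
    f1x1 := elt_eq (cF1.mul cX1) (((cX0.mul (cK1 1)).smul
        (sx q * (sx q ^ 2 + (sx q ^ 2)⁻¹))).add ((cX1.mul cF1).smul (sx q ^ 2)⁻¹)) (by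
      rw [wF1_X1 hx hq, show zq (sx q) 2 = sx q ^ 2 + (sx q ^ 2)⁻¹ by
        have h4 := pow_four_sub_one_ne_zero hq
        have h : sx q ^ (2 : ℤ) - sx q ^ (-2 : ℤ) ≠ 0 := by
          rw [zpow_neg, zpow_ofNat]
          intro h
          apply h4
          field_simp at h
          linear_combination h
        rw [zq, div_eq_iff h]
        norm_num [zpow_neg, zpow_ofNat]
        field_simp
        ring]
      norm_num [zpow_neg, zpow_ofNat]) }

end Generators

/-! ### The lowest weight vectors generate -/

section Cyclic

variable {q : ℝ} (hq0 : 0 < q) (hq1 : q < 1)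

/-- The label of a lowest weight vector. -/
def low (n : ℤ) : Lat := (n, -1, -n - 1, 0)

theorem lab_low {n : ℤ} (hn : 0 ≤ n) : Lab (low n) := by
  simp only [Lab, low, IsLabel]; omega

include hq0 hq1 in
theorem rq_ne {i : ℤ} (hi : i ≠ 0) : rq (sx q) i ≠ 0 := fun h => by
  have := rq_sq (sx q) i
  rw [h] at this
  exact zq_sx_ne_zero hq0 hq1 i hi (by rw [← this]; simp)

theorem e1_km (s : Bool) {p : Lat} (hp : Lab p) :
    ((opData hq0 hq1).e1 : Module.End ℂ finM) (km s p)
      = e1 (sx q) p.2.2.2 p.2.1 • km s (p + (0, 1, 0, 0)) :=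
  rp_km_one (elt_rp (isAdj_E1 hq0 hq1)) (good_E1 _) s hp

theorem f1_km (s : Bool) {p : Lat} (hp : Lab p) :
    ((opData hq0 hq1).f1 : Module.End ℂ finM) (km s p)
      = e1 (sx q) p.2.2.2 (p.2.1 - 1) • km s (p + (0, -1, 0, 0)) :=
  rp_km_one (elt_rp (isAdj_E1 hq0 hq1).symm) (good_F1 _) s hp

theorem e2_km (s : Bool) {p : Lat} (hp : Lab p) :
    ((opData hq0 hq1).e2 : Module.End ℂ finM) (km s p)
      = ∑ i, (es (sx q) i p.2.2.2 p.2.1 * ee (sx q) i p.1 p.2.2.2 p.2.2.1)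
          • km s (p + (0, -1, 1, dd i)) :=
  rp_km (elt_rp (isAdj_E2 hq0 hq1)) (good_E2 _) s hp

theorem f2_km (s : Bool) {p : Lat} (hp : Lab p) :
    ((opData hq0 hq1).f2 : Module.End ℂ finM) (km s p)
      = ∑ i, (fs (sx q) i p.2.2.2 p.2.1 * ef (sx q) i p.1 p.2.2.2 p.2.2.1)
          • km s (p + (0, 1, -1, dd i)) :=
  rp_km (elt_rp (isAdj_E2 hq0 hq1).symm) (good_F2 _) s hp

theorem k2_km (s : Bool) {p : Lat} (hp : Lab p) :
    ((opData hq0 hq1).k2 : Module.End ℂ finM) (km s p)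
      = sx q ^ (1 * (2 * (p.2.2.1 - p.2.1))) • km s p := by
  have := rp_km_one (elt_rp (isAdj_K2 hq0 1)) (good_zero _) s hp
  rwa [add_zero] at this

theorem f1_low (s : Bool) {n : ℤ} (hn : 0 ≤ n) :
    ((opData hq0 hq1).f1 : Module.End ℂ finM) (km s (low n)) = 0 := by
  rw [f1_km hq0 hq1 s (lab_low hn), km_of_not_lab, smul_zero]
  simp only [Lab, low, IsLabel, Prod.mk_add_mk]; omega

theorem f2_low (s : Bool) {n : ℤ} (hn : 0 ≤ n) :
    ((opData hq0 hq1).f2 : Module.End ℂ finM) (km s (low n)) = 0 := by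
  rw [f2_km hq0 hq1 s (lab_low hn)]
  refine Finset.sum_eq_zero fun i _ => ?_
  rw [km_of_not_lab, smul_zero]
  simp only [Lab, low, IsLabel, Prod.mk_add_mk]
  fin_cases i <;> simp [dd] <;> omega

/-- A subspace that is stable under `E_1` and `E_2` and contains the lowest weight vectors is the
whole space. -/
theorem eq_top_of_low {N : Submodule ℂ finM} (h : ∀ s n, 0 ≤ n → km s (low n) ∈ N)
    (h1 : ∀ v ∈ N, ((opData hq0 hq1).e1 : Module.End ℂ finM) v ∈ N)
    (h2 : ∀ v ∈ N, ((opData hq0 hq1).e2 : Module.End ℂ finM) v ∈ N) : N = ⊤ := by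
  have hr := fun {i : ℤ} => rq_ne hq0 hq1 (i := i)
  have hz := zq_sx_ne_zero hq0 hq1
  refine finM_induction fun s p hp => ?_
  obtain ⟨n, a, b, k⟩ := p
  have key : ∀ (m : ℕ) (b : ℤ), b = m - n - 1 → ∀ k a : ℤ, Lab (n, a, b, k) →
      km s (n, a, b, k) ∈ N := by
    intro m
    induction m with
    | zero =>
      rintro b hb k a hp
      simp only [Lab, IsLabel] at hp
      have hk : k = 0 := by omega
      subst hk
      have ha : a = -1 ∨ a = 0 := by omega
      have h0 : km s (n, -1, b, 0) ∈ N := by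
        have := h s n (by omega)
        rwa [low, show -n - 1 = b by omega] at this
      rcases ha with rfl | rfl
      · exact h0
      · have := h1 _ h0
        rw [e1_km hq0 hq1 s (by simp only [Lab, IsLabel]; omega)] at this
        simp only [Prod.mk_add_mk, add_zero, neg_add_cancel] at this
        refine (Submodule.smul_mem_iff N ?_).1 this
        simp only [e1]
        exact mul_ne_zero (hr (by omega)) (hr (by omega))
    | succ m ih =>
      rintro b hb
      have raise : ∀ k : ℤ, (Lab (n, -k - 1, b, k) → km s (n, -k - 1, b, k) ∈ N) →
          ∀ (i : ℕ) (a : ℤ), a = i - k - 1 → Lab (n, a, b, k) → km s (n, a, b, k) ∈ N := by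
        intro k hk i
        induction i with
        | zero =>
          rintro a ha hp
          have : a = -k - 1 := by push_cast at ha; omega
          subst this
          exact hk hp
        | succ i ih' =>
          rintro a ha hp
          push_cast at ha
          have hp' : Lab (n, a - 1, b, k) := by
            simp only [Lab, IsLabel] at hp ⊢; omega
          have := h1 _ (ih' (a - 1) (by omega) hp')
          rw [e1_km hq0 hq1 s hp'] at this
          simp only [Prod.mk_add_mk, add_zero, sub_add_cancel] at this
          refine (Submodule.smul_mem_iff N ?_).1 this
          simp only [Lab, IsLabel] at hp
          simp only [e1]
          exact mul_ne_zero (hr (by omega)) (hr (by omega))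
      have hpos : ∀ k : ℤ, 1 ≤ k → ∀ a, Lab (n, a, b, k) → km s (n, a, b, k) ∈ N := by
        intro k hk a hp
        refine raise k (fun hp => ?_) (a + k + 1).toNat a (by
          simp only [Lab, IsLabel] at hp; omega) hp
        have hp' : Lab (n, -k, b - 1, k - 1) := by
          simp only [Lab, IsLabel] at hp ⊢; omega
        have := h2 _ (ih (b - 1) (by push_cast at hb; omega) (k - 1) (-k) hp')
        rw [e2_km hq0 hq1 s hp', Fin.sum_univ_three,
          km_of_not_lab s (p := (n, -k, b - 1, k - 1) + (0, -1, 1, dd 1)) (by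
            simp [Lab, IsLabel, dd]),
          km_of_not_lab s (p := (n, -k, b - 1, k - 1) + (0, -1, 1, dd 2)) (by
            simp [Lab, IsLabel, dd]), smul_zero, smul_zero, add_zero, add_zero] at this
        simp only [Prod.mk_add_mk, add_zero, sub_add_cancel, dd, Matrix.cons_val,
          ← sub_eq_add_neg] at this
        refine (Submodule.smul_mem_iff N ?_).1 this
        simp only [Lab, IsLabel] at hp
        simp only [es, ee, Matrix.cons_val, Int.even_iff]
        refine mul_ne_zero (mul_ne_zero (hr (by omega)) (hr (by omega))) ?_
        split_ifs <;>
        exact div_ne_zero (mul_ne_zero (hr (by omega)) (hr (by omega)))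
          (mul_ne_zero (hz _ (by omega)) (hz _ (by omega)))
      intro k a hp
      rcases lt_or_ge k 1 with hk | hk
      · have hk0 : k = 0 := by simp only [Lab, IsLabel] at hp; omega
        subst hk0
        refine raise 0 (fun hp => ?_) (a + 1).toNat a (by
          simp only [Lab, IsLabel] at hp; omega) hp
        simp only [Lab, IsLabel] at hp
        have hp' : Lab (n, 0, b - 1, 0) := by
          simp only [Lab, IsLabel]; omega
        have := h2 _ (ih (b - 1) (by push_cast at hb; omega) 0 0 hp')
        rw [e2_km hq0 hq1 s hp', Fin.sum_univ_three,
          km_of_not_lab s (p := (n, 0, b - 1, 0) + (0, -1, 1, dd 2)) (by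
            simp [Lab, IsLabel, dd]), smul_zero, add_zero] at this
        simp only [Prod.mk_add_mk, add_zero, sub_add_cancel, dd, Matrix.cons_val, zero_add] at this
        have h3 : km s (n, -1, b, 1) ∈ N := by
          by_cases h3 : Lab (n, -1, b, 1)
          · exact hpos 1 le_rfl _ h3
          · rw [km_of_not_lab s h3]; exact zero_mem N
        have h4 := (N.add_mem_iff_right (N.smul_mem _ h3)).1 this
        refine (Submodule.smul_mem_iff N ?_).1 h4
        simp only [es, ee, Matrix.cons_val, Int.even_iff]
        refine mul_ne_zero (mul_ne_zero (hr (by omega)) (hr (by omega))) ?_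
        split_ifs <;>
        exact div_ne_zero (mul_ne_zero (hr (by omega)) (hr (by omega)))
          (mul_ne_zero (hz _ (by omega)) (hz _ (by omega)))
      · exact hpos k hk a hp
  refine key (b + n + 1).toNat b ?_ k a hp
  simp only [Lab, IsLabel] at hp
  omega

/-- An element that commutes up to a factor with `E_1` and `E_2` and kills the lowest weight
vectors vanishes. -/
theorem eq_zero_of_low {u : AdjAlg finM} {c1 c2 : ℂ} (hc1 : c1 ≠ 0) (hc2 : c2 ≠ 0)
    (h : ∀ s n, 0 ≤ n → (u : Module.End ℂ finM) (km s (low n)) = 0)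
    (h1 : (opData hq0 hq1).e1 * u = c1 • (u * (opData hq0 hq1).e1))
    (h2 : (opData hq0 hq1).e2 * u = c2 • (u * (opData hq0 hq1).e2)) : u = 0 := by
  have key : LinearMap.ker (u : Module.End ℂ finM) = ⊤ := by
    refine eq_top_of_low hq0 hq1 h (fun v hv => ?_) fun v hv => ?_
    · have := LinearMap.congr_fun (congrArg Subtype.val h1) v
      change ((opData hq0 hq1).e1 : Module.End ℂ finM) ((u : Module.End ℂ finM) v)
        = c1 • (u : Module.End ℂ finM) (((opData hq0 hq1).e1 : Module.End ℂ finM) v) at this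
      rw [LinearMap.mem_ker.1 hv, map_zero, eq_comm, smul_eq_zero_iff_right hc1] at this
      exact this
    · have := LinearMap.congr_fun (congrArg Subtype.val h2) v
      change ((opData hq0 hq1).e2 : Module.End ℂ finM) ((u : Module.End ℂ finM) v)
        = c2 • (u : Module.End ℂ finM) (((opData hq0 hq1).e2 : Module.End ℂ finM) v) at this
      rw [LinearMap.mem_ker.1 hv, map_zero, eq_comm, smul_eq_zero_iff_right hc2] at this
      exact this
  exact Subtype.ext (LinearMap.ker_eq_top.1 key)

theorem serre1_eq_zero : (opData hq0 hq1).serre1 = 0 := by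
  refine eq_zero_of_low hq0 hq1 one_ne_zero one_ne_zero (fun s n hn => ?_)
    (by rw [one_smul]; exact (opData hq0 hq1).e1_serre1)
    (by rw [one_smul]; exact (opData hq0 hq1).e2_serre1)
  change ((opData hq0 hq1).f2 ^ 2 * (opData hq0 hq1).f1 - _ • ((opData hq0 hq1).f2
    * (opData hq0 hq1).f1 * (opData hq0 hq1).f2) + (opData hq0 hq1).f1
    * (opData hq0 hq1).f2 ^ 2 : Module.End ℂ finM) (km s (low n)) = 0
  simp only [LinearMap.add_apply, LinearMap.sub_apply, LinearMap.smul_apply,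
    Module.End.mul_apply, sq, f1_low hq0 hq1 s hn, f2_low hq0 hq1 s hn, map_zero]
  simp

theorem serre2_eq_zero : (opData hq0 hq1).serre2 = 0 := by
  refine eq_zero_of_low hq0 hq1 one_ne_zero one_ne_zero (fun s n hn => ?_)
    (by rw [one_smul]; exact (opData hq0 hq1).e1_serre2)
    (by rw [one_smul]; exact (opData hq0 hq1).e2_serre2)
  change ((opData hq0 hq1).f2 * (opData hq0 hq1).f1 ^ 3 - _ • ((opData hq0 hq1).f1
    * (opData hq0 hq1).f2 * (opData hq0 hq1).f1 ^ 2 - (opData hq0 hq1).f1 ^ 2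
    * (opData hq0 hq1).f2 * (opData hq0 hq1).f1) - (opData hq0 hq1).f1 ^ 3
    * (opData hq0 hq1).f2 : Module.End ℂ finM) (km s (low n)) = 0
  simp only [LinearMap.add_apply, LinearMap.sub_apply, LinearMap.smul_apply,
    Module.End.mul_apply, pow_succ, pow_zero, one_mul, f1_low hq0 hq1 s hn, f2_low hq0 hq1 s hn,
    map_zero]
  simp

include hq0 hq1 in
theorem zz_low (s : Bool) (n : ℤ) :
    (wX1 (sx q) * wX2 (sx q) - (sx q) ^ (4 : ℤ) • (wX2 (sx q) * wX1 (sx q))) (dl s (low n)) = 0 := by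
  have hx := sx_ne_zero hq0
  have hq := zq_sx_ne_zero hq0 hq1
  have hb : bc (sx q) 2 0 (-1) = 0 := by simp [bc, fs, es, rev2, dd, rq_zero]
  simp only [LinearMap.sub_apply, LinearMap.smul_apply, Module.End.mul_apply, wX1, wX2,
    LinearMap.sum_apply, sh_dl, map_smul, map_sum, low]
  simp only [Fin.sum_univ_three, Prod.mk_add_mk, hb, zero_mul, mul_zero, zero_smul, smul_zero,
    add_zero, zero_add]
  simp only [dd, Matrix.cons_val, add_zero, zero_add, neg_add_cancel, sub_add_cancel,
    add_assoc, Int.reduceAdd, Int.reduceNeg]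
  have l02 := low_0_p2 hx hq (csgn_sq s) n
  have l01 := low_0_p1 hx hq (csgn_sq s) n
  have l00 := low_0_0 hx hq (csgn_sq s) n
  have k01 := low_0_m1 hx hq (csgn_sq s) n
  have k02 := low_0_m2 hx hq (csgn_sq s) n
  have l12 := low_1_p2 hx hq (csgn_sq s) n
  have l11 := low_1_p1 hx hq (csgn_sq s) n
  have l10 := low_1_0 hx hq (csgn_sq s) n
  have k11 := low_1_m1 hx hq (csgn_sq s) n
  have k12 := low_1_m2 hx hq (csgn_sq s) n
  simp only [dd, Matrix.cons_val, add_zero, zero_add] at l02 l01 l00 k01 k02 l12 l11 l10 k11 k12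
  linear_combination (norm := module) (bc (sx q) 0 0 (-1) * l02) • dl s (n + 2, 0, -n, 1)
    + (bc (sx q) 0 0 (-1) * l01) • dl s (n + 1, 0, -n, 1)
    + (bc (sx q) 0 0 (-1) * l00) • dl s (n, 0, -n, 1)
    + (bc (sx q) 0 0 (-1) * k01) • dl s (n + -1, 0, -n, 1)
    + (bc (sx q) 0 0 (-1) * k02) • dl s (n + -2, 0, -n, 1)
    + (bc (sx q) 1 0 (-1) * l12) • dl s (n + 2, 0, -n, 0)
    + (bc (sx q) 1 0 (-1) * l11) • dl s (n + 1, 0, -n, 0)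
    + (bc (sx q) 1 0 (-1) * l10) • dl s (n, 0, -n, 0)
    + (bc (sx q) 1 0 (-1) * k11) • dl s (n + -1, 0, -n, 0)
    + (bc (sx q) 1 0 (-1) * k12) • dl s (n + -2, 0, -n, 0)

theorem x1x2_rel : (opData hq0 hq1).x1 * (opData hq0 hq1).x2
    = sx q ^ 4 • ((opData hq0 hq1).x2 * (opData hq0 hq1).x1) := by
  have hx := sx_ne_zero hq0
  refine sub_eq_zero.1 (eq_zero_of_low hq0 hq1 (inv_ne_zero (pow_ne_zero 2 hx)) one_ne_zero
    (fun s n hn => ?_) (opData hq0 hq1).e1_zz (by rw [one_smul]; exact (opData hq0 hq1).e2_zz))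
  refine Subtype.ext (toFn_injective ?_)
  have h1 := ((elt_rp (isAdj_X1 (sx q))).mul (elt_rp (isAdj_X2 (sx q)))).sub
    (((elt_rp (isAdj_X2 (sx q))).mul (elt_rp (isAdj_X1 (sx q)))).smul (sx q ^ 4))
  refine (h1 _).trans ?_
  change _ = toFn 0
  rw [map_zero]
  change (_ : LatFun) = 0
  have h2 := zz_low hq0 hq1 s n
  rw [zpow_ofNat] at h2
  rw [show toFn (km s (low n) : SpinorSpace) = dl s (low n) from toFn_kv s (lab_low hn)]
  exact h2

/-- The grading and the operators `F` and `|D|` on functions of labels. -/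
def wG : Module.End ℂ LatFun := sh 0 fun s _ => csgn s

theorem isAdj_G : IsAdj wG wG :=
  IsAdj.shift (by simp) (good_zero _) (good_zero _) fun s p _ _ => (conj_csgn s).symm

/-- The multiplication by the eigenvalue of `|D|`. -/
def wAbs : Module.End ℂ LatFun := sh 0 fun _ p => (p.1 : ℂ) + 2

theorem isAdj_Abs : IsAdj wAbs wAbs :=
  IsAdj.shift (by simp) (good_zero _) (good_zero _) fun s p _ _ => by
    simp [Complex.conj_ofNat]

/-- The exchange of the two signs. -/
def wFlip : Module.End ℂ LatFun where
  toFun f s p := f (!s) p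
  map_add' _ _ := rfl
  map_smul' _ _ := rfl

theorem wFlip_dl (s : Bool) (p : Lat) : wFlip (dl s p) = dl (!s) p := by
  funext t r
  simp only [wFlip, LinearMap.coe_mk, AddHom.coe_mk, dl]
  congr 1
  cases s <;> cases t <;> simp

theorem isAdj_Flip : IsAdj wFlip wFlip := by
  have h : Pres wFlip := fun s p hp => ⟨km (!s) p, by
    rw [toFn_kv s hp, wFlip_dl]; exact toFn_kv _ hp⟩
  refine ⟨h, h, fun s p t r _ _ => ?_⟩
  simp only [wFlip_dl, dl]
  rw [apply_ite (starRingEnd ℂ), map_one, map_zero]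
  congr 1
  rw [eq_iff_iff]
  constructor <;> rintro ⟨rfl, rfl⟩ <;> simp

theorem diag_comm {g : LatFun} {d : Lat} {c : LatFun} (h : ∀ s p, g s (p + d) = g s p) :
    sh 0 g * sh d c = sh d c * sh 0 g := by
  rw [sh_mul, sh_mul]
  exact sh_congr (by simp) fun s p => by rw [h, add_zero, mul_comm]

theorem flip_comm {d : Lat} {c : LatFun} (h : ∀ s p, c (!s) p = c s p) :
    wFlip * sh d c = sh d c * wFlip := by
  refine LinearMap.ext fun f => funext fun s => funext fun p => ?_
  simp only [Module.End.mul_apply, wFlip, LinearMap.coe_mk, AddHom.coe_mk, sh_apply, h]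

theorem inner_km (s t : Bool) {p r : Lat} (hr : Lab r) :
    inner ℂ (km s p) (km t r) = dl t r s p := by
  change inner ℂ (kv s p) (kv t r) = _
  rw [inner_kv, toFn_kv t hr]

theorem comm_star_of_comm {g b : AdjAlg finM} (hg : star g = g) (h : g * b = b * g) :
    g * star b = star b * g := by
  have := congrArg star h
  rwa [star_mul, star_mul, hg, eq_comm] at this

/-- The generator `γ` on finitely supported vectors. -/
def gM : AdjAlg finM := elt isAdj_G

theorem gM_comm {ι : Type} {S : Finset ι} {d : ι → Lat} {c : ι → LatFun} {b : AdjAlg finM}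
    (hb : Rp (b : Module.End ℂ finM) (∑ i ∈ S, sh (d i) (c i))) : gM * b = b * gM :=
  elt_eq ((elt_rp isAdj_G).mul hb) (hb.mul (elt_rp isAdj_G)) (by
    rw [Finset.mul_sum, Finset.sum_mul]
    exact Finset.sum_congr rfl fun i _ => diag_comm fun _ _ => rfl)

theorem gM_comm_one {d : Lat} {c : LatFun} {b : AdjAlg finM}
    (hb : Rp (b : Module.End ℂ finM) (sh d c)) : gM * b = b * gM :=
  elt_eq ((elt_rp isAdj_G).mul hb) (hb.mul (elt_rp isAdj_G)) (diag_comm fun _ _ => rfl)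

theorem gM_comm_two {ι : Type} {S S' : Finset ι} {d : ι → ι → Lat} {c : ι → ι → LatFun}
    {b : AdjAlg finM} (hb : Rp (b : Module.End ℂ finM) (∑ i ∈ S, ∑ j ∈ S', sh (d i j) (c i j))) :
    gM * b = b * gM :=
  elt_eq ((elt_rp isAdj_G).mul hb) (hb.mul (elt_rp isAdj_G)) (by
    rw [Finset.mul_sum, Finset.sum_mul]
    refine Finset.sum_congr rfl fun i _ => ?_
    rw [Finset.mul_sum, Finset.sum_mul]
    exact Finset.sum_congr rfl fun j _ => diag_comm fun _ _ => rfl)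

theorem star_gM : star gM = gM := star_elt _

theorem gM_x0 : gM * (opData hq0 hq1).x0 = (opData hq0 hq1).x0 * gM :=
  gM_comm_two (elt_rp (isAdj_X0 hq0 hq1))

theorem gM_x1 : gM * (opData hq0 hq1).x1 = (opData hq0 hq1).x1 * gM :=
  gM_comm_two (elt_rp (isAdj_X1 (sx q)))

theorem gM_x2 : gM * (opData hq0 hq1).x2 = (opData hq0 hq1).x2 * gM :=
  gM_comm (elt_rp (isAdj_X2 (sx q)))

theorem gM_rr : gM * (opData hq0 hq1).rr = (opData hq0 hq1).rr * gM := by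
  exact (opData hq0 hq1).commute_rr (gM_x0 hq0 hq1) (gM_x1 hq0 hq1)
    (comm_star_of_comm star_gM (gM_x1 hq0 hq1)) (gM_x2 hq0 hq1)
    (comm_star_of_comm star_gM (gM_x2 hq0 hq1))

end Cyclic

/-! ### The radius is one -/

section Radius

section Generic

variable {E : Type} [NormedAddCommGroup E] [InnerProductSpace ℂ E]

theorem AdjAlg.comm_apply {f g : AdjAlg E} (h : f * g = g * f) (v : E) :
    (f : Module.End ℂ E) ((g : Module.End ℂ E) v) = (g : Module.End ℂ E) ((f : Module.End ℂ E) v) :=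
  LinearMap.congr_fun (congrArg Subtype.val h) v

theorem AdjAlg.sub_one_apply (f : AdjAlg E) (v : E) :
    ((f - 1 : AdjAlg E) : Module.End ℂ E) v = (f : Module.End ℂ E) v - v := rfl

theorem AdjAlg.comm_sub_one {f g : AdjAlg E} (h : f * g = g * f) :
    f * (g - 1) = (1 : ℂ) • ((g - 1) * f) := by
  rw [one_smul, mul_sub, sub_mul, h, mul_one, one_mul]

theorem WeightData.inner_rr {t : ℂ} (S : WeightData t (AdjAlg E)) (v : E) :
    inner ℂ v ((S.rr : Module.End ℂ E) v)
      = inner ℂ ((S.x0 : Module.End ℂ E) v) ((S.x0 : Module.End ℂ E) v)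
        + inner ℂ (((star S.x1 : AdjAlg E) : Module.End ℂ E) v)
          (((star S.x1 : AdjAlg E) : Module.End ℂ E) v)
        + inner ℂ (((star S.x2 : AdjAlg E) : Module.End ℂ E) v)
          (((star S.x2 : AdjAlg E) : Module.End ℂ E) v) := by
  rw [AdjAlg.inner_star, AdjAlg.inner_star, AdjAlg.inner_star, star_star, star_star, S.star_x0,
    ← inner_add_right, ← inner_add_right]
  rw [WeightData.rr, sq]
  rfl

end Generic

theorem rp_km_two {b : Module.End ℂ finM} {ι : Type} {S S' : Finset ι} {d : ι → ι → Lat}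
    {c : ι → ι → LatFun} (hb : Rp b (∑ i ∈ S, ∑ j ∈ S', sh (d i j) (c i j)))
    (hc : ∀ i j, Good (d i j) (c i j)) (s : Bool) {p : Lat} (hp : Lab p) :
    b (km s p) = ∑ i ∈ S, ∑ j ∈ S', c i j s p • km s (p + d i j) := by
  refine Subtype.ext (toFn_injective ?_)
  rw [hb, LinearMap.sum_apply, Submodule.coe_sum, map_sum]
  refine Finset.sum_congr rfl fun i _ => ?_
  rw [LinearMap.sum_apply, Submodule.coe_sum, map_sum]
  refine Finset.sum_congr rfl fun j _ => ?_
  rw [Submodule.coe_smul, map_smul]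
  exact (hc i j).sh_kv s hp

theorem finM_inner_smul_left (c : ℂ) (v w : finM) :
    inner ℂ (c • v) w = starRingEnd ℂ c * inner ℂ v w := inner_smul_left v w c

theorem finM_inner_smul_right (c : ℂ) (v w : finM) :
    inner ℂ v (c • w) = c * inner ℂ v w := inner_smul_right v w c

variable {q : ℝ} (hq0 : 0 < q) (hq1 : q < 1)

theorem x0_low (s : Bool) {n : ℤ} (hn : 0 ≤ n) :
    ((opData hq0 hq1).x0 : Module.End ℂ finM) (km s (low n))
      = (ac (sx q) 0 0 (-1) * yc (sx q) (csgn s) 0 0 n 0 (-n - 1)) • km s (n + 1, -1, -n - 1, 1)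
        + (ac (sx q) 1 0 (-1) * yc (sx q) (csgn s) 1 0 n 0 (-n - 1)) • km s (n + 1, -1, -n - 1, 0)
        + (ac (sx q) 1 0 (-1) * yc (sx q) (csgn s) 1 1 n 0 (-n - 1)) • km s (n, -1, -n - 1, 0) := by
  refine (rp_km_two (elt_rp (isAdj_X0 hq0 hq1)) (good_X0 _) s (lab_low hn)).trans ?_
  have hnl : ∀ i j : Fin 3, ¬Lab (low n + (dd j, 0, 0, dd i)) →
      (ac (sx q) i (low n).2.2.2 (low n).2.1
        * yc (sx q) (csgn s) i j (low n).1 (low n).2.2.2 (low n).2.2.1)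
        • km s (low n + (dd j, 0, 0, dd i)) = 0 := fun i j h => by rw [km_of_not_lab s h, smul_zero]
  simp only [Fin.sum_univ_three]
  rw [hnl 0 1 (by simp [Lab, IsLabel, dd, low]), hnl 0 2 (by simp [Lab, IsLabel, dd, low]),
    hnl 1 2 (by simp [Lab, IsLabel, dd, low]), hnl 2 0 (by simp [Lab, IsLabel, dd, low]),
    hnl 2 1 (by simp [Lab, IsLabel, dd, low]), hnl 2 2 (by simp [Lab, IsLabel, dd, low])]
  simp only [add_zero, low, Prod.mk_add_mk, dd, Matrix.cons_val, zero_add, add_assoc]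

theorem y1_low (s : Bool) {n : ℤ} (hn : 0 ≤ n) :
    ((star (opData hq0 hq1).x1 : AdjAlg finM) : Module.End ℂ finM) (km s (low n))
      = (bc (sx q) 2 1 (-2) * yc (sx q) (csgn s) 2 2 (n + 1) 1 (-n - 1))
        • km s (n + 1, -2, -n - 1, 1) := by
  have h0 : star (opData hq0 hq1).x1 = elt (isAdj_X1 (sx q)).symm := star_elt (isAdj_X1 (sx q))
  rw [h0, rp_km_two (elt_rp (isAdj_X1 (sx q)).symm) (fun i j => good_adjW _ _) s (lab_low hn)]
  have hnl : ∀ i j : Fin 3, ¬Lab (low n + -(dd j, 1, 0, dd i)) →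
      adjW (dd j, 1, 0, dd i) (fun s p =>
        bc (sx q) i p.2.2.2 p.2.1 * yc (sx q) (csgn s) i j p.1 p.2.2.2 p.2.2.1) s (low n)
        • km s (low n + -(dd j, 1, 0, dd i)) = 0 := fun i j h => by
    rw [km_of_not_lab s h, smul_zero]
  simp only [Fin.sum_univ_three]
  rw [hnl 0 0 (by simp [Lab, IsLabel, dd, low]), hnl 0 1 (by simp [Lab, IsLabel, dd, low]),
    hnl 0 2 (by simp [Lab, IsLabel, dd, low]), hnl 1 0 (by simp [Lab, IsLabel, dd, low]),
    hnl 1 1 (by simp [Lab, IsLabel, dd, low]), hnl 1 2 (by simp [Lab, IsLabel, dd, low]),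
    hnl 2 0 (by simp [Lab, IsLabel, dd, low]; try omega),
    hnl 2 1 (by simp [Lab, IsLabel, dd, low]; try omega)]
  have hB : LabB n 0 (-n - 1) := ⟨by omega, by omega⟩
  have hl : Lab (low n - (dd 2, 1, 0, dd 2)) := by simp [Lab, IsLabel, dd, low]; omega
  rw [adjW, if_pos hl]
  simp only [low, Prod.mk_sub_mk, Prod.neg_mk, Prod.mk_add_mk, dd, Matrix.cons_val, add_zero,
    zero_add, sub_neg_eq_add, neg_neg, Int.reduceNeg, Int.reduceSub, Int.reduceAdd, map_mul, sub_zero,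
    neg_zero]
  congr 2
  · rw [← cast_Bm hq0 hq1 ⟨by norm_num, by norm_num⟩, Complex.conj_ofReal]
  · exact conj_yc hq0 hq1 s 2 2 ⟨by omega, by omega⟩ (by norm_num)
      (by simp only [dd, Matrix.cons_val]; constructor <;> omega) (by simp [dd])

theorem y2_low (s : Bool) {n : ℤ} (hn : 0 ≤ n) :
    ((star (opData hq0 hq1).x2 : AdjAlg finM) : Module.End ℂ finM) (km s (low n))
      = dc (sx q) (csgn s) 2 (n + 1) 0 (-n - 2) • km s (n + 1, -1, -n - 2, 0) := by
  have h0 : star (opData hq0 hq1).x2 = elt (isAdj_X2 (sx q)).symm := star_elt (isAdj_X2 (sx q))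
  rw [h0, rp_km (elt_rp (isAdj_X2 (sx q)).symm) (fun j => good_adjW _ _) s (lab_low hn)]
  have hnl : ∀ j : Fin 3, ¬Lab (low n + -(dd j, 0, 1, 0)) →
      adjW (dd j, 0, 1, 0) (fun s p => dc (sx q) (csgn s) j p.1 p.2.2.2 p.2.2.1) s (low n)
        • km s (low n + -(dd j, 0, 1, 0)) = 0 := fun j h => by
    rw [km_of_not_lab s h, smul_zero]
  simp only [Fin.sum_univ_three]
  rw [hnl 0 (by simp [Lab, IsLabel, dd, low]; try omega),
    hnl 1 (by simp [Lab, IsLabel, dd, low]; try omega)]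
  have hl : Lab (low n - (dd 2, 0, 1, 0)) := by simp [Lab, IsLabel, dd, low]; omega
  rw [adjW, if_pos hl]
  simp only [low, Prod.mk_sub_mk, Prod.neg_mk, Prod.mk_add_mk, dd, Matrix.cons_val, add_zero,
    zero_add, sub_neg_eq_add, neg_neg, Int.reduceNeg, Int.reduceSub, Int.reduceAdd, sub_zero,
    neg_zero, show -n - 1 - 1 = -n - 2 by ring, show -n - 1 + -1 = -n - 2 by ring]
  congr 1
  rw [← cast_Dm hq0 hq1 _ ⟨by omega, by omega⟩ le_rfl, Complex.conj_ofReal]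

theorem inner_km_self (s : Bool) {p : Lat} (hp : Lab p) : inner ℂ (km s p) (km s p) = (1 : ℂ) := by
  rw [inner_km s s hp, dl, if_pos ⟨rfl, rfl⟩]

theorem inner_km_ne (s : Bool) {p r : Lat} (hr : Lab r) (h : p ≠ r) :
    inner ℂ (km s p) (km s r) = (0 : ℂ) := by
  rw [inner_km s s hr, dl, if_neg fun h' => h h'.2]

theorem rr_low_inner (s : Bool) {n : ℤ} (hn : 0 ≤ n) :
    inner ℂ (km s (low n)) (((opData hq0 hq1).rr : Module.End ℂ finM) (km s (low n))) = (1 : ℂ) := by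
  have hx := sx_ne_zero hq0
  have hq := zq_sx_ne_zero hq0 hq1
  have hca : ∀ i : Fin 3, i ≠ 2 → starRingEnd ℂ (ac (sx q) i 0 (-1)) = ac (sx q) i 0 (-1) := by
    intro i hi
    refine conj_ac hq0 hq1 i ⟨by norm_num, by norm_num⟩ ?_
    fin_cases i <;> simp [dd, LabA] at hi ⊢
  have c1 : starRingEnd ℂ (ac (sx q) 0 0 (-1) * yc (sx q) (csgn s) 0 0 n 0 (-n - 1))
      = ac (sx q) 0 0 (-1) * yc (sx q) (csgn s) 0 0 n 0 (-n - 1) := by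
    rw [map_mul, hca 0 (by decide), conj_yc hq0 hq1 s 0 0 ⟨by omega, by omega⟩ le_rfl
      (by simp only [dd, Matrix.cons_val]; constructor <;> omega) (by simp [dd])]
  have c2 : starRingEnd ℂ (ac (sx q) 1 0 (-1) * yc (sx q) (csgn s) 1 0 n 0 (-n - 1))
      = ac (sx q) 1 0 (-1) * yc (sx q) (csgn s) 1 0 n 0 (-n - 1) := by
    rw [map_mul, hca 1 (by decide), conj_yc hq0 hq1 s 1 0 ⟨by omega, by omega⟩ le_rfl
      (by simp only [dd, Matrix.cons_val]; constructor <;> omega) (by simp [dd])]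
  have c3 : starRingEnd ℂ (ac (sx q) 1 0 (-1) * yc (sx q) (csgn s) 1 1 n 0 (-n - 1))
      = ac (sx q) 1 0 (-1) * yc (sx q) (csgn s) 1 1 n 0 (-n - 1) := by
    rw [map_mul, hca 1 (by decide), conj_yc hq0 hq1 s 1 1 ⟨by omega, by omega⟩ le_rfl
      (by simp only [dd, Matrix.cons_val]; constructor <;> omega) (by simp [dd])]
  have c4 : starRingEnd ℂ (bc (sx q) 2 1 (-2) * yc (sx q) (csgn s) 2 2 (n + 1) 1 (-n - 1))
      = bc (sx q) 2 1 (-2) * yc (sx q) (csgn s) 2 2 (n + 1) 1 (-n - 1) := by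
    rw [map_mul, ← cast_Bm hq0 hq1 ⟨by norm_num, by norm_num⟩, Complex.conj_ofReal,
      conj_yc hq0 hq1 s 2 2 ⟨by omega, by omega⟩ (by norm_num)
      (by simp only [dd, Matrix.cons_val]; constructor <;> omega) (by simp [dd])]
  have c5 : starRingEnd ℂ (dc (sx q) (csgn s) 2 (n + 1) 0 (-n - 2))
      = dc (sx q) (csgn s) 2 (n + 1) 0 (-n - 2) := by
    rw [← cast_Dm hq0 hq1 _ ⟨by omega, by omega⟩ le_rfl, Complex.conj_ofReal]
  have l1 : Lab (n + 1, -1, -n - 1, 1) := by simp only [Lab, IsLabel]; omega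
  have l2 : Lab (n + 1, -1, -n - 1, 0) := by simp only [Lab, IsLabel]; omega
  have l3 : Lab (n, -1, -n - 1, 0) := by simp only [Lab, IsLabel]; omega
  have l4 : Lab (n + 1, -2, -n - 1, 1) := by simp only [Lab, IsLabel]; omega
  have l5 : Lab (n + 1, -1, -n - 2, 0) := by simp only [Lab, IsLabel]; omega
  rw [WeightData.inner_rr, x0_low hq0 hq1 s hn, y1_low hq0 hq1 s hn, y2_low hq0 hq1 s hn]
  simp only [inner_add_left, inner_add_right, finM_inner_smul_left, finM_inner_smul_right,
    inner_km_self s l1, inner_km_self s l2, inner_km_self s l3, inner_km_self s l4,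
    inner_km_self s l5]
  rw [inner_km_ne s l2 (by simp), inner_km_ne s l3 (by simp), inner_km_ne s l1 (by simp),
    inner_km_ne s l3 (by simp), inner_km_ne s l1 (by simp), inner_km_ne s l2 (by simp),
    c1, c2, c3, c4, c5]
  linear_combination low_norm hx hq (csgn_sq s) n

theorem inner_rr_low (s t : Bool) {n m : ℤ} (hn : 0 ≤ n) (hm : 0 ≤ m) :
    inner ℂ (km t (low m)) (((opData hq0 hq1).rr : Module.End ℂ finM) (km s (low n)))
      = inner ℂ (km t (low m)) (km s (low n)) := by
  have hx := sx_ne_zero hq0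
  have hgk : ∀ (s : Bool) {p : Lat}, Lab p → ((gM : AdjAlg finM) : Module.End ℂ finM) (km s p)
      = csgn s • km s p := fun s p hp => by
    have := rp_km_one (elt_rp isAdj_G) (good_zero _) s hp
    rwa [add_zero] at this
  by_cases hst : t = s
  · subst hst
    by_cases hnm : m = n
    · subst hnm
      rw [rr_low_inner hq0 hq1 t hn, inner_km_self t (lab_low hn)]
    · rw [inner_km_ne t (lab_low hn) (by simpa [low] using hnm)]
      have h1 := AdjAlg.comm_apply (opData hq0 hq1).k2_rr (km t (low n))
      rw [k2_km hq0 hq1 t (lab_low hn), map_smul] at h1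
      have h2 := congrArg (fun w => inner ℂ (km t (low m)) w) h1
      rw [← (opData hq0 hq1).star_k2, ← AdjAlg.inner_star, k2_km hq0 hq1 t (lab_low hm),
        finM_inner_smul_left, finM_inner_smul_right, map_zpow₀, conj_sx hq0, ← sub_eq_zero, ← sub_mul] at h2
      refine (mul_eq_zero.1 h2).resolve_left fun h3 => ?_
      have h4 := sub_eq_zero.1 h3
      simp only [low] at h4
      have h5 : sx q ^ (2 * (n - m)) = 1 := by
        rw [show 2 * (n - m) = 1 * (2 * (-m - 1 - -1)) - 1 * (2 * (-n - 1 - -1)) by ring,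
          zpow_sub₀ hx, h4, div_self (zpow_ne_zero _ hx)]
      have h6 := hq0
      have h7 : zq (sx q) (n - m) ≠ 0 := zq_sx_ne_zero hq0 hq1 _ (by omega)
      apply h7
      rw [zq, h5, show -2 * (n - m) = -(2 * (n - m)) by ring, zpow_neg, h5]
      simp
  · have h0 : inner ℂ (km t (low m)) (km s (low n)) = (0 : ℂ) := by
      rw [inner_km t s (lab_low hn), dl, if_neg fun h => hst h.1]
    rw [h0]
    have h1 := AdjAlg.comm_apply (gM_rr hq0 hq1) (km s (low n))
    rw [hgk s (lab_low hn), map_smul] at h1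
    have h2 := congrArg (fun w => inner ℂ (km t (low m)) w) h1
    rw [← star_gM, ← AdjAlg.inner_star, hgk t (lab_low hm),
      finM_inner_smul_left, finM_inner_smul_right, conj_csgn, ← sub_eq_zero, ← sub_mul] at h2
    refine (mul_eq_zero.1 h2).resolve_left ?_
    cases s <;> cases t <;> simp [csgn] at hst ⊢ <;> norm_num

theorem rr_eq_one : (opData hq0 hq1).rr = 1 := by
  have hz := x1x2_rel hq0 hq1
  refine sub_eq_zero.1 (eq_zero_of_low hq0 hq1 one_ne_zero one_ne_zero (fun s n hn => ?_)
    (AdjAlg.comm_sub_one ((opData hq0 hq1).e1_rr hz))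
    (AdjAlg.comm_sub_one (opData hq0 hq1).e2_rr))
  rw [AdjAlg.sub_one_apply]
  have hkill : ∀ f : AdjAlg finM, f * (opData hq0 hq1).rr = (opData hq0 hq1).rr * f →
      (f : Module.End ℂ finM) (km s (low n)) = 0 → (f : Module.End ℂ finM)
        (((opData hq0 hq1).rr : Module.End ℂ finM) (km s (low n)) - km s (low n)) = 0 :=
    fun f hf hfv => by
      rw [map_sub, AdjAlg.comm_apply hf, hfv, map_zero, sub_zero]
  have hlow := fun t m hm => inner_rr_low hq0 hq1 s t (n := n) (m := m) hn hm
  generalize hw : ((opData hq0 hq1).rr : Module.End ℂ finM) (km s (low n)) = w at hkill hlow ⊢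
  set u : finM := w - km s (low n) with hu
  have hf1 := hkill _ ((opData hq0 hq1).f1_rr hz) (f1_low hq0 hq1 s hn)
  have hf2 := hkill _ (opData hq0 hq1).f2_rr (f2_low hq0 hq1 s hn)
  let N : Submodule ℂ finM :=
    { carrier := {w | inner ℂ w u = (0 : ℂ)}
      zero_mem' := inner_zero_left _
      add_mem' := fun {a b} ha hb => by
        change inner ℂ (a + b) u = (0 : ℂ)
        rw [inner_add_left]
        change inner ℂ a u = (0 : ℂ) at ha
        change inner ℂ b u = (0 : ℂ) at hb
        rw [ha, hb, add_zero]
      smul_mem' := fun c a ha => by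
        change inner ℂ (c • a) u = (0 : ℂ)
        change inner ℂ a u = (0 : ℂ) at ha
        rw [finM_inner_smul_left, ha, mul_zero] }
  have hN : N = ⊤ := by
    refine eq_top_of_low hq0 hq1 (fun t m hm => ?_) (fun w _ => ?_) fun w _ => ?_
    · change inner ℂ (km t (low m)) u = (0 : ℂ)
      rw [hu, inner_sub_right, hlow t m hm, sub_self]
    · change inner ℂ (((opData hq0 hq1).e1 : Module.End ℂ finM) w) u = (0 : ℂ)
      rw [AdjAlg.inner_star, (opData hq0 hq1).star_e1, hf1, inner_zero_right]
    · change inner ℂ (((opData hq0 hq1).e2 : Module.End ℂ finM) w) u = (0 : ℂ)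
      rw [AdjAlg.inner_star, (opData hq0 hq1).star_e2, hf2, inner_zero_right]
  have hmem : u ∈ N := hN ▸ Submodule.mem_top
  exact inner_self_eq_zero.1 hmem

end Radius

/-! ### The representation of the crossed product -/

section FreeExt

variable {X : Type} {B : Type} [Ring B] [StarRing B] [Algebra ℂ B]

/-- `*`-morphisms on the free `*`-algebra are determined on generators. -/
theorem FreeStarAlg.hom_ext {f g : FreeStarAlg X →⋆ₐ[ℂ] B}
    (h : ∀ x, f (FreeStarAlg.gen x) = g (FreeStarAlg.gen x)) : f = g := by
  have h1 : (f : FreeStarAlg X →ₐ[ℂ] B) = (g : FreeStarAlg X →ₐ[ℂ] B) := by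
    refine FreeAlgebra.hom_ext (funext fun p => ?_)
    obtain ⟨x, b⟩ := p
    cases b
    · exact h x
    · have h2 : (FreeStarAlg.symb (x, true) : FreeStarAlg X) = star (FreeStarAlg.gen x) :=
        (FreeStarAlg.star_symb (x, false)).symm
      change f (FreeStarAlg.symb (x, true)) = g (FreeStarAlg.symb (x, true))
      rw [h2, map_star, map_star, h]
  ext a
  exact DFunLike.congr_fun h1 a

end FreeExt

section Crossed

variable {q : ℝ}

namespace WeightData

variable {B : Type} [Ring B] [StarRing B] [Algebra ℂ B] [StarModule ℂ B]
  (S : WeightData (sx q) B)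

/-- The images of the generators `x_i`. -/
def genX : Fin 3 → B := ![S.x0, S.x1, S.x2]

/-- The images of the generators of `U_q(so(5))`. -/
def genU : UqGen → B
  | .K i => ![S.k1, S.k2] i
  | .Kinv i => ![S.l1, S.l2] i
  | .E i => ![S.e1, S.e2] i

variable (hq0 : 0 < q)

include hq0 in
omit S in
theorem sx_sq : (q : ℂ) = sx q ^ 2 := by
  have := cast_rpow hq0 (h := 1) 2 (by norm_num)
  simpa [zpow_ofNat] using this

include hq0

theorem sphere_rel (hz : S.x1 * S.x2 = sx q ^ 4 • (S.x2 * S.x1)) (hr : S.rr = 1)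
    (a b : FreeStarAlg (Fin 3)) (h : SphereRel q a b) :
    FreeStarAlg.lift S.genX a = FreeStarAlg.lift S.genX b := by
  have ht : ((q ^ 2 : ℝ) : ℂ) = sx q ^ 4 := by push_cast; rw [sx_sq hq0]; ring
  have ht4 : ((q ^ 4 : ℝ) : ℂ) = sx q ^ 8 := by push_cast; rw [sx_sq hq0]; ring
  have ht1 : ((1 - q ^ 4 : ℝ) : ℂ) = 1 - sx q ^ 8 := by push_cast; rw [sx_sq hq0]; ring
  have e0 : S.genX 0 = S.x0 := rfl
  have e1 : S.genX 1 = S.x1 := rfl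
  have e2 : S.genX 2 = S.x2 := rfl
  have hs : ∀ {c d : B}, c * d = sx q ^ 4 • (d * c) → star d * star c = sx q ^ 4 • (star c * star d) :=
    fun h => by
      have := congrArg star h
      rwa [star_mul, star_smul, star_mul, RCLike.star_def, S.star_pow] at this
  cases h with
  | self_adj => simp only [map_star, FreeStarAlg.lift_gen, e0, S.star_x0]
  | comm i j h =>
    simp only [map_mul, map_smul, FreeStarAlg.lift_gen, ht]
    fin_cases i <;> fin_cases j <;> simp only [Fin.zero_eta, Fin.mk_one, Fin.reduceFinMk] at h ⊢ <;>
      first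
      | (exfalso; revert h; decide)
      | exact S.x0x1 hz
      | exact S.x0x2 hz
      | exact hz
  | star_comm i j h =>
    simp only [map_mul, map_smul, map_star, FreeStarAlg.lift_gen, ht]
    have h10 := hs (S.x0x1 hz)
    have h20 := hs (S.x0x2 hz)
    have h21 := hs (S.y1x2 hz)
    rw [S.star_x0] at h10 h20
    rw [star_star] at h21
    fin_cases i <;> fin_cases j <;> simp only [Fin.zero_eta, Fin.mk_one, Fin.reduceFinMk, e0, e1, e2,
      S.star_x0] at h ⊢ <;>
      first
      | (exfalso; exact h rfl)
      | exact S.x0x1 hz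
      | exact S.x0x2 hz
      | exact S.y1x2 hz
      | exact h10
      | exact h20
      | exact h21
  | comm_one =>
    simp only [map_mul, map_smul, map_sub, map_pow, map_star, FreeStarAlg.lift_gen, ht1, e0, e1]
    exact S.y1x1 hz
  | comm_two =>
    simp only [map_mul, map_smul, map_sub, map_star, FreeStarAlg.lift_gen, ht4, e1, e2]
    exact S.y2x2 hz
  | radius =>
    simp only [map_mul, map_add, map_pow, map_star, map_one, FreeStarAlg.lift_gen, e0, e1, e2]
    exact hr

theorem uq_rel (h1 : S.serre1 = 0) (h2 : S.serre2 = 0)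
    (a b : FreeStarAlg UqGen) (h : UqRel q a b) :
    FreeStarAlg.lift S.genU a = FreeStarAlg.lift S.genU b := by
  have ek0 : S.genU (.K 0) = S.k1 := rfl
  have ek1 : S.genU (.K 1) = S.k2 := rfl
  have el0 : S.genU (.Kinv 0) = S.l1 := rfl
  have el1 : S.genU (.Kinv 1) = S.l2 := rfl
  have ee0 : S.genU (.E 0) = S.e1 := rfl
  have ee1 : S.genU (.E 1) = S.e2 := rfl
  have h0 : (q : ℂ) = sx q ^ 2 := sx_sq hq0
  have hk : ∀ {k l e : B} {c : ℂ}, k * e = c • (e * k) → k * l = 1 → k * e * l = c • e := by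
    intro k l e c h hl
    rw [h, smul_mul_assoc, mul_assoc, hl, mul_one]
  cases h with
  | K_self_adj i =>
    simp only [map_star, FreeStarAlg.lift_gen]
    fin_cases i
    exacts [S.star_k1, S.star_k2]
  | K_comm =>
    simp only [map_mul, FreeStarAlg.lift_gen]
    exact S.k_comm
  | K_inv i =>
    simp only [map_mul, map_one, FreeStarAlg.lift_gen]
    fin_cases i
    exacts [S.k1l1, S.k2l2]
  | inv_K i =>
    simp only [map_mul, map_one, FreeStarAlg.lift_gen]
    fin_cases i
    exacts [S.l1k1, S.l2k2]
  | EF i =>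
    simp only [map_mul, map_sub, map_smul, map_pow, map_star, FreeStarAlg.lift_gen]
    fin_cases i
    · simp only [Fin.zero_eta, ek0, el0, ee0, S.star_e1, S.ef1, add_sub_cancel_left]
      congr 1
      push_cast
      rw [h0]; norm_num
    · simp only [Fin.mk_one, ek1, el1, ee1, S.star_e2, S.ef2, add_sub_cancel_left]
      congr 1
      push_cast
      rw [h0]; norm_num [← pow_mul]
  | EF_comm i j h =>
    simp only [map_mul, map_star, FreeStarAlg.lift_gen]
    fin_cases i <;> fin_cases j <;> simp only [Fin.zero_eta, Fin.mk_one, ee0, ee1, S.star_e1,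
      S.star_e2] at h ⊢
    · exact absurd rfl h
    · exact S.e1f2
    · exact S.e2f1
    · exact absurd rfl h
  | KE i =>
    simp only [map_mul, map_smul, FreeStarAlg.lift_gen]
    fin_cases i
    · simp only [Fin.zero_eta, ek0, el0, ee0, hk S.k1e1 S.k1l1]
      congr 1
      push_cast
      rw [h0]; norm_num
    · simp only [Fin.mk_one, ek1, el1, ee1, hk S.k2e2 S.k2l2]
      congr 1
      push_cast
      rw [h0]; norm_num [← pow_mul]
  | KE_ne i j h =>
    simp only [map_mul, map_smul, FreeStarAlg.lift_gen]
    fin_cases i <;> fin_cases j <;> simp only [Fin.zero_eta, Fin.mk_one, ek0, el0, ee0, ek1, el1,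
      ee1, hk S.k1e2 S.k1l1, hk S.k2e1 S.k2l2] at h ⊢
    · exact absurd rfl h
    · push_cast; rw [h0]
    · push_cast; rw [h0]
    · exact absurd rfl h
  | serre_one =>
    simp only [map_mul, map_smul, map_sub, map_add, map_pow, map_zero, FreeStarAlg.lift_gen, ee0, ee1]
    have h := congrArg star h1
    simp only [serre1, star_add, star_sub, star_smul, star_mul, _root_.star_pow, S.star_f1, S.star_f2,
      star_zero, RCLike.star_def, map_add, S.star_pow, S.star_inv_pow] at h
    have hc : ((q ^ 2 + (q ^ 2)⁻¹ : ℝ) : ℂ) = sx q ^ 4 + (sx q ^ 4)⁻¹ := by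
      push_cast; rw [h0, ← pow_mul]
    rw [hc, ← h]
    simp only [_root_.map_pow, S.star_t, mul_assoc]
  | serre_two =>
    simp only [map_mul, map_smul, map_sub, map_add, map_pow, map_zero, FreeStarAlg.lift_gen, ee0, ee1]
    have h := congrArg star h2
    simp only [serre2, star_add, star_sub, star_smul, star_mul, _root_.star_pow, S.star_f1, S.star_f2,
      star_zero, RCLike.star_def, map_add, map_one, S.star_pow, S.star_inv_pow] at h
    have hc : ((q ^ 2 + 1 + (q ^ 2)⁻¹ : ℝ) : ℂ) = sx q ^ 4 + 1 + (sx q ^ 4)⁻¹ := by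
      push_cast; rw [h0, ← pow_mul]
    rw [hc, ← h]
    simp only [_root_.map_pow, S.star_t, mul_assoc]

/-- The images of the generators of the crossed product. -/
def genC : Fin 3 ⊕ UqGen → B := Sum.elim S.genX S.genU

omit hq0 in
theorem lift_inX (a : FreeStarAlg (Fin 3)) :
    FreeStarAlg.lift S.genC (inX a) = FreeStarAlg.lift S.genX a := by
  have : (FreeStarAlg.lift S.genC).comp inX = FreeStarAlg.lift S.genX :=
    FreeStarAlg.hom_ext fun x => by
      rw [StarAlgHom.comp_apply, inX, FreeStarAlg.lift_gen, FreeStarAlg.lift_gen,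
        FreeStarAlg.lift_gen]; rfl
  exact DFunLike.congr_fun this a

omit hq0 in
theorem lift_inU (a : FreeStarAlg UqGen) :
    FreeStarAlg.lift S.genC (inU a) = FreeStarAlg.lift S.genU a := by
  have : (FreeStarAlg.lift S.genC).comp inU = FreeStarAlg.lift S.genU :=
    FreeStarAlg.hom_ext fun x => by
      rw [StarAlgHom.comp_apply, inU, FreeStarAlg.lift_gen, FreeStarAlg.lift_gen,
        FreeStarAlg.lift_gen]; rfl
  exact DFunLike.congr_fun this a

theorem crossed_rel (hz : S.x1 * S.x2 = sx q ^ 4 • (S.x2 * S.x1)) (hr : S.rr = 1)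
    (h1 : S.serre1 = 0) (h2 : S.serre2 = 0)
    (a b : FreeStarAlg (Fin 3 ⊕ UqGen)) (h : CrossedRel q a b) :
    FreeStarAlg.lift S.genC a = FreeStarAlg.lift S.genC b := by
  have ek0 : S.genU (.K 0) = S.k1 := rfl
  have ek1 : S.genU (.K 1) = S.k2 := rfl
  have ee0 : S.genU (.E 0) = S.e1 := rfl
  have ee1 : S.genU (.E 1) = S.e2 := rfl
  have e0 : S.genX 0 = S.x0 := rfl
  have e1 : S.genX 1 = S.x1 := rfl
  have e2 : S.genX 2 = S.x2 := rfl
  have h0 : (q : ℂ) = sx q ^ 2 := sx_sq hq0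
  have hr1 : ((q ^ (-(1 / 2 : ℝ)) : ℝ) : ℂ) = (sx q)⁻¹ := by
    rw [cast_rpow hq0 (-1) (by norm_num), zpow_neg_one]
  have hr2 : ((-q ^ (-(3 / 2 : ℝ)) : ℝ) : ℂ) = -(sx q ^ 3)⁻¹ := by
    rw [Complex.ofReal_neg, cast_rpow hq0 (-3) (by norm_num), zpow_neg]; norm_num [zpow_ofNat]
  have hr3 : ((q ^ (1 / 2 : ℝ) * qnum q 2 : ℝ) : ℂ) = sx q * (sx q ^ 2 + (sx q ^ 2)⁻¹) := by
    have hd := S.den1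
    have ht := S.t_ne
    rw [Complex.ofReal_mul, cast_rpow hq0 1 (by norm_num), zpow_one,
      cast_qnum hq0 2 (by norm_num), zq]
    have h : sx q ^ (2 : ℤ) - sx q ^ (-2 : ℤ) ≠ 0 := by
      rw [zpow_neg, zpow_ofNat]
      intro h
      apply hd
      field_simp at h
      linear_combination h
    congr 1
    rw [div_eq_iff h]
    norm_num [zpow_neg, zpow_ofNat]
    field_simp
    ring
  cases h with
  | sphere a b h => rw [S.lift_inX, S.lift_inX]; exact S.sphere_rel hq0 hz hr a b h
  | uq a b h => rw [S.lift_inU, S.lift_inU]; exact S.uq_rel hq0 h1 h2 a b h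
  | K i j =>
    simp only [map_mul, S.lift_inX, S.lift_inU, map_smul, FreeStarAlg.lift_gen, smul_mul_assoc]
    fin_cases i <;> fin_cases j <;> simp only [Fin.zero_eta, Fin.mk_one, Fin.reduceFinMk, e0, e1,
      e2, ek0, ek1, actK, Matrix.cons_val, Complex.ofReal_one, one_smul, Complex.ofReal_inv, h0]
    exacts [S.k1x0, S.k1x1, S.k1x2, S.k2x0, S.k2x1, S.k2x2]
  | E i j =>
    simp only [map_mul, map_add, S.lift_inX, S.lift_inU, map_smul, FreeStarAlg.lift_gen,
      smul_mul_assoc]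
    fin_cases i <;> fin_cases j <;> simp only [Fin.zero_eta, Fin.mk_one, Fin.reduceFinMk, e0, e1,
      e2, ek0, ek1, ee0, ee1, actK, actE, Matrix.cons_val, Complex.ofReal_one, one_smul,
      Complex.ofReal_inv, h0, map_smul, FreeStarAlg.lift_gen, map_zero, zero_mul, zero_add, inv_one,
      hr1, smul_mul_assoc, inv_inv]
    exacts [by rw [S.e1x0, add_comm], S.e1x1, S.e1x2, S.e2x0, S.e2x1, S.e2x2]
  | F i j =>
    simp only [map_mul, map_add, S.lift_inX, S.lift_inU, map_smul, map_star, FreeStarAlg.lift_gen,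
      smul_mul_assoc]
    fin_cases i <;> fin_cases j <;> simp only [Fin.zero_eta, Fin.mk_one, Fin.reduceFinMk, e0, e1,
      e2, ek0, ek1, ee0, ee1, actK, actF, Matrix.cons_val, Complex.ofReal_one, one_smul,
      Complex.ofReal_inv, h0, map_smul, map_star, FreeStarAlg.lift_gen, map_zero, zero_mul, zero_add,
      inv_one, hr2, hr3, smul_mul_assoc, inv_inv, S.star_e1, S.star_e2]
    exacts [by rw [S.f1x0, neg_smul]; abel, S.f1x1, S.f1x2, S.f2x0, S.f2x1, S.f2x2]

end WeightData

variable (hq0 : 0 < q) (hq1 : q < 1)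

/-- The representation of the crossed product on the finitely supported vectors. -/
def crossedRep : CrossedAlg q →⋆ₐ[ℂ] AdjAlg finM :=
  PresentedStarAlg.lift (CrossedRel q) (FreeStarAlg.lift (opData hq0 hq1).genC)
    ((opData hq0 hq1).crossed_rel hq0 (x1x2_rel hq0 hq1) (rr_eq_one hq0 hq1)
      (serre1_eq_zero hq0 hq1) (serre2_eq_zero hq0 hq1))

theorem crossedRep_sphere (a : FreeStarAlg (Fin 3)) :
    crossedRep hq0 hq1 (sphereToCrossed q (PresentedStarAlg.mk (SphereRel q) a))
      = FreeStarAlg.lift (opData hq0 hq1).genX a := by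
  have h : sphereToCrossed q (PresentedStarAlg.mk (SphereRel q) a)
      = PresentedStarAlg.mk (CrossedRel q) (inX a) := PresentedStarAlg.lift_mk (SphereRel q) _ _ a
  rw [h]
  exact (PresentedStarAlg.lift_mk (CrossedRel q) _ _ _).trans (WeightData.lift_inX _ a)

theorem crossedRep_uq (a : FreeStarAlg UqGen) :
    crossedRep hq0 hq1 (uqToCrossed q (PresentedStarAlg.mk (UqRel q) a))
      = FreeStarAlg.lift (opData hq0 hq1).genU a := by
  have h : uqToCrossed q (PresentedStarAlg.mk (UqRel q) a)
      = PresentedStarAlg.mk (CrossedRel q) (inU a) := PresentedStarAlg.lift_mk (UqRel q) _ _ a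
  rw [h]
  exact (PresentedStarAlg.lift_mk (CrossedRel q) _ _ _).trans (WeightData.lift_inU _ a)

end Crossed

/-! ### Bounded operators on the Hilbert space -/

section Extension

theorem clm_ext_finM {T T' : SpinorSpace →L[ℂ] SpinorSpace} (h : ∀ v : finM, T v = T' v) :
    T = T' := by
  have : Set.EqOn T T' (closure (finM : Set SpinorSpace)) :=
    Set.EqOn.closure (fun v hv => h ⟨v, hv⟩) T.continuous T'.continuous
  ext1 v
  exact this (finM_dense v)

/-- The adjointable operators that are bounded. -/
def Bdd (b : AdjAlg finM) : Prop := ∃ C : ℝ, ∀ v : finM, ‖(b : Module.End ℂ finM) v‖ ≤ C * ‖v‖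

theorem Bdd.exists_ext {b : AdjAlg finM} (h : Bdd b) :
    ∃ T : SpinorSpace →L[ℂ] SpinorSpace, ∀ v : finM,
      T v = ((b : Module.End ℂ finM) v : SpinorSpace) := by
  obtain ⟨C, hC⟩ := h
  let f : finM →L[ℂ] SpinorSpace :=
    LinearMap.mkContinuous (finM.subtype.comp (b : Module.End ℂ finM)) C hC
  have hd : DenseRange finM.subtypeL := by
    rw [DenseRange, Submodule.coe_subtypeL, Submodule.coe_subtype, Subtype.range_coe]
    exact finM_dense
  have hu : IsUniformInducing finM.subtypeL := isUniformInducing_val _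
  exact ⟨f.extend finM.subtypeL, fun v => f.extend_eq hd hu v⟩

theorem Bdd.of_algebraMap (c : ℂ) : Bdd (algebraMap ℂ _ c) := ⟨‖c‖, fun v => by
  change ‖c • v‖ ≤ _
  rw [norm_smul]⟩

theorem Bdd.add {a b : AdjAlg finM} (ha : Bdd a) (hb : Bdd b) : Bdd (a + b) := by
  obtain ⟨C, hC⟩ := ha
  obtain ⟨C', hC'⟩ := hb
  refine ⟨C + C', fun v => ?_⟩
  change ‖(a : Module.End ℂ finM) v + (b : Module.End ℂ finM) v‖ ≤ _
  rw [add_mul]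
  exact (norm_add_le _ _).trans (add_le_add (hC v) (hC' v))

theorem Bdd.mul {a b : AdjAlg finM} (ha : Bdd a) (hb : Bdd b) : Bdd (a * b) := by
  obtain ⟨C, hC⟩ := ha
  obtain ⟨C', hC'⟩ := hb
  refine ⟨|C| * C', fun v => ?_⟩
  change ‖(a : Module.End ℂ finM) ((b : Module.End ℂ finM) v)‖ ≤ _
  calc _ ≤ C * ‖(b : Module.End ℂ finM) v‖ := hC _
    _ ≤ |C| * ‖(b : Module.End ℂ finM) v‖ := by gcongr; exact le_abs_self C
    _ ≤ |C| * (C' * ‖v‖) := by gcongr; exact hC' v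
    _ = _ := by ring

theorem finM_inner_self (w : finM) : (inner ℂ w w : ℂ) = (‖w‖ : ℂ) ^ 2 :=
  inner_self_eq_norm_sq_to_K (𝕜 := ℂ) (w : SpinorSpace)

theorem Bdd.star {b : AdjAlg finM} (hb : Bdd b) : Bdd (star b) := by
  obtain ⟨C, hC⟩ := hb
  refine ⟨|C|, fun v => ?_⟩
  set w := ((Star.star b : AdjAlg finM) : Module.End ℂ finM) v with hw
  have h1 : ‖w‖ ^ 2 ≤ |C| * ‖w‖ * ‖v‖ := by
    have h2 := AdjAlg.inner_star b w v
    rw [← hw, finM_inner_self] at h2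
    have h3 : ‖w‖ ^ 2 = ‖((‖w‖ : ℂ)) ^ 2‖ := by simp
    rw [h3, ← h2]
    refine (norm_inner_le_norm (𝕜 := ℂ) (((b : Module.End ℂ finM) w : finM) : SpinorSpace)
      (v : SpinorSpace)).trans ?_
    change ‖(b : Module.End ℂ finM) w‖ * ‖v‖ ≤ _
    gcongr
    exact (hC w).trans (by gcongr; exact le_abs_self C)
  rcases (norm_nonneg w).eq_or_lt with h | h
  · rw [← h]; positivity
  · nlinarith

/-- The bounded extension of an operator on the finitely supported vectors. -/
def extOp (b : AdjAlg finM) (h : Bdd b) : SpinorSpace →L[ℂ] SpinorSpace := h.exists_ext.choose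

theorem extOp_apply (b : AdjAlg finM) (h : Bdd b) (v : finM) :
    extOp b h v = ((b : Module.End ℂ finM) v : SpinorSpace) := h.exists_ext.choose_spec v

theorem extOp_eq {a b : AdjAlg finM} (h : a = b) (ha : Bdd a) (hb : Bdd b) :
    extOp a ha = extOp b hb := by subst h; rfl

theorem extOp_algebraMap (c : ℂ) (h : Bdd (algebraMap ℂ _ c)) :
    extOp (algebraMap ℂ _ c) h = algebraMap ℂ _ c :=
  clm_ext_finM fun v => (extOp_apply _ h v).trans rfl

theorem extOp_add {a b : AdjAlg finM} (ha : Bdd a) (hb : Bdd b) :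
    extOp (a + b) (ha.add hb) = extOp a ha + extOp b hb :=
  clm_ext_finM fun v => by
    rw [extOp_apply, ContinuousLinearMap.add_apply, extOp_apply, extOp_apply]; rfl

theorem extOp_mul {a b : AdjAlg finM} (ha : Bdd a) (hb : Bdd b) :
    extOp (a * b) (ha.mul hb) = extOp a ha * extOp b hb :=
  clm_ext_finM fun v => by
    rw [extOp_apply]
    change _ = extOp a ha (extOp b hb v)
    rw [extOp_apply, extOp_apply]; rfl

theorem extOp_star {a : AdjAlg finM} (ha : Bdd a) :
    extOp (star a) ha.star = star (extOp a ha) :=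
  clm_ext_finM fun v => by
    refine finM_dense.eq_of_inner_left (𝕜 := ℂ) fun w hw => ?_
    rw [ContinuousLinearMap.star_eq_adjoint, ContinuousLinearMap.adjoint_inner_left, extOp_apply]
    have h1 := AdjAlg.inner_star (star a) v ⟨w, hw⟩
    rw [star_star] at h1
    have h2 := extOp_apply a ha ⟨w, hw⟩
    change extOp a ha w = _ at h2
    rw [h2]
    exact h1

/-- The bounded extension of a representation by bounded adjointable operators. -/
def extHom {A : Type} [Ring A] [StarRing A] [Algebra ℂ A] (φ : A →⋆ₐ[ℂ] AdjAlg finM)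
    (h : ∀ a, Bdd (φ a)) : A →⋆ₐ[ℂ] (SpinorSpace →L[ℂ] SpinorSpace) where
  toFun a := extOp (φ a) (h a)
  map_one' := (extOp_eq (by rw [map_one, map_one]) _ (Bdd.of_algebraMap 1)).trans
    ((extOp_algebraMap 1 _).trans (map_one _))
  map_mul' a b := (extOp_eq (map_mul φ a b) _ ((h a).mul (h b))).trans (extOp_mul _ _)
  map_zero' := (extOp_eq (by rw [map_zero, map_zero]) _ (Bdd.of_algebraMap 0)).trans
    ((extOp_algebraMap 0 _).trans (map_zero _))
  map_add' a b := (extOp_eq (map_add φ a b) _ ((h a).add (h b))).trans (extOp_add _ _)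
  commutes' c := (extOp_eq (AlgHomClass.commutes φ c) _ (Bdd.of_algebraMap c)).trans
    (extOp_algebraMap c _)
  map_star' a := (extOp_eq (map_star φ a) _ (h a).star).trans (extOp_star _)

theorem lift_bdd {X : Type} {f : X → AdjAlg finM} (hf : ∀ x, Bdd (f x)) (a : FreeStarAlg X) :
    Bdd (FreeStarAlg.lift f a) := by
  set φ := FreeStarAlg.lift f
  refine FreeAlgebra.induction (R := ℂ) (X := X × Bool)
    (motive := fun a : FreeStarAlg X => Bdd (φ a)) ?_ ?_ ?_ ?_ a
  · intro c
    have : φ (algebraMap ℂ (FreeStarAlg X) c) = algebraMap ℂ _ c := AlgHomClass.commutes φ c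
    have h2 := Bdd.of_algebraMap c
    rw [← this] at h2
    exact h2
  · rintro ⟨x, b⟩
    cases b
    · have : φ (FreeStarAlg.gen x) = f x := FreeStarAlg.lift_gen f x
      have h2 := hf x
      rw [← this] at h2
      exact h2
    · have h3 : (FreeStarAlg.symb (x, true) : FreeStarAlg X) = star (FreeStarAlg.gen x) :=
        (FreeStarAlg.star_symb (x, false)).symm
      have : φ (FreeStarAlg.symb (x, true)) = star (f x) := by
        rw [h3, map_star]; exact congrArg star (FreeStarAlg.lift_gen f x)
      have h2 := (hf x).star
      rw [← this] at h2
      exact h2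
  · intro a b ha hb
    have : φ (a * b) = φ a * φ b := map_mul φ a b
    have h2 := ha.mul hb
    rw [← this] at h2
    exact h2
  · intro a b ha hb
    have : φ (a + b) = φ a + φ b := map_add φ a b
    have h2 := ha.add hb
    rw [← this] at h2
    exact h2

theorem lift_comm {X B : Type} [Ring B] [StarRing B] [Algebra ℂ B] [StarModule ℂ B] {f : X → B}
    {g : B} (hf : ∀ x, g * f x = f x * g)
    (hf' : ∀ x, g * star (f x) = star (f x) * g) (a : FreeStarAlg X) :
    g * FreeStarAlg.lift f a = FreeStarAlg.lift f a * g := by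
  set φ := FreeStarAlg.lift f
  refine FreeAlgebra.induction (R := ℂ) (X := X × Bool)
    (motive := fun a : FreeStarAlg X => g * φ a = φ a * g) ?_ ?_ ?_ ?_ a
  · intro c
    have : φ (algebraMap ℂ (FreeStarAlg X) c) = algebraMap ℂ _ c := AlgHomClass.commutes φ c
    have h2 := (Algebra.commutes c g).symm
    rw [← this] at h2
    exact h2
  · rintro ⟨x, b⟩
    cases b
    · have : φ (FreeStarAlg.gen x) = f x := FreeStarAlg.lift_gen f x
      have h2 := hf x
      rw [← this] at h2
      exact h2
    · have h3 : (FreeStarAlg.symb (x, true) : FreeStarAlg X) = star (FreeStarAlg.gen x) :=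
        (FreeStarAlg.star_symb (x, false)).symm
      have : φ (FreeStarAlg.symb (x, true)) = star (f x) := by
        rw [h3, map_star]; exact congrArg star (FreeStarAlg.lift_gen f x)
      have h2 := hf' x
      rw [← this] at h2
      exact h2
  · intro a b ha hb
    have : φ (a * b) = φ a * φ b := map_mul φ a b
    have h2 : g * (φ a * φ b) = φ a * φ b * g := by rw [← mul_assoc, ha, mul_assoc, hb, mul_assoc]
    rw [← this] at h2
    exact h2
  · intro a b ha hb
    have : φ (a + b) = φ a + φ b := map_add φ a b
    have h2 : g * (φ a + φ b) = (φ a + φ b) * g := by rw [mul_add, add_mul, ha, hb]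
    rw [← this] at h2
    exact h2

end Extension

/-! ### The spinor representation -/

section SpinorRep

variable {q : ℝ} (hq0 : 0 < q) (hq1 : q < 1)

theorem norm_sq_rr {t : ℂ} (S : WeightData t (AdjAlg finM)) (h : S.rr = 1) (v : finM) :
    ‖(S.x0 : Module.End ℂ finM) v‖ ^ 2
      + ‖((star S.x1 : AdjAlg finM) : Module.End ℂ finM) v‖ ^ 2
      + ‖((star S.x2 : AdjAlg finM) : Module.End ℂ finM) v‖ ^ 2 = ‖v‖ ^ 2 := by
  have h1 := S.inner_rr v
  rw [h] at h1
  change inner ℂ v v = _ at h1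
  simp only [finM_inner_self] at h1
  exact_mod_cast h1.symm

theorem bdd_genX (i : Fin 3) : Bdd ((opData hq0 hq1).genX i) := by
  have h := norm_sq_rr (opData hq0 hq1) (rr_eq_one hq0 hq1)
  fin_cases i
  · refine ⟨1, fun v => ?_⟩
    rw [one_mul]
    refine (sq_le_sq₀ (norm_nonneg _) (norm_nonneg _)).1 ?_
    rw [← h v, add_assoc]
    exact le_add_of_nonneg_right (by positivity)
  · have h1 : Bdd (star (opData hq0 hq1).x1) := ⟨1, fun v => by
      rw [one_mul]
      refine (sq_le_sq₀ (norm_nonneg _) (norm_nonneg _)).1 ?_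
      rw [← h v, add_right_comm]
      exact le_add_of_nonneg_left (by positivity)⟩
    have := h1.star
    rwa [star_star] at this
  · have h1 : Bdd (star (opData hq0 hq1).x2) := ⟨1, fun v => by
      rw [one_mul]
      refine (sq_le_sq₀ (norm_nonneg _) (norm_nonneg _)).1 ?_
      rw [← h v]
      exact le_add_of_nonneg_left (by positivity)⟩
    have := h1.star
    rwa [star_star] at this

theorem bdd_crossedRep (a : SphereAlg q) : Bdd (crossedRep hq0 hq1 (sphereToCrossed q a)) := by
  obtain ⟨a, rfl⟩ := PresentedStarAlg.mkAlg_surjective (SphereRel q) a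
  have := lift_bdd (bdd_genX hq0 hq1) a
  rw [← crossedRep_sphere] at this
  exact this

/-- The representation of the algebra of the sphere by bounded operators. -/
def spinorRep : SphereAlg q →⋆ₐ[ℂ] (SpinorSpace →L[ℂ] SpinorSpace) :=
  extHom ((crossedRep hq0 hq1).comp (sphereToCrossed q)) (bdd_crossedRep hq0 hq1)

theorem spinorRep_apply (a : SphereAlg q) (v : finM) :
    spinorRep hq0 hq1 a v
      = (((crossedRep hq0 hq1 (sphereToCrossed q a) : AdjAlg finM) : Module.End ℂ finM) v :
        SpinorSpace) := extOp_apply _ (bdd_crossedRep hq0 hq1 a) v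

theorem spinorRep_x (i : Fin 3) (s : Bool) (p : Lat) :
    spinorRep hq0 hq1 (sphereX q i) (kv s p)
      = (((opData hq0 hq1).genX i : Module.End ℂ finM) (km s p) : SpinorSpace) := by
  have h := crossedRep_sphere hq0 hq1 (FreeStarAlg.gen i)
  rw [FreeStarAlg.lift_gen] at h
  refine (spinorRep_apply hq0 hq1 _ (km s p)).trans ?_
  exact congrArg (fun b : AdjAlg finM => (((b : Module.End ℂ finM) (km s p) : finM) :
    SpinorSpace)) h

theorem sgn_cast (s : Bool) : ((sgn s : ℝ) : ℂ) = csgn s := by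
  cases s <;> simp [sgn, csgn]

theorem smul_ket_congr {c c' : ℂ} {s : Bool} {n a b k : ℤ} (h : Lab (n, a, b, k) → c = c') :
    c • ket s n a b k = c' • ket s n a b k := by
  by_cases hp : Lab (n, a, b, k)
  · rw [h hp]
  · rw [show ket s n a b k = 0 from kv_of_not_lab s hp, smul_zero, smul_zero]

theorem isSpinorRep_spinorRep : IsSpinorRep q (spinorRep hq0 hq1) := by
  have hlab : ∀ {n a b k : ℤ}, Lab (n, a, b, k) ↔ LabA k a ∧ LabB n k b := lab_iff
  constructor
  · intro s n a b k h
    have hp : Lab (n, a, b, k) := h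
    have hA := (hlab.1 hp).1
    have hB := (hlab.1 hp).2
    have hk : 0 ≤ k := h.1
    have hA2 : ac (sx q) 2 k a = ac (sx q) 0 (k - 1) a := by
      have := ac_rev (x := sx q) 2 k a
      exact this.symm
    refine (spinorRep_x hq0 hq1 0 s (n, a, b, k)).trans ?_
    rw [show (((opData hq0 hq1).genX 0 : Module.End ℂ finM)) (km s (n, a, b, k)) = _ from
      rp_km_two (elt_rp (isAdj_X0 hq0 hq1)) (good_X0 (sx q)) s hp]
    simp only [Fin.sum_univ_three, Submodule.coe_add, Submodule.coe_smul]
    change _ • ket s (n + 1) (a + 0) (b + 0) (k + 1) + _ • ket s (n + 0) (a + 0) (b + 0) (k + 1)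
      + _ • ket s (n + -1) (a + 0) (b + 0) (k + 1) + (_ • ket s (n + 1) (a + 0) (b + 0) (k + 0)
      + _ • ket s (n + 0) (a + 0) (b + 0) (k + 0) + _ • ket s (n + -1) (a + 0) (b + 0) (k + 0))
      + (_ • ket s (n + 1) (a + 0) (b + 0) (k + -1) + _ • ket s (n + 0) (a + 0) (b + 0) (k + -1)
      + _ • ket s (n + -1) (a + 0) (b + 0) (k + -1)) = _
    simp only [add_zero, ← sub_eq_add_neg]
    have e : ∀ u v : SpinorSpace, u - v = u + -v := sub_eq_add_neg
    simp only [e, ← neg_smul, ← add_assoc]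
    congr 1; congr 1; congr 1; congr 1; congr 1; congr 1; congr 1; congr 1
    all_goals
      refine smul_ket_congr fun hp' => ?_
      obtain ⟨hA', hB'⟩ := hlab.1 hp'
      have hk' := hp'.1
      simp only [Complex.ofReal_mul, sgn_cast, yc, Matrix.cons_val, cast_Ap hq0 hq1 hA, cast_A0 hq0 hq1 hA]
    · rw [cast_Cp hq0 hq1 hB hk]
    · rw [cast_C0 hq0 hq1 hB hk]; ring
    · rw [cast_Cm hq0 hq1 hB hk]
    · rw [cast_Hp hq0 hq1 hB hk]
    · rw [cast_H0 hq0 hq1 hB hk]; ring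
    · rw [cast_Hp hq0 hq1 hB' hk']
    · rw [cast_Ap hq0 hq1 hA', cast_Cm hq0 hq1 hB' hk', hA2]
    · rw [cast_Ap hq0 hq1 hA', cast_C0 hq0 hq1 hB' hk', hA2]; ring
    · rw [cast_Ap hq0 hq1 hA', cast_Cp hq0 hq1 hB' hk', hA2]
  · intro s n a b k h
    have hp : Lab (n, a, b, k) := h
    have hA := (hlab.1 hp).1
    have hB := (hlab.1 hp).2
    have hk : 0 ≤ k := h.1
    refine (spinorRep_x hq0 hq1 1 s (n, a, b, k)).trans ?_
    rw [show (((opData hq0 hq1).genX 1 : Module.End ℂ finM)) (km s (n, a, b, k)) = _ from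
      rp_km_two (elt_rp (isAdj_X1 (sx q))) (good_X1 (sx q)) s hp]
    simp only [Fin.sum_univ_three, Submodule.coe_add, Submodule.coe_smul]
    change _ • ket s (n + 1) (a + 1) (b + 0) (k + 1) + _ • ket s (n + 0) (a + 1) (b + 0) (k + 1)
      + _ • ket s (n + -1) (a + 1) (b + 0) (k + 1) + (_ • ket s (n + 1) (a + 1) (b + 0) (k + 0)
      + _ • ket s (n + 0) (a + 1) (b + 0) (k + 0) + _ • ket s (n + -1) (a + 1) (b + 0) (k + 0))
      + (_ • ket s (n + 1) (a + 1) (b + 0) (k + -1) + _ • ket s (n + 0) (a + 1) (b + 0) (k + -1)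
      + _ • ket s (n + -1) (a + 1) (b + 0) (k + -1)) = _
    simp only [add_zero, ← sub_eq_add_neg]
    have e : ∀ u v : SpinorSpace, u - v = u + -v := sub_eq_add_neg
    simp only [e, ← neg_smul, ← add_assoc]
    congr 1; congr 1; congr 1; congr 1; congr 1; congr 1; congr 1; congr 1
    all_goals
      refine smul_ket_congr fun hp' => ?_
      obtain ⟨hA', hB'⟩ := hlab.1 hp'
      have hk' := hp'.1
      simp only [Complex.ofReal_mul, sgn_cast, yc, Matrix.cons_val, cast_Bp hq0 hq1 hA, cast_B0 hq0 hq1 hA]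
    · rw [cast_Cp hq0 hq1 hB hk]
    · rw [cast_C0 hq0 hq1 hB hk]; ring
    · rw [cast_Cm hq0 hq1 hB hk]
    · rw [cast_Hp hq0 hq1 hB hk]
    · rw [cast_H0 hq0 hq1 hB hk]; ring
    · rw [cast_Hp hq0 hq1 hB' hk']
    · rw [cast_Bm hq0 hq1 ⟨by have := hA'.1; omega, by have := hA'.2; omega⟩, cast_Cm hq0 hq1 hB' hk']
    · rw [cast_Bm hq0 hq1 ⟨by have := hA'.1; omega, by have := hA'.2; omega⟩, cast_C0 hq0 hq1 hB' hk']; ring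
    · rw [cast_Bm hq0 hq1 ⟨by have := hA'.1; omega, by have := hA'.2; omega⟩, cast_Cp hq0 hq1 hB' hk']
  · intro s n a b k h
    have hp : Lab (n, a, b, k) := h
    have hA := (hlab.1 hp).1
    have hB := (hlab.1 hp).2
    have hk : 0 ≤ k := h.1
    refine (spinorRep_x hq0 hq1 2 s (n, a, b, k)).trans ?_
    rw [show (((opData hq0 hq1).genX 2 : Module.End ℂ finM)) (km s (n, a, b, k)) = _ from
      rp_km (elt_rp (isAdj_X2 (sx q))) (good_X2 (sx q)) s hp]
    simp only [Fin.sum_univ_three, Submodule.coe_add, Submodule.coe_smul]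
    change _ • ket s (n + 1) (a + 0) (b + 1) (k + 0) + _ • ket s (n + 0) (a + 0) (b + 1) (k + 0)
      + _ • ket s (n + -1) (a + 0) (b + 1) (k + 0) = _
    simp only [add_zero, ← sub_eq_add_neg]
    congr 1; congr 1
    all_goals
      refine smul_ket_congr fun hp' => ?_
    · exact (cast_Dp hq0 hq1 _ hB hk).symm
    · rw [Complex.ofReal_mul, sgn_cast, cast_D0 hq0 hq1 hB hk]
      unfold dc
      split <;> simp <;> ring
    · exact (cast_Dm hq0 hq1 _ hB hk).symm

end SpinorRep

/-! ### Equivariance -/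

section Equivariance

variable {q : ℝ} (hq0 : 0 < q) (hq1 : q < 1)

/-- The Dirac operator on finitely supported vectors. -/
def dM : AdjAlg finM := elt isAdj_Flip * elt isAdj_Abs

theorem dM_rp : Rp (dM : Module.End ℂ finM) (wFlip * wAbs) :=
  (elt_rp isAdj_Flip).mul (elt_rp isAdj_Abs)

theorem dM_comm_aux {d : Lat} {c : LatFun} (hd : d.1 = 0) (hc : ∀ s p, c (!s) p = c s p) :
    wFlip * wAbs * sh d c = sh d c * (wFlip * wAbs) := by
  rw [mul_assoc, wAbs, diag_comm (fun s p => by simp [hd]), ← mul_assoc, flip_comm hc, mul_assoc]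

theorem dM_comm {b : AdjAlg finM} {d : Lat} {c : LatFun} (hb : Rp (b : Module.End ℂ finM) (sh d c))
    (hd : d.1 = 0) (hc : ∀ s p, c (!s) p = c s p) : dM * b = b * dM :=
  elt_eq (dM_rp.mul hb) (hb.mul dM_rp) (dM_comm_aux hd hc)

theorem dM_comm_sum {b : AdjAlg finM} {d : Fin 3 → Lat} {c : Fin 3 → LatFun}
    (hb : Rp (b : Module.End ℂ finM) (∑ i, sh (d i) (c i)))
    (hd : ∀ i, (d i).1 = 0) (hc : ∀ i s p, c i (!s) p = c i s p) : dM * b = b * dM :=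
  elt_eq (dM_rp.mul hb) (hb.mul dM_rp) (by
    rw [Finset.mul_sum, Finset.sum_mul]
    exact Finset.sum_congr rfl fun i _ => dM_comm_aux (hd i) (hc i))

theorem dM_comm_genU (g : UqGen) : dM * (opData hq0 hq1).genU g = (opData hq0 hq1).genU g * dM ∧
    dM * star ((opData hq0 hq1).genU g) = star ((opData hq0 hq1).genU g) * dM := by
  have hK1 (e : ℤ) : dM * elt (isAdj_K1 hq0 e) = elt (isAdj_K1 hq0 e) * dM :=
    dM_comm (elt_rp (isAdj_K1 hq0 e)) rfl fun _ _ => rfl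
  have hK2 (e : ℤ) : dM * elt (isAdj_K2 hq0 e) = elt (isAdj_K2 hq0 e) * dM :=
    dM_comm (elt_rp (isAdj_K2 hq0 e)) rfl fun _ _ => rfl
  cases g with
  | K i =>
    fin_cases i
    · exact ⟨hK1 1, by
        change dM * star (opData hq0 hq1).k1 = star (opData hq0 hq1).k1 * dM
        rw [(opData hq0 hq1).star_k1]; exact hK1 1⟩
    · exact ⟨hK2 1, by
        change dM * star (opData hq0 hq1).k2 = star (opData hq0 hq1).k2 * dM
        rw [(opData hq0 hq1).star_k2]; exact hK2 1⟩
  | Kinv i =>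
    fin_cases i
    · exact ⟨hK1 (-1), by
        change dM * star (opData hq0 hq1).l1 = star (opData hq0 hq1).l1 * dM
        rw [(opData hq0 hq1).star_l1]; exact hK1 (-1)⟩
    · exact ⟨hK2 (-1), by
        change dM * star (opData hq0 hq1).l2 = star (opData hq0 hq1).l2 * dM
        rw [(opData hq0 hq1).star_l2]; exact hK2 (-1)⟩
  | E i =>
    fin_cases i
    · refine ⟨dM_comm (elt_rp (isAdj_E1 hq0 hq1)) rfl fun _ _ => rfl, ?_⟩
      change dM * star (opData hq0 hq1).e1 = star (opData hq0 hq1).e1 * dM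
      rw [(opData hq0 hq1).star_e1]
      exact dM_comm (elt_rp (isAdj_E1 hq0 hq1).symm) rfl fun _ _ => rfl
    · refine ⟨dM_comm_sum (elt_rp (isAdj_E2 hq0 hq1)) (fun _ => rfl) fun _ _ _ => rfl, ?_⟩
      change dM * star (opData hq0 hq1).e2 = star (opData hq0 hq1).e2 * dM
      rw [(opData hq0 hq1).star_e2]
      exact dM_comm_sum (elt_rp (isAdj_E2 hq0 hq1).symm) (fun _ => rfl) fun _ _ _ => rfl

theorem gM_comm_genC (g : Fin 3 ⊕ UqGen) :
    gM * (opData hq0 hq1).genC g = (opData hq0 hq1).genC g * gM := by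
  have hK1 (e : ℤ) : gM * elt (isAdj_K1 hq0 e) = elt (isAdj_K1 hq0 e) * gM :=
    gM_comm_one (elt_rp (isAdj_K1 hq0 e))
  have hK2 (e : ℤ) : gM * elt (isAdj_K2 hq0 e) = elt (isAdj_K2 hq0 e) * gM :=
    gM_comm_one (elt_rp (isAdj_K2 hq0 e))
  rcases g with i | g
  · fin_cases i
    · exact gM_x0 hq0 hq1
    · exact gM_x1 hq0 hq1
    · exact gM_x2 hq0 hq1
  · cases g with
    | K i =>
      fin_cases i
      · exact hK1 1
      · exact hK2 1
    | Kinv i =>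
      fin_cases i
      · exact hK1 (-1)
      · exact hK2 (-1)
    | E i =>
      fin_cases i
      · exact gM_comm_one (elt_rp (isAdj_E1 hq0 hq1))
      · exact gM_comm (elt_rp (isAdj_E2 hq0 hq1))

theorem crossedRep_mk (a : FreeStarAlg (Fin 3 ⊕ UqGen)) :
    crossedRep hq0 hq1 (PresentedStarAlg.mk (CrossedRel q) a)
      = FreeStarAlg.lift (opData hq0 hq1).genC a :=
  PresentedStarAlg.lift_mk _ _ _ _

theorem toFn_finM_mul {b : AdjAlg finM} {T : Module.End ℂ LatFun}
    (hb : Rp (b : Module.End ℂ finM) T) (v : finM) (s : Bool) (p : Lat) (hp : Lab p) :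
    (((b : Module.End ℂ finM) v : finM) : SpinorSpace) (s, lb p hp) = T (toFn v) s p := by
  rw [← toFn_of_lab, hb]

theorem grading_apply (v : SpinorSpace) (i : Bool × Label) :
    grading v i = (sgn i.1 : ℂ) * v i :=
  diagOp_apply (C := 1) (fun i => by
    obtain ⟨s, p⟩ := i
    cases s <;> simp [sgn]) v i

theorem mem_dirac_domain {v w : SpinorSpace}
    (h : ∀ s p, w (s, p) = ((p.val.1 : ℂ) + 2) * v (!s, p)) :
    ∃ hv : v ∈ dirac.domain, w = dirac ⟨v, hv⟩ := by
  have e : (fun i : Bool × Label => eigval i * v (!i.1, i.2)) = w := by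
    funext i
    exact (h i.1 i.2).symm
  have hv : v ∈ dirac.domain := by
    change Memℓp (fun i : Bool × Label => eigval i * v (!i.1, i.2)) 2
    rw [e]
    exact lp.memℓp w
  exact ⟨hv, lp.ext (funext fun i => h i.1 i.2)⟩

theorem isEquivariant_spinorRep :
    IsEquivariant (sphereToCrossed q) (uqToCrossed q) (spinorRep hq0 hq1) dirac grading := by
  refine ⟨finM, (AdjAlg finM).val.comp (crossedRep hq0 hq1 : CrossedAlg q →ₐ[ℂ] AdjAlg finM),
    (dM : Module.End ℂ finM), (gM : Module.End ℂ finM), finM_dense, ?_, ?_, ?_, ?_, ?_, ?_⟩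
  · intro c v w
    have := AdjAlg.inner_star (crossedRep hq0 hq1 c) v w
    rw [← map_star] at this
    exact this
  · intro a v
    exact (spinorRep_apply hq0 hq1 a v).symm
  · intro v
    refine mem_dirac_domain fun s p => ?_
    obtain ⟨p, hp⟩ := p
    refine (toFn_finM_mul dM_rp v s p hp).trans ?_
    change ((p - 0).1 + 2 : ℂ) * toFn (v : SpinorSpace) (!s) (p - 0) = _
    rw [sub_zero, toFn_of_lab _ _ hp]
    rfl
  · intro v
    refine lp.ext (funext fun i => ?_)
    obtain ⟨s, p, hp⟩ := i
    refine (toFn_finM_mul (elt_rp isAdj_G) v s p hp).trans ?_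
    rw [grading_apply, sgn_cast]
    change csgn s * toFn (v : SpinorSpace) s (p - 0) = _
    rw [sub_zero, toFn_of_lab _ _ hp]
    rfl
  · intro u
    obtain ⟨a, rfl⟩ := PresentedStarAlg.mkAlg_surjective (UqRel q) u
    have h := lift_comm (g := dM) (fun g => (dM_comm_genU hq0 hq1 g).1)
      (fun g => (dM_comm_genU hq0 hq1 g).2) a
    rw [← crossedRep_uq] at h
    exact congrArg Subtype.val h
  · intro c
    obtain ⟨a, rfl⟩ := PresentedStarAlg.mkAlg_surjective (CrossedRel q) c
    have h := lift_comm (g := gM) (gM_comm_genC hq0 hq1)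
      (fun g => comm_star_of_comm star_gM (gM_comm_genC hq0 hq1 g)) a
    rw [← crossedRep_mk] at h
    exact congrArg Subtype.val h

theorem grading_selfAdjoint : IsSelfAdjoint grading := by
  refine (ContinuousLinearMap.isSelfAdjoint_iff_isSymmetric).2 fun v w => ?_
  change inner ℂ (grading v) w = inner ℂ v (grading w)
  rw [lp.inner_eq_tsum, lp.inner_eq_tsum]
  refine tsum_congr fun i => ?_
  rw [grading_apply, grading_apply, sgn_cast]
  simp only [RCLike.inner_apply, map_mul, conj_csgn]
  ring

theorem grading_sq : grading * grading = 1 := by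
  refine ContinuousLinearMap.ext fun v => lp.ext (funext fun i => ?_)
  change grading (grading v) i = v i
  rw [grading_apply, grading_apply, sgn_cast, ← mul_assoc, ← sq, csgn_sq, one_mul]

theorem grading_comm (a : SphereAlg q) :
    grading * spinorRep hq0 hq1 a = spinorRep hq0 hq1 a * grading := by
  obtain ⟨M, ρ, D', γ', hM, -, h1, -, h2, -, h3⟩ := isEquivariant_spinorRep hq0 hq1
  have key : Set.EqOn (grading * spinorRep hq0 hq1 a) (spinorRep hq0 hq1 a * grading)
      (closure (M : Set SpinorSpace)) := by
    refine Set.EqOn.closure (fun v hv => ?_) (ContinuousLinearMap.continuous _)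
      (ContinuousLinearMap.continuous _)
    have e1 := h1 a ⟨v, hv⟩
    have e2 := h2 ⟨v, hv⟩
    have e3 := h2 (ρ (sphereToCrossed q a) ⟨v, hv⟩)
    have e4 := h1 a (γ' ⟨v, hv⟩)
    change grading (spinorRep hq0 hq1 a v) = spinorRep hq0 hq1 a (grading v)
    rw [← e1, ← e2, ← e3, ← e4]
    exact congrArg Subtype.val (LinearMap.congr_fun (h3 (sphereToCrossed q a)) ⟨v, hv⟩)
  ext1 v
  exact key (hM v)

theorem grading_anticomm (v : dirac.domain) :
    ∃ h : grading v ∈ dirac.domain, dirac ⟨grading v, h⟩ = -grading (dirac v) := by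
  obtain ⟨h, h'⟩ := mem_dirac_domain (v := grading v) (w := -grading (dirac v)) fun s p => by
    change -(grading (dirac v) (s, p)) = _
    rw [grading_apply, grading_apply, sgn_cast, sgn_cast]
    have : dirac v (s, p) = ((p.val.1 : ℂ) + 2) * (v : SpinorSpace) (!s, p) := rfl
    rw [this]
    cases s <;> simp [csgn]
  exact ⟨h, h'.symm⟩

end Equivariance

/-! ### Band operators -/

section Band

theorem toFn_kv_apply (u s : Bool) (p r : Lat) [Decidable (s = u ∧ r = p ∧ Lab p)] :
    toFn (kv u p) s r = if s = u ∧ r = p ∧ Lab p then 1 else 0 := by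
  by_cases h : Lab p
  · rw [toFn_kv u h, dl]
    simp [h]
  · rw [toFn_kv_of_not_lab u h, if_neg (by tauto)]
    rfl

theorem norm_kv_le (s : Bool) (p : Lat) : ‖kv s p‖ ≤ 1 := by
  by_cases h : Lab p
  · rw [kv_of_lab s h, ← ellBasis_apply]
    exact ((ellBasis _).orthonormal.1 _).le
  · rw [kv_of_not_lab s h]; simp

/-- The matrix coefficient of `T` between `|p⟩_t` and `|p + d⟩_s`. -/
def cf (T : SpinorSpace →L[ℂ] SpinorSpace) (s t : Bool) (d p : Lat) : ℂ := toFn (T (kv t p)) s (p + d)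

variable {T T' S : SpinorSpace →L[ℂ] SpinorSpace} {F F' : Finset Lat}

theorem cf_eq_zero (s t : Bool) {d p : Lat} (h : ¬(Lab p ∧ Lab (p + d))) : cf T s t d p = 0 := by
  by_cases h1 : Lab p
  · exact toFn_of_not_lab _ _ fun h2 => h ⟨h1, h2⟩
  · rw [cf, kv_of_not_lab t h1, map_zero, map_zero]; rfl

theorem norm_cf_le (T : SpinorSpace →L[ℂ] SpinorSpace) (s t : Bool) (d p : Lat) :
    ‖cf T s t d p‖ ≤ ‖T‖ := by
  rw [cf, ← inner_kv]
  calc _ ≤ ‖kv s (p + d)‖ * ‖T (kv t p)‖ := norm_inner_le_norm _ _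
    _ ≤ 1 * (‖T‖ * 1) := by
      gcongr
      · exact norm_kv_le _ _
      · exact (T.le_opNorm _).trans (by gcongr; exact norm_kv_le _ _)
    _ = _ := by ring

theorem cf_add (s t : Bool) (d p : Lat) : cf (T + T') s t d p = cf T s t d p + cf T' s t d p := by
  simp [cf]

theorem cf_smul (c : ℂ) (s t : Bool) (d p : Lat) : cf (c • T) s t d p = c * cf T s t d p := by
  simp [cf]

theorem cf_sum {ι : Type} (A : Finset ι) (f : ι → SpinorSpace →L[ℂ] SpinorSpace) (s t : Bool)
    (d p : Lat) : cf (∑ i ∈ A, f i) s t d p = ∑ i ∈ A, cf (f i) s t d p := by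
  simp [cf, Finset.sum_apply, ContinuousLinearMap.sum_apply]

open Classical in
theorem cf_one (s t : Bool) (d p : Lat) :
    cf (1 : SpinorSpace →L[ℂ] SpinorSpace) s t d p = if s = t ∧ d = 0 ∧ Lab p then 1 else 0 := by
  rw [cf, ContinuousLinearMap.one_apply, toFn_kv_apply]
  simp

theorem cf_star (s t : Bool) (d p : Lat) :
    cf (star T) s t d p = starRingEnd ℂ (cf T t s (-d) (p + d)) := by
  rw [cf, cf, ← inner_kv, ← inner_kv, ContinuousLinearMap.star_eq_adjoint,
    ContinuousLinearMap.adjoint_inner_right, inner_conj_symm, add_neg_cancel_right]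

/-- The coefficients of `T` vanish outside the finitely many diagonals in `F`. -/
def Band (T : SpinorSpace →L[ℂ] SpinorSpace) (F : Finset Lat) : Prop :=
  ∀ s t d p, d ∉ F → cf T s t d p = 0

open Classical in
theorem Band.kv_eq (h : Band T F) (t : Bool) (p : Lat) :
    T (kv t p) = ∑ s, ∑ d ∈ F, cf T s t d p • kv s (p + d) := by
  refine toFn_injective (funext fun u => funext fun r => ?_)
  rw [map_sum]
  simp only [map_sum, map_smul, Finset.sum_apply, Pi.smul_apply, smul_eq_mul, toFn_kv_apply]
  have e : toFn (T (kv t p)) u r = cf T u t (r - p) p := by rw [cf, add_sub_cancel]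
  rw [e, Finset.sum_eq_single u]
  · by_cases hF : r - p ∈ F
    · rw [Finset.sum_eq_single (r - p)]
      · by_cases hl : Lab r
        · simp [hl]
        · rw [cf_eq_zero u t (by rw [add_sub_cancel]; tauto), zero_mul]
      · intro d _ hd
        rw [if_neg, mul_zero]
        rintro ⟨-, rfl, -⟩
        exact hd (by abel)
      · exact fun h' => absurd hF h'
    · rw [h u t _ p hF, Finset.sum_eq_zero]
      intro d hd
      rw [if_neg, mul_zero]
      rintro ⟨-, rfl, -⟩
      rw [add_sub_cancel_left] at hF
      exact hF hd
  · intro b _ hb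
    refine Finset.sum_eq_zero fun d _ => ?_
    rw [if_neg, mul_zero]
    rintro ⟨rfl, -⟩
    exact hb rfl
  · exact fun h' => absurd (Finset.mem_univ _) h'

theorem cf_mul (h : Band T' F') (s t : Bool) (d p : Lat) :
    cf (T * T') s t d p = ∑ u, ∑ d' ∈ F', cf T s u (d - d') (p + d') * cf T' u t d' p := by
  rw [cf, ContinuousLinearMap.mul_apply, h.kv_eq]
  simp only [map_sum, map_smul, Finset.sum_apply, Pi.smul_apply, smul_eq_mul]
  refine Finset.sum_congr rfl fun u _ => Finset.sum_congr rfl fun d' _ => ?_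
  rw [mul_comm]
  congr 1
  simp only [cf]
  congr 1
  abel

open Classical in
theorem Band.star (h : Band T F) : Band (star T) (F.image Neg.neg) := fun s t d p hd => by
  rw [cf_star, h, map_zero]
  intro h'
  exact hd (Finset.mem_image.2 ⟨-d, h', neg_neg d⟩)

open Classical in
theorem Band.mul (h : Band T F) (h' : Band T' F') :
    Band (T * T') ((F ×ˢ F').image fun x => x.1 + x.2) := fun s t d p hd => by
  rw [cf_mul h']
  refine Finset.sum_eq_zero fun u _ => Finset.sum_eq_zero fun d' hd' => ?_
  rw [h, zero_mul]
  intro h1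
  exact hd (Finset.mem_image.2 ⟨(d - d', d'), Finset.mk_mem_product h1 hd', by simp⟩)

theorem Band.mono (h : Band T F) (hF : F ⊆ F') : Band T F' := fun s t d p hd =>
  h s t d p fun h' => hd (hF h')

theorem Band.toFn_apply (h : Band T F) (v : SpinorSpace) (s : Bool) (p : Lat) :
    toFn (T v) s p = ∑ t, ∑ d ∈ F, cf T s t d (p - d) * toFn v t (p - d) := by
  classical
  rw [← inner_kv, ← ContinuousLinearMap.adjoint_inner_left, ← ContinuousLinearMap.star_eq_adjoint,
    h.star.kv_eq, sum_inner]
  refine Finset.sum_congr rfl fun t _ => ?_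
  rw [Finset.sum_image neg_injective.injOn, sum_inner]
  refine Finset.sum_congr rfl fun d _ => ?_
  rw [inner_smul_left, inner_kv, cf_star, Complex.conj_conj, neg_neg, ← sub_eq_add_neg]

end Band

/-! ### Weighted partial shifts -/

section Shifts

theorem sum_toFn_le (v : SpinorSpace) (t : Bool) (B : Finset Lat) :
    ∑ r ∈ B, ‖toFn v t r‖ ^ 2 ≤ ‖v‖ ^ 2 := by
  classical
  have ho : Orthonormal ℂ (fun x : Label => (ellBasis (Bool × Label)) (t, x)) :=
    (ellBasis (Bool × Label)).orthonormal.comp _ (fun x y h => (Prod.mk.inj h).2)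
  have h := ho.sum_inner_products_le (s := B.subtype Lab) v
  refine le_trans (le_of_eq ?_) h
  have e : ∀ x : Label, ‖(inner ℂ (ellBasis (Bool × Label) (t, x)) v : ℂ)‖ ^ 2
      = ‖toFn v t x.val‖ ^ 2 := fun x => by
    rw [ellBasis_apply, inner_basisVec, toFn_of_lab v t x.2]; rfl
  have h2 : ∑ x ∈ B.subtype Lab, ‖toFn v t x.val‖ ^ 2 = ∑ r ∈ B.filter Lab, ‖toFn v t r‖ ^ 2 :=
    Finset.sum_subtype_eq_sum_filter (s := B) (p := Lab) (fun r => ‖toFn v t r‖ ^ 2)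
  refine Eq.trans ?_ (Finset.sum_congr rfl fun x _ => (e x)).symm
  refine Eq.trans ?_ h2.symm
  rw [Finset.sum_filter]
  refine Finset.sum_congr rfl fun r _ => ?_
  split_ifs with hr
  · rfl
  · rw [toFn_of_not_lab v t hr]; simp

open Classical in
theorem exists_shift (s t : Bool) (d : Lat) (c : Lat → ℂ) {C : ℝ} (hc : ∀ p, ‖c p‖ ≤ C) :
    ∃ S : SpinorSpace →L[ℂ] SpinorSpace, ∀ v u r, Lab r →
      toFn (S v) u r = if u = s then c (r - d) * toFn v t (r - d) else 0 := by
  have hC : 0 ≤ C := (norm_nonneg _).trans (hc 0)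
  let f : SpinorSpace → Bool × Label → ℂ := fun v i =>
    if i.1 = s then c (i.2.val - d) * toFn v t (i.2.val - d) else 0
  have key : ∀ v (A : Finset (Bool × Label)), ∑ i ∈ A, ‖f v i‖ ^ (2 : ℝ≥0∞).toReal
      ≤ (C * ‖v‖) ^ (2 : ℝ≥0∞).toReal := by
    intro v A
    simp only [ENNReal.toReal_ofNat, Real.rpow_ofNat]
    calc ∑ i ∈ A, ‖f v i‖ ^ 2
        ≤ ∑ i ∈ A, if i.1 = s then C ^ 2 * ‖toFn v t (i.2.val - d)‖ ^ 2 else 0 := by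
          refine Finset.sum_le_sum fun i _ => ?_
          simp only [f]
          split_ifs
          · rw [norm_mul, mul_pow]
            gcongr
            exact hc _
          · simp
      _ = ∑ i ∈ A.filter (fun i => i.1 = s), C ^ 2 * ‖toFn v t (i.2.val - d)‖ ^ 2 :=
          (Finset.sum_filter _ _).symm
      _ = ∑ r ∈ (A.filter (fun i => i.1 = s)).image (fun i => i.2.val - d),
            C ^ 2 * ‖toFn v t r‖ ^ 2 := by
          rw [Finset.sum_image]
          intro i hi j hj hij
          have hi := (Finset.mem_filter.1 hi).2
          have hj := (Finset.mem_filter.1 hj).2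
          exact Prod.ext (hi.trans hj.symm) (Subtype.ext (sub_left_injective hij))
      _ ≤ C ^ 2 * ‖v‖ ^ 2 := by
          rw [← Finset.mul_sum]
          gcongr
          exact sum_toFn_le v t _
      _ = _ := by ring
  let S : SpinorSpace →ₗ[ℂ] SpinorSpace :=
    { toFun := fun v => ⟨f v, memℓp_gen' (key v)⟩
      map_add' := fun v w => Subtype.ext (funext fun i => by
        change f (v + w) i = f v i + f w i
        simp only [f, map_add, Pi.add_apply]
        split_ifs <;> ring)
      map_smul' := fun a v => Subtype.ext (funext fun i => by
        change f (a • v) i = a * f v i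
        simp only [f, map_smul, Pi.smul_apply, smul_eq_mul]
        split_ifs <;> ring) }
  refine ⟨S.mkContinuous C fun v =>
    lp.norm_le_of_forall_sum_le (by norm_num) (by positivity) (key v), fun v u r hr => ?_⟩
  rw [toFn_of_lab _ _ hr]
  rfl

open Classical in
theorem exists_of_cf (F : Finset Lat) (c : Bool → Bool → Lat → Lat → ℂ) {C : ℝ}
    (hc : ∀ s t d p, ‖c s t d p‖ ≤ C)
    (h0 : ∀ s t d p, ¬(Lab p ∧ Lab (p + d)) → c s t d p = 0)
    (hF : ∀ s t d p, d ∉ F → c s t d p = 0) :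
    ∃ S : SpinorSpace →L[ℂ] SpinorSpace, Band S F ∧ ∀ s t d p, cf S s t d p = c s t d p := by
  choose S hS using fun s t d => exists_shift s t d (c s t d) (hc s t d)
  have key : ∀ s t d s' t' d' p, cf (S s t d) s' t' d' p
      = if s' = s ∧ t' = t ∧ d' = d then c s t d p else 0 := by
    intro s t d s' t' d' p
    by_cases hl : Lab p ∧ Lab (p + d')
    · rw [cf, hS s t d _ _ _ hl.2, toFn_kv_apply]
      by_cases h1 : s' = s
      · by_cases h2 : t' = t
        · by_cases h3 : d' = d
          · subst h1 h2 h3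
            simp [hl.1]
          · rw [if_pos h1, if_neg, mul_zero, if_neg (by tauto)]
            rintro ⟨-, h4, -⟩
            exact h3 (by rw [add_sub_assoc, add_eq_left, sub_eq_zero] at h4; exact h4)
        · rw [if_pos h1, if_neg, mul_zero, if_neg (by tauto)]
          rintro ⟨h4, -⟩
          exact h2 h4.symm
      · rw [if_neg h1, if_neg (by tauto)]
    · rw [cf_eq_zero _ _ hl]
      split_ifs with h
      · obtain ⟨-, -, rfl⟩ := h
        exact (h0 _ _ _ _ hl).symm
      · rfl
  have main : ∀ s t d p, cf (∑ s, ∑ t, ∑ d ∈ F, S s t d) s t d p = c s t d p := by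
    intro s t d p
    simp only [cf_sum, key]
    rw [Finset.sum_eq_single s, Finset.sum_eq_single t]
    · by_cases hd : d ∈ F
      · rw [Finset.sum_eq_single d]
        · simp
        · intro d' _ hd'
          rw [if_neg (by rintro ⟨-, -, rfl⟩; exact hd' rfl)]
        · exact fun h => absurd hd h
      · rw [hF s t d p hd]
        refine Finset.sum_eq_zero fun d' hd' => ?_
        rw [if_neg (by rintro ⟨-, -, rfl⟩; exact hd hd')]
    · intro t' _ ht
      exact Finset.sum_eq_zero fun d' _ => if_neg (by rintro ⟨-, rfl, -⟩; exact ht rfl)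
    · exact fun h => absurd (Finset.mem_univ _) h
    · intro s' _ hs
      exact Finset.sum_eq_zero fun t' _ => Finset.sum_eq_zero fun d' _ =>
        if_neg (by rintro ⟨rfl, -⟩; exact hs rfl)
    · exact fun h => absurd (Finset.mem_univ _) h
  exact ⟨_, fun s t d p hd => (main s t d p).trans (hF s t d p hd), main⟩

end Shifts

/-! ### Commutators with the Dirac operator -/

section Commutators

variable {T S : SpinorSpace →L[ℂ] SpinorSpace} {F : Finset Lat}

theorem toFn_dirac (v : dirac.domain) (s : Bool) (p : Lat) :
    toFn (dirac v) s p = ((p.1 : ℂ) + 2) * toFn (v : SpinorSpace) (!s) p := by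
  by_cases h : Lab p
  · rw [toFn_of_lab _ _ h, toFn_of_lab _ _ h]; rfl
  · rw [toFn_of_not_lab _ _ h, toFn_of_not_lab _ _ h, mul_zero]

theorem toFn_absDirac (v : absDirac.domain) (s : Bool) (p : Lat) :
    toFn (absDirac v) s p = ((p.1 : ℂ) + 2) * toFn (v : SpinorSpace) s p := by
  by_cases h : Lab p
  · rw [toFn_of_lab _ _ h, toFn_of_lab _ _ h]; rfl
  · rw [toFn_of_not_lab _ _ h, toFn_of_not_lab _ _ h, mul_zero]

theorem mem_dirac {v w : SpinorSpace}
    (h : ∀ s p, toFn w s p = ((p.1 : ℂ) + 2) * toFn v (!s) p) :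
    ∃ hv : v ∈ dirac.domain, dirac ⟨v, hv⟩ = w := by
  obtain ⟨hv, e⟩ := mem_dirac_domain (v := v) (w := w) fun s p => by
    have := h s p.val
    rwa [toFn_of_lab _ _ p.2, toFn_of_lab _ _ p.2] at this
  exact ⟨hv, e.symm⟩

theorem mem_absDirac {v w : SpinorSpace}
    (h : ∀ s p, toFn w s p = ((p.1 : ℂ) + 2) * toFn v s p) :
    ∃ hv : v ∈ absDirac.domain, absDirac ⟨v, hv⟩ = w := by
  have h' : ∀ i : Bool × Label, w i = eigval i * v i := fun i => by
    have := h i.1 i.2.val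
    rwa [toFn_of_lab _ _ i.2.2, toFn_of_lab _ _ i.2.2] at this
  have e : (fun i : Bool × Label => eigval i * v (id i)) = w := funext fun i => (h' i).symm
  have hv : v ∈ absDirac.domain := by
    change Memℓp (fun i : Bool × Label => eigval i * v (id i)) 2
    rw [e]
    exact lp.memℓp w
  exact ⟨hv, lp.ext (funext fun i => (h' i).symm)⟩

theorem kv_dirac (s : Bool) (p : Lat) :
    ∃ h : kv s p ∈ dirac.domain, dirac ⟨kv s p, h⟩ = ((p.1 : ℂ) + 2) • kv (!s) p := by
  classical
  refine mem_dirac fun u r => ?_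
  rw [map_smul, Pi.smul_apply, Pi.smul_apply, smul_eq_mul, toFn_kv_apply, toFn_kv_apply]
  by_cases h : r = p
  · subst h; cases u <;> cases s <;> simp
  · simp [h]

theorem kv_absDirac (s : Bool) (p : Lat) :
    ∃ h : kv s p ∈ absDirac.domain, absDirac ⟨kv s p, h⟩ = ((p.1 : ℂ) + 2) • kv s p := by
  classical
  refine mem_absDirac fun u r => ?_
  rw [map_smul, Pi.smul_apply, Pi.smul_apply, smul_eq_mul, toFn_kv_apply]
  by_cases h : r = p
  · subst h; rfl
  · simp [h]

theorem cf_of_commutator_abs (h : IsCommutator absDirac T S) (s t : Bool) (d p : Lat) :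
    cf S s t d p = d.1 * cf T s t d p := by
  obtain ⟨hk, e⟩ := kv_absDirac t p
  obtain ⟨h1, h2⟩ := h ⟨kv t p, hk⟩
  rw [cf, ← h2, map_sub, Pi.sub_apply, Pi.sub_apply, toFn_absDirac, e, map_smul, map_smul,
    Pi.smul_apply, Pi.smul_apply, smul_eq_mul]
  simp only [cf, Prod.fst_add, Int.cast_add]
  ring

theorem cf_of_commutator_dirac (h : IsCommutator dirac T S) (s t : Bool) (d p : Lat) :
    cf S s t d p = ((p.1 : ℂ) + d.1 + 2) * cf T (!s) t d p - ((p.1 : ℂ) + 2) * cf T s (!t) d p := by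
  obtain ⟨hk, e⟩ := kv_dirac t p
  obtain ⟨h1, h2⟩ := h ⟨kv t p, hk⟩
  rw [cf, ← h2, map_sub, Pi.sub_apply, Pi.sub_apply, toFn_dirac, e, map_smul, map_smul,
    Pi.smul_apply, Pi.smul_apply, smul_eq_mul]
  simp only [cf, Prod.fst_add, Int.cast_add]

theorem isCommutator_abs (hT : Band T F) (hS : Band S F)
    (h : ∀ s t d p, cf S s t d p = d.1 * cf T s t d p) : IsCommutator absDirac T S := fun v => by
  obtain ⟨h1, h2⟩ := mem_absDirac (v := T v) (w := T (absDirac v) + S v) fun s p => by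
    rw [map_add, Pi.add_apply, Pi.add_apply, hT.toFn_apply, hS.toFn_apply, hT.toFn_apply,
      Finset.mul_sum, ← Finset.sum_add_distrib]
    refine Finset.sum_congr rfl fun t _ => ?_
    rw [Finset.mul_sum, ← Finset.sum_add_distrib]
    refine Finset.sum_congr rfl fun d _ => ?_
    rw [h, toFn_absDirac]
    simp only [Prod.fst_sub, Int.cast_sub]
    ring
  exact ⟨h1, by rw [h2, add_sub_cancel_left]⟩

theorem isCommutator_dirac (hT : Band T F) (hS : Band S F)
    (h : ∀ s t d p, cf S s t d p
      = ((p.1 : ℂ) + d.1 + 2) * cf T (!s) t d p - ((p.1 : ℂ) + 2) * cf T s (!t) d p) :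
    IsCommutator dirac T S := fun v => by
  obtain ⟨h1, h2⟩ := mem_dirac (v := T v) (w := T (dirac v) + S v) fun s p => by
    rw [map_add, Pi.add_apply, Pi.add_apply, hT.toFn_apply, hS.toFn_apply, hT.toFn_apply,
      Finset.mul_sum]
    simp only [Finset.mul_sum, ← Finset.sum_add_distrib, Fintype.sum_bool]
    refine Finset.sum_congr rfl fun d _ => ?_
    simp only [h, toFn_dirac, Prod.fst_sub, Int.cast_sub]
    cases s <;> simp only [Bool.not_true, Bool.not_false] <;> ring
  exact ⟨h1, by rw [h2, add_sub_cancel_left]⟩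

end Commutators

/-! ### Symbols -/

section Symbols

/-- The weights that govern the decay of the matrix coefficients. -/
def wt (p : Lat) : ℤ := p.1 - p.2.2.2 + p.2.2.1 + 1

/-- The change of `wt` under a translation. -/
def wl (d : Lat) : ℤ := d.1 - d.2.2.2 + d.2.2.1

/-- The second weight. -/
def ut (p : Lat) : ℤ := p.2.2.2 + p.2.1 + 1

theorem wt_add (p d : Lat) : wt (p + d) = wt p + wl d := by
  simp only [wt, wl, Prod.fst_add, Prod.snd_add]; ring

variable (q : ℝ)

/-- The size of the error terms. -/
def ge (p : Lat) : ℝ := q ^ (wt p + ut p) + q ^ p.1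

/-- The function `c` is, up to an error of size `ge`, a function of `wt` with limit `L`. The estimate
is also required at the labels from which or to which the translation by `d` is inadmissible. -/
def SymC (d : Lat) (c : Lat → ℂ) (L : ℂ) : Prop :=
  ∃ (Ψ : ℤ → ℂ) (C : ℝ), 0 ≤ C ∧ (∀ w, ‖Ψ w‖ ≤ C) ∧ (∀ w, ‖Ψ w - L‖ ≤ C * q ^ w) ∧
    ∀ p, Lab p ∨ Lab (p + d) → ‖c p - Ψ (wt p)‖ ≤ C * ge q p

variable {q} (hq0 : 0 < q) (hq1 : q < 1)

include hq0

theorem ge_pos (p : Lat) : 0 < ge q p := add_pos (zpow_pos hq0 _) (zpow_pos hq0 _)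

theorem ge_add_le (d : Lat) : ∃ K : ℝ, 0 ≤ K ∧ ∀ p, ge q (p + d) ≤ K * ge q p := by
  refine ⟨q ^ (wl d + d.2.2.2 + d.2.1) + q ^ d.1, add_nonneg (zpow_pos hq0 _).le (zpow_pos hq0 _).le,
    fun p => ?_⟩
  have h1 : q ^ (wt (p + d) + ut (p + d)) = q ^ (wl d + d.2.2.2 + d.2.1) * q ^ (wt p + ut p) := by
    rw [← zpow_add₀ hq0.ne', wt_add]
    congr 1
    simp only [ut, Prod.fst_add, Prod.snd_add]; ring
  have h2 : q ^ (p + d).1 = q ^ d.1 * q ^ p.1 := by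
    rw [← zpow_add₀ hq0.ne', Prod.fst_add, add_comm]
  rw [ge, ge, h1, h2]
  have a1 := zpow_pos hq0 (wl d + d.2.2.2 + d.2.1)
  have a2 := zpow_pos hq0 d.1
  have a3 := zpow_pos hq0 (wt p + ut p)
  have a4 := zpow_pos hq0 p.1
  nlinarith [mul_pos a1 a4, mul_pos a2 a3]

theorem SymC.zero (d : Lat) : SymC q d (fun _ => 0) 0 :=
  ⟨fun _ => 0, 0, le_rfl, by simp, by simp, by simp⟩

variable {d d' : Lat} {c c' : Lat → ℂ} {L L' : ℂ}

omit hq0 in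
theorem SymC.congr (h : SymC q d c L) (e : ∀ p, c' p = c p) : SymC q d c' L := by
  rwa [show c' = c from funext e]

theorem SymC.add (h : SymC q d c L) (h' : SymC q d c' L') :
    SymC q d (fun p => c p + c' p) (L + L') := by
  obtain ⟨Ψ, C, h0, h1, h2, h3⟩ := h
  obtain ⟨Ψ', C', h0', h1', h2', h3'⟩ := h'
  refine ⟨fun w => Ψ w + Ψ' w, C + C', add_nonneg h0 h0',
    fun w => (norm_add_le _ _).trans (add_le_add (h1 w) (h1' w)), fun w => ?_, fun p hp => ?_⟩
  · rw [add_sub_add_comm, add_mul]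
    exact (norm_add_le _ _).trans (add_le_add (h2 w) (h2' w))
  · rw [add_sub_add_comm, add_mul]
    exact (norm_add_le _ _).trans (add_le_add (h3 p hp) (h3' p hp))

theorem SymC.smul (a : ℂ) (h : SymC q d c L) : SymC q d (fun p => a * c p) (a * L) := by
  obtain ⟨Ψ, C, h0, h1, h2, h3⟩ := h
  refine ⟨fun w => a * Ψ w, ‖a‖ * C, by positivity, fun w => ?_, fun w => ?_, fun p hp => ?_⟩
  · rw [norm_mul]; gcongr; exact h1 w
  · rw [← mul_sub, norm_mul, mul_assoc]; gcongr; exact h2 w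
  · rw [← mul_sub, norm_mul, mul_assoc]; gcongr; exact h3 p hp

theorem SymC.sum {ι : Type} {A : Finset ι} {c : ι → Lat → ℂ} {L : ι → ℂ}
    (h : ∀ i ∈ A, SymC q d (c i) (L i)) : SymC q d (fun p => ∑ i ∈ A, c i p) (∑ i ∈ A, L i) := by
  classical
  induction A using Finset.induction_on with
  | empty => simpa using SymC.zero hq0 d
  | insert i A hi ih =>
    simp only [Finset.sum_insert hi]
    exact (h i (Finset.mem_insert_self _ _)).add hq0
      (ih fun j hj => h j (Finset.mem_insert_of_mem hj))

theorem SymC.conj (h : SymC q d c L) :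
    SymC q (-d) (fun p => starRingEnd ℂ (c (p + -d))) (starRingEnd ℂ L) := by
  obtain ⟨Ψ, C, h0, h1, h2, h3⟩ := h
  obtain ⟨K, hK, hK'⟩ := ge_add_le hq0 (-d)
  have e := zpow_pos hq0 (wl (-d))
  refine ⟨fun w => starRingEnd ℂ (Ψ (w + wl (-d))), C + C * q ^ wl (-d) + C * K, by positivity,
    fun w => ?_, fun w => ?_, fun p hp => ?_⟩
  · rw [RCLike.norm_conj]
    exact (h1 _).trans (by nlinarith [mul_nonneg h0 e.le, mul_nonneg h0 hK])
  · rw [← map_sub, RCLike.norm_conj]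
    refine (h2 _).trans ?_
    rw [zpow_add₀ hq0.ne']
    nlinarith [mul_nonneg h0 (zpow_pos hq0 w).le, mul_nonneg (mul_nonneg h0 hK) (zpow_pos hq0 w).le]
  · rw [← map_sub, RCLike.norm_conj, ← wt_add]
    refine (h3 _ (by rw [neg_add_cancel_right]; exact hp.symm)).trans ?_
    have := mul_le_mul_of_nonneg_left (hK' p) h0
    nlinarith [mul_nonneg h0 (ge_pos hq0 p).le, mul_nonneg (mul_nonneg h0 e.le) (ge_pos hq0 p).le]

theorem norm_mul_sub_mul_le {a b x y : ℂ} {A B X Y : ℝ} (h1 : ‖a - x‖ ≤ A) (h2 : ‖b - y‖ ≤ B)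
    (h3 : ‖b‖ ≤ Y) (h4 : ‖x‖ ≤ X) : ‖a * b - x * y‖ ≤ A * Y + X * B := by
  have e : a * b - x * y = (a - x) * b + x * (b - y) := by ring
  rw [e]
  refine (norm_add_le _ _).trans ?_
  rw [norm_mul, norm_mul]
  have := (norm_nonneg _).trans h1
  have := (norm_nonneg _).trans h4
  gcongr

theorem SymC.mul (h : SymC q d c L) (h' : SymC q d' c' L') {B : ℝ}
    (hc : ∀ p, ¬(Lab p ∧ Lab (p + d)) → c p = 0) (hc' : ∀ p, ¬(Lab p ∧ Lab (p + d')) → c' p = 0)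
    (hB : ∀ p, ‖c' p‖ ≤ B) :
    SymC q (d + d') (fun p => c (p + d') * c' p) (L * L') := by
  obtain ⟨Ψ, C, h0, h1, h2, h3⟩ := h
  obtain ⟨Ψ', C', h0', h1', h2', h3'⟩ := h'
  obtain ⟨K, hK, hK'⟩ := ge_add_le hq0 d'
  have e := zpow_pos hq0 (wl d')
  have hB0 : 0 ≤ B := (norm_nonneg _).trans (hB 0)
  set M := C * C' + (C * q ^ wl d' * C' + ‖L‖ * C') + (C * K * B + C * C') + C * K * C' with hM
  refine ⟨fun w => Ψ (w + wl d') * Ψ' w, M, by positivity, fun w => ?_, fun w => ?_, fun p hp => ?_⟩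
  · rw [norm_mul]
    refine (mul_le_mul (h1 _) (h1' _) (norm_nonneg _) h0).trans ?_
    rw [hM, add_assoc, add_assoc]
    exact le_add_of_nonneg_right (by positivity)
  · have hw := zpow_pos hq0 w
    refine (norm_mul_sub_mul_le hq0 (h2 _) (h2' w) (h1' w) le_rfl).trans ?_
    rw [zpow_add₀ hq0.ne']
    have : M * q ^ w = (C * (q ^ w * q ^ wl d') * C' + ‖L‖ * (C' * q ^ w))
      + (C * C' + (C * K * B + C * C') + C * K * C') * q ^ w := by rw [hM]; ring
    rw [this]
    exact le_add_of_nonneg_right (by positivity)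
  · have hg := ge_pos hq0 p
    change ‖c (p + d') * c' p - Ψ (wt p + wl d') * Ψ' (wt p)‖ ≤ _
    rw [← wt_add]
    by_cases hm : Lab (p + d')
    · refine (norm_mul_sub_mul_le hq0 ((h3 _ (Or.inl hm)).trans
        (mul_le_mul_of_nonneg_left (hK' p) h0)) (h3' _ (Or.inr hm)) (hB p) (h1 _)).trans ?_
      have : M * ge q p = (C * (K * ge q p) * B + C * (C' * ge q p))
        + (C * C' + (C * q ^ wl d' * C' + ‖L‖ * C') + C * K * C') * ge q p := by rw [hM]; ring
      rw [this]
      exact le_add_of_nonneg_right (by positivity)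
    · rw [hc _ (fun h => hm h.1), zero_mul, zero_sub, norm_neg, norm_mul]
      rcases hp with hp | hp
      · have h4 := h3' p (Or.inl hp)
        rw [hc' _ (fun h => hm h.2), zero_sub, norm_neg] at h4
        refine (mul_le_mul (h1 _) h4 (norm_nonneg _) h0).trans ?_
        have : M * ge q p = C * (C' * ge q p)
          + ((C * q ^ wl d' * C' + ‖L‖ * C') + (C * K * B + C * C') + C * K * C') * ge q p := by
          rw [hM]; ring
        rw [this]
        exact le_add_of_nonneg_right (by positivity)
      · have h4 := h3 (p + d') (Or.inr (by rwa [add_assoc, add_comm d' d]))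
        rw [hc _ (fun h => hm h.1), zero_sub, norm_neg] at h4
        refine (mul_le_mul (h4.trans (mul_le_mul_of_nonneg_left (hK' p) h0)) (h1' _)
          (norm_nonneg _) (by positivity)).trans ?_
        have : M * ge q p = C * (K * ge q p) * C'
          + (C * C' + (C * q ^ wl d' * C' + ‖L‖ * C') + (C * K * B + C * C')) * ge q p := by
          rw [hM]; ring
        rw [this]
        exact le_add_of_nonneg_right (by positivity)

end Symbols

/-! ### Operators with symbols -/

section SymOperators

variable (q : ℝ)

/-- The band operators whose coefficients have symbols. -/
def IsSym (T : SpinorSpace →L[ℂ] SpinorSpace) : Prop :=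
  ∃ F, Band T F ∧ ∀ s t d, ∃ L, SymC q d (cf T s t d) L

variable {q} (hq0 : 0 < q) {T T' S : SpinorSpace →L[ℂ] SpinorSpace}

include hq0

theorem IsSym.add (h : IsSym q T) (h' : IsSym q T') : IsSym q (T + T') := by
  classical
  obtain ⟨F, h1, h2⟩ := h
  obtain ⟨F', h1', h2'⟩ := h'
  refine ⟨F ∪ F', fun s t d p hd => ?_, fun s t d => ?_⟩
  · rw [Finset.mem_union, not_or] at hd
    rw [cf_add, h1 _ _ _ _ hd.1, h1' _ _ _ _ hd.2, add_zero]
  · obtain ⟨L, hL⟩ := h2 s t d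
    obtain ⟨L', hL'⟩ := h2' s t d
    exact ⟨_, (hL.add hq0 hL').congr fun p => cf_add s t d p⟩

theorem IsSym.smul (a : ℂ) (h : IsSym q T) : IsSym q (a • T) := by
  obtain ⟨F, h1, h2⟩ := h
  refine ⟨F, fun s t d p hd => ?_, fun s t d => ?_⟩
  · rw [cf_smul, h1 _ _ _ _ hd, mul_zero]
  · obtain ⟨L, hL⟩ := h2 s t d
    exact ⟨_, (hL.smul hq0 a).congr fun p => cf_smul a s t d p⟩

theorem symC_one (s t : Bool) (d : Lat) :
    SymC q d (cf (1 : SpinorSpace →L[ℂ] SpinorSpace) s t d) (if s = t ∧ d = 0 then 1 else 0) := by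
  classical
  rw [show cf (1 : SpinorSpace →L[ℂ] SpinorSpace) s t d = _ from funext fun p => cf_one s t d p]
  by_cases h : s = t ∧ d = 0
  · obtain ⟨rfl, rfl⟩ := h
    refine ⟨fun _ => 1, 1, zero_le_one, by simp, fun w => ?_, fun p hp => ?_⟩
    · simp [(zpow_pos hq0 w).le]
    · have : Lab p := by simpa using hp
      simp [this, (ge_pos hq0 p).le]
  · rw [if_neg h]
    have : (fun p => if s = t ∧ d = 0 ∧ Lab p then (1 : ℂ) else 0) = fun _ => 0 :=
      funext fun p => if_neg (by tauto)
    rw [this]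
    exact SymC.zero hq0 d

theorem band_one : Band 1 {0} := fun s t d p hd => by
  classical
  rw [cf_one, if_neg]
  rintro ⟨-, rfl, -⟩
  exact hd (Finset.mem_singleton_self _)

theorem IsSym.one : IsSym q 1 := ⟨{0}, band_one hq0, fun s t d => ⟨_, symC_one hq0 s t d⟩⟩

theorem symC_mul_term {s u t : Bool} {d d' : Lat} {L L' : ℂ}
    (h : SymC q (d - d') (cf T s u (d - d')) L) (h' : SymC q d' (cf T' u t d') L') :
    SymC q d (fun p => cf T s u (d - d') (p + d') * cf T' u t d' p) (L * L') := by
  have := h.mul hq0 h' (fun p hp => cf_eq_zero _ _ hp) (fun p hp => cf_eq_zero _ _ hp)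
    (norm_cf_le T' u t d')
  rwa [sub_add_cancel] at this

theorem IsSym.mul (h : IsSym q T) (h' : IsSym q T') : IsSym q (T * T') := by
  classical
  obtain ⟨F, h1, h2⟩ := h
  obtain ⟨F', h1', h2'⟩ := h'
  refine ⟨_, h1.mul h1', fun s t d => ?_⟩
  choose L hL using h2
  choose L' hL' using h2'
  exact ⟨_, (SymC.sum hq0 fun u _ => SymC.sum hq0 fun d' _ =>
    symC_mul_term hq0 (hL s u _) (hL' u t d')).congr fun p => cf_mul h1' s t d p⟩

theorem IsSym.of_commutator (h : IsSym q T) (hS : IsCommutator absDirac T S) : IsSym q S := by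
  obtain ⟨F, h1, h2⟩ := h
  refine ⟨F, fun s t d p hd => ?_, fun s t d => ?_⟩
  · rw [cf_of_commutator_abs hS, h1 _ _ _ _ hd, mul_zero]
  · obtain ⟨L, hL⟩ := h2 s t d
    exact ⟨_, (hL.smul hq0 _).congr fun p => cf_of_commutator_abs hS s t d p⟩

omit hq0 in
theorem Band.exists_commutator {F : Finset Lat} (h : Band T F) :
    ∃ S, IsCommutator absDirac T S ∧ Band S F := by
  have hb : ∀ d ∈ F, ‖(d.1 : ℂ)‖ ≤ ∑ d ∈ F, ‖(d.1 : ℂ)‖ := fun d hd =>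
    Finset.single_le_sum (f := fun d : Lat => ‖(d.1 : ℂ)‖) (fun _ _ => norm_nonneg _) hd
  have hb0 : 0 ≤ ∑ d ∈ F, ‖(d.1 : ℂ)‖ := Finset.sum_nonneg fun _ _ => norm_nonneg _
  obtain ⟨S, hS, hS'⟩ := exists_of_cf F (fun s t d p => (d.1 : ℂ) * cf T s t d p)
    (C := (∑ d ∈ F, ‖(d.1 : ℂ)‖) * ‖T‖) (fun s t d p => by
      by_cases hd : d ∈ F
      · rw [norm_mul]
        exact mul_le_mul (hb d hd) (norm_cf_le T s t d p) (norm_nonneg _) hb0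
      · rw [h s t d p hd, mul_zero, norm_zero]; positivity)
    (fun s t d p hp => by rw [cf_eq_zero s t hp, mul_zero])
    (fun s t d p hd => by rw [h s t d p hd, mul_zero])
  exact ⟨S, isCommutator_abs h hS hS', hS⟩

omit hq0 in
theorem Band.opZero {F : Finset Lat} (h : Band T F) : OPZero absDirac T := by
  let next : {T : SpinorSpace →L[ℂ] SpinorSpace // Band T F} →
      {T : SpinorSpace →L[ℂ] SpinorSpace // Band T F} := fun T =>
    ⟨T.2.exists_commutator.choose, T.2.exists_commutator.choose_spec.2⟩
  refine ⟨fun k => (next^[k] ⟨T, h⟩).1, rfl, fun k => ?_⟩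
  simp only [Function.iterate_succ_apply']
  exact (next^[k] ⟨T, h⟩).2.exists_commutator.choose_spec.1

end SymOperators

/-! ### Operators with scalar leading symbols on the circle -/

section Circle

/-- The translations in the direction of `x_2`. -/
def em (m : ℤ) : Lat := (m, 0, m, 0)

theorem em_injective : Function.Injective em := fun _ _ h => (Prod.mk.inj h).1

variable (q : ℝ)

open Classical in
/-- The operators that are diagonal in the sign, with nearly the same coefficients for both signs,
and whose leading symbol is the function `f` on the circle. -/
structure SymA (f : C(Circle, ℂ)) (T : SpinorSpace →L[ℂ] SpinorSpace) (F : Finset Lat) (G : Finset ℤ)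
    (l : ℤ → ℂ) : Prop where
  band : Band T F
  supp : ∀ m, m ∉ G → l m = 0
  eval : ∀ z : Circle, f z = ∑ m ∈ G, l m * (z : ℂ) ^ m
  sym : ∀ s d, SymC q d (cf T s s d) (if d = em d.1 then l d.1 else 0)
  diag : ∀ s d p, cf T s (!s) d p = 0
  sign : ∀ d, ∃ C, 0 ≤ C ∧ ∀ p, ‖cf T true true d p - cf T false false d p‖ ≤ C * q ^ (2 * p.1)

/-- The existence of a leading symbol on the circle. -/
def IsSymA (f : C(Circle, ℂ)) (T : SpinorSpace →L[ℂ] SpinorSpace) : Prop :=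
  ∃ F G l, SymA q f T F G l

variable {q} (hq0 : 0 < q) {f f' : C(Circle, ℂ)} {T T' : SpinorSpace →L[ℂ] SpinorSpace}

theorem IsSymA.isSym (h : IsSymA q f T) : IsSym q T := by
  obtain ⟨F, G, l, h⟩ := h
  refine ⟨F, h.band, fun s t d => ?_⟩
  by_cases hst : t = s
  · subst hst
    exact ⟨_, h.sym t d⟩
  · obtain rfl : t = !s := by cases s <;> cases t <;> simp_all
    refine ⟨0, ?_⟩
    rw [show cf T s (!s) d = fun _ => 0 from funext fun p => h.diag s d p]
    exact ⟨fun _ => 0, 0, le_rfl, by simp, by simp, by simp⟩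

include hq0

theorem IsSymA.add (h : IsSymA q f T) (h' : IsSymA q f' T') : IsSymA q (f + f') (T + T') := by
  classical
  obtain ⟨F, G, l, h⟩ := h
  obtain ⟨F', G', l', h'⟩ := h'
  refine ⟨F ∪ F', G ∪ G', fun m => l m + l' m, ?_, ?_, ?_, ?_, ?_, ?_⟩
  · intro s t d p hd
    rw [Finset.mem_union, not_or] at hd
    rw [cf_add, h.band _ _ _ _ hd.1, h'.band _ _ _ _ hd.2, add_zero]
  · intro m hm
    rw [Finset.mem_union, not_or] at hm
    rw [h.supp m hm.1, h'.supp m hm.2, add_zero]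
  · intro z
    simp only [add_mul, Finset.sum_add_distrib]
    rw [ContinuousMap.add_apply, h.eval, h'.eval]
    congr 1
    · exact Finset.sum_subset Finset.subset_union_left fun m _ hm => by rw [h.supp m hm, zero_mul]
    · exact Finset.sum_subset Finset.subset_union_right fun m _ hm => by rw [h'.supp m hm, zero_mul]
  · intro s d
    rw [show cf (T + T') s s d = _ from funext fun p => cf_add s s d p]
    have := (h.sym s d).add hq0 (h'.sym s d)
    convert this using 1
    split_ifs <;> simp
  · intro s d p
    rw [cf_add, h.diag, h'.diag, add_zero]
  · intro d
    obtain ⟨C, h0, hC⟩ := h.sign d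
    obtain ⟨C', h0', hC'⟩ := h'.sign d
    refine ⟨C + C', by positivity, fun p => ?_⟩
    rw [cf_add, cf_add, add_sub_add_comm, add_mul]
    exact (norm_add_le _ _).trans (add_le_add (hC p) (hC' p))

theorem IsSymA.of_algebraMap (a : ℂ) :
    IsSymA q (algebraMap ℂ C(Circle, ℂ) a) (algebraMap ℂ (SpinorSpace →L[ℂ] SpinorSpace) a) := by
  classical
  have e : ∀ s t d p, cf (algebraMap ℂ (SpinorSpace →L[ℂ] SpinorSpace) a) s t d p
    = a * cf 1 s t d p := fun s t d p => by rw [Algebra.algebraMap_eq_smul_one, cf_smul]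
  refine ⟨{0}, {0}, fun m => if m = 0 then a else 0, ?_, ?_, ?_, ?_, ?_, ?_⟩
  · intro s t d p hd
    rw [e, band_one hq0 s t d p hd, mul_zero]
  · intro m hm
    exact if_neg fun h => hm (Finset.mem_singleton.2 h)
  · intro z
    rw [Finset.sum_singleton, if_pos rfl, zpow_zero, mul_one]
    rfl
  · intro s d
    rw [show cf _ s s d = _ from funext fun p => e s s d p]
    have := (symC_one hq0 s s d).smul hq0 a
    convert this using 1
    by_cases h : d = 0
    · subst h
      rw [if_pos (show (0 : Lat) = em (0 : Lat).1 from rfl)]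
      simp
    · rw [if_neg (fun h' : s = s ∧ d = 0 => h h'.2), mul_zero]
      split_ifs with h1 h2
      · exact absurd (by rw [h1, h2]; rfl) h
      · rfl
      · rfl
  · intro s d p
    rw [e, cf_one, if_neg, mul_zero]
    rintro ⟨h, -⟩
    cases s <;> simp at h
  · intro d
    refine ⟨0, le_rfl, fun p => ?_⟩
    rw [e, e, cf_one, cf_one]
    simp

theorem IsSymA.star (h : IsSymA q f T) : IsSymA q (star f) (star T) := by
  classical
  obtain ⟨F, G, l, h⟩ := h
  refine ⟨F.image Neg.neg, G.image Neg.neg, fun m => starRingEnd ℂ (l (-m)), h.band.star, ?_, ?_, ?_,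
    ?_, ?_⟩
  · intro m hm
    rw [h.supp, map_zero]
    exact fun h' => hm (Finset.mem_image.2 ⟨-m, h', neg_neg m⟩)
  · intro z
    rw [Finset.sum_image neg_injective.injOn, ContinuousMap.star_apply, h.eval, RCLike.star_def,
      map_sum]
    refine Finset.sum_congr rfl fun m _ => ?_
    rw [neg_neg, map_mul, map_zpow₀, zpow_neg, ← inv_zpow, ← Circle.coe_inv_eq_conj, Circle.coe_inv]
  · intro s d
    rw [show cf (Star.star T) s s d = _ from funext fun p => cf_star s s d p]
    have := (h.sym s (-d)).conj hq0
    rw [neg_neg] at this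
    convert this using 1
    have e : -d = em (-d).1 ↔ d = em d.1 := by
      rw [neg_eq_iff_eq_neg]
      simp [em]
    simp only [e]
    split_ifs <;> simp
  · intro s d p
    have := h.diag (!s) (-d) (p + d)
    rw [Bool.not_not] at this
    rw [cf_star, this, map_zero]
  · intro d
    obtain ⟨C, h0, hC⟩ := h.sign (-d)
    refine ⟨C * q ^ (2 * d.1), mul_nonneg h0 (zpow_pos hq0 _).le, fun p => ?_⟩
    rw [cf_star, cf_star, ← map_sub, RCLike.norm_conj]
    refine (hC _).trans (le_of_eq ?_)
    rw [mul_assoc, ← zpow_add₀ hq0.ne', Prod.fst_add]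
    congr 2
    ring

theorem IsSymA.mul (h : IsSymA q f T) (h' : IsSymA q f' T') : IsSymA q (f * f') (T * T') := by
  classical
  obtain ⟨F, G, l, h⟩ := h
  obtain ⟨F₀, G', l', h'⟩ := h'
  set F' := F₀ ∪ G'.image em with hF'
  have hb' : Band T' F' := h'.band.mono Finset.subset_union_left
  have hdiag : ∀ s d p, cf (T * T') s s d p
      = ∑ d' ∈ F', cf T s s (d - d') (p + d') * cf T' s s d' p := fun s d p => by
    rw [cf_mul hb', Fintype.sum_bool]
    cases s
    · rw [Finset.sum_eq_zero, zero_add]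
      exact fun d' _ => by rw [show cf T false true _ _ = 0 from h.diag false _ _, zero_mul]
    · rw [add_eq_left]
      exact Finset.sum_eq_zero fun d' _ => by
        rw [show cf T true false _ _ = 0 from h.diag true _ _, zero_mul]
  refine ⟨_, (G ×ˢ G').image fun x => x.1 + x.2, fun m => ∑ m' ∈ G', l (m - m') * l' m',
    h.band.mul hb', ?_, ?_, ?_, ?_, ?_⟩
  · intro m hm
    refine Finset.sum_eq_zero fun m' hm' => ?_
    rw [h.supp, zero_mul]
    exact fun h1 => hm (Finset.mem_image.2 ⟨(m - m', m'), Finset.mk_mem_product h1 hm', by simp⟩)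
  · intro z
    have hz : (z : ℂ) ≠ 0 := Circle.coe_ne_zero z
    simp only [Finset.sum_mul]
    rw [Finset.sum_comm, ContinuousMap.mul_apply, h.eval, h'.eval, Finset.mul_sum]
    refine Finset.sum_congr rfl fun m' hm' => ?_
    have e : ∀ m, l (m - m') * l' m' * (z : ℂ) ^ m
        = (l (m - m') * (z : ℂ) ^ (m - m')) * (l' m' * (z : ℂ) ^ m') := fun m => by
      rw [zpow_sub₀ hz]
      field_simp
    simp only [e, ← Finset.sum_mul]
    congr 1
    have hsub : G.image (fun m => m + m') ⊆ (G ×ˢ G').image fun x => x.1 + x.2 := fun m hm => by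
      obtain ⟨m₁, h1, rfl⟩ := Finset.mem_image.1 hm
      exact Finset.mem_image.2 ⟨(m₁, m'), Finset.mk_mem_product h1 hm', rfl⟩
    rw [← Finset.sum_subset hsub, Finset.sum_image (add_left_injective m').injOn]
    · simp
    · intro m _ hm
      rw [h.supp, zero_mul]
      exact fun h1 => hm (Finset.mem_image.2 ⟨m - m', h1, by simp⟩)
  · intro s d
    rw [show cf (T * T') s s d = _ from funext fun p => hdiag s d p]
    have := SymC.sum (A := F') hq0 fun d' _ => symC_mul_term hq0 (h.sym s (d - d')) (h'.sym s d')
    convert this using 1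
    have hsub : G'.image em ⊆ F' := Finset.subset_union_right
    rw [← Finset.sum_subset hsub, Finset.sum_image em_injective.injOn]
    · have e : ∀ m', d - em m' = em (d - em m').1 ↔ d = em d.1 := fun m' => by
        rw [sub_eq_iff_eq_add]
        simp [em]
      simp only [e]
      split_ifs with hd
      · exact Finset.sum_congr rfl fun m' _ => by simp [em]
      · simp
    · intro d' _ hd'
      by_cases h2 : d' = em d'.1
      · rw [if_pos h2, h'.supp d'.1, mul_zero]
        exact fun h3 => hd' (h2 ▸ Finset.mem_image_of_mem _ h3)
      · rw [if_neg h2, mul_zero]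
  · intro s d p
    rw [cf_mul hb']
    refine Finset.sum_eq_zero fun u _ => Finset.sum_eq_zero fun d' _ => ?_
    by_cases hu : u = s
    · subst hu
      rw [h'.diag, mul_zero]
    · obtain rfl : u = !s := by cases s <;> cases u <;> simp_all
      rw [h.diag, zero_mul]
  · intro d
    choose C h0 hC using h.sign
    choose C' h0' hC' using h'.sign
    refine ⟨∑ d' ∈ F', (C (d - d') * q ^ (2 * d'.1) * ‖T'‖ + ‖T‖ * C' d'),
      Finset.sum_nonneg fun d' _ => add_nonneg (mul_nonneg (mul_nonneg (h0 _) (zpow_pos hq0 _).le)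
        (norm_nonneg _)) (mul_nonneg (norm_nonneg _) (h0' _)), fun p => ?_⟩
    rw [hdiag, hdiag, ← Finset.sum_sub_distrib, Finset.sum_mul]
    refine (norm_sum_le _ _).trans (Finset.sum_le_sum fun d' _ => ?_)
    refine (norm_mul_sub_mul_le hq0 (hC _ _) (hC' _ _) (norm_cf_le _ _ _ _ _)
      (norm_cf_le _ _ _ _ _)).trans (le_of_eq ?_)
    rw [Prod.fst_add, mul_add, zpow_add₀ hq0.ne']
    ring

end Circle

/-! ### Orders of decay -/

section Decay

variable {q : ℝ} {ι : Type}

/-- The family `c` is `O(q^{e/2})` on `D`. -/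
def OB (q : ℝ) (D : ι → Prop) (c : ι → ℂ) (e : ι → ℤ) : Prop :=
  ∃ K : ℝ, 0 ≤ K ∧ ∀ i, D i → ‖c i‖ ≤ K * √q ^ e i

variable (hq0 : 0 < q) (hq1 : q < 1) {D : ι → Prop} {c c' : ι → ℂ} {e e' : ι → ℤ}

include hq0

theorem sqrt_pos : 0 < √q := Real.sqrt_pos.2 hq0

theorem sq_sqrt_zpow (m : ℤ) : √q ^ (2 * m) = q ^ m := by
  rw [zpow_mul]
  congr 1
  rw [zpow_ofNat, Real.sq_sqrt hq0.le]

theorem norm_sx_zpow (m : ℤ) : ‖sx q ^ m‖ = √q ^ m := by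
  rw [norm_zpow, sx, Complex.norm_real, Real.norm_of_nonneg (Real.sqrt_nonneg _)]

theorem OB.mul (h : OB q D c e) (h' : OB q D c' e') :
    OB q D (fun i => c i * c' i) (fun i => e i + e' i) := by
  obtain ⟨K, hK, h⟩ := h
  obtain ⟨K', hK', h'⟩ := h'
  refine ⟨K * K', by positivity, fun i hi => ?_⟩
  rw [norm_mul, zpow_add₀ (sqrt_pos hq0).ne']
  have := zpow_pos (sqrt_pos hq0) (e i)
  calc _ ≤ (K * √q ^ e i) * (K' * √q ^ e' i) :=
        mul_le_mul (h i hi) (h' i hi) (norm_nonneg _) (by positivity)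
    _ = _ := by ring

omit hq0 in
theorem OB.neg (h : OB q D c e) : OB q D (fun i => -c i) e := by
  obtain ⟨K, hK, h⟩ := h
  exact ⟨K, hK, fun i hi => by rw [norm_neg]; exact h i hi⟩

omit hq0 in
theorem OB.add (h : OB q D c e) (h' : OB q D c' e) : OB q D (fun i => c i + c' i) e := by
  obtain ⟨K, hK, h⟩ := h
  obtain ⟨K', hK', h'⟩ := h'
  refine ⟨K + K', by positivity, fun i hi => ?_⟩
  rw [add_mul]
  exact (norm_add_le _ _).trans (add_le_add (h i hi) (h' i hi))

omit hq0 in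
theorem OB.sub (h : OB q D c e) (h' : OB q D c' e) : OB q D (fun i => c i - c' i) e := by
  simp only [sub_eq_add_neg]
  exact h.add h'.neg

omit hq0 in
theorem OB.congr (h : OB q D c e) (h' : ∀ i, D i → c' i = c i) : OB q D c' e := by
  obtain ⟨K, hK, h⟩ := h
  exact ⟨K, hK, fun i hi => by rw [h' i hi]; exact h i hi⟩

include hq1 in
theorem OB.mono (h : OB q D c e) (k : ℤ) (hk : ∀ i, D i → e' i - k ≤ e i) : OB q D c e' := by
  obtain ⟨K, hK, h⟩ := h
  refine ⟨K * √q ^ (-k), mul_nonneg hK (zpow_pos (sqrt_pos hq0) _).le, fun i hi => ?_⟩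
  refine (h i hi).trans ?_
  rw [mul_assoc, ← zpow_add₀ (sqrt_pos hq0).ne']
  refine mul_le_mul_of_nonneg_left ?_ hK
  refine zpow_le_zpow_right_of_le_one₀ (sqrt_pos hq0) ?_ (by linarith [hk i hi])
  exact Real.sqrt_le_one.2 hq1.le

theorem OB.const (a : ℂ) : OB q D (fun _ => a) (fun _ => 0) :=
  ⟨‖a‖, norm_nonneg _, fun i _ => by simp⟩

omit hq0 in
theorem OB.of_norm_le (h : ∀ i, D i → ‖c i‖ ≤ 1) : OB q D c (fun _ => 0) :=
  ⟨1, zero_le_one, fun i hi => by simpa using h i hi⟩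

theorem OB.zpow (m : ι → ℤ) : OB q D (fun i => sx q ^ m i) m :=
  ⟨1, zero_le_one, fun i _ => by rw [norm_sx_zpow hq0, one_mul]⟩

omit hq0 in
theorem OB.ite {P : ι → Prop} [DecidablePred P] (h : OB q (fun i => D i ∧ P i) c e)
    (h' : OB q (fun i => D i ∧ ¬P i) c' e) : OB q D (fun i => if P i then c i else c' i) e := by
  obtain ⟨K, hK, h⟩ := h
  obtain ⟨K', hK', h'⟩ := h'
  refine ⟨max K K', le_max_of_le_left hK, fun i hi => ?_⟩
  have := zpow_nonneg (Real.sqrt_nonneg q) (e i)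
  beta_reduce
  split_ifs with hP
  · exact (h i ⟨hi, hP⟩).trans (mul_le_mul_of_nonneg_right (le_max_left _ _) this)
  · exact (h' i ⟨hi, hP⟩).trans (mul_le_mul_of_nonneg_right (le_max_right _ _) this)

/-- The normalization `√(q⁻¹ - q)`. -/
def kap (q : ℝ) : ℝ := √(q⁻¹ - q)

/-- The function `√(1 - q^{2 i})`, which vanishes for `i ≤ 0`. -/
def rho (q : ℝ) (i : ℤ) : ℝ := √(1 - q ^ (2 * i))

include hq1

theorem kap_pos : 0 < kap q := Real.sqrt_pos.2 (by linarith [qnum_den_neg hq0 hq1])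

theorem kap_sq : kap q ^ 2 = q⁻¹ - q := Real.sq_sqrt (by linarith [qnum_den_neg hq0 hq1])

theorem qnum_eq (i : ℤ) : qnum q i = (√q ^ (-i)) ^ 2 * (1 - q ^ (2 * i)) / kap q ^ 2 := by
  rw [qnum, kap_sq hq0 hq1, ← Int.cast_neg, Real.rpow_intCast, Real.rpow_intCast,
    ← neg_sub q⁻¹ q, div_neg, ← neg_div, ← zpow_natCast, ← zpow_mul, Nat.cast_ofNat, mul_comm (-i),
    sq_sqrt_zpow hq0, mul_sub, ← zpow_add₀ hq0.ne']
  congr 1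
  rw [show -i + 2 * i = i by ring]
  ring

theorem zq_eq (i : ℤ) : zq (sx q) i = sx q ^ (-2 * i) * ((1 - q ^ (2 * i) : ℝ) : ℂ)
    / ((kap q : ℝ) : ℂ) ^ 2 := by
  rw [← cast_qnum hq0 i rfl, qnum_eq hq0 hq1]
  push_cast
  rw [← Complex.ofReal_zpow]
  congr 2
  rw [sx, ← Complex.ofReal_zpow, ← Complex.ofReal_pow]
  congr 1
  rw [← zpow_natCast, ← zpow_mul]
  congr 1
  push_cast
  ring

theorem rq_eq {i : ℤ} (h0 : 0 ≤ i) : rq (sx q) i = sx q ^ (-i) * (rho q i : ℂ) / (kap q : ℂ) := by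
  rw [rq_sx hq0 hq1 i rfl h0, qnum_eq hq0 hq1, Real.sqrt_div' _ (sq_nonneg _),
    Real.sqrt_mul (sq_nonneg _), Real.sqrt_sq (zpow_pos (sqrt_pos hq0) _).le,
    Real.sqrt_sq (kap_pos hq0 hq1).le, sx, rho]
  push_cast
  rfl

theorem zpow_two_le_one {i : ℤ} (h0 : 0 ≤ i) : q ^ (2 * i) ≤ 1 :=
  zpow_le_one₀ hq0 hq1.le (by omega)

theorem rho_nonneg (i : ℤ) : 0 ≤ rho q i := Real.sqrt_nonneg _

theorem rho_le_one (i : ℤ) : rho q i ≤ 1 :=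
  Real.sqrt_le_one.2 (by linarith [zpow_pos hq0 (2 * i)])

theorem rho_of_nonpos {i : ℤ} (h : i ≤ 0) : rho q i = 0 := by
  refine Real.sqrt_eq_zero_of_nonpos ?_
  have := one_le_zpow_of_nonpos₀ hq0 hq1.le (show 2 * i ≤ 0 by omega)
  linarith

theorem rho_sub_one {i : ℤ} (h : 0 ≤ i) : |rho q i - 1| ≤ q ^ (2 * i) := by
  have h1 := rho_le_one hq0 hq1 i
  have h2 := rho_nonneg hq0 hq1 i
  have h3 : rho q i ^ 2 = 1 - q ^ (2 * i) :=
    Real.sq_sqrt (by linarith [zpow_two_le_one hq0 hq1 h])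
  rw [abs_le]
  constructor <;> nlinarith [zpow_pos hq0 (2 * i)]

theorem rho_sub_one' (i : ℤ) : |rho q i - 1| ≤ q ^ i := by
  rcases le_total 0 i with h | h
  · exact (rho_sub_one hq0 hq1 h).trans (zpow_le_zpow_right_of_le_one₀ hq0 hq1.le (by omega))
  · rw [rho_of_nonpos hq0 hq1 h]
    simpa using one_le_zpow_of_nonpos₀ hq0 hq1.le h

theorem norm_zq_le {i : ℤ} (h0 : 0 ≤ i) : ‖zq (sx q) i‖ ≤ (kap q ^ 2)⁻¹ * √q ^ (-2 * i) := by
  have hk := kap_pos hq0 hq1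
  rw [zq_eq hq0 hq1, norm_div, norm_mul, norm_sx_zpow hq0, Complex.norm_real, norm_pow,
    Complex.norm_real, Real.norm_of_nonneg hk.le, Real.norm_of_nonneg
      (by linarith [zpow_two_le_one hq0 hq1 h0]), div_eq_inv_mul]
  have := zpow_pos (sqrt_pos hq0) (-2 * i)
  gcongr
  exact mul_le_of_le_one_right this.le (by linarith [zpow_pos hq0 (2 * i)])

omit hq0 hq1 in
theorem zq_neg_one (x : ℂ) : zq x (-1) = -zq x 1 := by
  simp only [zq]
  ring_nf

theorem ob_zq {m : ι → ℤ} (hm : ∀ i, D i → -1 ≤ m i) :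
    OB q D (fun i => zq (sx q) (m i)) (fun i => -2 * m i) := by
  have hk := kap_pos hq0 hq1
  have hr := sqrt_pos hq0
  refine ⟨(kap q ^ 2)⁻¹ * √q ^ (-4 : ℤ), mul_nonneg (by positivity) (zpow_pos hr _).le,
    fun i hi => ?_⟩
  beta_reduce
  rcases (hm i hi).eq_or_lt with h | h
  · rw [← h, zq_neg_one, norm_neg, mul_assoc, ← zpow_add₀ hr.ne']
    exact norm_zq_le hq0 hq1 (show (0 : ℤ) ≤ 1 by norm_num)
  · refine (norm_zq_le hq0 hq1 (show 0 ≤ m i by omega)).trans ?_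
    rw [mul_assoc]
    gcongr
    have : 1 ≤ √q ^ (-4 : ℤ) := one_le_zpow_of_nonpos₀ hr (Real.sqrt_le_one.2 hq1.le) (by norm_num)
    exact le_mul_of_one_le_left (zpow_pos hr _).le this

theorem ob_rq {m : ι → ℤ} (hm : ∀ i, D i → -1 ≤ m i) :
    OB q D (fun i => rq (sx q) (m i)) (fun i => -m i) := by
  obtain ⟨K, hK, h⟩ := ob_zq hq0 hq1 hm
  refine ⟨√K, Real.sqrt_nonneg _, fun i hi => ?_⟩
  have h1 := h i hi
  beta_reduce at h1 ⊢
  rw [← rq_sq, norm_pow, show -2 * m i = 2 * (-m i) by ring, zpow_mul' _ 2] at h1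
  have hr := zpow_pos (sqrt_pos hq0) (-m i)
  refine (sq_le_sq₀ (norm_nonneg _) (by positivity)).1 (h1.trans (le_of_eq ?_))
  rw [mul_pow, Real.sq_sqrt hK]
  norm_cast

theorem ob_zq_inv {m : ι → ℤ} (hm : ∀ i, D i → 1 ≤ m i) :
    OB q D (fun i => (zq (sx q) (m i))⁻¹) (fun i => 2 * m i) := by
  have hk := kap_pos hq0 hq1
  have h2 : q ^ (2 : ℤ) < 1 := zpow_lt_one₀ hq0 hq1 (by norm_num)
  refine ⟨kap q ^ 2 * (1 - q ^ (2 : ℤ))⁻¹, mul_nonneg (by positivity) (inv_nonneg.2 (by linarith)),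
    fun i hi => ?_⟩
  have h3 : q ^ (2 * m i) ≤ q ^ (2 : ℤ) :=
    zpow_le_zpow_right_of_le_one₀ hq0 hq1.le (by linarith [hm i hi])
  beta_reduce
  rw [zq_eq hq0 hq1, norm_inv, norm_div, norm_mul, norm_sx_zpow hq0, Complex.norm_real, norm_pow,
    Complex.norm_real, Real.norm_of_nonneg hk.le, Real.norm_of_nonneg
      (by linarith), inv_div, neg_mul, zpow_neg, div_eq_mul_inv, mul_inv, inv_inv,
      mul_assoc, mul_comm _ (√q ^ (2 * m i))]
  have h4 := zpow_pos (sqrt_pos hq0) (2 * m i)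
  have h5 : 0 < 1 - q ^ (2 : ℤ) := by linarith
  have h6 : (1 - q ^ (2 * m i))⁻¹ ≤ (1 - q ^ (2 : ℤ))⁻¹ := inv_anti₀ h5 (by linarith)
  calc _ ≤ kap q ^ 2 * (√q ^ (2 * m i) * (1 - q ^ (2 : ℤ))⁻¹) := by gcongr
    _ = _ := by ring

/-- The normalized product of square roots. -/
def ld (q : ℝ) (A B M : ℤ) : ℂ := (rho q A : ℂ) * (rho q B : ℂ) / ((1 - q ^ (2 * M) : ℝ) : ℂ)

theorem rq_mul_rq_div {A B M : ℤ} (hA : 0 ≤ A) (hB : 0 ≤ B) (hM : 1 ≤ M) :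
    rq (sx q) A * rq (sx q) B / zq (sx q) M = sx q ^ (2 * M - A - B) * ld q A B M := by
  have hk : (kap q : ℂ) ≠ 0 := by exact_mod_cast (kap_pos hq0 hq1).ne'
  have hx := sx_ne_zero hq0
  have h2 : ((1 - q ^ (2 * M) : ℝ) : ℂ) ≠ 0 := by
    have : q ^ (2 * M) < 1 := zpow_lt_one₀ hq0 hq1 (by omega)
    exact_mod_cast (by linarith : (1 - q ^ (2 * M) : ℝ) ≠ 0)
  rw [rq_eq hq0 hq1 hA, rq_eq hq0 hq1 hB, zq_eq hq0 hq1, ld,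
    show 2 * M - A - B = (-A) + (-B) + -(-2 * M) by ring, zpow_add₀ hx, zpow_add₀ hx,
    zpow_neg _ (-2 * M)]
  have := zpow_ne_zero (-2 * M) hx
  field_simp

theorem ob_rho {m e : ι → ℤ} (k : ℤ) (hm : ∀ i, D i → 0 ≤ m i)
    (he : ∀ i, D i → e i - k ≤ 4 * m i) : OB q D (fun i => (rho q (m i) : ℂ) - 1) e := by
  refine OB.mono (e := fun i => 4 * m i) hq0 hq1 ⟨1, zero_le_one, fun i hi => ?_⟩ k he
  beta_reduce
  rw [one_mul, show (4 * m i) = 2 * (2 * m i) by ring, sq_sqrt_zpow hq0, ← Complex.ofReal_one,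
    ← Complex.ofReal_sub, Complex.norm_real]
  exact rho_sub_one hq0 hq1 (hm i hi)

theorem ob_den {M e : ι → ℤ} (k : ℤ) (hM : ∀ i, D i → 1 ≤ M i)
    (he : ∀ i, D i → e i - k ≤ 4 * M i) :
    OB q D (fun i => (((1 - q ^ (2 * M i) : ℝ) : ℂ))⁻¹ - 1) e := by
  refine OB.mono (e := fun i => 4 * M i) hq0 hq1
    ⟨(1 - q ^ (2 : ℤ))⁻¹, ?_, fun i hi => ?_⟩ k he
  · have h2 : q ^ (2 : ℤ) < 1 := zpow_lt_one₀ hq0 hq1 (by norm_num)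
    exact inv_nonneg.2 (by linarith)
  · beta_reduce
    rw [show (4 * M i) = 2 * (2 * M i) by ring, sq_sqrt_zpow hq0, ← Complex.ofReal_one,
      ← Complex.ofReal_inv, ← Complex.ofReal_sub, Complex.norm_real]
    have h2 : q ^ (2 : ℤ) < 1 := zpow_lt_one₀ hq0 hq1 (by norm_num)
    have h3 : q ^ (2 * M i) ≤ q ^ (2 : ℤ) :=
      zpow_le_zpow_right_of_le_one₀ hq0 hq1.le (by linarith [hM i hi])
    have h5 : 0 < 1 - q ^ (2 : ℤ) := by linarith
    have h4 := zpow_pos hq0 (2 * M i)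
    have h7 : (1 - q ^ (2 * M i))⁻¹ - 1 = (1 - q ^ (2 * M i))⁻¹ * q ^ (2 * M i) := by
      have : (1 - q ^ (2 * M i)) ≠ 0 := by linarith
      field_simp
      ring
    rw [h7, Real.norm_of_nonneg (mul_nonneg (inv_nonneg.2 (by linarith)) h4.le)]
    gcongr

theorem norm_rho_le (i : ℤ) : ‖(rho q i : ℂ)‖ ≤ 1 := by
  rw [Complex.norm_real, Real.norm_of_nonneg (rho_nonneg hq0 hq1 i)]
  exact rho_le_one hq0 hq1 i

theorem ob_ld_sub {A B M e : ι → ℤ} (k : ℤ) (hA : ∀ i, D i → 0 ≤ A i) (hM : ∀ i, D i → 1 ≤ M i)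
    (heA : ∀ i, D i → e i - k ≤ 4 * A i) (heM : ∀ i, D i → e i - k ≤ 4 * M i) :
    OB q D (fun i => ld q (A i) (B i) (M i) - (rho q (B i) : ℂ)) e := by
  have hA' : OB q D (fun i => (rho q (A i) : ℂ)) fun _ => 0 :=
    OB.of_norm_le fun i _ => norm_rho_le hq0 hq1 _
  have hB' : OB q D (fun i => (rho q (B i) : ℂ)) fun _ => 0 :=
    OB.of_norm_le fun i _ => norm_rho_le hq0 hq1 _
  have h1 := (hB'.mul hq0 (hA'.mul hq0 (ob_den hq0 hq1 k hM heM))).mono hq0 hq1 (e' := e) 0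
    fun i _ => by simp
  have h2 := (hB'.mul hq0 (ob_rho hq0 hq1 k hA heA)).mono hq0 hq1 (e' := e) 0 fun i _ => by simp
  refine (h1.add h2).congr fun i _ => ?_
  rw [ld]
  ring

theorem ob_ld {A B M : ι → ℤ} (hM : ∀ i, D i → 1 ≤ M i) :
    OB q D (fun i => ld q (A i) (B i) (M i)) (fun _ => 0) := by
  have h1 : OB q D (fun i => (rho q (A i) : ℂ)) fun _ => 0 :=
    OB.of_norm_le fun i _ => norm_rho_le hq0 hq1 _
  have h2 : OB q D (fun i => (rho q (B i) : ℂ)) fun _ => 0 :=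
    OB.of_norm_le fun i _ => norm_rho_le hq0 hq1 _
  have h3 := (ob_den (e := fun _ => 0) hq0 hq1 (D := D) 0 hM fun i hi => by linarith [hM i hi]).add
    (OB.const hq0 1)
  refine ((h1.mul hq0 h2).mul hq0 h3).congr fun i _ => ?_
  rw [ld]
  ring

theorem ob_ld_sub_one {A B M e : ι → ℤ} (k : ℤ) (hA : ∀ i, D i → 0 ≤ A i)
    (hB : ∀ i, D i → 0 ≤ B i) (hM : ∀ i, D i → 1 ≤ M i)
    (heA : ∀ i, D i → e i - k ≤ 4 * A i) (heB : ∀ i, D i → e i - k ≤ 4 * B i)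
    (heM : ∀ i, D i → e i - k ≤ 4 * M i) :
    OB q D (fun i => ld q (A i) (B i) (M i) - 1) e :=
  ((ob_ld_sub hq0 hq1 k hA hM heA heM).add (ob_rho hq0 hq1 k hB heB)).congr fun i _ => by ring

end Decay

/-! ### Decay of the structure constants -/

section CoefDecay

variable {q : ℝ} (hq0 : 0 < q) (hq1 : q < 1) {ι : Type} {D : ι → Prop} {c : ι → ℂ}
  {e m m' n k a b : ι → ℤ}

include hq0 hq1

theorem ob_div_zq (h : OB q D c e) (hm : ∀ i, D i → 1 ≤ m i) :
    OB q D (fun i => c i / zq (sx q) (m i)) (fun i => e i + 2 * m i) :=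
  (h.mul hq0 (ob_zq_inv hq0 hq1 hm)).congr fun i _ => div_eq_mul_inv _ _

theorem ob_div_zq_two (h : OB q D c e) (hm : ∀ i, D i → 1 ≤ m i) (hm' : ∀ i, D i → 1 ≤ m' i) :
    OB q D (fun i => c i / (zq (sx q) (m i) * zq (sx q) (m' i)))
      (fun i => e i + 2 * m i + 2 * m' i) :=
  (ob_div_zq hq0 hq1 (ob_div_zq hq0 hq1 h hm) hm').congr fun i _ => by rw [div_div]

theorem ob_rq_two (hm : ∀ i, D i → -1 ≤ m i) (hm' : ∀ i, D i → -1 ≤ m' i) :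
    OB q D (fun i => rq (sx q) (m i) * rq (sx q) (m' i)) (fun i => -m i + -m' i) :=
  (ob_rq hq0 hq1 hm).mul hq0 (ob_rq hq0 hq1 hm')

section SecondPair

variable (h : ∀ i, D i → 0 ≤ n i - k i - b i ∧ -1 ≤ n i - k i + b i ∧ -1 ≤ k i ∧ -1 ≤ n i)

include h

theorem ob_cp : OB q D (fun i => cp (sx q) (n i) (k i) (b i))
    (fun i => 2 * b i + 2 * n i - 2 * k i) := by
  simp only [cp]
  refine OB.ite ?_ ?_ <;>
  refine OB.mono hq0 hq1 (ob_div_zq hq0 hq1 (OB.mul hq0 (OB.neg (OB.zpow hq0 _))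
    (ob_rq_two hq0 hq1 ?_ ?_)) ?_) 100 ?_ <;>
  (intro i hi; have := h i hi.1; omega)

theorem ob_cm : OB q D (fun i => cm (sx q) (n i) (k i) (b i))
    (fun i => 2 * b i + 2 * n i + 2 * k i) := by
  simp only [cm]
  refine OB.ite ?_ ?_ <;>
  refine OB.mono hq0 hq1 (ob_div_zq hq0 hq1 (OB.mul hq0 (OB.neg (OB.zpow hq0 _))
    (ob_rq_two hq0 hq1 ?_ ?_)) ?_) 100 ?_ <;>
  (intro i hi; have := h i hi.1; omega)

theorem ob_cz : OB q D (fun i => cz (sx q) (n i) (k i) (b i)) (fun i => 4 * n i) := by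
  simp only [cz]
  refine OB.ite ?_ ?_
  · refine OB.mono hq0 hq1 (ob_div_zq_two hq0 hq1 (OB.mul hq0 (OB.mul hq0 (OB.const hq0 _)
      (OB.zpow hq0 _)) (ob_rq_two hq0 hq1 ?_ ?_)) ?_ ?_) 100 ?_ <;>
    (intro i hi; have := h i hi.1; omega)
  · refine OB.mono hq0 hq1 (ob_div_zq_two hq0 hq1 (OB.mul hq0 (OB.neg (OB.mul hq0 (OB.const hq0 _)
      (OB.zpow hq0 _))) (ob_rq_two hq0 hq1 ?_ ?_)) ?_ ?_) 100 ?_ <;>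
    (intro i hi; have := h i hi.1; omega)

theorem ob_hz (hk : ∀ i, D i → 0 ≤ k i) :
    OB q D (fun i => hz (sx q) (n i) (k i) (b i)) (fun i => 4 * n i - 4 * k i) := by
  simp only [hz]
  refine OB.ite ?_ ?_ <;>
  refine OB.mono hq0 hq1 (ob_div_zq_two hq0 hq1 (OB.sub
    (OB.mono hq0 hq1 (e' := fun i => -4 * n i - 4 * k i) (OB.mul hq0 (ob_zq hq0 hq1 ?_)
      (ob_zq hq0 hq1 ?_)) 100 ?_)
    (OB.mono hq0 hq1 (OB.mul hq0 (OB.const hq0 _) (OB.mul hq0 (ob_zq hq0 hq1 ?_)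
      (ob_zq hq0 hq1 ?_))) 100 ?_)) ?_ ?_) 100 ?_ <;>
  (intro i hi; have := h i hi.1; have := hk i hi.1; omega)

theorem ob_dc_one {σ : ℂ} :
    OB q D (fun i => dc (sx q) σ 1 (n i) (k i) (b i)) (fun i => 4 * n i) := by
  simp only [dc]
  refine OB.ite ?_ ?_ <;>
  refine OB.mono hq0 hq1 (ob_div_zq_two hq0 hq1 (OB.mul hq0 (OB.mul hq0 (OB.const hq0 _)
    (OB.zpow hq0 _)) (ob_rq_two hq0 hq1 ?_ ?_)) ?_ ?_) 100 ?_ <;>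
  (intro i hi; have := h i hi.1; omega)

theorem ob_dc_two {σ : ℂ} :
    OB q D (fun i => dc (sx q) σ 2 (n i) (k i) (b i)) (fun i => 4 * n i + 4 * b i) := by
  simp only [dc]
  refine OB.ite ?_ ?_ <;>
  refine OB.mono hq0 hq1 (ob_div_zq hq0 hq1 (OB.mul hq0 (OB.neg (OB.zpow hq0 _))
    (ob_rq_two hq0 hq1 ?_ ?_)) ?_) 100 ?_ <;>
  (intro i hi; have := h i hi.1; omega)

end SecondPair

theorem ob_hp
    (h : ∀ i, D i → -1 ≤ n i - k i - b i ∧ -2 ≤ n i - k i + b i ∧ 0 ≤ k i ∧ -1 ≤ n i) :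
    OB q D (fun i => hp (sx q) (n i) (k i) (b i)) (fun i => 2 * b i + 2 * n i - 2 * k i) := by
  simp only [hp]
  refine OB.ite ?_ ?_ <;>
  refine OB.mono hq0 hq1 (ob_div_zq hq0 hq1 (OB.mul hq0 (OB.zpow hq0 _)
    (ob_rq_two hq0 hq1 ?_ ?_)) ?_) 100 ?_ <;>
  (intro i hi; have := h i hi.1; omega)

omit hq0 hq1 in
theorem bc_zero_eq (x : ℂ) (k a : ℤ) : bc x 0 k a = x ^ (2 * a) * (x ^ (-2 * k - 1) / zq x (2 * k + 3))
    * (rq x (k + a + 3) * rq x (k + a + 2)) := by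
  simp only [bc, gB, fs, es, dd, rev0, Matrix.cons_val]
  ring_nf

omit hq0 hq1 in
theorem bc_one_eq (x : ℂ) (k a : ℤ) : bc x 1 k a = x ^ (2 * a) * ((1 + x ^ (4 : ℤ))
    / (zq x (2 * k + 1) * zq x (2 * k + 3))) * (rq x (k + a + 2) * rq x (k - a)) := by
  simp only [bc, gB, fs, es, dd, rev1, Matrix.cons_val]
  ring_nf

omit hq0 hq1 in
theorem bc_two_eq (x : ℂ) (k a : ℤ) : bc x 2 k a = x ^ (2 * a) * (-x ^ (2 * k + 3) / zq x (2 * k + 1))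
    * (rq x (k - a - 1) * rq x (k - a)) := by
  simp only [bc, gB, fs, es, dd, rev2, Matrix.cons_val]
  ring_nf

section FirstPair

variable (h : ∀ i, D i → 0 ≤ k i ∧ -k i - 1 ≤ a i ∧ a i ≤ k i)

include h

theorem ob_ac_one : OB q D (fun i => ac (sx q) 1 (k i) (a i)) (fun i => 4 * k i) := by
  simp only [ac, Matrix.cons_val]
  refine OB.mono hq0 hq1 (ob_div_zq_two hq0 hq1 (OB.mul hq0 (OB.const hq0 _) (OB.sub
    (OB.mono hq0 hq1 (e' := fun i => -4 * k i) (OB.mul hq0 (OB.mul hq0 (OB.zpow hq0 _)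
      (OB.const hq0 _)) (ob_zq hq0 hq1 ?_)) 100 ?_)
    (OB.mono hq0 hq1 (ob_zq hq0 hq1 ?_) 100 ?_))) ?_ ?_) 100 ?_ <;>
  (intro i hi; have := h i hi; omega)

theorem ob_ac (j : Fin 3) :
    OB q D (fun i => ac (sx q) j (k i) (a i)) (fun i => 2 * k i + 2 * a i) := by
  fin_cases j
  · refine OB.mono hq0 hq1 (ob_div_zq hq0 hq1 (OB.mul hq0 (OB.zpow hq0 _)
      (ob_rq_two hq0 hq1 ?_ ?_)) ?_) 100 ?_ <;>
    (intro i hi; have := h i hi; omega)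
  · exact (ob_ac_one hq0 hq1 h).mono hq0 hq1 100 fun i hi => by have := h i hi; omega
  · refine OB.mono hq0 hq1 (ob_div_zq hq0 hq1 (OB.mul hq0 (OB.zpow hq0 _)
      (ob_rq_two hq0 hq1 ?_ ?_)) ?_) 100 ?_ <;>
    (intro i hi; have := h i hi; omega)

theorem ob_bc_zero : OB q D (fun i => bc (sx q) 0 (k i) (a i)) (fun i => 0) := by
  simp only [bc_zero_eq]
  refine OB.mono hq0 hq1 (OB.mul hq0 (OB.mul hq0 (OB.zpow hq0 _) (ob_div_zq hq0 hq1
    (OB.zpow hq0 _) ?_)) (ob_rq_two hq0 hq1 ?_ ?_)) 100 ?_ <;>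
  (intro i hi; have := h i hi; omega)

theorem ob_bc_one : OB q D (fun i => bc (sx q) 1 (k i) (a i)) (fun i => 6 * k i + 2 * a i) := by
  simp only [bc_one_eq]
  refine OB.mono hq0 hq1 (OB.mul hq0 (OB.mul hq0 (OB.zpow hq0 _) (ob_div_zq_two hq0 hq1
    (OB.const hq0 _) ?_ ?_)) (ob_rq_two hq0 hq1 ?_ ?_)) 100 ?_ <;>
  (intro i hi; have := h i hi; omega)

theorem ob_bc_two : OB q D (fun i => bc (sx q) 2 (k i) (a i)) (fun i => 4 * k i + 4 * a i) := by
  simp only [bc_two_eq]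
  refine OB.mono hq0 hq1 (OB.mul hq0 (OB.mul hq0 (OB.zpow hq0 _) (ob_div_zq hq0 hq1
    (OB.neg (OB.zpow hq0 _)) ?_)) (ob_rq_two hq0 hq1 ?_ ?_)) 100 ?_ <;>
  (intro i hi; have := h i hi; omega)

end FirstPair

end CoefDecay

section GeneratorDecay

variable {q : ℝ} (hq0 : 0 < q) (hq1 : q < 1)

theorem lab_bounds {p : Lat} (h : Lab p) : 0 ≤ p.2.2.2 ∧ p.2.2.2 ≤ p.1 ∧ -p.2.2.2 - 1 ≤ p.2.1 ∧
    p.2.1 ≤ p.2.2.2 ∧ p.2.2.2 - p.1 - 1 ≤ p.2.2.1 ∧ p.2.2.1 ≤ p.1 - p.2.2.2 := h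

include hq0 in
theorem OB.le_ge {D : Lat → Prop} {c : Lat → ℂ}
    (h : OB q D c (fun p => 2 * (p.1 + p.2.1 + p.2.2.1))) :
    ∃ C, 0 ≤ C ∧ ∀ p, D p → ‖c p‖ ≤ C * ge q p := by
  obtain ⟨K, hK, h⟩ := h
  refine ⟨K * q ^ (-2 : ℤ), mul_nonneg hK (zpow_pos hq0 _).le, fun p hp => (h p hp).trans ?_⟩
  rw [sq_sqrt_zpow hq0, mul_assoc]
  refine mul_le_mul_of_nonneg_left ?_ hK
  rw [ge, mul_add, ← zpow_add₀ hq0.ne', show -2 + (wt p + ut p) = p.1 + p.2.1 + p.2.2.1 by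
    simp only [wt, ut]; ring]
  exact le_add_of_nonneg_right (mul_nonneg (zpow_pos hq0 _).le (zpow_pos hq0 _).le)

include hq0 in
theorem OB.le_ge' {D : Lat → Prop} {c : Lat → ℂ} (h : OB q D c (fun p => 2 * p.1)) :
    ∃ C, 0 ≤ C ∧ ∀ p, D p → ‖c p‖ ≤ C * ge q p := by
  obtain ⟨K, hK, h⟩ := h
  refine ⟨K, hK, fun p hp => (h p hp).trans ?_⟩
  rw [sq_sqrt_zpow hq0]
  refine mul_le_mul_of_nonneg_left ?_ hK
  exact le_add_of_nonneg_left (zpow_pos hq0 _).le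

include hq0 in
theorem OB.le_zpow {D : Lat → Prop} {c : Lat → ℂ} (h : OB q D c (fun p => 4 * p.1)) :
    ∃ C, 0 ≤ C ∧ ∀ p, D p → ‖c p‖ ≤ C * q ^ (2 * p.1) := by
  obtain ⟨K, hK, h⟩ := h
  refine ⟨K, hK, fun p hp => (h p hp).trans (le_of_eq ?_)⟩
  rw [← sq_sqrt_zpow hq0]
  congr 2
  ring

/-- The weights of `x_0`, `x_1` and `x_2`. -/
def c0 (q : ℝ) (α : Fin 3 × Fin 3) : LatFun := fun s p =>
  ac (sx q) α.1 p.2.2.2 p.2.1 * yc (sx q) (csgn s) α.1 α.2 p.1 p.2.2.2 p.2.2.1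

/-- The weights of `x_1`. -/
def c1 (q : ℝ) (α : Fin 3 × Fin 3) : LatFun := fun s p =>
  bc (sx q) α.1 p.2.2.2 p.2.1 * yc (sx q) (csgn s) α.1 α.2 p.1 p.2.2.2 p.2.2.1

/-- The weights of `x_2`. -/
def c2 (q : ℝ) (j : Fin 3) : LatFun := fun s p => dc (sx q) (csgn s) j p.1 p.2.2.2 p.2.2.1

include hq0 hq1

theorem ob_yc_one (i : Fin 3) (s : Bool) :
    OB q Lab (fun p => yc (sx q) (csgn s) i 1 p.1 p.2.2.2 p.2.2.1)
      (fun p => if i = 1 then 4 * p.1 - 4 * p.2.2.2 else 4 * p.1) := by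
  fin_cases i
  · refine (((OB.const hq0 (csgn s)).mul hq0 (ob_cz (n := fun p : Lat => p.1)
      (k := fun p => p.2.2.2) (b := fun p => p.2.2.1) hq0 hq1 (D := Lab) ?_)).neg).mono hq0 hq1 0 ?_
    all_goals intro p hp; have := lab_bounds hp; simp; try omega
  · refine ((OB.const hq0 (csgn s)).mul hq0 (ob_hz (n := fun p : Lat => p.1)
      (k := fun p => p.2.2.2) (b := fun p => p.2.2.1) hq0 hq1 (D := Lab) ?_ ?_)).mono hq0 hq1 0 ?_
    all_goals intro p hp; have := lab_bounds hp; simp; try omega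
  · refine (((OB.const hq0 (csgn s)).mul hq0 (ob_cz (n := fun p : Lat => p.1)
      (k := fun p => p.2.2.2 - 1) (b := fun p => p.2.2.1) hq0 hq1 (D := Lab) ?_)).neg).mono
        hq0 hq1 0 ?_
    all_goals intro p hp; have := lab_bounds hp; simp; try omega

theorem ob_yc (i j : Fin 3) (hj : j ≠ 1) (s : Bool) :
    OB q Lab (fun p => yc (sx q) (csgn s) i j p.1 p.2.2.2 p.2.2.1)
      (fun p => 2 * p.2.2.1 + 2 * p.1 - 2 * p.2.2.2) := by
  fin_cases i <;> fin_cases j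
  · refine (ob_cp (n := fun p : Lat => p.1)
      (k := fun p => p.2.2.2) (b := fun p => p.2.2.1) hq0 hq1 (D := Lab) ?_)
    all_goals intro p hp; have := lab_bounds hp; omega
  · exact absurd rfl hj
  · refine (ob_cm (n := fun p : Lat => p.1) (k := fun p => p.2.2.2) (b := fun p => p.2.2.1)
      hq0 hq1 (D := Lab) ?_).mono hq0 hq1 100 ?_
    all_goals intro p hp; have := lab_bounds hp; omega
  · refine (ob_hp (n := fun p : Lat => p.1) (k := fun p => p.2.2.2) (b := fun p => p.2.2.1)
      hq0 hq1 (D := Lab) ?_)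
    all_goals intro p hp; have := lab_bounds hp; omega
  · exact absurd rfl hj
  · refine (ob_hp (n := fun p : Lat => p.1 - 1) (k := fun p => p.2.2.2) (b := fun p => p.2.2.1)
      hq0 hq1 (D := Lab) ?_).mono hq0 hq1 100 ?_
    all_goals intro p hp; have := lab_bounds hp; omega
  · refine (ob_cm (n := fun p : Lat => p.1 + 1) (k := fun p => p.2.2.2 - 1)
      (b := fun p => p.2.2.1) hq0 hq1 (D := Lab) ?_).mono hq0 hq1 100 ?_
    all_goals intro p hp; have := lab_bounds hp; omega
  · exact absurd rfl hj
  · refine (ob_cp (n := fun p : Lat => p.1 - 1) (k := fun p => p.2.2.2 - 1)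
      (b := fun p => p.2.2.1) hq0 hq1 (D := Lab) ?_).mono hq0 hq1 100 ?_
    all_goals intro p hp; have := lab_bounds hp; omega

theorem ob_ac_lab (i : Fin 3) :
    OB q Lab (fun p => ac (sx q) i p.2.2.2 p.2.1) (fun p => 2 * p.2.2.2 + 2 * p.2.1) :=
  ob_ac (k := fun p : Lat => p.2.2.2) (a := fun p => p.2.1) hq0 hq1 (D := Lab)
    (fun p hp => by have := lab_bounds hp; omega) i

theorem ob_c0_one (i : Fin 3) (s : Bool) : OB q Lab (c0 q (i, 1) s) (fun p => 4 * p.1) := by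
  by_cases hi : i = 1
  · subst hi
    exact ((ob_ac_one (k := fun p : Lat => p.2.2.2) (a := fun p => p.2.1) hq0 hq1 (D := Lab)
      (fun p hp => by have := lab_bounds hp; omega)).mul hq0 (ob_yc_one hq0 hq1 1 s)).mono
      hq0 hq1 100 fun p hp => by simp
  · refine ((ob_ac_lab hq0 hq1 i).mul hq0 (ob_yc_one hq0 hq1 i s)).mono hq0 hq1 100 fun p hp => ?_
    have := lab_bounds hp
    simp only [if_neg hi]
    omega

theorem c0_le (α : Fin 3 × Fin 3) (s : Bool) :
    ∃ C, 0 ≤ C ∧ ∀ p, Lab p → ‖c0 q α s p‖ ≤ C * ge q p := by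
  obtain ⟨i, j⟩ := α
  by_cases hj : j = 1
  · subst hj
    exact ((ob_c0_one hq0 hq1 i s).mono hq0 hq1 100 fun p hp => by
      have := lab_bounds hp; omega).le_ge' hq0
  · exact (((ob_ac_lab hq0 hq1 i).mul hq0 (ob_yc hq0 hq1 i j hj s)).mono hq0 hq1 100 fun p hp => by
      omega).le_ge hq0

omit hq0 hq1 in
theorem yc_sign {x : ℂ} {i j : Fin 3} (hj : j ≠ 1) (σ σ' : ℂ) (n k b : ℤ) :
    yc x σ i j n k b = yc x σ' i j n k b := by
  fin_cases j
  · fin_cases i <;> simp [yc]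
  · exact absurd rfl hj
  · fin_cases i <;> simp [yc]

theorem c0_sign (α : Fin 3 × Fin 3) :
    ∃ C, 0 ≤ C ∧ ∀ p, Lab p → ‖c0 q α true p - c0 q α false p‖ ≤ C * q ^ (2 * p.1) := by
  obtain ⟨i, j⟩ := α
  by_cases hj : j = 1
  · subst hj
    exact ((ob_c0_one hq0 hq1 i true).sub (ob_c0_one hq0 hq1 i false)).le_zpow hq0
  · refine ⟨0, le_rfl, fun p _ => ?_⟩
    simp [c0, yc_sign hj (csgn true) (csgn false)]

theorem ob_c1_one (i : Fin 3) (s : Bool) : OB q Lab (c1 q (i, 1) s) (fun p => 4 * p.1) := by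
  fin_cases i
  · exact ((ob_bc_zero (k := fun p : Lat => p.2.2.2) (a := fun p => p.2.1) hq0 hq1 (D := Lab)
      (fun p hp => by have := lab_bounds hp; omega)).mul hq0 (ob_yc_one hq0 hq1 0 s)).mono
      hq0 hq1 100 fun p hp => by simp
  · refine ((ob_bc_one (k := fun p : Lat => p.2.2.2) (a := fun p => p.2.1) hq0 hq1 (D := Lab)
      (fun p hp => by have := lab_bounds hp; omega)).mul hq0 (ob_yc_one hq0 hq1 1 s)).mono
      hq0 hq1 100 fun p hp => ?_
    have := lab_bounds hp
    simp only [if_true]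
    omega
  · refine ((ob_bc_two (k := fun p : Lat => p.2.2.2) (a := fun p => p.2.1) hq0 hq1 (D := Lab)
      (fun p hp => by have := lab_bounds hp; omega)).mul hq0 (ob_yc_one hq0 hq1 2 s)).mono
      hq0 hq1 100 fun p hp => ?_
    have := lab_bounds hp
    simp only [show (2 : Fin 3) ≠ 1 by decide, if_false]
    omega

theorem c1_le (α : Fin 3 × Fin 3) (hα : α ≠ (0, 0)) (s : Bool) :
    ∃ C, 0 ≤ C ∧ ∀ p, Lab p → ‖c1 q α s p‖ ≤ C * ge q p := by
  obtain ⟨i, j⟩ := α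
  by_cases hj : j = 1
  · subst hj
    exact ((ob_c1_one hq0 hq1 i s).mono hq0 hq1 100 fun p hp => by
      have := lab_bounds hp; omega).le_ge' hq0
  · have hb := ob_yc hq0 hq1 i j hj s
    fin_cases i
    · obtain rfl : j = 2 := by fin_cases j <;> simp_all
      refine (((ob_bc_zero (k := fun p : Lat => p.2.2.2) (a := fun p => p.2.1) hq0 hq1 (D := Lab)
        ?_).mul hq0 (ob_cm (n := fun p : Lat => p.1) (k := fun p => p.2.2.2) (b := fun p => p.2.2.1)
        hq0 hq1 (D := Lab) ?_)).mono hq0 hq1 100 ?_).le_ge hq0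
      all_goals intro p hp; have := lab_bounds hp; omega
    · refine (((ob_bc_one (k := fun p : Lat => p.2.2.2) (a := fun p => p.2.1) hq0 hq1 (D := Lab)
        ?_).mul hq0 hb).mono hq0 hq1 100 ?_).le_ge hq0
      all_goals intro p hp; have := lab_bounds hp; omega
    · refine (((ob_bc_two (k := fun p : Lat => p.2.2.2) (a := fun p => p.2.1) hq0 hq1 (D := Lab)
        ?_).mul hq0 hb).mono hq0 hq1 100 ?_).le_ge hq0
      all_goals intro p hp; have := lab_bounds hp; omega

theorem c1_sign (α : Fin 3 × Fin 3) :
    ∃ C, 0 ≤ C ∧ ∀ p, Lab p → ‖c1 q α true p - c1 q α false p‖ ≤ C * q ^ (2 * p.1) := by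
  obtain ⟨i, j⟩ := α
  by_cases hj : j = 1
  · subst hj
    exact ((ob_c1_one hq0 hq1 i true).sub (ob_c1_one hq0 hq1 i false)).le_zpow hq0
  · refine ⟨0, le_rfl, fun p _ => ?_⟩
    simp [c1, yc_sign hj (csgn true) (csgn false)]

theorem ob_c2_one (s : Bool) : OB q Lab (c2 q 1 s) (fun p => 4 * p.1) := by
  refine ob_dc_one (n := fun p : Lat => p.1) (k := fun p => p.2.2.2) (b := fun p => p.2.2.1)
    hq0 hq1 (D := Lab) ?_
  intro p hp; have := lab_bounds hp; omega

theorem c2_le (j : Fin 3) (hj : j ≠ 0) (s : Bool) :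
    ∃ C, 0 ≤ C ∧ ∀ p, Lab p → ‖c2 q j s p‖ ≤ C * ge q p := by
  fin_cases j
  · exact absurd rfl hj
  · exact ((ob_c2_one hq0 hq1 s).mono hq0 hq1 100 fun p hp => by
      have := lab_bounds hp; omega).le_ge' hq0
  · refine ((ob_dc_two (n := fun p : Lat => p.1) (k := fun p => p.2.2.2) (b := fun p => p.2.2.1)
      hq0 hq1 (D := Lab) ?_).mono hq0 hq1 100 ?_).le_ge hq0
    all_goals intro p hp; have := lab_bounds hp; omega

theorem c2_sign (j : Fin 3) :
    ∃ C, 0 ≤ C ∧ ∀ p, Lab p → ‖c2 q j true p - c2 q j false p‖ ≤ C * q ^ (2 * p.1) := by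
  by_cases hj : j = 1
  · subst hj
    exact ((ob_c2_one hq0 hq1 true).sub (ob_c2_one hq0 hq1 false)).le_zpow hq0
  · refine ⟨0, le_rfl, fun p _ => ?_⟩
    have : c2 q j true p = c2 q j false p := by
      simp only [c2, dc]
      fin_cases j <;> first | rfl | exact absurd rfl hj
    simp [this]

omit hq1 in
theorem sx_zpow_two (m : ℤ) : sx q ^ (2 * m) = ((q ^ m : ℝ) : ℂ) := by
  rw [sx, ← Complex.ofReal_zpow, sq_sqrt_zpow hq0]

/-- The leading symbol of `x_1`. -/
def sym1 (q : ℝ) (w : ℤ) : ℂ := if w < 0 then 0 else -((q ^ (if Even w then w else w - 1) : ℝ) : ℂ)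

/-- The leading symbol of `x_2`. -/
def sym2 (q : ℝ) (w : ℤ) : ℂ := (rho q (if Even w then w + 2 else w + 1) : ℂ)

theorem c1_lead (s : Bool) :
    ∃ C, 0 ≤ C ∧ ∀ p, Lab p → ‖c1 q (0, 0) s p - sym1 q (wt p)‖ ≤ C * ge q p := by
  have main : ∀ (D : Lat → Prop) (A B : Lat → ℤ), (∀ p, D p → Lab p) →
      (∀ p, D p → p.1 + p.2.2.2 + p.2.2.1 + 4 ≤ A p) →
      (∀ p, D p → p.1 + p.2.2.2 - p.2.2.1 + 3 ≤ B p) →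
      OB q D (fun p => ld q (p.2.2.2 + p.2.1 + 3) (p.2.2.2 + p.2.1 + 2) (2 * p.2.2.2 + 3)
        * ld q (A p) (B p) (2 * p.1 + 5) - 1) (fun p => 2 * p.2.2.2 + 2 * p.2.1) := by
    intro D A B hD hA hB
    have h1 : OB q D (fun p => ld q (p.2.2.2 + p.2.1 + 3) (p.2.2.2 + p.2.1 + 2) (2 * p.2.2.2 + 3) - 1)
        (fun p => 2 * p.2.2.2 + 2 * p.2.1) := by
      refine ob_ld_sub_one hq0 hq1 100 ?_ ?_ ?_ ?_ ?_ ?_ <;>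
      (intro p hp; have := lab_bounds (hD p hp); omega)
    have h2 : OB q D (fun p => ld q (A p) (B p) (2 * p.1 + 5) - 1)
        (fun p => 2 * p.2.2.2 + 2 * p.2.1) := by
      refine ob_ld_sub_one hq0 hq1 100 ?_ ?_ ?_ ?_ ?_ ?_ <;>
      (intro p hp; have := lab_bounds (hD p hp); have := hA p hp; have := hB p hp; omega)
    have h3 : OB q D (fun p => ld q (A p) (B p) (2 * p.1 + 5)) fun _ => 0 :=
      ob_ld hq0 hq1 fun p hp => by have := lab_bounds (hD p hp); omega
    exact ((h1.mul hq0 h3).mono hq0 hq1 0 (fun p _ => by simp)).add h2 |>.congr fun p _ => by ring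
  have hbc : ∀ p, Lab p → bc (sx q) 0 p.2.2.2 p.2.1
      = ld q (p.2.2.2 + p.2.1 + 3) (p.2.2.2 + p.2.1 + 2) (2 * p.2.2.2 + 3) := fun p hp => by
    have hl := lab_bounds hp
    have hx := sx_ne_zero hq0
    have e := rq_mul_rq_div hq0 hq1 (A := p.2.2.2 + p.2.1 + 3) (B := p.2.2.2 + p.2.1 + 2)
      (M := 2 * p.2.2.2 + 3) (by omega) (by omega) (by omega)
    rw [bc_zero_eq, show sx q ^ (2 * p.2.1) * (sx q ^ (-2 * p.2.2.2 - 1) / zq (sx q) (2 * p.2.2.2 + 3))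
      * (rq (sx q) (p.2.2.2 + p.2.1 + 3) * rq (sx q) (p.2.2.2 + p.2.1 + 2))
      = sx q ^ (2 * p.2.1) * sx q ^ (-2 * p.2.2.2 - 1) * (rq (sx q) (p.2.2.2 + p.2.1 + 3)
        * rq (sx q) (p.2.2.2 + p.2.1 + 2) / zq (sx q) (2 * p.2.2.2 + 3)) by ring, e, ← mul_assoc,
      ← zpow_add₀ hx, ← zpow_add₀ hx]
    rw [show 2 * p.2.1 + (-2 * p.2.2.2 - 1) + (2 * (2 * p.2.2.2 + 3) - (p.2.2.2 + p.2.1 + 3)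
      - (p.2.2.2 + p.2.1 + 2)) = 0 by ring, zpow_zero, one_mul]
  have key : OB q Lab (fun p => c1 q (0, 0) s p - sym1 q (wt p))
      (fun p => 2 * (p.1 + p.2.1 + p.2.2.1)) := by
    have h1 := ((OB.zpow hq0 (D := fun p => Lab p ∧ Even (p.1 - p.2.2.2 - p.2.2.1))
      (fun p => 2 * (wt p - 1))).neg.mul hq0 (main _ (fun p => p.1 + p.2.2.2 + p.2.2.1 + 5)
        (fun p => p.1 + p.2.2.2 - p.2.2.1 + 3) (fun p hp => hp.1) (fun p _ => by omega)
        (fun p _ => by omega))).mono hq0 hq1 (e' := fun p => 2 * (p.1 + p.2.1 + p.2.2.1)) 100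
        fun p _ => by simp only [wt]; omega
    have h2 := ((OB.zpow hq0 (D := fun p => Lab p ∧ ¬Even (p.1 - p.2.2.2 - p.2.2.1))
      (fun p => 2 * wt p)).neg.mul hq0 (main _ (fun p => p.1 + p.2.2.2 + p.2.2.1 + 4)
        (fun p => p.1 + p.2.2.2 - p.2.2.1 + 4) (fun p hp => hp.1) (fun p _ => by omega)
        (fun p _ => by omega))).mono hq0 hq1 (e' := fun p => 2 * (p.1 + p.2.1 + p.2.2.1)) 100
        fun p _ => by simp only [wt]; omega
    refine (OB.ite h1 h2).congr fun p hp => ?_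
    have hl := lab_bounds hp
    have hx := sx_ne_zero hq0
    have hw : ¬wt p < 0 := by simp only [wt]; omega
    rw [show c1 q (0, 0) s p = bc (sx q) 0 p.2.2.2 p.2.1 * cp (sx q) p.1 p.2.2.2 p.2.2.1 from rfl,
      hbc p hp, sym1, if_neg hw, cp]
    by_cases hE : Even (p.1 - p.2.2.2 - p.2.2.1)
    · have hE' : ¬Even (wt p) := by simp only [wt]; grind
      rw [if_pos hE, if_pos hE, if_neg hE', mul_div_assoc, rq_mul_rq_div hq0 hq1 (by omega)
        (by omega) (by omega), ← sx_zpow_two hq0, ← mul_assoc, ← mul_assoc]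
      rw [show 2 * (wt p - 1) = 2 * p.2.2.1 - 2 + (2 * (2 * p.1 + 5) - (p.1 + p.2.2.2 + p.2.2.1 + 5)
        - (p.1 + p.2.2.2 - p.2.2.1 + 3)) by simp only [wt]; ring, zpow_add₀ hx]
      ring
    · have hE' : Even (wt p) := by simp only [wt]; grind
      rw [if_neg hE, if_neg hE, if_pos hE', mul_div_assoc, rq_mul_rq_div hq0 hq1 (by omega)
        (by omega) (by omega), ← sx_zpow_two hq0, ← mul_assoc, ← mul_assoc]
      rw [show 2 * wt p = 2 * p.2.2.1 + (2 * (2 * p.1 + 5) - (p.1 + p.2.2.2 + p.2.2.1 + 4)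
        - (p.1 + p.2.2.2 - p.2.2.1 + 4)) by simp only [wt]; ring, zpow_add₀ hx]
      ring
  exact key.le_ge hq0

theorem c2_lead (s : Bool) :
    ∃ C, 0 ≤ C ∧ ∀ p, Lab p → ‖c2 q 0 s p - sym2 q (wt p)‖ ≤ C * ge q p := by
  have key : OB q Lab (fun p => c2 q 0 s p - sym2 q (wt p))
      (fun p => 2 * (p.1 + p.2.1 + p.2.2.1)) := by
    have h1 : OB q (fun p => Lab p ∧ Even (p.1 - p.2.2.2 - p.2.2.1))
        (fun p => ld q (p.1 + p.2.2.2 + p.2.2.1 + 5) (p.1 - p.2.2.2 + p.2.2.1 + 2) (2 * p.1 + 5)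
          - (rho q (p.1 - p.2.2.2 + p.2.2.1 + 2) : ℂ)) (fun p => 2 * (p.1 + p.2.1 + p.2.2.1)) := by
      refine ob_ld_sub hq0 hq1 100 ?_ ?_ ?_ ?_ <;>
      (intro p hp; have := lab_bounds hp.1; omega)
    have h2 : OB q (fun p => Lab p ∧ ¬Even (p.1 - p.2.2.2 - p.2.2.1))
        (fun p => ld q (p.1 + p.2.2.2 + p.2.2.1 + 4) (p.1 - p.2.2.2 + p.2.2.1 + 3) (2 * p.1 + 5)
          - (rho q (p.1 - p.2.2.2 + p.2.2.1 + 3) : ℂ)) (fun p => 2 * (p.1 + p.2.1 + p.2.2.1)) := by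
      refine ob_ld_sub hq0 hq1 100 ?_ ?_ ?_ ?_ <;>
      (intro p hp; have := lab_bounds hp.1; omega)
    refine (OB.ite h1 h2).congr fun p hp => ?_
    have hl := lab_bounds hp
    have hx := sx_ne_zero hq0
    simp only [c2, dc, sym2, Matrix.cons_val]
    by_cases hE : Even (p.1 - p.2.2.2 - p.2.2.1)
    · have hE' : ¬Even (wt p) := by simp only [wt]; grind
      rw [if_pos hE, if_pos hE, if_neg hE', mul_div_assoc, rq_mul_rq_div hq0 hq1 (by omega)
        (by omega) (by omega), ← mul_assoc, ← zpow_add₀ hx]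
      rw [show 2 * p.2.2.1 - 2 * p.1 - 3 + (2 * (2 * p.1 + 5) - (p.1 + p.2.2.2 + p.2.2.1 + 5)
        - (p.1 - p.2.2.2 + p.2.2.1 + 2)) = 0 by ring, zpow_zero, one_mul,
        show wt p + 1 = p.1 - p.2.2.2 + p.2.2.1 + 2 by simp only [wt]; ring]
    · have hE' : Even (wt p) := by simp only [wt]; grind
      rw [if_neg hE, if_neg hE, if_pos hE', mul_div_assoc, rq_mul_rq_div hq0 hq1 (by omega)
        (by omega) (by omega), ← mul_assoc, ← zpow_add₀ hx]
      rw [show 2 * p.2.2.1 - 2 * p.1 - 3 + (2 * (2 * p.1 + 5) - (p.1 + p.2.2.2 + p.2.2.1 + 4)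
        - (p.1 - p.2.2.2 + p.2.2.1 + 3)) = 0 by ring, zpow_zero, one_mul,
        show wt p + 2 = p.1 - p.2.2.2 + p.2.2.1 + 3 by simp only [wt]; ring]
  exact key.le_ge hq0

end GeneratorDecay

/-! ### The symbols of the represented algebra -/

section Expansion

variable {q : ℝ} (hq0 : 0 < q) {ι : Type} [Fintype ι] {T : SpinorSpace →L[ℂ] SpinorSpace}
  {dα : ι → Lat} {c : ι → LatFun}

open Classical in
theorem cf_of_expansion (hT : ∀ t p, Lab p → T (kv t p) = ∑ α, c α t p • kv t (p + dα α))
    (s t : Bool) (d p : Lat) : cf T s t d p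
      = ∑ α, if s = t ∧ d = dα α ∧ Lab p ∧ Lab (p + d) then c α t p else 0 := by
  by_cases h : Lab p
  · rw [cf, hT t p h, map_sum]
    simp only [Finset.sum_apply, map_smul, Pi.smul_apply, smul_eq_mul, toFn_kv_apply]
    refine Finset.sum_congr rfl fun α _ => ?_
    by_cases h1 : s = t ∧ d = dα α ∧ Lab p ∧ Lab (p + d)
    · obtain ⟨h2, h3, h4, h5⟩ := h1
      rw [if_pos ⟨h2, by rw [h3], h3 ▸ h5⟩, mul_one, if_pos ⟨h2, h3, h4, h5⟩]
    · rw [if_neg h1, if_neg, mul_zero]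
      rintro ⟨h2, h3, h4⟩
      have h5 : d = dα α := add_left_cancel h3
      exact h1 ⟨h2, h5, h, h5 ▸ h4⟩
  · rw [cf_eq_zero s t fun h' => h h'.1, Finset.sum_eq_zero]
    exact fun α _ => if_neg fun h' => h h'.2.2.1

variable {L : ι → ℂ} {f : C(Circle, ℂ)} {G : Finset ℤ} {l : ℤ → ℂ}

include hq0

open Classical in
theorem symA_of_expansion (hT : ∀ t p, Lab p → T (kv t p) = ∑ α, c α t p • kv t (p + dα α))
    (hgood : ∀ α, Good (dα α) (c α))
    (hsym : ∀ α t, ∃ (Ψ : ℤ → ℂ) (C : ℝ), 0 ≤ C ∧ (∀ w, ‖Ψ w‖ ≤ C) ∧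
      (∀ w, ‖Ψ w - L α‖ ≤ C * q ^ w) ∧ (∀ p, Lab p → ‖c α t p - Ψ (wt p)‖ ≤ C * ge q p) ∧
      ∀ p, ¬Lab p → Lab (p + dα α) → ‖Ψ (wt p)‖ ≤ C * ge q p)
    (hsign : ∀ α, ∃ C, 0 ≤ C ∧ ∀ p, Lab p → ‖c α true p - c α false p‖ ≤ C * q ^ (2 * p.1))
    (hsupp : ∀ m, m ∉ G → l m = 0) (heval : ∀ z : Circle, f z = ∑ m ∈ G, l m * (z : ℂ) ^ m)
    (hl : ∀ d, ∑ α, (if d = dα α then L α else 0) = if d = em d.1 then l d.1 else 0) :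
    SymA q f T (Finset.univ.image dα) G l := by
  have e := cf_of_expansion hT
  refine ⟨fun s t d p hd => ?_, hsupp, heval, fun s d => ?_, fun s d p => ?_, fun d => ?_⟩
  · rw [e]
    refine Finset.sum_eq_zero fun α _ => if_neg ?_
    rintro ⟨-, rfl, -⟩
    exact hd (Finset.mem_image_of_mem _ (Finset.mem_univ α))
  · rw [← hl]
    refine SymC.congr (SymC.sum hq0 (c := fun α p =>
      if s = s ∧ d = dα α ∧ Lab p ∧ Lab (p + d) then c α s p else 0) fun α _ => ?_) (e s s d)
    by_cases hd : d = dα α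
    · subst hd
      rw [if_pos rfl]
      obtain ⟨Ψ, C, h0, h1, h2, h3, h4⟩ := hsym α s
      refine ⟨Ψ, C, h0, h1, h2, fun p hp => ?_⟩
      beta_reduce
      by_cases hl : Lab p
      · refine le_trans (le_of_eq ?_) (h3 p hl)
        by_cases hl' : Lab (p + dα α)
        · rw [if_pos ⟨rfl, rfl, hl, hl'⟩]
        · rw [if_neg (by tauto), hgood α s p hl hl']
      · rw [if_neg (by tauto), zero_sub, norm_neg]
        exact h4 p hl (hp.resolve_left hl)
    · rw [if_neg hd]
      exact (SymC.zero hq0 d).congr fun p => if_neg fun h => hd h.2.1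
  · rw [e]
    refine Finset.sum_eq_zero fun α _ => if_neg ?_
    rintro ⟨h, -⟩
    cases s <;> simp at h
  · choose C h0 hC using hsign
    refine ⟨∑ α, C α, Finset.sum_nonneg fun α _ => h0 α, fun p => ?_⟩
    rw [e, e, ← Finset.sum_sub_distrib, Finset.sum_mul]
    refine (norm_sum_le _ _).trans (Finset.sum_le_sum fun α _ => ?_)
    have hz := mul_nonneg (h0 α) (zpow_pos hq0 (2 * p.1)).le
    by_cases h : d = dα α ∧ Lab p ∧ Lab (p + d)
    · rw [if_pos ⟨rfl, h⟩, if_pos ⟨rfl, h⟩]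
      exact hC α p h.2.1
    · rw [if_neg fun h' => h h'.2, if_neg fun h' => h h'.2, sub_zero, norm_zero]
      exact hz

end Expansion

section Generators

variable {q : ℝ} (hq0 : 0 < q) (hq1 : q < 1)

theorem spinorRep_x_zero (t : Bool) (p : Lat) (hp : Lab p) : spinorRep hq0 hq1 (sphereX q 0) (kv t p)
    = ∑ α : Fin 3 × Fin 3, c0 q α t p • kv t (p + (dd α.2, 0, 0, dd α.1)) := by
  rw [spinorRep_x, show (((opData hq0 hq1).genX 0 : Module.End ℂ finM)) (km t p) = _ from
    rp_km_two (elt_rp (isAdj_X0 hq0 hq1)) (good_X0 (sx q)) t hp, Fintype.sum_prod_type]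
  simp only [Submodule.coe_sum, Submodule.coe_smul]
  rfl

theorem spinorRep_x_one (t : Bool) (p : Lat) (hp : Lab p) : spinorRep hq0 hq1 (sphereX q 1) (kv t p)
    = ∑ α : Fin 3 × Fin 3, c1 q α t p • kv t (p + (dd α.2, 1, 0, dd α.1)) := by
  rw [spinorRep_x, show (((opData hq0 hq1).genX 1 : Module.End ℂ finM)) (km t p) = _ from
    rp_km_two (elt_rp (isAdj_X1 (sx q))) (good_X1 (sx q)) t hp, Fintype.sum_prod_type]
  simp only [Submodule.coe_sum, Submodule.coe_smul]
  rfl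

theorem spinorRep_x_two (t : Bool) (p : Lat) (hp : Lab p) : spinorRep hq0 hq1 (sphereX q 2) (kv t p)
    = ∑ j : Fin 3, c2 q j t p • kv t (p + (dd j, 0, 1, 0)) := by
  rw [spinorRep_x, show (((opData hq0 hq1).genX 2 : Module.End ℂ finM)) (km t p) = _ from
    rp_km (elt_rp (isAdj_X2 (sx q))) (good_X2 (sx q)) t hp]
  simp only [Submodule.coe_sum, Submodule.coe_smul]
  rfl

include hq0 in
theorem error_sym {c : Lat → ℂ} {d : Lat}
    (h : ∃ C, 0 ≤ C ∧ ∀ p, Lab p → ‖c p‖ ≤ C * ge q p) :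
    ∃ (Ψ : ℤ → ℂ) (C : ℝ), 0 ≤ C ∧ (∀ w, ‖Ψ w‖ ≤ C) ∧
      (∀ w, ‖Ψ w - 0‖ ≤ C * q ^ w) ∧ (∀ p, Lab p → ‖c p - Ψ (wt p)‖ ≤ C * ge q p) ∧
      ∀ p, ¬Lab p → Lab (p + d) → ‖Ψ (wt p)‖ ≤ C * ge q p := by
  obtain ⟨C, h0, h⟩ := h
  refine ⟨fun _ => 0, C, h0, fun _ => by simpa using h0,
    fun w => by simpa using mul_nonneg h0 (zpow_pos hq0 w).le, fun p hp => by simpa using h p hp,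
    fun p _ _ => by simpa using mul_nonneg h0 (ge_pos hq0 p).le⟩

include hq0 hq1

theorem norm_sym1_le (w : ℤ) : ‖sym1 q w‖ ≤ q⁻¹ * q ^ w := by
  have h1 : q⁻¹ * q ^ w = q ^ (w - 1) := by rw [zpow_sub_one₀ hq0.ne', mul_comm]
  rw [h1, sym1]
  split_ifs with h2 h3
  · simpa using (zpow_pos hq0 _).le
  · rw [norm_neg, Complex.norm_real, Real.norm_of_nonneg (zpow_pos hq0 _).le]
    exact zpow_le_zpow_right_of_le_one₀ hq0 hq1.le (by omega)
  · rw [norm_neg, Complex.norm_real, Real.norm_of_nonneg (zpow_pos hq0 _).le]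

theorem norm_sym1_le' (w : ℤ) : ‖sym1 q w‖ ≤ q⁻¹ := by
  by_cases h : w < 0
  · rw [sym1, if_pos h, norm_zero]; exact inv_nonneg.2 hq0.le
  · refine (norm_sym1_le hq0 hq1 w).trans (mul_le_of_le_one_right (inv_nonneg.2 hq0.le) ?_)
    exact zpow_le_one₀ hq0 hq1.le (by omega)

theorem isSymA_x0 : IsSymA q 0 (spinorRep hq0 hq1 (sphereX q 0)) :=
  ⟨_, ∅, fun _ => 0, symA_of_expansion hq0 (L := fun _ => 0) (spinorRep_x_zero hq0 hq1)
    (fun α => good_X0 (sx q) α.1 α.2) (fun α t => error_sym hq0 (c0_le hq0 hq1 α t))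
    (c0_sign hq0 hq1) (fun _ _ => rfl) (fun z => by simp) (fun d => by simp)⟩

theorem isSymA_x1 : IsSymA q 0 (spinorRep hq0 hq1 (sphereX q 1)) := by
  refine ⟨_, ∅, fun _ => 0, symA_of_expansion hq0 (L := fun _ => 0) (spinorRep_x_one hq0 hq1)
    (fun α => good_X1 (sx q) α.1 α.2) (fun α t => ?_)
    (c1_sign hq0 hq1) (fun _ _ => rfl) (fun z => by simp) (fun d => by simp)⟩
  by_cases hα : α = (0, 0)
  · subst hα
    obtain ⟨C, h0, hC⟩ := c1_lead hq0 hq1 t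
    have hq : 0 ≤ q⁻¹ := inv_nonneg.2 hq0.le
    have hq2 : 0 ≤ q⁻¹ ^ 2 := sq_nonneg _
    refine ⟨sym1 q, C + q⁻¹ + q⁻¹ ^ 2, by positivity, fun w => ?_, fun w => ?_, fun p hp => ?_,
      fun p hp hp' => ?_⟩
    · exact (norm_sym1_le' hq0 hq1 w).trans (by linarith)
    · rw [sub_zero]
      refine (norm_sym1_le hq0 hq1 w).trans ?_
      have := (zpow_pos hq0 w).le
      gcongr
      linarith
    · refine (hC p hp).trans ?_
      have := (ge_pos hq0 p).le
      gcongr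
      linarith
    · refine (norm_sym1_le hq0 hq1 _).trans ?_
      have hl := lab_bounds hp'
      have hu : ut p ≤ 0 := by
        by_contra hu
        refine hp ?_
        simp only [dd, Prod.fst_add, Prod.snd_add, Matrix.cons_val_zero, add_zero] at hl
        simp only [ut] at hu
        refine ⟨?_, ?_, ?_, ?_, ?_, ?_⟩ <;> omega
      have h1 : q ^ wt p ≤ ge q p := by
        refine le_add_of_le_of_nonneg ?_ (zpow_pos hq0 _).le
        exact zpow_le_zpow_right_of_le_one₀ hq0 hq1.le (by omega)
      have h2 := (zpow_pos hq0 (wt p)).le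
      gcongr
      linarith
  · exact error_sym hq0 (c1_le hq0 hq1 α hα t)

theorem isSymA_x2 : IsSymA q circleU (spinorRep hq0 hq1 (sphereX q 2)) := by
  classical
  refine ⟨_, {1}, fun m => if m = 1 then 1 else 0, symA_of_expansion hq0
    (L := fun j => if j = 0 then 1 else 0) (spinorRep_x_two hq0 hq1)
    (fun j => good_X2 (sx q) j) (fun j t => ?_)
    (c2_sign hq0 hq1) (fun m hm => if_neg fun h => hm (by simp [h])) (fun z => by simp [circleU]; rfl)
    (fun d => ?_)⟩
  · by_cases hj : j = 0
    · subst hj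
      obtain ⟨C, h0, hC⟩ := c2_lead hq0 hq1 t
      refine ⟨sym2 q, C + 1, by positivity, fun w => ?_, fun w => ?_, fun p hp => ?_,
        fun p hp hp' => ?_⟩
      · exact (norm_rho_le hq0 hq1 _).trans (by linarith)
      · rw [if_pos rfl, sym2, ← Complex.ofReal_one, ← Complex.ofReal_sub, Complex.norm_real]
        refine (rho_sub_one' hq0 hq1 _).trans ?_
        have h1 := (zpow_pos hq0 w).le
        have h2 : q ^ (if Even w then w + 2 else w + 1) ≤ q ^ w :=
          zpow_le_zpow_right_of_le_one₀ hq0 hq1.le (by split_ifs <;> omega)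
        nlinarith
      · refine (hC p hp).trans ?_
        have := (ge_pos hq0 p).le
        gcongr
        linarith
      · have hl := lab_bounds hp'
        simp only [dd, Prod.fst_add, Prod.snd_add, Matrix.cons_val_zero, add_zero] at hl
        have hw : wt p = -1 ∨ wt p = -2 := by
          by_contra hw
          refine hp ?_
          simp only [wt] at hw
          refine ⟨?_, ?_, ?_, ?_, ?_, ?_⟩ <;> omega
        have : sym2 q (wt p) = 0 := by
          rcases hw with hw | hw <;> rw [hw, sym2]
          · rw [if_neg (by decide), rho_of_nonpos hq0 hq1 (by norm_num), Complex.ofReal_zero]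
          · rw [if_pos (by decide), rho_of_nonpos hq0 hq1 (by norm_num), Complex.ofReal_zero]
        rw [this, norm_zero]
        exact mul_nonneg (by positivity) (ge_pos hq0 p).le
    · simp only [if_neg hj]
      exact error_sym hq0 (c2_le hq0 hq1 j hj t)
  · rw [Finset.sum_eq_single 0]
    · by_cases hd : d = (1, 0, 1, 0)
      · subst hd
        simp [dd, em]
      · rw [if_neg (by simpa [dd] using hd)]
        by_cases h1 : d.1 = 1
        · rw [if_neg]
          rw [h1]
          exact hd
        · simp [h1]
    · intro j _ hj
      simp [hj]
    · simp

theorem isSymA_spinorRep (a : SphereAlg q) : IsSymA q (sphereSymbol q a) (spinorRep hq0 hq1 a) := by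
  obtain ⟨a, rfl⟩ := PresentedStarAlg.mkAlg_surjective (SphereRel q) a
  have hs : ∀ b, sphereSymbol q (PresentedStarAlg.mkAlg (SphereRel q) b)
      = FreeStarAlg.lift symbolGen b := fun b => PresentedStarAlg.lift_mk _ _ _ b
  have hgen : ∀ i : Fin 3, IsSymA q (symbolGen i) (spinorRep hq0 hq1 (sphereX q i)) := by
    intro i
    fin_cases i
    · exact isSymA_x0 hq0 hq1
    · exact isSymA_x1 hq0 hq1
    · exact isSymA_x2 hq0 hq1
  rw [hs]
  set φ := FreeStarAlg.lift symbolGen with hφ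
  set ψ : FreeStarAlg (Fin 3) →⋆ₐ[ℂ] (SpinorSpace →L[ℂ] SpinorSpace) :=
    (spinorRep hq0 hq1).comp (PresentedStarAlg.mk (SphereRel q)) with hψ
  change IsSymA q (φ a) (ψ a)
  refine FreeAlgebra.induction (R := ℂ) (X := Fin 3 × Bool)
    (motive := fun a : FreeStarAlg (Fin 3) => IsSymA q (φ a) (ψ a)) ?_ ?_ ?_ ?_ a
  · intro c
    have h1 : φ (algebraMap ℂ (FreeStarAlg (Fin 3)) c) = algebraMap ℂ _ c := AlgHomClass.commutes φ c
    have h2 : ψ (algebraMap ℂ (FreeStarAlg (Fin 3)) c) = algebraMap ℂ _ c := AlgHomClass.commutes ψ c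
    have := IsSymA.of_algebraMap hq0 c
    rw [← h1, ← h2] at this
    exact this
  · rintro ⟨i, b⟩
    have h1 : IsSymA q (φ (FreeStarAlg.gen i)) (ψ (FreeStarAlg.gen i)) := by
      rw [hφ, FreeStarAlg.lift_gen]
      exact hgen i
    cases b
    · exact h1
    · have h3 : (FreeStarAlg.symb (i, true) : FreeStarAlg (Fin 3)) = star (FreeStarAlg.gen i) :=
        (FreeStarAlg.star_symb (i, false)).symm
      have h2 := h1.star hq0
      rw [← map_star, ← map_star, ← h3] at h2
      exact h2
  · intro a b ha hb
    have h1 : φ (a * b) = φ a * φ b := map_mul φ a b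
    have h2 : ψ (a * b) = ψ a * ψ b := map_mul ψ a b
    have := ha.mul hq0 hb
    rw [← h1, ← h2] at this
    exact this
  · intro a b ha hb
    have h1 : φ (a + b) = φ a + φ b := map_add φ a b
    have h2 : ψ (a + b) = ψ a + ψ b := map_add ψ a b
    have := ha.add hq0 hb
    rw [← h1, ← h2] at this
    exact this

end Generators

/-! ### Regularity -/

section Regularity

variable {q : ℝ} (hq0 : 0 < q) (hq1 : q < 1) {f : C(Circle, ℂ)} {T S : SpinorSpace →L[ℂ] SpinorSpace}

theorem nat_mul_pow_le (hq0 : 0 < q) (hq1 : q < 1) :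
    ∃ C : ℝ, 0 ≤ C ∧ ∀ n : ℤ, 0 ≤ n → ((n : ℝ) + 2) * q ^ (2 * n) ≤ C * q ^ n := by
  have h1 := tendsto_self_mul_const_pow_of_lt_one hq0.le hq1
  obtain ⟨C, hC⟩ := h1.bddAbove_range
  have hC' : ∀ n : ℕ, (n : ℝ) * q ^ n ≤ C := fun n => hC ⟨n, rfl⟩
  have hC0 : 0 ≤ C := by simpa using hC' 0
  refine ⟨C + 2, by positivity, fun n hn => ?_⟩
  lift n to ℕ using hn
  have e : q ^ (2 * (n : ℤ)) = q ^ n * q ^ n := by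
    rw [two_mul, zpow_add₀ hq0.ne', zpow_natCast]
  rw [e, zpow_natCast, ← mul_assoc]
  refine mul_le_mul_of_nonneg_right ?_ (pow_nonneg hq0.le n)
  have h2 : q ^ n ≤ 1 := pow_le_one₀ hq0.le hq1.le
  have h3 := hC' n
  push_cast
  nlinarith

include hq0 hq1

theorem SymA.flip_le {F : Finset Lat} {G : Finset ℤ} {l : ℤ → ℂ} (h : SymA q f T F G l) (d : Lat) :
    ∃ C, 0 ≤ C ∧ ∀ s p, ‖((p.1 : ℂ) + 2) * (cf T (!s) (!s) d p - cf T s s d p)‖ ≤ C * q ^ p.1 := by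
  obtain ⟨C, h0, hC⟩ := h.sign d
  obtain ⟨K, hK, hK'⟩ := nat_mul_pow_le hq0 hq1
  refine ⟨C * K, by positivity, fun s p => ?_⟩
  by_cases hp : Lab p
  · have hn : 0 ≤ p.1 := by have := lab_bounds hp; omega
    have e : ‖(p.1 : ℂ) + 2‖ = (p.1 : ℝ) + 2 := by
      rw [← Complex.ofReal_intCast, ← Complex.ofReal_ofNat, ← Complex.ofReal_add, Complex.norm_real]
      refine Real.norm_of_nonneg ?_
      have : (0 : ℝ) ≤ p.1 := by exact_mod_cast hn
      positivity
    have h1 : ‖cf T (!s) (!s) d p - cf T s s d p‖ ≤ C * q ^ (2 * p.1) := by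
      cases s
      · exact hC p
      · rw [norm_sub_rev]; exact hC p
    rw [norm_mul, e]
    have h2 : (0 : ℝ) ≤ (p.1 : ℝ) + 2 := by
      have : (0 : ℝ) ≤ p.1 := by exact_mod_cast hn
      positivity
    calc _ ≤ ((p.1 : ℝ) + 2) * (C * q ^ (2 * p.1)) := by gcongr
      _ = C * (((p.1 : ℝ) + 2) * q ^ (2 * p.1)) := by ring
      _ ≤ C * (K * q ^ p.1) := by exact mul_le_mul_of_nonneg_left (hK' _ hn) h0
      _ = _ := by ring
  · rw [cf_eq_zero _ _ fun h => hp h.1, cf_eq_zero _ _ fun h => hp h.1]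
    simpa using mul_nonneg (mul_nonneg h0 hK) (zpow_pos hq0 p.1).le

omit hq0 hq1 in
theorem SymA.cf_commutator {F : Finset Lat} {G : Finset ℤ} {l : ℤ → ℂ} (h : SymA q f T F G l)
    (s t : Bool) (d p : Lat) :
    ((p.1 : ℂ) + d.1 + 2) * cf T (!s) t d p - ((p.1 : ℂ) + 2) * cf T s (!t) d p
      = if t = !s then (d.1 : ℂ) * cf T (!s) (!s) d p
        + ((p.1 : ℂ) + 2) * (cf T (!s) (!s) d p - cf T s s d p) else 0 := by
  split_ifs with hst
  · subst hst
    rw [Bool.not_not]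
    ring
  · obtain rfl : t = s := by cases s <;> cases t <;> simp_all
    have h1 := h.diag t d p
    have h2 := h.diag (!t) d p
    rw [Bool.not_not] at h2
    rw [h1, h2]
    ring

theorem SymA.exists_commutator {F : Finset Lat} {G : Finset ℤ} {l : ℤ → ℂ} (h : SymA q f T F G l) :
    ∃ S, IsCommutator dirac T S ∧ Band S F := by
  choose C h0 hC using h.flip_le hq0 hq1
  have hb : ∀ d ∈ F, ‖(d.1 : ℂ)‖ ≤ ∑ d ∈ F, ‖(d.1 : ℂ)‖ := fun d hd =>
    Finset.single_le_sum (f := fun d : Lat => ‖(d.1 : ℂ)‖) (fun _ _ => norm_nonneg _) hd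
  have hb0 : 0 ≤ ∑ d ∈ F, ‖(d.1 : ℂ)‖ := Finset.sum_nonneg fun _ _ => norm_nonneg _
  have hc : ∀ d ∈ F, C d ≤ ∑ d ∈ F, C d := fun d hd =>
    Finset.single_le_sum (f := C) (fun d _ => h0 d) hd
  have hc0 : 0 ≤ ∑ d ∈ F, C d := Finset.sum_nonneg fun d _ => h0 d
  obtain ⟨S, hS, hS'⟩ := exists_of_cf F (fun s t d p =>
    ((p.1 : ℂ) + d.1 + 2) * cf T (!s) t d p - ((p.1 : ℂ) + 2) * cf T s (!t) d p)
    (C := (∑ d ∈ F, ‖(d.1 : ℂ)‖) * ‖T‖ + ∑ d ∈ F, C d) (fun s t d p => by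
      rw [h.cf_commutator]
      split_ifs
      · by_cases hd : d ∈ F
        · by_cases hp : Lab p
          · refine (norm_add_le _ _).trans (add_le_add ?_ ?_)
            · rw [norm_mul]
              exact mul_le_mul (hb d hd) (norm_cf_le T _ _ d p) (norm_nonneg _) hb0
            · refine ((hC d s p).trans (mul_le_of_le_one_right (h0 d) ?_)).trans (hc d hd)
              exact zpow_le_one₀ hq0 hq1.le (by have := lab_bounds hp; omega)
          · rw [cf_eq_zero _ _ fun h => hp h.1, cf_eq_zero _ _ fun h => hp h.1, sub_zero, mul_zero,
              mul_zero, add_zero, norm_zero]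
            positivity
        · rw [h.band _ _ _ _ hd, h.band _ _ _ _ hd, sub_zero, mul_zero, mul_zero, add_zero, norm_zero]
          positivity
      · rw [norm_zero]; positivity)
    (fun s t d p hp => by rw [cf_eq_zero _ _ hp, cf_eq_zero _ _ hp]; ring)
    (fun s t d p hd => by rw [h.band _ _ _ _ hd, h.band _ _ _ _ hd]; ring)
  exact ⟨S, isCommutator_dirac h.band hS hS', hS⟩

theorem SymA.isSym_commutator {F : Finset Lat} {G : Finset ℤ} {l : ℤ → ℂ} (h : SymA q f T F G l)
    (hS : IsCommutator dirac T S) : IsSym q S := by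
  have e : ∀ s t d p, cf S s t d p = _ := fun s t d p =>
    (cf_of_commutator_dirac hS s t d p).trans (h.cf_commutator s t d p)
  refine ⟨F, fun s t d p hd => ?_, fun s t d => ?_⟩
  · rw [cf_of_commutator_dirac hS, h.band _ _ _ _ hd, h.band _ _ _ _ hd]
    ring
  · by_cases hst : t = !s
    · refine ⟨_, SymC.congr (((h.sym (!s) d).smul hq0 (d.1 : ℂ)).add hq0 (L' := 0) (c' := fun p =>
        ((p.1 : ℂ) + 2) * (cf T (!s) (!s) d p - cf T s s d p)) ?_) fun p => by
          rw [e, if_pos hst]⟩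
      obtain ⟨C, h0, hC⟩ := h.flip_le hq0 hq1 d
      refine ⟨fun _ => 0, C, h0, fun _ => by simpa using h0,
        fun w => by simpa using mul_nonneg h0 (zpow_pos hq0 w).le, fun p _ => ?_⟩
      rw [sub_zero]
      refine (hC s p).trans (mul_le_mul_of_nonneg_left ?_ h0)
      exact le_add_of_nonneg_left (zpow_pos hq0 _).le
    · exact ⟨0, (SymC.zero hq0 d).congr fun p => by rw [e, if_neg hst]⟩

theorem bounded_commutator (a : SphereAlg q) :
    ∃ S, IsCommutator dirac (spinorRep hq0 hq1 a) S := by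
  obtain ⟨F, G, l, h⟩ := isSymA_spinorRep hq0 hq1 a
  obtain ⟨S, hS, -⟩ := h.exists_commutator hq0 hq1
  exact ⟨S, hS⟩

theorem isRegularTriple_spinorRep : IsRegularTriple (spinorRep hq0 hq1) dirac absDirac := fun a => by
  obtain ⟨F, G, l, h⟩ := isSymA_spinorRep hq0 hq1 a
  obtain ⟨S, hS, hS'⟩ := h.exists_commutator hq0 hq1
  exact ⟨h.band.opZero, S, hS, hS'.opZero⟩

theorem isSym_of_psiZero {T : SpinorSpace →L[ℂ] SpinorSpace}
    (h : T ∈ PsiZero (spinorRep hq0 hq1) dirac absDirac) : IsSym q T := by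
  refine Algebra.adjoin_induction (fun T hT => ?_) (fun c => ?_) (fun T T' _ _ hT hT' => hT.add hq0 hT')
    (fun T T' _ _ hT hT' => hT.mul hq0 hT') h
  · change PsiGen _ _ _ T at hT
    induction hT with
    | rep a => exact (isSymA_spinorRep hq0 hq1 a).isSym
    | comm a S hS =>
      obtain ⟨F, G, l, h⟩ := isSymA_spinorRep hq0 hq1 a
      exact h.isSym_commutator hq0 hq1 hS
    | delta T S _ hS ih => exact ih.of_commutator hq0 hS
  · rw [Algebra.algebraMap_eq_smul_one]
    exact (IsSym.one hq0).smul hq0 c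

end Regularity

/-! ### Weighted permutations and diagonal operators -/

section Diagonal

variable {ι : Type}

theorem weightedPerm_basisVec {e : ι → ι} {d : ι → ℂ} (he : ∀ i, e (e i) = i) (i : ι) :
    ∃ h : basisVec (e i) ∈ (weightedPerm e d).domain,
      weightedPerm e d ⟨basisVec (e i), h⟩ = d i • basisVec i := by
  have key : ∀ j, d j * (basisVec (e i) : EllTwo ι) (e j) = (d i • (basisVec i : EllTwo ι)) j := fun j => by
    rw [lp.coeFn_smul, Pi.smul_apply, smul_eq_mul, basisVec_apply, basisVec_apply]
    by_cases h : j = i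
    · simp [h]
    · rw [if_neg h, if_neg fun h' => h (by rw [← he j, h', he]), mul_zero, mul_zero]
  refine ⟨?_, lp.ext (funext key)⟩
  change Memℓp (fun j => d j * (basisVec (e i) : EllTwo ι) (e j)) 2
  rw [funext key]
  exact lp.memℓp _

theorem weightedPerm_dense {e : ι → ι} {d : ι → ℂ} (he : ∀ i, e (e i) = i) :
    Dense ((weightedPerm e d).domain : Set (EllTwo ι)) := by
  have h := Submodule.dense_iff_topologicalClosure_eq_top.2 (ellBasis ι).dense_span
  refine h.mono (Submodule.span_le.2 ?_)
  rintro _ ⟨i, rfl⟩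
  obtain ⟨h', -⟩ := weightedPerm_basisVec (d := d) he (e i)
  rw [ellBasis_apply, ← he i]
  exact h'

theorem weightedPerm_isSelfAdjoint {e : ι → ι} {d : ι → ℂ} (he : ∀ i, e (e i) = i)
    (hd : ∀ i, starRingEnd ℂ (d i) = d i) (hde : ∀ i, d (e i) = d i) :
    IsSelfAdjoint (weightedPerm e d) := by
  have hdense := weightedPerm_dense (d := d) he
  rw [LinearPMap.isSelfAdjoint_def]
  refine le_antisymm ?_ (LinearPMap.IsFormalAdjoint.le_adjoint hdense fun v w => ?_)
  · have key : ∀ (y : ((weightedPerm e d).adjoint).domain) (i : ι),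
        d i * (y : EllTwo ι) (e i) = ((weightedPerm e d).adjoint y) i := fun y i => by
      obtain ⟨h, h1⟩ := weightedPerm_basisVec (d := d) he (e i)
      have h2 := LinearPMap.adjoint_isFormalAdjoint hdense y ⟨_, h⟩
      rw [h1, inner_smul_right, hde] at h2
      dsimp only at h2
      simp only [he] at h2
      have h3 := congrArg (starRingEnd ℂ) h2
      rw [map_mul, inner_conj_symm, inner_conj_symm, inner_basisVec, inner_basisVec, hd] at h3
      exact h3.symm
    have hm : ∀ y : ((weightedPerm e d).adjoint).domain, (y : EllTwo ι) ∈ (weightedPerm e d).domain :=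
      fun y => by
        change Memℓp (fun j => d j * (y : EllTwo ι) (e j)) 2
        rw [funext (key y)]
        exact lp.memℓp _
    refine ⟨fun y hy => hm ⟨y, hy⟩, fun y z hyz => ?_⟩
    refine lp.ext (funext fun i => ?_)
    rw [← key y i, hyz]
    rfl
  · rw [lp.inner_eq_tsum, lp.inner_eq_tsum]
    let e' : ι ≃ ι := ⟨e, e, he, he⟩
    rw [← e'.tsum_eq]
    refine tsum_congr fun i => ?_
    change inner ℂ (d (e i) * (v : EllTwo ι) (e (e i))) ((w : EllTwo ι) (e i))
      = inner ℂ ((v : EllTwo ι) i) (d i * (w : EllTwo ι) (e i))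
    simp only [RCLike.inner_apply, map_mul, hde, hd, he]
    ring

theorem norm_diagOp_apply_le {d : ι → ℂ} {C : ℝ} (hC : ∀ i, ‖d i‖ ≤ C) (v : EllTwo ι) :
    ‖diagOp d v‖ ≤ C * ‖v‖ := by
  rw [show diagOp d v = (⟨fun i => d i * v i, memℓp_mul hC v⟩ : EllTwo ι) from
    lp.ext (funext fun i => diagOp_apply hC v i)]
  exact norm_mul_le hC v

open Classical in
theorem diagOp_finite (A : Finset ι) (d : ι → ℂ) : diagOp (fun i => if i ∈ A then d i else 0)
    = ∑ i ∈ A, d i • (innerSL ℂ (basisVec i : EllTwo ι)).smulRight (basisVec i : EllTwo ι) := by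
  have hC : ∀ i, ‖if i ∈ A then d i else 0‖ ≤ ∑ j ∈ A, ‖d j‖ := fun i => by
    split_ifs with h
    · exact Finset.single_le_sum (f := fun j => ‖d j‖) (fun j _ => norm_nonneg _) h
    · rw [norm_zero]
      exact Finset.sum_nonneg fun j _ => norm_nonneg _
  refine ContinuousLinearMap.ext fun v => lp.ext (funext fun i => ?_)
  rw [diagOp_apply hC, sum_apply, lp.coeFn_sum, Finset.sum_apply]
  simp [inner_basisVec, basisVec_apply]

theorem isCompactOperator_diagOp {d : ι → ℂ} {C : ℝ} (hC : ∀ i, ‖d i‖ ≤ C)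
    (h : ∀ ε : ℝ, 0 < ε → {i | ε ≤ ‖d i‖}.Finite) : IsCompactOperator (diagOp d) := by
  classical
  refine (isClosed_setOfPred_isCompactOperator (M₁ := EllTwo ι) (σ₁₂ := RingHom.id ℂ)).closure_subset
    (Metric.mem_closure_iff.2 fun ε hε => ?_)
  set A := (h (ε / 2) (by positivity)).toFinset
  refine ⟨diagOp (fun i => if i ∈ A then d i else 0), ?_, ?_⟩
  · rw [diagOp_finite]
    refine Finset.sum_induction _ (fun T : EllTwo ι →L[ℂ] EllTwo ι => IsCompactOperator T)
      (fun _ _ => IsCompactOperator.add) isCompactOperator_zero fun i _ => IsCompactOperator.smul ?_ (d i)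
    exact (isCompactOperator_of_locallyCompactSpace_rng (M₂ := ℂ)
      (ContinuousLinearMap.toSpanSingleton ℂ (basisVec i : EllTwo ι))).comp_clm
      (innerSL ℂ (basisVec i : EllTwo ι))
  · rw [dist_eq_norm]
    refine lt_of_le_of_lt (ContinuousLinearMap.opNorm_le_bound _ (half_pos hε).le fun v => ?_)
      (half_lt_self hε)
    have h1 : ∀ i, ‖if i ∈ A then 0 else d i‖ ≤ ε / 2 := fun i => by
      split_ifs with hi
      · rw [norm_zero]; positivity
      · simp only [A, Set.Finite.mem_toFinset, Set.mem_ofPred_eq, not_le] at hi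
        exact hi.le
    have h2 : ∀ i, ‖if i ∈ A then d i else 0‖ ≤ C := fun i => by
      split_ifs
      · exact hC i
      · rw [norm_zero]; exact (norm_nonneg _).trans (hC i)
    rw [show (diagOp d - diagOp fun i => if i ∈ A then d i else 0) v
        = diagOp (fun i => if i ∈ A then 0 else d i) v from lp.ext (funext fun i => by
      rw [sub_apply, lp.coeFn_sub, Pi.sub_apply, diagOp_apply hC,
        diagOp_apply h2, diagOp_apply h1]
      split_ifs <;> ring)]
    exact norm_diagOp_apply_le h1 v

end Diagonal

/-! ### The labels of a level -/

section Levels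

/-- Coordinates of labels by natural numbers. -/
def lc (n i u w : ℕ) : Lat := (n, u - i - 1, w - (n - i) - 1, i)

theorem lab_lc {n i u w : ℕ} (hi : i < n + 1) (hu : u < 2 * i + 2) (hw : w < 2 * (n - i) + 2) :
    Lab (lc n i u w) := by
  change IsLabel _ _ _ _
  simp only [IsLabel, lc]
  omega

/-- The labels, with the natural number `n` split off. -/
def labelEquiv : (Σ n : ℕ, Σ i : Fin (n + 1), Fin (2 * i + 2) × Fin (2 * (n - i) + 2)) ≃ Label :=
  Equiv.ofBijective (fun x => ⟨lc x.1 x.2.1 x.2.2.1 x.2.2.2, lab_lc x.2.1.2 x.2.2.1.2 x.2.2.2.2⟩) (by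
    constructor
    · rintro ⟨n, ⟨i, hi⟩, ⟨u, hu⟩, ⟨w, hw⟩⟩ ⟨n', ⟨i', hi'⟩, ⟨u', hu'⟩, ⟨w', hw'⟩⟩ h
      have h := congrArg Subtype.val h
      simp only [lc, Prod.mk.injEq] at h
      obtain ⟨h1, h2, h3, h4⟩ := h
      obtain rfl : n = n' := by omega
      obtain rfl : i = i' := by omega
      obtain rfl : u = u' := by omega
      obtain rfl : w = w' := by omega
      rfl
    · rintro ⟨⟨n, a, b, k⟩, hp⟩
      have hp' := hp
      simp only [IsLabel] at hp'
      refine ⟨⟨n.toNat, ⟨k.toNat, by omega⟩, ⟨(a + k + 1).toNat, ?_⟩, ⟨(b + n - k + 1).toNat, ?_⟩⟩, ?_⟩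
      · change _ < 2 * k.toNat + 2
        omega
      · change _ < 2 * (n.toNat - k.toNat) + 2
        omega
      · refine Subtype.ext ?_
        simp only [lc, Prod.mk.injEq]
        omega)

/-- The basis labels up to a level. -/
def upTo (M : ℕ) : Finset (Bool × Label) :=
  Finset.univ ×ˢ ((Finset.range M).sigma fun _ => Finset.univ).map labelEquiv.toEmbedding

theorem mem_upTo {M : ℕ} {i : Bool × Label} : i ∈ upTo M ↔ i.2.val.1 < M := by
  obtain ⟨s, x⟩ := i
  obtain ⟨x, rfl⟩ := labelEquiv.surjective x
  simp only [upTo, Finset.mem_product, Finset.mem_univ, true_and, Finset.mem_map_equiv,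
    Equiv.symm_apply_apply, Finset.mem_sigma, and_true, Finset.mem_range]
  change _ ↔ (x.1 : ℤ) < M
  omega

theorem sum_level (N m : ℕ) (h : m ≤ N + 1) :
    3 * ∑ i ∈ Finset.range m, (2 * (i : ℤ) + 2) * (2 * (N - i) + 2)
      = 2 * m * (m + 1) * (3 * N + 5 - 2 * m) := by
  induction m with
  | zero => simp
  | succ m ih =>
    rw [Finset.sum_range_succ, mul_add, ih (by omega)]
    push_cast
    ring

theorem card_level (n : ℕ) :
    (3 * Fintype.card (Σ i : Fin (n + 1), Fin (2 * i + 2) × Fin (2 * (n - i) + 2)) : ℤ)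
      = 2 * (n + 1) * (n + 2) * (n + 3) := by
  rw [Fintype.card_sigma]
  simp only [Fintype.card_prod, Fintype.card_fin]
  rw [Fin.sum_univ_eq_sum_range fun i => (2 * i + 2) * (2 * (n - i) + 2)]
  push_cast
  have h := sum_level n (n + 1) le_rfl
  rw [Finset.sum_congr rfl fun i hi => by
    rw [show ((n - i : ℕ) : ℤ) = (n : ℤ) - i by have := Finset.mem_range.1 hi; omega]]
  rw [h]
  push_cast
  ring

theorem card_upTo (M : ℕ) : 3 * (upTo M).card = M * (M + 1) * (M + 2) * (M + 3) := by
  rw [upTo, Finset.card_product, Finset.card_map, Finset.card_sigma]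
  zify
  simp only [Finset.card_univ, Fintype.card_bool]
  induction M with
  | zero => simp
  | succ M ih =>
    rw [Finset.sum_range_succ]
    push_cast at ih ⊢
    linear_combination ih + 2 * card_level M

end Levels

/-! ### The Dirac operator -/

section Dirac

theorem eigval_conj (i : Bool × Label) : starRingEnd ℂ (eigval i) = eigval i := by
  simp only [eigval, map_add, map_ofNat, map_intCast]

theorem eigval_eq (i : Bool × Label) : eigval i = ((i.2.val.1.toNat + 2 : ℕ) : ℂ) := by
  have h : 0 ≤ i.2.val.1 := i.2.2.1.trans i.2.2.2.1
  simp only [eigval]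
  push_cast
  congr 1
  exact_mod_cast (Int.toNat_of_nonneg h).symm

theorem dirac_isSelfAdjoint : IsSelfAdjoint dirac :=
  weightedPerm_isSelfAdjoint (fun i => by simp) eigval_conj fun _ => rfl

/-- The exchange of the two signs. -/
def flipEquiv : Bool × Label ≃ Bool × Label :=
  ⟨fun i => (!i.1, i.2), fun i => (!i.1, i.2), fun i => by simp, fun i => by simp⟩

theorem norm_eigval_cpow (s : ℂ) (i : Bool × Label) :
    ‖eigval i ^ (-s)‖ = ((i.2.val.1.toNat + 2 : ℕ) : ℝ) ^ (-s.re) := by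
  rw [eigval_eq, Complex.norm_natCast_cpow_of_pos (by omega), Complex.neg_re]

theorem norm_eigval_cpow_le {s : ℂ} (hs : 0 ≤ s.re) (i : Bool × Label) : ‖eigval i ^ (-s)‖ ≤ 1 := by
  rw [norm_eigval_cpow]
  exact Real.rpow_le_one_of_one_le_of_nonpos (by push_cast; linarith [Nat.cast_nonneg (α := ℝ) i.2.val.1.toNat]) (by linarith)

theorem isOperatorAbs : IsOperatorAbs dirac absDirac where
  selfAdjoint := weightedPerm_isSelfAdjoint (fun _ => rfl) eigval_conj fun _ => rfl
  nonneg v := by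
    rw [lp.inner_eq_tsum]
    refine le_of_le_of_eq ?_ (Complex.re_tsum (lp.summable_inner _ _)).symm
    refine tsum_nonneg fun i => ?_
    change 0 ≤ RCLike.re (inner ℂ (eigval i * (v : SpinorSpace) i) ((v : SpinorSpace) i))
    rw [eigval_eq, ← Complex.ofReal_natCast, ← smul_eq_mul, inner_smul_left, Complex.conj_ofReal]
    simp only [RCLike.inner_apply, RCLike.re_to_complex, Complex.re_ofReal_mul, Complex.mul_conj,
      Complex.ofReal_re]
    exact mul_nonneg (Nat.cast_nonneg _) (Complex.normSq_nonneg _)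
  domain_eq := Submodule.ext fun v => by
    change Memℓp (fun i => eigval i * v i) 2 ↔ Memℓp (fun i => eigval i * v (!i.1, i.2)) 2
    rw [memℓp_gen_iff (by norm_num), memℓp_gen_iff (by norm_num), ← flipEquiv.summable_iff]
    rfl
  norm_eq v hA hD := by
    rw [lp.norm_eq_tsum_rpow (by norm_num), lp.norm_eq_tsum_rpow (by norm_num), ← flipEquiv.tsum_eq]
    rfl

theorem absDiracPow_apply {s : ℂ} (hs : 0 ≤ s.re) (v : SpinorSpace) (i : Bool × Label) :
    absDiracPow s v i = eigval i ^ (-s) * v i := diagOp_apply (norm_eigval_cpow_le hs) v i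

theorem hasCompactResolvent_dirac : HasCompactResolvent dirac := by
  classical
  have hN : ∀ p : Lat, (((p.1 : ℝ) + 2 : ℝ) : ℂ) = (p.1 : ℂ) + 2 := fun p => by push_cast; rfl
  have hne : ∀ p : Lat, ((p.1 : ℂ) + 2) ^ 2 + 1 ≠ 0 := fun p => by
    rw [← hN]
    exact_mod_cast (by positivity : (((p.1 : ℝ) + 2) ^ 2 + 1) ≠ 0)
  have hn : ∀ p : Lat, ‖((p.1 : ℂ) + 2) ^ 2 + 1‖ = ((p.1 : ℝ) + 2) ^ 2 + 1 := fun p => by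
    rw [← hN]
    exact (congrArg norm (by push_cast; rfl)).trans
      (Complex.norm_of_nonneg (r := ((p.1 : ℝ) + 2) ^ 2 + 1) (by positivity))
  obtain ⟨S, hS, hc⟩ := exists_of_cf {0} (fun s t d p => if d = 0 ∧ Lab p then
      (if s = t then -Complex.I else (p.1 : ℂ) + 2) * ((p.1 : ℂ) + 2) / (((p.1 : ℂ) + 2) ^ 2 + 1) else 0)
    (C := 1) (fun s t d p => by
      split_ifs
      · rw [norm_div, norm_mul, norm_neg, Complex.norm_I, hn, one_mul, ← hN, Complex.norm_real,
          Real.norm_eq_abs, div_le_one (by positivity)]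
        nlinarith [sq_abs ((p.1 : ℝ) + 2), sq_nonneg (|(p.1 : ℝ) + 2| - 1)]
      · rw [norm_div, norm_mul, hn, ← hN, Complex.norm_real, Real.norm_eq_abs,
          div_le_one (by positivity)]
        nlinarith [sq_abs ((p.1 : ℝ) + 2)]
      · simp)
    (fun s t d p h => if_neg fun h' => h ⟨h'.2, by rw [h'.1, add_zero]; exact h'.2⟩)
    (fun s t d p h => if_neg fun h' => h (by simp [h'.1]))
  have hR : ∀ v s p, toFn ((S * absDiracPow 1) v) s p
      = (-Complex.I * toFn v s p + ((p.1 : ℂ) + 2) * toFn v (!s) p) / (((p.1 : ℂ) + 2) ^ 2 + 1) := by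
    intro v s p
    by_cases hp : Lab p
    · have h2 : ((p.1 : ℂ) + 2) ≠ 0 := by
        have h0 : (0 : ℤ) ≤ p.1 := hp.1.trans hp.2.1
        rw [← hN]
        exact_mod_cast (by have : (0 : ℝ) ≤ p.1 := by exact_mod_cast h0
                           positivity : (p.1 : ℝ) + 2 ≠ 0)
      have h1 : ∀ t, toFn (absDiracPow 1 v) t p = ((p.1 : ℂ) + 2)⁻¹ * toFn v t p := fun t => by
        rw [toFn_of_lab _ _ hp, toFn_of_lab _ _ hp, absDiracPow_apply (by simp), Complex.cpow_neg_one]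
        rfl
      rw [mul_apply_eq_comp, hS.toFn_apply]
      simp only [Finset.sum_singleton, sub_zero, hc, true_and, if_pos hp, Fintype.sum_bool, h1]
      cases s <;> simp <;> field_simp <;> ring
    · rw [toFn_of_not_lab _ _ hp, toFn_of_not_lab _ _ hp, toFn_of_not_lab _ _ hp]
      simp
  refine ⟨S * absDiracPow 1, ?_, fun v => ?_, fun v => ?_⟩
  · refine IsCompactOperator.clm_comp (isCompactOperator_diagOp (norm_eigval_cpow_le (by simp))
      fun ε hε => ?_) S
    obtain ⟨M, hM⟩ := exists_nat_gt ε⁻¹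
    refine (upTo M).finite_toSet.subset fun i hi => ?_
    rw [Finset.mem_coe, mem_upTo]
    by_contra h
    rw [Set.mem_ofPred_eq, Complex.cpow_neg_one, eigval_eq, norm_inv, Complex.norm_natCast] at hi
    have h1 : (M : ℝ) ≤ ((i.2.val.1.toNat + 2 : ℕ) : ℝ) := by
      have : M ≤ i.2.val.1.toNat + 2 := by omega
      exact_mod_cast this
    have h2 := (le_inv_comm₀ hε (by push_cast; positivity)).1 hi
    linarith
  · obtain ⟨h, e⟩ := mem_dirac (v := (S * absDiracPow 1) v)
      (w := v - Complex.I • (S * absDiracPow 1) v) fun s p => by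
        rw [map_sub, map_smul, Pi.sub_apply, Pi.sub_apply, Pi.smul_apply, Pi.smul_apply, smul_eq_mul, hR,
          hR, Bool.not_not]
        field_simp [hne p]
        linear_combination (toFn v s p) * Complex.I_sq
    exact ⟨h, by rw [e, sub_add_cancel]⟩
  · refine toFn_injective (funext fun s => funext fun p => ?_)
    rw [hR, map_add, map_smul]
    simp only [Pi.add_apply, Pi.smul_apply, smul_eq_mul, toFn_dirac, Bool.not_not]
    field_simp [hne p]
    linear_combination (-toFn v s p) * Complex.I_sq

theorem isEvenSpectralTriple_spinorRep {q : ℝ} (hq0 : 0 < q) (hq1 : q < 1) :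
    IsEvenSpectralTriple (spinorRep hq0 hq1) dirac grading where
  dense_domain := weightedPerm_dense fun i => by simp
  selfAdjoint := dirac_isSelfAdjoint
  compact_resolvent := hasCompactResolvent_dirac
  bounded_commutator := bounded_commutator hq0 hq1
  grading_selfAdjoint := grading_selfAdjoint
  grading_sq := grading_sq
  grading_comm := grading_comm hq0 hq1
  grading_anticomm := grading_anticomm

end Dirac

/-! ### Singular values of diagonal operators -/

section SingularValues

variable {ι : Type}

theorem singularVal_nonneg (T : EllTwo ι →L[ℂ] EllTwo ι) (k : ℕ) : 0 ≤ singularVal T k :=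
  Real.iInf_nonneg fun V => Real.sSup_nonneg fun r ⟨v, _, _, hr⟩ => hr ▸ norm_nonneg _

/-- The subspace spanned by finitely many basis vectors. -/
def spanB (B : Finset ι) : Submodule ℂ (EllTwo ι) := Submodule.span ℂ (Set.range fun i : B => basisVec (i : ι))

theorem spanB_dim (B : Finset ι) : FiniteDimensional ℂ (spanB B) ∧ Module.finrank ℂ (spanB B) = B.card := by
  have h : LinearIndependent ℂ (fun i : B => (basisVec (i : ι) : EllTwo ι)) := by
    have := ((ellBasis ι).orthonormal.comp (fun i : B => (i : ι)) Subtype.val_injective).linearIndependent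
    rwa [show ellBasis ι ∘ (fun i : B => (i : ι)) = fun i : B => basisVec (i : ι) from
      funext fun i => ellBasis_apply (i : ι)] at this
  exact ⟨FiniteDimensional.span_of_finite ℂ (Set.finite_range _),
    (finrank_span_eq_card h).trans (Fintype.card_coe B)⟩

theorem singularVal_le [Infinite ι] (T : EllTwo ι →L[ℂ] EllTwo ι) {d : ι → ℂ} {C ε : ℝ} (hC : ∀ i, ‖d i‖ ≤ C)
    {A : Finset ι} {k : ℕ} (hA : A.card ≤ k) (hε : 0 ≤ ε) (h : ∀ i ∉ A, ‖d i‖ ≤ ε) :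
    singularVal (T * diagOp d) k ≤ ‖T‖ * ε := by
  classical
  obtain ⟨B, hAB, rfl⟩ := Infinite.exists_superset_card_eq A k hA
  refine (ciInf_le ⟨0, ?_⟩ ⟨spanB B, spanB_dim B⟩).trans (Real.sSup_le ?_ (by positivity))
  · rintro _ ⟨V, rfl⟩
    exact Real.sSup_nonneg fun r ⟨v, _, _, hr⟩ => hr ▸ norm_nonneg _
  · rintro _ ⟨v, hv, hv1, rfl⟩
    have h1 : ∀ i, ‖if i ∈ B then 0 else d i‖ ≤ ε := fun i => by
      split_ifs with hi
      · rwa [norm_zero]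
      · exact h i fun hi' => hi (hAB hi')
    have h2 : diagOp d v = diagOp (fun i => if i ∈ B then 0 else d i) v := lp.ext (funext fun i => by
      rw [diagOp_apply hC, diagOp_apply h1]
      split_ifs with hi
      · rw [← inner_basisVec i v, (Submodule.mem_orthogonal _ _).1 hv _
          (Submodule.subset_span ⟨⟨i, hi⟩, rfl⟩), mul_zero, zero_mul]
      · rfl)
    rw [mul_apply_eq_comp, h2]
    refine (T.le_opNorm _).trans (mul_le_mul_of_nonneg_left ?_ (norm_nonneg _))
    simpa [hv1] using norm_diagOp_apply_le h1 v

theorem le_singularVal [Infinite ι] {d : ι → ℂ} {C ε : ℝ} (hC : ∀ i, ‖d i‖ ≤ C)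
    {A : Finset ι} {k : ℕ} (hA : k < A.card) (hε : 0 < ε) (h : ∀ i ∈ A, ε ≤ ‖d i‖) :
    ε ≤ singularVal (diagOp d) k := by
  classical
  obtain ⟨B, hB⟩ := Infinite.exists_subset_card_eq ι k
  have : Nonempty {V : Submodule ℂ (EllTwo ι) // FiniteDimensional ℂ V ∧ Module.finrank ℂ V = k} :=
    ⟨⟨spanB B, (spanB_dim B).1, (spanB_dim B).2.trans hB⟩⟩
  refine le_ciInf fun ⟨V, hV, hVk⟩ => ?_
  have := hV
  have := (spanB_dim A).1
  let φ : spanB A →ₗ[ℂ] V := (V.orthogonalProjectionOnto : EllTwo ι →ₗ[ℂ] V) ∘ₗ (spanB A).subtype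
  obtain ⟨w, hw, hw0⟩ := Submodule.exists_mem_ne_zero_of_ne_bot
    (LinearMap.ker_ne_bot_of_finrank_lt (f := φ) (by rw [hVk, (spanB_dim A).2]; exact hA))
  have hwV : (w : EllTwo ι) ∈ Vᗮ := by
    have h1 : V.orthogonalProjectionOnto (w : EllTwo ι) = 0 := hw
    simpa using h1
  have hwA : ∀ i ∉ A, (w : EllTwo ι) i = 0 := fun i hi => by
    rw [← inner_basisVec]
    refine Submodule.span_induction (p := fun v _ => inner ℂ (basisVec i) v = 0) ?_
      (inner_zero_right _) (fun x y _ _ hx hy => by rw [inner_add_right, hx, hy, add_zero])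
      (fun a x _ hx => by rw [inner_smul_right, hx, mul_zero]) w.2
    rintro _ ⟨j, rfl⟩
    rw [inner_basisVec, basisVec_apply, if_neg]
    rintro rfl
    exact hi j.2
  have hn : 0 < ‖(w : EllTwo ι)‖ := norm_pos_iff.2 fun h0 => hw0 (Subtype.ext h0)
  have h1 : ∀ i, ‖if i ∈ A then (d i)⁻¹ else 0‖ ≤ ε⁻¹ := fun i => by
    split_ifs with hi
    · rw [norm_inv]
      exact inv_anti₀ hε (h i hi)
    · rw [norm_zero]; positivity
  have h2 : diagOp (fun i => if i ∈ A then (d i)⁻¹ else 0) (diagOp d w) = w :=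
    lp.ext (funext fun i => by
      rw [diagOp_apply h1, diagOp_apply hC]
      split_ifs with hi
      · exact inv_mul_cancel_left₀ (norm_pos_iff.1 (hε.trans_le (h i hi))) _
      · rw [hwA i hi, zero_mul])
  have h3 : ε * ‖(w : EllTwo ι)‖ ≤ ‖diagOp d (w : EllTwo ι)‖ := by
    have := norm_diagOp_apply_le h1 (diagOp d (w : EllTwo ι))
    rw [h2] at this
    exact (le_inv_mul_iff₀ hε).1 this
  refine le_csSup_of_le ⟨C, ?_⟩ ⟨((‖(w : EllTwo ι)‖⁻¹ : ℝ) : ℂ) • (w : EllTwo ι), Vᗮ.smul_mem _ hwV, ?_, rfl⟩ ?_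
  · rintro _ ⟨v, -, hv, rfl⟩
    simpa [hv] using norm_diagOp_apply_le hC v
  · rw [norm_smul, Complex.norm_real, norm_inv, norm_norm, inv_mul_cancel₀ hn.ne']
  · rw [map_smul, norm_smul, Complex.norm_real, norm_inv, norm_norm, le_inv_mul_iff₀ hn, mul_comm]
    exact h3

end SingularValues

section MetricDimension

instance : Infinite Label := labelEquiv.symm.infinite_iff.2 inferInstance

theorem exists_upTo (k : ℕ) : ∃ M : ℕ, (upTo M).card ≤ k ∧ k < (upTo (M + 1)).card ∧
    k + 1 ≤ (M + 2) ^ 4 ∧ (M + 2) ^ 4 ≤ 48 * (k + 1) := by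
  have hex : ∃ M : ℕ, k < (upTo (M + 1)).card := ⟨k, by
    have := card_upTo (k + 1)
    nlinarith [Nat.zero_le (k ^ 2), Nat.zero_le (k ^ 3), Nat.zero_le (k ^ 4)]⟩
  classical
  have h1 := Nat.find_spec hex
  have h2 : (upTo (Nat.find hex)).card ≤ k := by
    rcases h : Nat.find hex with _ | m
    · have := card_upTo 0
      omega
    · exact not_lt.1 (Nat.find_min hex (h ▸ m.lt_succ_self))
  have h3 := card_upTo (Nat.find hex)
  have h4 := card_upTo (Nat.find hex + 1)
  generalize Nat.find hex = M at *
  refine ⟨M, h2, h1, ?_, ?_⟩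
  · nlinarith [Nat.zero_le (M ^ 2), Nat.zero_le (M ^ 3), Nat.zero_le (M ^ 4)]
  · nlinarith [Nat.zero_le (M ^ 2), Nat.zero_le (M ^ 3), Nat.zero_le (M ^ 4)]

theorem singularVal_absDiracPow_le (T : SpinorSpace →L[ℂ] SpinorSpace) {s : ℂ} (hs : 0 ≤ s.re) (k : ℕ) :
    singularVal (T * absDiracPow s) k ≤ ‖T‖ * ((k : ℝ) + 1) ^ (-(s.re / 4)) := by
  obtain ⟨M, h1, -, h2, -⟩ := exists_upTo k
  have h3 : ((M : ℝ) + 2) ^ (-s.re) ≤ ((k : ℝ) + 1) ^ (-(s.re / 4)) := by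
    rw [show -s.re = 4 * (-(s.re / 4)) by ring, Real.rpow_mul (by positivity)]
    refine Real.rpow_le_rpow_of_nonpos (by positivity) ?_ (by linarith)
    rw [show ((M : ℝ) + 2) ^ (4 : ℝ) = ((M : ℝ) + 2) ^ 4 from
      Real.rpow_ofNat _ 4]
    exact_mod_cast h2
  refine (singularVal_le T (norm_eigval_cpow_le hs) h1 (by positivity) fun i hi => ?_).trans
    (mul_le_mul_of_nonneg_left h3 (norm_nonneg _))
  rw [norm_eigval_cpow]
  rw [mem_upTo] at hi
  refine Real.rpow_le_rpow_of_nonpos (by positivity) ?_ (by linarith)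
  have : M + 2 ≤ i.2.val.1.toNat + 2 := by omega
  exact_mod_cast this

theorem isTraceClass_mul_absDiracPow (T : SpinorSpace →L[ℂ] SpinorSpace) {s : ℂ} (hs : 4 < s.re) :
    IsTraceClass (T * absDiracPow s) := by
  refine Summable.of_nonneg_of_le (singularVal_nonneg _)
    (singularVal_absDiracPow_le T (by linarith)) (Summable.mul_left _ ?_)
  have := (summable_nat_add_iff 1).2 (Real.summable_nat_rpow.2 (show -(s.re / 4) < -1 by linarith))
  exact_mod_cast this

theorem le_singularVal_absDiracPow (k : ℕ) :
    1 / 48 * ((k : ℝ) + 1)⁻¹ ≤ singularVal (absDiracPow (4 : ℝ)) k := by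
  obtain ⟨M, -, h1, -, h2⟩ := exists_upTo k
  have h3 : 1 / 48 * ((k : ℝ) + 1)⁻¹ ≤ (((M : ℝ) + 2) ^ 4)⁻¹ := by
    rw [one_div, ← mul_inv]
    exact inv_anti₀ (by positivity) (by exact_mod_cast h2)
  refine h3.trans (le_singularVal (norm_eigval_cpow_le (by norm_num)) h1 (by positivity) fun i hi => ?_)
  rw [norm_eigval_cpow, Complex.ofReal_re, Real.rpow_neg (by positivity),
    show (4 : ℝ) = ((4 : ℕ) : ℝ) by norm_num, Real.rpow_natCast]
  rw [mem_upTo] at hi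
  refine inv_anti₀ (by positivity) ?_
  have : (i.2.val.1.toNat + 2) ^ 4 ≤ (M + 2) ^ 4 := Nat.pow_le_pow_left (by omega) 4
  exact_mod_cast this

theorem hasMetricDimension : HasMetricDimension absDiracPow 4 := by
  have hup : ∀ k, singularVal (absDiracPow (4 : ℝ)) k
      ≤ ‖(1 : SpinorSpace →L[ℂ] SpinorSpace)‖ * ((k : ℝ) + 1)⁻¹ := fun k => by
    have := singularVal_absDiracPow_le 1 (s := (4 : ℝ)) (by norm_num) k
    rwa [one_mul, Complex.ofReal_re, div_self (by norm_num), Real.rpow_neg_one] at this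
  set C := ‖(1 : SpinorSpace →L[ℂ] SpinorSpace)‖
  have hC : 0 ≤ C := norm_nonneg _
  have hharm : ∀ N : ℕ, ∑ k ∈ Finset.range N, ((k : ℝ) + 1)⁻¹ = harmonic N := fun N => by
    simp [harmonic]
  have hu : ∀ N, dixmierSeq (absDiracPow (4 : ℝ)) N ≤ 3 * C := fun N => by
    rw [dixmierSeq]
    rcases Nat.lt_or_ge N 2 with h | h
    · interval_cases N <;> simp [hC]
    · have hl : 1 / 2 ≤ Real.log N := by
        refine le_trans ?_ (Real.log_le_log (by norm_num) (by exact_mod_cast h : (2 : ℝ) ≤ N))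
        linarith [Real.log_two_gt_d9]
      rw [div_le_iff₀ (by linarith)]
      refine (Finset.sum_le_sum fun k _ => hup k).trans ?_
      rw [← Finset.mul_sum, hharm]
      nlinarith [harmonic_le_one_add_log N]
  have hl : ∀ N, 2 ≤ N → 1 / 48 ≤ dixmierSeq (absDiracPow (4 : ℝ)) N := fun N h => by
    have hl : 0 < Real.log N := Real.log_pos (by exact_mod_cast h)
    rw [dixmierSeq, le_div_iff₀ hl]
    refine le_trans ?_ (Finset.sum_le_sum fun k _ => le_singularVal_absDiracPow k)
    rw [← Finset.mul_sum, hharm]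
    have h1 : Real.log N ≤ Real.log ((N + 1 : ℕ) : ℝ) :=
      Real.log_le_log (by positivity) (by push_cast; linarith)
    nlinarith [log_add_one_le_harmonic N]
  have h0 : ∀ N, 0 ≤ dixmierSeq (absDiracPow (4 : ℝ)) N := fun N =>
    div_nonneg (Finset.sum_nonneg fun k _ => singularVal_nonneg _ _) (Real.log_natCast_nonneg N)
  refine ⟨⟨C, fun k => by rw [div_eq_mul_inv]; exact hup k⟩,
    BoundedContinuousFunction.ofNormedAddCommGroup (dixmierSeq (absDiracPow (4 : ℝ)))
      continuous_of_discreteTopology (3 * C) fun N => by rw [Real.norm_of_nonneg (h0 N)]; exact hu N,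
    fun N => rfl, fun ω => ?_⟩
  set u : ℕ →ᵇ ℝ := BoundedContinuousFunction.ofNormedAddCommGroup _ _ _ _
  let v : ℕ →ᵇ ℝ := BoundedContinuousFunction.ofNormedAddCommGroup
    (fun N : ℕ => if N < 2 then (0 : ℝ) else 1 / 48) continuous_of_discreteTopology 1 fun N => by
      split_ifs <;> norm_num
  have hv : ω.toFun v = 1 / 48 := ω.eq_lim v _ (tendsto_const_nhds.congr' (by
    filter_upwards [Filter.eventually_ge_atTop 2] with N hN
    exact (if_neg (not_lt.2 hN)).symm))
  have hw : 0 ≤ ω.toFun (u - v) := ω.nonneg _ fun N => by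
    change 0 ≤ dixmierSeq (absDiracPow (4 : ℝ)) N - if N < 2 then (0 : ℝ) else 1 / 48
    split_ifs with h
    · simpa using h0 N
    · linarith [hl N (not_lt.1 h)]
  rw [map_sub, hv] at hw
  linarith

end MetricDimension

/-! ### Functions with simple poles -/

section Poles

open Filter

variable {f g : ℂ → ℂ} {a p : ℂ}

theorem polar_eq (h : f =ᶠ[𝓝[≠] p] fun s => a * (s - p)⁻¹ + g s) :
    f =ᶠ[𝓝[≠] p] fun s => (s - p) ^ (-1 : ℤ) • (a + (s - p) * g s) := by
  filter_upwards [h, self_mem_nhdsWithin] with s hs hp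
  have : s - p ≠ 0 := sub_ne_zero.2 hp
  rw [hs, zpow_neg_one, smul_eq_mul]
  field_simp

theorem polar_residue (hg : AnalyticAt ℂ g p) (h : f =ᶠ[𝓝[≠] p] fun s => a * (s - p)⁻¹ + g s) :
    Tendsto (fun s => (s - p) * f s) (𝓝[≠] p) (𝓝 a) := by
  have h1 : Tendsto (fun s => a + (s - p) * g s) (𝓝[≠] p) (𝓝 (a + (p - p) * g p)) :=
    Tendsto.mono_left (ContinuousAt.tendsto (f := fun s => a + (s - p) * g s)
      (by have := hg.continuousAt; fun_prop)) nhdsWithin_le_nhds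
  rw [sub_self, zero_mul, add_zero] at h1
  refine h1.congr' ?_
  filter_upwards [h, self_mem_nhdsWithin] with s hs hp
  have : s - p ≠ 0 := sub_ne_zero.2 hp
  rw [hs]
  field_simp

theorem polar_meromorphicAt (hg : AnalyticAt ℂ g p) (h : f =ᶠ[𝓝[≠] p] fun s => a * (s - p)⁻¹ + g s) :
    MeromorphicAt f p := by
  refine MeromorphicAt.congr ?_ h.symm
  have := hg.meromorphicAt
  fun_prop

theorem polar_order (hg : AnalyticAt ℂ g p) (h : f =ᶠ[𝓝[≠] p] fun s => a * (s - p)⁻¹ + g s) :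
    -1 ≤ meromorphicOrderAt f p ∧ (a = 0 → 0 ≤ meromorphicOrderAt f p) ∧
      (a ≠ 0 → meromorphicOrderAt f p < 0) := by
  have hG : AnalyticAt ℂ (fun s => a + (s - p) * g s) p := by fun_prop
  have key : a ≠ 0 → meromorphicOrderAt f p = (-1 : ℤ) := fun ha =>
    (meromorphicOrderAt_eq_int_iff (polar_meromorphicAt hg h)).2
      ⟨_, hG, by simpa using ha, polar_eq h⟩
  have key' : a = 0 → 0 ≤ meromorphicOrderAt f p := fun ha => by
    subst ha
    rw [meromorphicOrderAt_congr (h.trans (Eventually.of_forall fun s => by simp : _ =ᶠ[_] g))]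
    exact hg.meromorphicOrderAt_nonneg
  refine ⟨?_, key', fun ha => ?_⟩
  · by_cases ha : a = 0
    · exact le_trans (by decide) (key' ha)
    · rw [key ha]; exact le_rfl
  · rw [key ha]; decide

/-- A sum of two polar parts and a function that is holomorphic for `Re s > 2`. -/
def polar (α β : ℂ) (R : ℂ → ℂ) (s : ℂ) : ℂ := α * (s - 4)⁻¹ + (β * (s - 3)⁻¹ + R s)

theorem isOpen_halfPlane (r : ℝ) : IsOpen {s : ℂ | r < s.re} := isOpen_lt continuous_const Complex.continuous_re

theorem polar_local {α β : ℂ} {R : ℂ → ℂ} (hR : DifferentiableOn ℂ R {s | 2 < s.re}) {s : ℂ}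
    (hs : 2 < s.re) : ∃ g : ℂ → ℂ, AnalyticAt ℂ g s ∧
      polar α β R =ᶠ[𝓝[≠] s] fun z => (if s = 4 then α else if s = 3 then β else 0) * (z - s)⁻¹ + g z := by
  have hR' : AnalyticAt ℂ R s := hR.analyticAt ((isOpen_halfPlane 2).mem_nhds hs)
  have h1 : ∀ c p : ℂ, s ≠ p → AnalyticAt ℂ (fun z => c * (z - p)⁻¹) s := fun c p h =>
    analyticAt_const.mul ((analyticAt_id.sub analyticAt_const).inv (sub_ne_zero.2 h))
  split_ifs with h4 h3
  · exact ⟨_, (h1 β 3 (by rw [h4]; norm_num)).add hR', Eventually.of_forall fun z => by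
      simp [polar, h4]⟩
  · exact ⟨_, (h1 α 4 h4).add hR', Eventually.of_forall fun z => by simp [polar, h3]; ring⟩
  · exact ⟨_, (h1 α 4 h4).add ((h1 β 3 h3).add hR'), Eventually.of_forall fun z => by simp [polar]⟩

theorem meromorphicOn_polar {α β : ℂ} {R : ℂ → ℂ} (hR : DifferentiableOn ℂ R {s | 2 < s.re}) :
    MeromorphicOn (polar α β R) {s | 2 < s.re} := fun s hs => by
  obtain ⟨g, hg, h⟩ := polar_local (α := α) (β := β) hR hs
  exact polar_meromorphicAt hg h

theorem eq_of_extension {f Z Z' : ℂ → ℂ} (h : IsMeromorphicExtension f 4 2 Z)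
    (h' : IsMeromorphicExtension f 4 2 Z') {s : ℂ} (hs : 2 < s.re) : Z =ᶠ[𝓝[≠] s] Z' := by
  have hm : MeromorphicOn (Z - Z') {s : ℂ | 2 < s.re} := fun s hs => (h.1 s hs).sub (h'.1 s hs)
  have hc : IsPreconnected {s : ℂ | 2 < s.re} := (convex_halfSpace_re_gt 2).isPreconnected
  have h5 : meromorphicOrderAt (Z - Z') 5 = ⊤ := by
    rw [meromorphicOrderAt_eq_top_iff]
    refine Filter.Eventually.filter_mono nhdsWithin_le_nhds ?_
    filter_upwards [(isOpen_halfPlane 4).mem_nhds (by simp; norm_num : (5 : ℂ) ∈ {s : ℂ | 4 < s.re})]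
      with z hz
    rw [Pi.sub_apply, h.2 z hz, h'.2 z hz, sub_self]
  have hT : meromorphicOrderAt (Z - Z') s = ⊤ := by
    by_contra hne
    exact hm.meromorphicOrderAt_ne_top_of_isPreconnected hc hs
      (show (2 : ℝ) < (5 : ℂ).re by simp; norm_num) hne h5
  filter_upwards [meromorphicOrderAt_eq_top_iff.1 hT] with z hz
  exact sub_eq_zero.1 hz

end Poles

/-! ### Sums over the labels of a level -/

section LevelSums

/-- The sum over the labels of a level. -/
def levelSum (c : Lat → ℂ) (n : ℕ) : ℂ :=
  ∑ x : (Σ i : Fin (n + 1), Fin (2 * i + 2) × Fin (2 * (n - i) + 2)), c (lc n x.1 x.2.1 x.2.2)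

theorem levelSum_eq (c : Lat → ℂ) (n : ℕ) : levelSum c n = ∑ i ∈ Finset.range (n + 1),
    ∑ u ∈ Finset.range (2 * i + 2), ∑ w ∈ Finset.range (2 * (n - i) + 2), c (lc n i u w) := by
  rw [levelSum, Fintype.sum_sigma, ← Fin.sum_univ_eq_sum_range fun i =>
    ∑ u ∈ Finset.range (2 * i + 2), ∑ w ∈ Finset.range (2 * (n - i) + 2), c (lc n i u w)]
  refine Finset.sum_congr rfl fun i _ => ?_
  rw [Fintype.sum_prod_type, ← Fin.sum_univ_eq_sum_range fun u =>
    ∑ w ∈ Finset.range (2 * (n - i) + 2), c (lc n i u w)]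
  refine Finset.sum_congr rfl fun u _ => ?_
  exact Fin.sum_univ_eq_sum_range (fun w => c (lc n i u w)) _

theorem sum_level_one (n : ℕ) : ∑ i ∈ Finset.range (n + 1), (2 * (i : ℂ) + 2) = (n + 1) * (n + 2) := by
  induction n with
  | zero => simp
  | succ n ih => rw [Finset.sum_range_succ, ih]; push_cast; ring

theorem sum_level_two (n : ℕ) : ∑ i ∈ Finset.range (n + 1), (2 * (i : ℂ) + 2) * (2 * (n - i : ℕ) + 2 : ℕ)
    = 2 / 3 * ((n + 1) * (n + 2) * (n + 3)) := by
  have h := congrArg (Int.cast (R := ℂ)) (sum_level n (n + 1) le_rfl)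
  push_cast at h
  rw [Finset.sum_congr rfl fun i hi => by
    rw [Nat.cast_add, Nat.cast_mul, Nat.cast_sub (Nat.lt_succ_iff.1 (Finset.mem_range.1 hi))]]
  push_cast
  linear_combination h / 3

variable {q : ℝ} (hq0 : 0 < q) (hq1 : q < 1)
include hq0 hq1

theorem geom_sum_le (m : ℕ) : ∑ w ∈ Finset.range m, q ^ w ≤ (1 - q)⁻¹ := by
  rw [← tsum_geometric_of_lt_one hq0.le hq1]
  exact (summable_geometric_of_lt_one hq0.le hq1).sum_le_tsum _ fun i _ => (pow_pos hq0 i).le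

theorem norm_sum_sub_tsum_le {Φ : ℕ → ℂ} {C : ℝ} (h : ∀ w, ‖Φ w‖ ≤ C * q ^ w) (m : ℕ) :
    ‖∑ w ∈ Finset.range m, Φ w - ∑' w, Φ w‖ ≤ C * (1 - q)⁻¹ * q ^ m := by
  have hs := (hasSum_geometric_of_lt_one hq0.le hq1).mul_left C
  rw [← (Summable.of_norm_bounded hs.summable h).sum_add_tsum_nat_add m, sub_add_cancel_left, norm_neg]
  refine tsum_of_norm_bounded (hs.mul_right (q ^ m)) fun w => ?_
  rw [mul_assoc, ← pow_add]
  exact h _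

theorem norm_levelSum_sub_le {c : Lat → ℂ} {Ψ : ℕ → ℂ} {L : ℂ} {C : ℝ} (hC : 0 ≤ C)
    (h1 : ∀ w, ‖Ψ w - L‖ ≤ C * q ^ w)
    (h2 : ∀ n i u w, i < n + 1 → u < 2 * i + 2 → w < 2 * (n - i) + 2 →
      ‖c (lc n i u w) - Ψ w‖ ≤ C * (q ^ (w + u) + q ^ n)) :
    ∃ K, 0 ≤ K ∧ ∀ n : ℕ, ‖levelSum c n - (2 / 3 * L * ((n : ℂ) + 2) ^ 3
      + (∑' w, (Ψ w - L)) * ((n : ℂ) + 2) ^ 2)‖ ≤ K * ((n : ℝ) + 2) := by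
  set B := ∑' w, (Ψ w - L)
  set G := (1 - q)⁻¹
  have hG : 0 ≤ G := inv_nonneg.2 (sub_nonneg.2 hq1.le)
  obtain ⟨K3, hK3⟩ := (tendsto_pow_const_mul_const_pow_of_lt_one 3 hq0.le hq1).bddAbove_range
  have hK3 : ∀ n : ℕ, (n : ℝ) ^ 3 * q ^ n ≤ K3 := fun n => hK3 ⟨n, rfl⟩
  have hK0 : 0 ≤ K3 := le_trans (by simp) (hK3 0)
  have hstep : ∀ n : ℕ, ‖levelSum c n - ∑ i ∈ Finset.range (n + 1), ∑ u ∈ Finset.range (2 * i + 2),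
      ∑ w ∈ Finset.range (2 * (n - i) + 2), Ψ w‖ ≤ C * ((n + 1) * G ^ 2 + 64 * (K3 + 1)) := by
    intro n
    rw [levelSum_eq, ← Finset.sum_sub_distrib]
    have hi : ∀ i ∈ Finset.range (n + 1), ‖∑ u ∈ Finset.range (2 * i + 2),
        ∑ w ∈ Finset.range (2 * (n - i) + 2), c (lc n i u w)
        - ∑ u ∈ Finset.range (2 * i + 2), ∑ w ∈ Finset.range (2 * (n - i) + 2), Ψ w‖
        ≤ C * (G ^ 2 + (2 * n + 2) ^ 2 * q ^ n) := by
      intro i hi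
      have hi := Finset.mem_range.1 hi
      simp only [← Finset.sum_sub_distrib]
      calc _ ≤ ∑ u ∈ Finset.range (2 * i + 2), ∑ w ∈ Finset.range (2 * (n - i) + 2),
            C * (q ^ (w + u) + q ^ n) :=
            (norm_sum_le _ _).trans (Finset.sum_le_sum fun u hu => (norm_sum_le _ _).trans
              (Finset.sum_le_sum fun w hw => h2 n i u w hi (Finset.mem_range.1 hu) (Finset.mem_range.1 hw)))
        _ = C * ((∑ u ∈ Finset.range (2 * i + 2), q ^ u) * (∑ w ∈ Finset.range (2 * (n - i) + 2), q ^ w)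
            + ((2 * i + 2 : ℕ) * (2 * (n - i) + 2 : ℕ)) * q ^ n) := by
            simp only [← Finset.mul_sum, Finset.sum_add_distrib, Finset.sum_const, Finset.card_range,
              nsmul_eq_mul, Finset.sum_mul_sum, ← pow_add]
            congr 2
            · exact Finset.sum_congr rfl fun u _ => Finset.sum_congr rfl fun w _ => by rw [add_comm]
            · ring
        _ ≤ _ := by
            refine mul_le_mul_of_nonneg_left (add_le_add ?_ (mul_le_mul_of_nonneg_right ?_
              (pow_pos hq0 n).le)) hC
            · rw [sq]
              exact mul_le_mul (geom_sum_le hq0 hq1 _) (geom_sum_le hq0 hq1 _)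
                (Finset.sum_nonneg fun i _ => (pow_pos hq0 i).le) hG
            · rw [sq]
              have e1 : ((2 * i + 2 : ℕ) : ℝ) ≤ 2 * n + 2 := by exact_mod_cast (by omega : 2 * i + 2 ≤ 2 * n + 2)
              have e2 : ((2 * (n - i) + 2 : ℕ) : ℝ) ≤ 2 * n + 2 := by
                exact_mod_cast (by omega : 2 * (n - i) + 2 ≤ 2 * n + 2)
              exact mul_le_mul e1 e2 (Nat.cast_nonneg _) (by positivity)
    refine (norm_sum_le _ _).trans ((Finset.sum_le_sum hi).trans ?_)
    rw [Finset.sum_const, Finset.card_range, nsmul_eq_mul]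
    push_cast
    have hqn : q ^ n ≤ 1 := pow_le_one₀ hq0.le hq1.le
    have hqn0 := pow_pos hq0 n
    have hn3 : ((n : ℝ) + 1) ^ 3 ≤ 16 * (n : ℝ) ^ 3 + 16 := by
      have hn : (0 : ℝ) ≤ n := Nat.cast_nonneg n
      nlinarith [mul_nonneg hn (sq_nonneg ((n : ℝ) - 1)), sq_nonneg ((n : ℝ) - 1)]
    have hb : ((n : ℝ) + 1) ^ 3 * q ^ n ≤ 16 * (K3 + 1) := by
      nlinarith [hK3 n, mul_le_mul_of_nonneg_right hn3 hqn0.le]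
    have := mul_le_mul_of_nonneg_left hb hC
    nlinarith
  have hmain : ∀ n : ℕ, ‖∑ i ∈ Finset.range (n + 1), ∑ u ∈ Finset.range (2 * i + 2),
      ∑ w ∈ Finset.range (2 * (n - i) + 2), Ψ w - (2 / 3 * L * (((n : ℂ) + 1) * (n + 2) * (n + 3))
        + B * ((n + 1) * (n + 2)))‖ ≤ C * G * ((2 * n + 2) * G) := by
    intro n
    have e : ∑ i ∈ Finset.range (n + 1), ∑ u ∈ Finset.range (2 * i + 2),
        ∑ w ∈ Finset.range (2 * (n - i) + 2), Ψ w - (2 / 3 * L * (((n : ℂ) + 1) * (n + 2) * (n + 3))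
        + B * ((n + 1) * (n + 2))) = ∑ i ∈ Finset.range (n + 1), (2 * (i : ℂ) + 2) *
          (∑ w ∈ Finset.range (2 * (n - i) + 2), (Ψ w - L) - B) := by
      simp only [Finset.sum_const, Finset.card_range, nsmul_eq_mul, Finset.sum_sub_distrib, mul_sub]
      rw [← Finset.sum_mul (a := B), sum_level_one, Finset.sum_congr rfl fun i _ => (mul_assoc _ _ L).symm,
        ← Finset.sum_mul (a := L), sum_level_two]
      push_cast
      ring
    rw [e]
    refine (norm_sum_le _ _).trans ?_
    have hi : ∀ i ∈ Finset.range (n + 1), ‖(2 * (i : ℂ) + 2) *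
        (∑ w ∈ Finset.range (2 * (n - i) + 2), (Ψ w - L) - B)‖ ≤ C * G * ((2 * n + 2) * q ^ (n - i)) := by
      intro i hi
      have hi := Finset.mem_range.1 hi
      rw [norm_mul, show (2 * (i : ℂ) + 2) = ((2 * i + 2 : ℕ) : ℂ) by push_cast; ring, Complex.norm_natCast]
      have e1 : ((2 * i + 2 : ℕ) : ℝ) ≤ 2 * n + 2 := by exact_mod_cast (by omega : 2 * i + 2 ≤ 2 * n + 2)
      have e2 : q ^ (2 * (n - i) + 2) ≤ q ^ (n - i) := pow_le_pow_of_le_one hq0.le hq1.le (by omega)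
      calc _ ≤ (2 * (n : ℝ) + 2) * (C * G * q ^ (n - i)) :=
            mul_le_mul e1 ((norm_sum_sub_tsum_le hq0 hq1 h1 _).trans
              (mul_le_mul_of_nonneg_left e2 (mul_nonneg hC hG))) (norm_nonneg _) (by positivity)
        _ = _ := by ring
    refine (Finset.sum_le_sum hi).trans ?_
    rw [← Finset.mul_sum, ← Finset.mul_sum,
      Finset.sum_congr rfl fun i _ => by rw [show n - i = n + 1 - 1 - i by omega],
      Finset.sum_range_reflect (fun i => q ^ i) (n + 1)]
    exact mul_le_mul_of_nonneg_left (mul_le_mul_of_nonneg_left (geom_sum_le hq0 hq1 _)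
      (by positivity)) (mul_nonneg hC hG)
  refine ⟨C * (G ^ 2 + 64 * (K3 + 1)) + C * G * (2 * G) + (‖L‖ + ‖B‖), by positivity, fun n => ?_⟩
  have e : levelSum c n - (2 / 3 * L * ((n : ℂ) + 2) ^ 3 + B * ((n : ℂ) + 2) ^ 2)
      = (levelSum c n - ∑ i ∈ Finset.range (n + 1), ∑ u ∈ Finset.range (2 * i + 2),
        ∑ w ∈ Finset.range (2 * (n - i) + 2), Ψ w) + (∑ i ∈ Finset.range (n + 1),
        ∑ u ∈ Finset.range (2 * i + 2), ∑ w ∈ Finset.range (2 * (n - i) + 2), Ψ w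
        - (2 / 3 * L * (((n : ℂ) + 1) * (n + 2) * (n + 3)) + B * ((n + 1) * (n + 2))))
        + ((-(2 / 3) * L - B) * ((n : ℂ) + 2)) := by ring
  have e3 : ‖(-(2 / 3) * L - B) * ((n : ℂ) + 2)‖ ≤ (‖L‖ + ‖B‖) * ((n : ℝ) + 2) := by
    rw [norm_mul, show ((n : ℂ) + 2) = ((n + 2 : ℕ) : ℂ) by push_cast; ring, Complex.norm_natCast]
    push_cast
    refine mul_le_mul_of_nonneg_right ((norm_sub_le _ _).trans (add_le_add_left ?_ _)) (by positivity)
    rw [norm_mul]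
    have : ‖(-(2 / 3) : ℂ)‖ ≤ 1 := by norm_num
    exact mul_le_of_le_one_left (norm_nonneg _) this
  rw [e]
  refine (norm_add₃_le).trans ?_
  have hn : (0 : ℝ) ≤ n := Nat.cast_nonneg n
  have e4 : C * ((n + 1) * G ^ 2 + 64 * (K3 + 1)) ≤ C * (G ^ 2 + 64 * (K3 + 1)) * ((n : ℝ) + 2) := by
    rw [mul_assoc]
    refine mul_le_mul_of_nonneg_left ?_ hC
    nlinarith [sq_nonneg G, mul_nonneg hn hK0]
  have e5 : C * G * ((2 * n + 2) * G) ≤ C * G * (2 * G) * ((n : ℝ) + 2) := by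
    rw [mul_assoc (C * G)]
    refine mul_le_mul_of_nonneg_left ?_ (mul_nonneg hC hG)
    nlinarith
  linarith [hstep n, hmain n]

end LevelSums

/-! ### Zeta functions -/

section Zeta

theorem summable_level {c : Lat → ℂ} {C : ℝ} (hc : ∀ p, ‖c p‖ ≤ C) {s : ℂ} (hs : 4 < s.re) :
    Summable fun x : (Σ n : ℕ, Σ i : Fin (n + 1), Fin (2 * i + 2) × Fin (2 * (n - i) + 2)) =>
      ((x.1 + 2 : ℕ) : ℂ) ^ (-s) * c (lc x.1 x.2.1 x.2.2.1 x.2.2.2) := by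
  have hC : 0 ≤ C := (norm_nonneg _).trans (hc 0)
  refine Summable.of_norm_bounded (g := fun x => ((x.1 + 2 : ℕ) : ℝ) ^ (-s.re) * C) ?_ fun x => ?_
  · refine (summable_sigma_of_nonneg fun x => by positivity).2 ⟨fun n => .of_finite, ?_⟩
    simp only [tsum_fintype, Finset.sum_const, nsmul_eq_mul]
    have h : Summable fun n : ℕ => C * ((n + 2 : ℕ) : ℝ) ^ (3 - s.re) :=
      ((summable_nat_add_iff 2).2 (Real.summable_nat_rpow.2 (by linarith))).mul_left C
    refine Summable.of_nonneg_of_le (fun n => by positivity) (fun n => ?_) h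
    have h1 : (Finset.univ (α := Σ i : Fin (n + 1), Fin (2 * i + 2) × Fin (2 * (n - i) + 2))).card
        ≤ (n + 2) ^ 3 := by
      have := card_level n
      rw [Finset.card_univ]
      zify
      nlinarith
    have h2 : ((n + 2 : ℕ) : ℝ) ^ (3 - s.re) = ((n + 2 : ℕ) : ℝ) ^ 3 * ((n + 2 : ℕ) : ℝ) ^ (-s.re) := by
      rw [sub_eq_add_neg, Real.rpow_add (by positivity)]
      exact congrArg (· * _) (Real.rpow_ofNat _ 3)
    have h3 := mul_le_mul_of_nonneg_right (Nat.cast_le (α := ℝ).2 h1)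
      (show 0 ≤ C * ((n + 2 : ℕ) : ℝ) ^ (-s.re) by positivity)
    rw [h2]
    push_cast at h3 ⊢
    linarith
  · rw [norm_mul, Complex.norm_natCast_cpow_of_pos (by omega), Complex.neg_re]
    exact mul_le_mul_of_nonneg_left (hc _) (by positivity)

variable {q : ℝ} (hq0 : 0 < q) (hq1 : q < 1)
include hq0 hq1

theorem exists_expansion {c : Lat → ℂ} {Ψ : ℕ → ℂ} {L : ℂ} {C : ℝ} (hC : 0 ≤ C) (hc : ∀ p, ‖c p‖ ≤ C)
    (h1 : ∀ w, ‖Ψ w - L‖ ≤ C * q ^ w)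
    (h2 : ∀ n i u w, i < n + 1 → u < 2 * i + 2 → w < 2 * (n - i) + 2 →
      ‖c (lc n i u w) - Ψ w‖ ≤ C * (q ^ (w + u) + q ^ n)) :
    ∃ R : ℂ → ℂ, DifferentiableOn ℂ R {s | 2 < s.re} ∧ ∀ s : ℂ, 4 < s.re →
      HasSum (fun p : Label => ((p.1.1 : ℂ) + 2) ^ (-s) * c p.1)
        (polar (2 / 3 * L) (∑' w, (Ψ w - L)) R s) := by
  obtain ⟨K, hK, hb⟩ := norm_levelSum_sub_le hq0 hq1 hC h1 h2
  set B := ∑' w, (Ψ w - L)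
  let A : ℕ → ℂ := fun N => if N < 2 then 0 else levelSum c (N - 2)
  let r : ℕ → ℂ := fun N => A N - (2 / 3 * L * (N : ℂ) ^ 3 + B * (N : ℂ) ^ 2)
  have hr : ∀ N ≠ 0, ‖r N‖ ≤ (K + ‖r 1‖) * (N : ℝ) ^ (1 : ℝ) := fun N hN => by
    rw [Real.rpow_one]
    obtain rfl | ⟨n, rfl⟩ : N = 1 ∨ ∃ n, N = n + 2 := by
      rcases N with _ | _ | n
      · exact absurd rfl hN
      · exact Or.inl rfl
      · exact Or.inr ⟨n, rfl⟩
    · simpa using hK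
    · have := hb n
      have hn : (0 : ℝ) ≤ ‖r 1‖ * ((n : ℝ) + 2) := by positivity
      simp only [r, A, if_neg (show ¬ n + 2 < 2 by omega), Nat.add_sub_cancel] at hn ⊢
      push_cast at hn ⊢
      linarith
  have hab : LSeries.abscissaOfAbsConv r ≤ 2 := by
    refine (LSeries.abscissaOfAbsConv_le_of_le_const_mul_rpow ⟨_, hr⟩).trans (le_of_eq ?_)
    rw [← EReal.coe_one, ← EReal.coe_add]
    norm_num
    rfl
  refine ⟨fun s => 2 / 3 * L * riemannZeta₀ (s - 3) + B * riemannZeta₀ (s - 2) + LSeries r s, ?_, ?_⟩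
  · have hL : DifferentiableOn ℂ (LSeries r) {s | 2 < s.re} := (LSeries_differentiableOn r).mono
      fun s hs => lt_of_le_of_lt hab (show ((2 : ℝ) : EReal) < s.re from EReal.coe_lt_coe_iff.2 hs)
    have h0 := differentiable_riemannZeta₀
    refine DifferentiableOn.add (Differentiable.differentiableOn ?_) hL
    fun_prop
  · intro s hs
    have hsum := summable_level hc hs
    have e1 : (fun p : Label => ((p.1.1 : ℂ) + 2) ^ (-s) * c p.1) ∘ labelEquiv
        = fun x => ((x.1 + 2 : ℕ) : ℂ) ^ (-s) * c (lc x.1 x.2.1 x.2.2.1 x.2.2.2) := funext fun x => by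
      simp only [Function.comp, labelEquiv, Equiv.ofBijective_apply, lc]
      push_cast
      rfl
    rw [← labelEquiv.hasSum_iff, e1]
    have hsr : LSeriesSummable r s := LSeriesSummable_of_le_const_mul_rpow
      (x := 2) (by linarith) ⟨K + ‖r 1‖, by norm_num at hr ⊢; exact hr⟩
    have hz : ∀ k : ℕ, 1 < (s - k).re → HasSum (fun N : ℕ => 1 / (N : ℂ) ^ (s - k)) (riemannZeta (s - k)) :=
      fun k hk => by
        rw [zeta_eq_tsum_one_div_nat_cpow hk]
        exact (Complex.summable_one_div_nat_cpow.2 hk).hasSum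
    have h3 := hz 3 (by simp; linarith)
    have h4 := hz 2 (by simp; linarith)
    have hA := ((h3.mul_left (2 / 3 * L)).add (h4.mul_left B)).add hsr.hasSum
    have e2 : (fun N : ℕ => 2 / 3 * L * (1 / (N : ℂ) ^ (s - (3 : ℕ))) + B * (1 / (N : ℂ) ^ (s - (2 : ℕ)))
        + LSeries.term r s N) = fun N : ℕ => (N : ℂ) ^ (-s) * A N := funext fun N => by
      rcases Nat.eq_zero_or_pos N with rfl | hN
      · have hne : ∀ k : ℕ, k < 4 → s - (k : ℂ) ≠ 0 := fun k hk h => by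
          have := congrArg Complex.re h
          simp only [Complex.sub_re, Complex.natCast_re, Complex.zero_re] at this
          have hk' : (k : ℝ) < 4 := by exact_mod_cast hk
          linarith
        have a3 := hne 3 (by norm_num)
        have a2 := hne 2 (by norm_num)
        rw [Nat.cast_ofNat] at a3 a2
        simp [Complex.zero_cpow a3, Complex.zero_cpow a2, A]
      · have hN' : (N : ℂ) ≠ 0 := by exact_mod_cast hN.ne'
        rw [LSeries.term_of_ne_zero hN.ne', Complex.cpow_sub _ _ hN', Complex.cpow_sub _ _ hN',
          Complex.cpow_natCast, Complex.cpow_natCast, Complex.cpow_neg]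
        have := (Complex.cpow_ne_zero_iff_of_exponent_ne_zero (x := (N : ℂ)) (y := s)
          (by rintro rfl; simp at hs; linarith)).2 hN'
        simp only [r]
        field_simp
        ring
    rw [e2] at hA
    have hA2 := (hasSum_nat_add_iff' 2).2 hA
    rw [Finset.sum_eq_zero (fun i hi => by
      rw [show A i = 0 from if_pos (Finset.mem_range.1 hi), mul_zero]), sub_zero] at hA2
    have hfin : ∀ n : ℕ, HasSum (fun y : (Σ i : Fin (n + 1), Fin (2 * i + 2) × Fin (2 * (n - i) + 2)) =>
        ((n + 2 : ℕ) : ℂ) ^ (-s) * c (lc n y.1 y.2.1 y.2.2)) (((n + 2 : ℕ) : ℂ) ^ (-s) * A (n + 2)) :=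
      fun n => by
        rw [show A (n + 2) = levelSum c n from if_neg (by omega), levelSum, Finset.mul_sum]
        exact hasSum_fintype _
    have h5 := hsum.hasSum.sigma hfin
    have h6 := h5.unique hA2
    rw [show polar (2 / 3 * L) B (fun s => 2 / 3 * L * riemannZeta₀ (s - 3) + B * riemannZeta₀ (s - 2)
        + LSeries r s) s = ∑' x : (Σ n : ℕ, Σ i : Fin (n + 1), Fin (2 * i + 2) × Fin (2 * (n - i) + 2)),
          ((x.1 + 2 : ℕ) : ℂ) ^ (-s) * c (lc x.1 x.2.1 x.2.2.1 x.2.2.2) from ?_]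
    · exact hsum.hasSum
    · rw [h6, riemannZeta_eq_inv_sub_add (fun h => by
        have := congrArg Complex.re h; simp at this; linarith), riemannZeta_eq_inv_sub_add (fun h => by
        have := congrArg Complex.re h; simp at this; linarith)]
      simp only [polar, LSeries]
      push_cast
      rw [show s - 3 - 1 = s - 4 by ring, show s - 2 - 1 = s - 3 by ring]
      ring

theorem zetaFun_eq (T : SpinorSpace →L[ℂ] SpinorSpace) {s : ℂ} (hs : 0 ≤ s.re) :
    zetaFun absDiracPow T s = ∑' i : Bool × Label, ((i.2.1.1 : ℂ) + 2) ^ (-s) * cf T i.1 i.1 0 i.2.1 :=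
  tsum_congr fun i => by
    have h1 : absDiracPow s (basisVec i) = eigval i ^ (-s) • basisVec i := lp.ext (funext fun j => by
      rw [absDiracPow_apply hs, lp.coeFn_smul, Pi.smul_apply, smul_eq_mul, basisVec_apply]
      split_ifs with h
      · rw [h]
      · rw [mul_zero, mul_zero])
    rw [mul_apply_eq_comp, h1, map_smul, inner_smul_right, inner_basisVec, cf, add_zero,
      toFn_of_lab _ _ i.2.2, kv_of_lab _ i.2.2]
    rfl

/-- The leading symbols of the diagonal of an operator. -/
structure DiagSym (T : SpinorSpace →L[ℂ] SpinorSpace) (Ψ : Bool → ℕ → ℂ) (L : Bool → ℂ) (C : ℝ) : Prop where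
  nonneg : 0 ≤ C
  sub_le : ∀ s w, ‖Ψ s w - L s‖ ≤ C * q ^ w
  diag_le : ∀ s n i u w, i < n + 1 → u < 2 * i + 2 → w < 2 * (n - i) + 2 →
    ‖cf T s s 0 (lc n i u w) - Ψ s w‖ ≤ C * (q ^ (w + u) + q ^ n)

omit hq1 in
theorem exists_diagSym {T : SpinorSpace →L[ℂ] SpinorSpace} {L : Bool → ℂ}
    (h : ∀ s, SymC q 0 (cf T s s 0) (L s)) : ∃ Ψ C, DiagSym (q := q) T Ψ L C := by
  choose Ψ C h0 h1 h2 h3 using h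
  have hC : ∀ s, C s ≤ ∑ t, C t := fun s => Finset.single_le_sum (fun t _ => h0 t) (Finset.mem_univ s)
  refine ⟨fun s w => Ψ s w, ∑ t, C t, Finset.sum_nonneg fun t _ => h0 t, fun s w => ?_,
    fun s n i u w hi hu hw => ?_⟩
  · refine (h2 s w).trans ?_
    rw [zpow_natCast]
    exact mul_le_mul_of_nonneg_right (hC s) (by positivity)
  · have e1 : wt (lc n i u w) = w := by simp only [wt, lc]; ring
    have e2 : wt (lc n i u w) + ut (lc n i u w) = (w + u : ℕ) := by
      rw [e1]; simp only [ut, lc]; push_cast; ring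
    have := h3 s _ (Or.inl (lab_lc hi hu hw))
    rw [ge, e2, e1, show (lc n i u w).1 = (n : ℤ) from rfl, zpow_natCast, zpow_natCast] at this
    exact this.trans (mul_le_mul_of_nonneg_right (hC s) (by positivity))

theorem DiagSym.exists_expansion {T : SpinorSpace →L[ℂ] SpinorSpace} {Ψ : Bool → ℕ → ℂ} {L : Bool → ℂ}
    {C : ℝ} (h : DiagSym (q := q) T Ψ L C) : ∃ R : ℂ → ℂ, DifferentiableOn ℂ R {s | 2 < s.re} ∧
      ∀ s : ℂ, 4 < s.re → zetaFun absDiracPow T s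
        = polar (2 / 3 * ∑ t, L t) (∑ t, ∑' w, (Ψ t w - L t)) R s := by
  have key := fun t => QuantumSphere.exists_expansion hq0 hq1 (c := cf T t t 0) (Ψ := Ψ t) (L := L t)
    (C := max C ‖T‖) (h.nonneg.trans (le_max_left _ _)) (fun p => (norm_cf_le T t t 0 p).trans (le_max_right _ _))
    (fun w => (h.sub_le t w).trans (by gcongr; exact le_max_left _ _))
    (fun n i u w hi hu hw => (h.diag_le t n i u w hi hu hw).trans (by gcongr; exact le_max_left _ _))
  choose R hR hs using key
  refine ⟨fun s => ∑ t, R t s, DifferentiableOn.fun_sum fun t _ => hR t, fun s h4 => ?_⟩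
  rw [zetaFun_eq hq0 hq1 T (by linarith)]
  have hsum : Summable fun i : Bool × Label => ((i.2.1.1 : ℂ) + 2) ^ (-s) * cf T i.1 i.1 0 i.2.1 :=
    Summable.of_norm ((summable_prod_of_nonneg fun i => norm_nonneg _).2
      ⟨fun t => (hs t s h4).summable.norm, .of_finite⟩)
  rw [hsum.tsum_prod, tsum_fintype, Finset.sum_congr rfl fun t _ => (hs t s h4).tsum_eq]
  simp only [polar, Fintype.sum_bool]
  ring

end Zeta

/-! ### The dimension spectrum -/

section Spectrum

open Filter

variable {q : ℝ} (hq0 : 0 < q) (hq1 : q < 1)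

theorem integral_symbol {f : C(Circle, ℂ)} {T : SpinorSpace →L[ℂ] SpinorSpace} {F : Finset Lat}
    {G : Finset ℤ} {l : ℤ → ℂ} (h : SymA q f T F G l) :
    ∫ θ in (0 : ℝ)..(2 * Real.pi), f (Circle.exp θ) = 2 * Real.pi * l 0 := by
  have e : ∀ θ : ℝ, f (Circle.exp θ) = ∑ m ∈ G, l m * Complex.exp ((m * Complex.I) * θ) := fun θ => by
    rw [h.eval]
    refine Finset.sum_congr rfl fun m _ => ?_
    rw [Circle.coe_exp, ← Complex.exp_int_mul]
    ring_nf
  simp only [e]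
  rw [intervalIntegral.integral_finsetSum fun m _ => Continuous.intervalIntegrable (by fun_prop) _ _]
  have hm : ∀ m : ℤ, ∫ θ in (0 : ℝ)..(2 * Real.pi), l m * Complex.exp ((m * Complex.I) * θ)
      = if m = 0 then 2 * Real.pi * l 0 else 0 := fun m => by
    rw [intervalIntegral.integral_const_mul]
    split_ifs with h0
    · subst h0
      simp [mul_comm]
    · rw [integral_exp_mul_complex (by simp [h0])]
      have : Complex.exp (m * Complex.I * ((2 * Real.pi : ℝ) : ℂ)) = 1 := by
        rw [← Complex.exp_int_mul_two_pi_mul_I m]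
        push_cast
        ring_nf
      rw [this]
      simp
  simp only [hm, Finset.sum_ite_eq']
  split_ifs with h0
  · rfl
  · rw [h.supp 0 h0, mul_zero]

theorem SymA.symC_zero {f : C(Circle, ℂ)} {T : SpinorSpace →L[ℂ] SpinorSpace} {F : Finset Lat}
    {G : Finset ℤ} {l : ℤ → ℂ} (h : SymA q f T F G l) (s : Bool) : SymC q 0 (cf T s s 0) (l 0) := by
  have h' := h.sym s 0
  rw [if_pos (by rfl)] at h'
  exact h'

include hq0 hq1

theorem sym1_sq_le (t : Bool) {p : Lat} (hp : Lab p) (hp' : Lab (p + (1, 1, 0, 1))) :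
    ‖c1 q (0, 0) t p‖ ^ 2
      ≤ (cf (spinorRep hq0 hq1 (star (sphereX q 1) * sphereX q 1)) t t 0 p).re := by
  set S := spinorRep hq0 hq1 (sphereX q 1)
  have h1 : cf (spinorRep hq0 hq1 (star (sphereX q 1) * sphereX q 1)) t t 0 p
      = ((‖S (kv t p)‖ ^ 2 : ℝ) : ℂ) := by
    rw [map_mul, map_star, cf, add_zero, ← inner_kv, mul_apply_eq_comp,
      ContinuousLinearMap.star_eq_adjoint, ContinuousLinearMap.adjoint_inner_right,
      inner_self_eq_norm_sq_to_K]
    push_cast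
    rfl
  have h2 := sum_toFn_le (S (kv t p)) t {p + (1, 1, 0, 1)}
  rw [Finset.sum_singleton] at h2
  have h3 := cf_of_expansion (spinorRep_x_one hq0 hq1) t t (1, 1, 0, 1) p
  rw [h1, Complex.ofReal_re]
  refine le_trans (le_of_eq ?_) h2
  change _ = ‖cf S t t (1, 1, 0, 1) p‖ ^ 2
  rw [h3, Finset.sum_eq_single (0, 0)]
  · rw [if_pos ⟨rfl, by simp [dd], hp, hp'⟩]
  · intro α _ hα
    rw [if_neg]
    rintro ⟨-, h, -⟩
    refine hα ?_
    revert h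
    revert α
    decide
  · exact fun h => absurd (Finset.mem_univ _) h

theorem norm_sym1_sq_le {Ψ : Bool → ℕ → ℂ} {L : Bool → ℂ} {C : ℝ}
    (h : DiagSym (q := q) (spinorRep hq0 hq1 (star (sphereX q 1) * sphereX q 1)) Ψ L C)
    (t : Bool) (w : ℕ) : ‖sym1 q w‖ ^ 2 ≤ (Ψ t w).re := by
  obtain ⟨C', h0, hC'⟩ := c1_lead hq0 hq1 t
  have hlim : Tendsto (fun m : ℕ => q ^ (w + m) + q ^ (2 * m)) atTop (𝓝 0) := by
    have h1 := tendsto_pow_atTop_nhds_zero_of_lt_one hq0.le hq1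
    have h2 := (h1.const_mul (q ^ w)).add (h1.pow 2)
    simp only [mul_zero, ne_eq, OfNat.ofNat_ne_zero, not_false_eq_true, zero_pow, add_zero] at h2
    refine h2.congr fun m => ?_
    rw [pow_add, mul_comm 2 m, pow_mul]
  have hd : Tendsto (fun m : ℕ => cf (spinorRep hq0 hq1 (star (sphereX q 1) * sphereX q 1)) t t 0
      (lc (2 * m) m m w)) atTop (𝓝 (Ψ t w)) := by
    rw [tendsto_iff_norm_sub_tendsto_zero]
    refine squeeze_zero' (Eventually.of_forall fun _ => norm_nonneg _) ?_
      (by simpa using hlim.const_mul C)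
    filter_upwards [eventually_ge_atTop w] with m hm
    exact h.diag_le t _ _ _ _ (by omega) (by omega) (by omega)
  have hc : Tendsto (fun m : ℕ => c1 q (0, 0) t (lc (2 * m) m m w)) atTop (𝓝 (sym1 q w)) := by
    rw [tendsto_iff_norm_sub_tendsto_zero]
    refine squeeze_zero' (Eventually.of_forall fun _ => norm_nonneg _) ?_
      (by simpa using hlim.const_mul C')
    filter_upwards [eventually_ge_atTop w] with m hm
    have e1 : wt (lc (2 * m) m m w) = w := by simp only [wt, lc]; push_cast; ring
    have e2 : wt (lc (2 * m) m m w) + ut (lc (2 * m) m m w) = (w + m : ℕ) := by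
      rw [e1]; simp only [ut, lc]; push_cast; ring
    have := hC' _ (lab_lc (n := 2 * m) (i := m) (u := m) (w := w) (by omega) (by omega) (by omega))
    rwa [ge, e2, e1, show (lc (2 * m) m m w).1 = ((2 * m : ℕ) : ℤ) from rfl, zpow_natCast,
      zpow_natCast] at this
  refine le_of_tendsto_of_tendsto (hc.norm.pow 2) ((Complex.continuous_re.tendsto _).comp hd) ?_
  filter_upwards [eventually_ge_atTop (w + 1)] with m hm
  have hl := lab_lc (n := 2 * m) (i := m) (u := m) (w := w) (by omega) (by omega) (by omega)
  refine sym1_sq_le hq0 hq1 t hl ?_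
  have : lc (2 * m) m m w + (1, 1, 0, 1) = lc (2 * m + 1) (m + 1) (m + 2) w := by
    simp only [lc, Prod.mk_add_mk, Prod.mk.injEq]
    push_cast
    refine ⟨?_, ?_, ?_, ?_⟩ <;> ring
  rw [this]
  exact lab_lc (by omega) (by omega) (by omega)

theorem exists_extension {T : SpinorSpace →L[ℂ] SpinorSpace} (h : IsSym q T) :
    ∃ α β R, DifferentiableOn ℂ R {s : ℂ | 2 < s.re} ∧
      ∀ s : ℂ, 4 < s.re → zetaFun absDiracPow T s = polar α β R s := by
  obtain ⟨F, -, h⟩ := h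
  choose L hL using fun s => h s s 0
  obtain ⟨Ψ, C, hd⟩ := exists_diagSym hq0 hL
  obtain ⟨R, hR⟩ := hd.exists_expansion hq0 hq1
  exact ⟨_, _, R, hR⟩

omit hq0 hq1 in
theorem isMeromorphicExtension_polar {T : SpinorSpace →L[ℂ] SpinorSpace} {α β : ℂ} {R : ℂ → ℂ}
    (hR : DifferentiableOn ℂ R {s : ℂ | 2 < s.re})
    (h : ∀ s : ℂ, 4 < s.re → zetaFun absDiracPow T s = polar α β R s) :
    IsMeromorphicExtension (zetaFun absDiracPow T) 4 2 (polar α β R) :=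
  ⟨meromorphicOn_polar hR, fun s hs => (h s hs).symm⟩

theorem differentiableOn_zetaFun {T : SpinorSpace →L[ℂ] SpinorSpace} (h : IsSym q T) :
    DifferentiableOn ℂ (zetaFun absDiracPow T) {s : ℂ | 4 < s.re} := by
  obtain ⟨α, β, R, hR, e⟩ := exists_extension hq0 hq1 h
  refine DifferentiableOn.congr (f := polar α β R) (fun s hs => ?_) e
  have hs' : 4 < s.re := hs
  have hne : ∀ p : ℂ, p.re ≤ 4 → s - p ≠ 0 := fun p hp h0 => by
    rw [sub_eq_zero.1 h0] at hs'
    exact absurd hs' (not_lt.2 hp)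
  have h4 := hne 4 (by norm_num)
  have h3 := hne 3 (by norm_num)
  have hRs := (hR.differentiableAt ((isOpen_halfPlane 2).mem_nhds (show (2 : ℝ) < s.re by linarith)))
  have : DifferentiableAt ℂ (polar α β R) s := by
    unfold polar
    fun_prop (disch := assumption)
  exact this.differentiableWithinAt

theorem dimensionSpectrum_eq : dimensionSpectrum absDiracPow
    (PsiZero (spinorRep hq0 hq1) dirac absDirac) 4 2 = {3, 4} := by
  refine Set.Subset.antisymm ?_ ?_
  · rintro s ⟨hs, T, hT, Z, hZ, ho⟩
    obtain ⟨α, β, R, hR, e⟩ := exists_extension hq0 hq1 (isSym_of_psiZero hq0 hq1 hT)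
    rw [meromorphicOrderAt_congr (eq_of_extension hZ (isMeromorphicExtension_polar hR e) hs)] at ho
    obtain ⟨g, hg, h⟩ := polar_local (α := α) (β := β) hR hs
    by_contra hn
    simp only [Set.mem_insert_iff, Set.mem_singleton_iff, not_or] at hn
    exact absurd ho (not_lt.2 ((polar_order hg h).2.1 (by rw [if_neg hn.2, if_neg hn.1])))
  · have mem : ∀ {a : SphereAlg q} {α β : ℂ} {R : ℂ → ℂ} {s : ℂ}, 2 < s.re →
        DifferentiableOn ℂ R {s : ℂ | 2 < s.re} →
        (∀ s : ℂ, 4 < s.re → zetaFun absDiracPow (spinorRep hq0 hq1 a) s = polar α β R s) →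
        (if s = 4 then α else if s = 3 then β else 0) ≠ 0 → s ∈ dimensionSpectrum absDiracPow
          (PsiZero (spinorRep hq0 hq1) dirac absDirac) 4 2 := fun {a α β R s} hs hR e hne => by
      obtain ⟨g, hg, h⟩ := polar_local (α := α) (β := β) hR hs
      exact ⟨hs, _, Algebra.subset_adjoin (PsiGen.rep a), _, isMeromorphicExtension_polar hR e,
        (polar_order hg h).2.2 hne⟩
    rintro s (rfl | rfl)
    · obtain ⟨F, G, l, hl⟩ := isSymA_spinorRep hq0 hq1 (star (sphereX q 1) * sphereX q 1)
      obtain ⟨Ψ, C, hd⟩ := exists_diagSym hq0 hl.symC_zero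
      obtain ⟨R, hR, e⟩ := hd.exists_expansion hq0 hq1
      refine mem (by norm_num) hR e ?_
      have hσ : sphereSymbol q (star (sphereX q 1) * sphereX q 1) = 0 := by
        rw [map_mul, show sphereSymbol q (sphereX q 1) = 0 from
          (PresentedStarAlg.lift_mk _ _ _ _).trans (FreeStarAlg.lift_gen _ _), mul_zero]
      have hl0 : l 0 = 0 := by
        have := integral_symbol hl
        rw [hσ] at this
        simpa [Real.pi_ne_zero] using this.symm
      rw [if_neg (by norm_num), if_pos rfl]
      have hpos : ∀ t, 0 < (∑' w, (Ψ t w - l 0)).re := fun t => by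
        have hs : Summable fun w : ℕ => Ψ t w - l 0 := Summable.of_norm_bounded
          ((summable_geometric_of_lt_one hq0.le hq1).mul_left C) (hd.sub_le t)
        rw [Complex.re_tsum hs]
        have hn : ∀ w : ℕ, ‖sym1 q w‖ ^ 2 ≤ (Ψ t w - l 0).re := fun w => by
          rw [hl0, sub_zero]
          exact norm_sym1_sq_le hq0 hq1 hd t w
        refine Summable.tsum_pos (Complex.hasSum_re hs.hasSum).summable
          (fun w => (sq_nonneg _).trans (hn w)) 0 (lt_of_lt_of_le ?_ (hn 0))
        simp [sym1]
      rw [Fintype.sum_bool]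
      intro h0
      have := congrArg Complex.re h0
      rw [Complex.add_re, Complex.zero_re] at this
      linarith [hpos true, hpos false]
    · have h1 : ∀ s, SymC q 0 (cf (spinorRep hq0 hq1 1) s s 0) 1 := fun s => by
        rw [map_one]
        simpa using symC_one hq0 s s 0
      obtain ⟨Ψ, C, hd⟩ := exists_diagSym hq0 h1
      obtain ⟨R, hR, e⟩ := hd.exists_expansion hq0 hq1
      exact mem (by norm_num) hR e (by norm_num)

theorem residue_eq (a : SphereAlg q) {Z : ℂ → ℂ}
    (hZ : IsMeromorphicExtension (zetaFun absDiracPow (spinorRep hq0 hq1 a)) 4 2 Z) :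
    Tendsto (fun s : ℂ => (s - 4) * Z s) (𝓝[≠] 4) (𝓝 ((2 / (3 * Real.pi) : ℝ) *
      ∫ θ in (0 : ℝ)..(2 * Real.pi), sphereSymbol q a (Circle.exp θ))) := by
  obtain ⟨F, G, l, hl⟩ := isSymA_spinorRep hq0 hq1 a
  obtain ⟨Ψ, C, hd⟩ := exists_diagSym hq0 hl.symC_zero
  obtain ⟨R, hR, e⟩ := hd.exists_expansion hq0 hq1
  have h4 : (2 : ℝ) < (4 : ℂ).re := by norm_num
  obtain ⟨g, hg, h⟩ := polar_local (α := 2 / 3 * ∑ t : Bool, l 0)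
    (β := ∑ t, ∑' w, (Ψ t w - l 0)) hR h4
  have := polar_residue hg ((eq_of_extension hZ (isMeromorphicExtension_polar hR e) h4).trans h)
  rw [if_pos rfl] at this
  convert this using 2
  rw [integral_symbol hl, Fintype.sum_bool]
  have : (Real.pi : ℂ) ≠ 0 := by exact_mod_cast Real.pi_ne_zero
  push_cast
  field_simp
  ring

end Spectrum

end QuantumSphere

end

open QuantumSphere

theorem mainTheorem8 (q : ℝ) (hq0 : 0 < q) (hq1 : q < 1) :
    ∃ π : SphereAlg q →⋆ₐ[ℂ] (SpinorSpace →L[ℂ] SpinorSpace),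
      IsSpinorRep q π ∧
      -- `(𝒜(S⁴_q), ℋ, D, γ)` is an equivariant regular even spectral triple of metric dimension 4
      IsEvenSpectralTriple π dirac grading ∧
      IsEquivariant (sphereToCrossed q) (uqToCrossed q) π dirac grading ∧
      IsOperatorAbs dirac absDirac ∧
      IsRegularTriple π dirac absDirac ∧
      HasMetricDimension absDiracPow 4 ∧
      -- the zeta functions are defined and holomorphic for `Re s > 4`
      (∀ T ∈ PsiZero π dirac absDirac,
        (∀ s : ℂ, 4 < s.re → IsTraceClass (T * absDiracPow s)) ∧
        DifferentiableOn ℂ (zetaFun absDiracPow T) {s : ℂ | 4 < s.re}) ∧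
      -- they extend meromorphically to `Re s > 2`, where all their poles are simple
      (∀ T ∈ PsiZero π dirac absDirac,
        ∃ Z, IsMeromorphicExtension (zetaFun absDiracPow T) 4 2 Z ∧
          ∀ s : ℂ, 2 < s.re → -1 ≤ meromorphicOrderAt Z s) ∧
      -- the dimension spectrum in `Re s > 2`
      dimensionSpectrum absDiracPow (PsiZero π dirac absDirac) 4 2 = {3, 4} ∧
      -- the residue at `s = 4` of (the extension of) `ζ_a`
      ∀ (a : SphereAlg q) (Z : ℂ → ℂ),
        IsMeromorphicExtension (zetaFun absDiracPow (π a)) 4 2 Z →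
        Filter.Tendsto (fun s : ℂ => (s - 4) * Z s) (𝓝[≠] 4)
          (𝓝 ((2 / (3 * Real.pi) : ℝ) *
            ∫ θ in (0 : ℝ)..(2 * Real.pi), sphereSymbol q a (Circle.exp θ))) := by
  refine ⟨spinorRep hq0 hq1, isSpinorRep_spinorRep hq0 hq1, isEvenSpectralTriple_spinorRep hq0 hq1,
    isEquivariant_spinorRep hq0 hq1, isOperatorAbs, isRegularTriple_spinorRep hq0 hq1,
    hasMetricDimension, fun T hT => ⟨fun s hs => isTraceClass_mul_absDiracPow T hs,
      differentiableOn_zetaFun hq0 hq1 (isSym_of_psiZero hq0 hq1 hT)⟩, fun T hT => ?_,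
    dimensionSpectrum_eq hq0 hq1, fun a Z hZ => residue_eq hq0 hq1 a hZ⟩
  obtain ⟨α, β, R, hR, e⟩ := exists_extension hq0 hq1 (isSym_of_psiZero hq0 hq1 hT)
  refine ⟨_, isMeromorphicExtension_polar hR e, fun s hs => ?_⟩
  obtain ⟨g, hg, h⟩ := polar_local (α := α) (β := β) hR hs
  exact (polar_order hg h).1
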